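/- Let $A=(a_{ij})_{i,j\in I}$, $I=\{1,\dots,n\}$, be an indecomposable Cartan matrix of finite type with relatively prime positive integers $d_i$ such that $(d_ia_{ij})$ is symmetric; let $d_0=\max_i d_i$, $q_i=q^{d_i}$, $[m]_p=\frac{p^m-p^{-m}}{p-p^{-1}}$, $[m]_i=[m]_{q_i}$. Let $\mathfrak g$ be the corresponding untwisted affine Kac–Moody algebra and $U_q(\mathfrak g)$ its quantum affine algebra over $\mathbb C(q^{1/2})$ in Drinfeld's realization, i.e. the algebra generated by $x^\pm_{ir}$, $h_{ik}$, $K_i^{\pm1}$, $\gamma^{\pm1/2}$, $D^{\pm1}$ ($i\in I$, $r,k\in\mathbb Z$, $k\ne0$), with $\gamma^{\pm 1/2}$ central, $[D,K_i]=[K_i,K_j]=[K_i,h_{jk}]=0$, $Dh_{ik}D^{-1}=q^kh_{ik}$, $Dx^\pm_{ir}D^{-1}=q^rx^\pm_{ir}$, $K_ix^\pm_{jr}K_i^{-1}=q_i^{\pm a_{ij}}x^\pm_{jr}$, $[h_{ik},h_{jl}]=\delta_{k,-l}\frac1k[ka_{ij}]_i\frac{\gamma^k-\gamma^{-k}}{q_j-q_j^{-1}}$,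 $[h_{ik},x^\pm_{jl}]=\pm\frac1k[ka_{ij}]_i\gamma^{\mp|k|/2}x^\pm_{j,k+l}$, $x^\pm_{i,k+1}x^\pm_{jl}-q_i^{\pm a_{ij}}x^\pm_{jl}x^\pm_{i,k+1}=q_i^{\pm a_{ij}}x^\pm_{ik}x^\pm_{j,l+1}-x^\pm_{j,l+1}x^\pm_{ik}$, $[x^+_{ik},x^-_{jl}]=\delta_{ij}\Psi_{i;k,l}$ with $\Psi_{i;k,l}=\frac{\gamma^{(k-l)/2}\psi_{i,k+l}-\gamma^{(l-k)/2}\phi_{i,k+l}}{q_i-q_i^{-1}}$, where $\sum_{k\ge0}\psi_{ik}z^k=K_i\exp\big((q_i-q_i^{-1})\sum_{l>0}h_{il}z^l\big)$, $\sum_{k\ge0}\phi_{i,-k}z^{-k}=K_i^{-1}\exp\big(-(q_i-q_i^{-1})\sum_{l>0}h_{i,-l}z^{-l}\big)$ and $\psi_{ik}=\phi_{i,-k}=0$ for $k<0$, and the Drinfeld–Serre relations. Let $G_q\subset U_q(\mathfrak g)$ be the quantum Heisenberg subalgebra, generated by all $h_{ik}$ and $\gamma^{\pm1/2}$, graded by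 $\deg h_{ik}=k$, $\deg\gamma^{\pm1/2}=0$, and let $\mathcal K_q$ be the category of $\mathbb Z$-graded $G_q$-modules. Let $\varphi:\mathbb Z_{>0}\to\{+,-\}$ be any function and let $\lambda$ be an integral weight, with integer values $\lambda(h_i)$ ($i\in I$), $\lambda(c)$, $\lambda(d)$. The $\varphi$-imaginary Verma module $M_q^\varphi(\lambda)$ is the $U_q(\mathfrak g)$-module generated by a vector $v_\lambda$ with defining relations $x^+_{ik}v_\lambda=0$ ($k\in\mathbb Z$), $h_{i,\varphi(k)k}v_\lambda=0$ ($k>0$), $K_iv_\lambda=q^{\lambda(h_i)}v_\lambda$, $Dv_\lambda=q^{\lambda(d)}v_\lambda$, $\gamma^{1/2}v_\lambda=q^{\lambda(c)/2}v_\lambda$. Let $N_q=G_qv_\lambda$, graded by letting $N_{q,m}$ be the $q^{\lambda(d)+m}$-eigenspace of $D$ on $N_q$. Let $\mathbb A=\mathbb C[q^{\pm1/2},\,1/[m]_{i}: i\in I,\ m>1]$ and let $G^d_{\mathbb A}$ be the $\mathbb A$-subalgebra of $U_q(\mathfrak g)$ generated by $h_{ik}$, $K_i^{\pm1}$, $\gamma^{\pm1/2}$,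 $D^{\pm1}$, $\Psi_{i;k,l}$, $\frac{\gamma^s-\gamma^{-s}}{q_i-q_i^{-1}}$, $\prod_{j=1}^r\frac{K_iq_i^{s-j+1}-K_i^{-1}q_i^{-(s-j+1)}}{q_i^j-q_i^{-j}}$ and $\prod_{j=1}^r\frac{Dq_0^{s-j+1}-D^{-1}q_0^{-(s-j+1)}}{q_0^j-q_0^{-j}}$ with $q_0=q^{d_0}$. Let $G+\mathfrak h=\dot{\mathfrak h}\otimes\mathbb C[t,t^{-1}]\oplus\mathbb Cc\oplus\mathbb Cd$, with $c$ central, $[d,h_i\otimes t^k]=k\,h_i\otimes t^k$ and $[h_i\otimes t^k,h_j\otimes t^l]=\delta_{k+l,0}\,k\,\frac{a_{ij}}{d_j}c$. An irreducible graded module $V$ in $\mathcal K_q$ (with its action of $G_q$ extended to $K_i^{\pm1},D^{\pm1}$) is called $\mathbb A$-admissible if it has a $\mathbb C(q^{1/2})$-basis whose $\mathbb A$-span $V_{\mathbb A}$ is stable under $G_{\mathbb A}^d$ and whose classical limit $V_{\mathbb A}/(q^{1/2}-1)V_{\mathbb A}$, with the induced grading, is an irreducible $\mathbb Z$-graded $G+\mathfrak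 h$-module; here $h_i\otimes t^k$ ($k\ne0$), $h_i$, $c$, $d$ act as the images of $h_{ik}$, $\frac{K_i-K_i^{-1}}{q_i-q_i^{-1}}$, $\frac{\gamma-\gamma^{-1}}{q-q^{-1}}$, $\frac{D-D^{-1}}{q-q^{-1}}$. Then $N_q$ is a $\mathbb Z$-graded $G_q$-module, and it is irreducible in $\mathcal K_q$ if and only if $\lambda(c)\neq0$; likewise it is irreducible as an ungraded $G_q$-module if and only if $\lambda(c)\ne0$. Moreover, if $\lambda(c)\neq0$, then $N_q$ is $\mathbb A$-admissible; the $\mathbb A$-form can be taken to be $N_{\mathbb A}=G^d_{\mathbb A}v_\lambda$. -/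

import Mathlib

noncomputable section

namespace QHeis

/-! ### Cartan data of untwisted affine type -/

/-- The finite part of an untwisted affine Cartan matrix `X_n^{(1)}`: an indecomposable Cartan
matrix of finite type indexed by `I = {1, …, n}`, with its relatively prime symmetrizing integers
`d_i`. (The coprimality forces `n ≥ 1`.) -/
structure CartanDatum (n : ℕ) where
  /-- the Cartan matrix -/
  a : Matrix (Fin n) (Fin n) ℤ
  /-- the symmetrizing integers -/
  d : Fin n → ℕ
  diag : ∀ i, a i i = 2
  offDiag : ∀ i j, i ≠ j → a i j ≤ 0
  d_pos : ∀ i, 0 < d i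
  symm : ∀ i j, (d i : ℤ) * a i j = (d j : ℤ) * a j i
  coprime : Finset.univ.gcd d = 1
  posDef : (Matrix.of fun i j => ((d i : ℝ) * (a i j : ℝ))).PosDef
  indecomposable : ∀ S : Set (Fin n), S.Nonempty → S ≠ Set.univ →
    ∃ i ∈ S, ∃ j ∉ S, a i j ≠ 0

/-- The integer `d_0` attached to the affine node: `α_0 = δ - θ` with `θ` a long root, so `d_0`
is the largest of the `d_i`. -/
def CartanDatum.d0 {n : ℕ} (C : CartanDatum n) : ℕ := Finset.univ.sup C.d

/-- An element `λ` of the weight lattice `P`, given by the integers `λ(h_i)` (`i ∈ I`), `λ(c)`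
and `λ(d)`. -/
structure Weight (n : ℕ) where
  /-- the values `λ(h_i)` -/
  h : Fin n → ℤ
  /-- the level `λ(c)` -/
  c : ℤ
  /-- the value `λ(d)` -/
  d : ℤ

/-! ### The ground field and quantum integers -/

/-- The field `ℂ(q^{1/2})`; its variable is `q^{1/2}`. -/
abbrev Kq : Type := RatFunc ℂ

/-- `q^{1/2}` -/
def qh : Kq := RatFunc.X

/-- `q` -/
def q : Kq := qh ^ 2

/-- `[m]_p = (p^m - p^{-m}) / (p - p^{-1})` -/
def qInt (p : Kq) (m : ℤ) : Kq := (p ^ m - p ^ (-m)) / (p - p⁻¹)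

/-- `[m]_p!` -/
def qFact (p : Kq) (m : ℕ) : Kq := ∏ k ∈ Finset.Icc 1 m, qInt p k

/-- the Gaussian binomial coefficient -/
def qBinom (p : Kq) (m r : ℕ) : Kq := qFact p m / (qFact p r * qFact p (m - r))

variable {n : ℕ} (C : CartanDatum n)

/-- `q_i = q^{d_i}` -/
def qi (i : Fin n) : Kq := q ^ C.d i

/-- `q_0 = q^{d_0}` -/
def q0 : Kq := q ^ C.d0

/-- The ring `𝔸 = ℂ[q^{1/2}, q^{-1/2}, 1/[m]_{q_i} : i ∈ I, m > 1]`. -/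
def AA : Subalgebra ℂ Kq :=
  Algebra.adjoin ℂ ({qh, qh⁻¹} ∪ {x | ∃ (i : Fin n) (m : ℕ), 1 < m ∧ x = (qInt (qi C i) m)⁻¹})

/-! ### The quantum affine algebra in Drinfeld's realization -/

/-- Drinfeld generators; the sign `ε = ±1` in `x ε i r` stands for `x^±_{ir}`. -/
inductive Gen (n : ℕ) : Type
  | x (ε : ℤˣ) (i : Fin n) (r : ℤ)
  | h (i : Fin n) (k : {k : ℤ // k ≠ 0})
  | K (i : Fin n)
  | Kinv (i : Fin n)
  | gammaHalf
  | gammaHalfInv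
  | D
  | Dinv

/-- The free algebra on the Drinfeld generators. -/
abbrev Free (n : ℕ) : Type := FreeAlgebra Kq (Gen n)

namespace Free

/-- `x^ε_{ir}` -/
def x (ε : ℤˣ) (i : Fin n) (r : ℤ) : Free n := FreeAlgebra.ι Kq (Gen.x ε i r)

/-- `h_{ik}` for `k ≠ 0`, with the convention `h_{i0} = 0`. -/
def h (i : Fin n) (k : ℤ) : Free n :=
  if hk : k ≠ 0 then FreeAlgebra.ι Kq (Gen.h i ⟨k, hk⟩) else 0

/-- `K_i` -/
def K (i : Fin n) : Free n := FreeAlgebra.ι Kq (Gen.K i)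

/-- `K_i^{-1}` -/
def Kinv (i : Fin n) : Free n := FreeAlgebra.ι Kq (Gen.Kinv i)

/-- `γ^{m/2}` for an integer `m` -/
def gam (m : ℤ) : Free n :=
  if 0 ≤ m then FreeAlgebra.ι Kq Gen.gammaHalf ^ m.toNat
  else FreeAlgebra.ι Kq Gen.gammaHalfInv ^ (-m).toNat

/-- `D` -/
def D : Free n := FreeAlgebra.ι Kq Gen.D

/-- `D^{-1}` -/
def Dinv : Free n := FreeAlgebra.ι Kq Gen.Dinv

/-- The coefficient of `z^m` in `exp (t * ∑_{l > 0} u_l z^l)`, where `u_0 = 0`. -/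
def expCoeff (t : Kq) (u : ℕ → Free n) (m : ℕ) : Free n :=
  ∑ r ∈ Finset.range (m + 1),
    (t ^ r / (r.factorial : Kq)) • PowerSeries.coeff m (PowerSeries.mk u ^ r)

/-- `ψ_{ik}`: `∑_{k ≥ 0} ψ_{ik} z^k = K_i exp ((q_i - q_i^{-1}) ∑_{l>0} h_{il} z^l)`,
and `ψ_{ik} = 0` for `k < 0`. -/
def psi (i : Fin n) (k : ℤ) : Free n :=
  if 0 ≤ k then K i * expCoeff (qi C i - (qi C i)⁻¹) (fun l => h i l) k.toNat else 0

/-- `φ_{ik}`: `∑_{k ≥ 0} φ_{i,-k} z^{-k} = K_i^{-1} exp (-(q_i - q_i^{-1}) ∑_{l>0} h_{i,-l} z^{-l})`,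
and `φ_{ik} = 0` for `k > 0`. -/
def phi (i : Fin n) (k : ℤ) : Free n :=
  if k ≤ 0 then Kinv i * expCoeff (-(qi C i - (qi C i)⁻¹)) (fun l => h i (-l)) (-k).toNat else 0

/-- The Lusztig element `(γ^{(k-l)/2} ψ_{i,k+l} - γ^{(l-k)/2} φ_{i,k+l}) / (q_i - q_i^{-1})`. -/
def gammaPsi (i : Fin n) (k l : ℤ) : Free n :=
  (qi C i - (qi C i)⁻¹)⁻¹ • (gam (k - l) * psi C i (k + l) - gam (l - k) * phi C i (k + l))

/-- The Lusztig element `(γ^s - γ^{-s}) / (q_i - q_i^{-1})`. -/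
def gammaBinom (i : Fin n) (s : ℤ) : Free n :=
  (qi C i - (qi C i)⁻¹)⁻¹ • (gam (2 * s) - gam (-(2 * s)))

/-- The Lusztig element `∏_{j=1}^r (Y p^{s-j+1} - Y⁻¹ p^{-(s-j+1)}) / (p^j - p^{-j})`
for an element `Y` with inverse `Y⁻¹ = Yinv`. -/
def lusztig (p : Kq) (Y Yinv : Free n) (s : ℤ) (r : ℕ) : Free n :=
  ((List.range r).map fun j =>
    (p ^ ((j : ℤ) + 1) - p ^ (-((j : ℤ) + 1)))⁻¹ • (p ^ (s - j) • Y - p ^ (-(s - j)) • Yinv)).prod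

/-- `[K_i; s; r]` -/
def KBinom (i : Fin n) (s : ℤ) (r : ℕ) : Free n := lusztig (qi C i) (K i) (Kinv i) s r

/-- `[D; s; r]` -/
def DBinom (s : ℤ) (r : ℕ) : Free n := lusztig (q0 C) D Dinv s r

/-- The left-hand side of the Drinfeld–Serre relation, with `N = 1 - a_{ij}`:
`Sym_{k_1,…,k_N} ∑_{r=0}^N (-1)^r [N choose r]_i x_{ik_1} ⋯ x_{ik_r} x_{jl} x_{ik_{r+1}} ⋯ x_{ik_N}`. -/
def serre (ε : ℤˣ) (i j : Fin n) {N : ℕ} (k : Fin N → ℤ) (l : ℤ) : Free n :=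
  ∑ σ : Equiv.Perm (Fin N), ∑ r ∈ Finset.range (N + 1),
    ((-1) ^ r * qBinom (qi C i) N r) •
      (((List.ofFn fun t => x ε i (k (σ t))).take r).prod * x ε j l *
        ((List.ofFn fun t => x ε i (k (σ t))).drop r).prod)

end Free

open Free in
/-- Drinfeld's defining relations of `U_q(𝔤)`. Here `(α_i|α_j) = d_i a_{ij}`. -/
inductive Rel : Free n → Free n → Prop
  | K_mul_Kinv (i) : Rel (K i * Kinv i) 1
  | Kinv_mul_K (i) : Rel (Kinv i * K i) 1
  | D_mul_Dinv : Rel (D * Dinv) 1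
  | Dinv_mul_D : Rel (Dinv * D) 1
  | gamma_mul_inv : Rel (gam 1 * gam (-1)) 1
  | inv_mul_gamma : Rel (gam (-1) * gam 1) 1
  | gamma_central (g : Gen n) : Rel (gam 1 * FreeAlgebra.ι Kq g) (FreeAlgebra.ι Kq g * gam 1)
  | D_K (i) : Rel (D * K i) (K i * D)
  | K_K (i j) : Rel (K i * K j) (K j * K i)
  | K_h (i j) (k : ℤ) : Rel (K i * h j k) (h j k * K i)
  | D_h (i) (k : ℤ) : Rel (D * h i k) (q ^ k • (h i k * D))
  | D_x (ε : ℤˣ) (i) (r : ℤ) : Rel (D * x ε i r) (q ^ r • (x ε i r * D))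
  | K_x (ε : ℤˣ) (i j) (r : ℤ) :
      Rel (K i * x ε j r) (q ^ ((ε : ℤ) * (C.d i * C.a i j)) • (x ε j r * K i))
  | h_h (i j) (k l : ℤ) (hk : k ≠ 0) (hl : l ≠ 0) :
      Rel (h i k * h j l - h j l * h i k)
        (if k = -l then ((k : Kq)⁻¹ * qInt (qi C i) (k * C.a i j) * (qi C j - (qi C j)⁻¹)⁻¹) •
          (gam (2 * k) - gam (-(2 * k))) else 0)
  | h_x (ε : ℤˣ) (i j) (k l : ℤ) (hk : k ≠ 0) :
      Rel (h i k * x ε j l - x ε j l * h i k)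
        ((((ε : ℤ) : Kq) * (k : Kq)⁻¹ * qInt (qi C i) (k * C.a i j)) •
          (gam (-((ε : ℤ) * |k|)) * x ε j (k + l)))
  | x_x (ε : ℤˣ) (i j) (k l : ℤ) :
      Rel (x ε i (k + 1) * x ε j l -
            q ^ ((ε : ℤ) * (C.d i * C.a i j)) • (x ε j l * x ε i (k + 1)))
        (q ^ ((ε : ℤ) * (C.d i * C.a i j)) • (x ε i k * x ε j (l + 1)) -
            x ε j (l + 1) * x ε i k)
  | xp_xm (i j) (k l : ℤ) :
      Rel (x 1 i k * x (-1) j l - x (-1) j l * x 1 i k) (if i = j then gammaPsi C i k l else 0)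
  | serre (ε : ℤˣ) (i j) (hij : i ≠ j) (k : Fin (1 - C.a i j).toNat → ℤ) (l : ℤ) :
      Rel (Free.serre C ε i j k l) 0

/-- The quantum affine algebra `U_q(𝔤)` over `ℂ(q^{1/2})`. -/
def Uq : Type := RingQuot (Rel C)

instance : Ring (Uq C) := inferInstanceAs (Ring (RingQuot (Rel C)))
instance : Algebra Kq (Uq C) := inferInstanceAs (Algebra Kq (RingQuot (Rel C)))
instance : Algebra ℂ (Uq C) := inferInstanceAs (Algebra ℂ (RingQuot (Rel C)))
instance : IsScalarTower ℂ Kq (Uq C) :=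
  inferInstanceAs (IsScalarTower ℂ Kq (RingQuot (Rel C)))

/-- The projection of the free algebra onto `U_q(𝔤)`. -/
def toUq : Free n →ₐ[Kq] Uq C := RingQuot.mkAlgHom Kq (Rel C)

/-- The quantum Heisenberg subalgebra `G_q`, generated by the `h_{ik}` (`k ≠ 0`) and
`γ^{±1/2}`. -/
def Gq : Subalgebra Kq (Uq C) :=
  Algebra.adjoin Kq (toUq C ''
    ({y | ∃ (i : Fin n) (k : ℤ), k ≠ 0 ∧ y = Free.h i k} ∪ {Free.gam 1, Free.gam (-1)}))

/-- The generators of `G_𝔸^d`. -/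
inductive GAGen : Free n → Prop
  | h (i : Fin n) (k : ℤ) (hk : k ≠ 0) : GAGen (Free.h i k)
  | K (i : Fin n) : GAGen (Free.K i)
  | Kinv (i : Fin n) : GAGen (Free.Kinv i)
  | gamma : GAGen (Free.gam 1)
  | gammaInv : GAGen (Free.gam (-1))
  | D : GAGen Free.D
  | Dinv : GAGen Free.Dinv
  | KBinom (i : Fin n) (s : ℤ) (r : ℕ) : GAGen (Free.KBinom C i s r)
  | DBinom (s : ℤ) (r : ℕ) : GAGen (Free.DBinom C s r)
  | gammaBinom (i : Fin n) (s : ℤ) : GAGen (Free.gammaBinom C i s)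
  | gammaPsi (i : Fin n) (k l : ℤ) : GAGen (Free.gammaPsi C i k l)

/-- The `𝔸`-subalgebra `G_𝔸^d` of `U_q(𝔤)`: the subring generated by `𝔸` and the elements
above. -/
def GA : Subalgebra ℂ (Uq C) :=
  Algebra.adjoin ℂ (algebraMap Kq (Uq C) '' (AA C : Set Kq) ∪ toUq C '' {y | GAGen C y})

/-- A generator of `G_𝔸^d` as an element of `G_𝔸^d`. -/
def gaGen {y : Free n} (hy : GAGen C y) : GA C :=
  ⟨toUq C y, Algebra.subset_adjoin (Or.inr ⟨y, hy, rfl⟩)⟩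

/-! ### `φ`-imaginary Verma modules -/

/-- The generators of the left ideal `{b - χ(b)}` of the one-dimensional module `ℂ(q^{1/2}) v_λ`
over `B_q^φ`: the `x^+_{ik}` and the `h_{i,φ(k)k}` annihilate `v_λ`, while `K_i`, `D`, `γ^{1/2}`
act by `q^{λ(h_i)}`, `q^{λ(d)}`, `q^{λ(c)/2}`. -/
inductive VermaRel (φ : ℕ+ → ℤˣ) (lam : Weight n) : Uq C → Prop
  | x (i : Fin n) (k : ℤ) : VermaRel φ lam (toUq C (Free.x 1 i k))
  | h (i : Fin n) (k : ℕ+) : VermaRel φ lam (toUq C (Free.h i ((φ k : ℤ) * (k : ℤ))))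
  | K (i : Fin n) : VermaRel φ lam (toUq C (Free.K i) - algebraMap Kq (Uq C) (q ^ lam.h i))
  | D : VermaRel φ lam (toUq C Free.D - algebraMap Kq (Uq C) (q ^ lam.d))
  | gamma : VermaRel φ lam (toUq C (Free.gam 1) - algebraMap Kq (Uq C) (qh ^ lam.c))

/-- The left ideal of `U_q(𝔤)` generated by the relations of `v_λ`. -/
def vermaIdeal (φ : ℕ+ → ℤˣ) (lam : Weight n) : Submodule (Uq C) (Uq C) :=
  Submodule.span (Uq C) {y | VermaRel C φ lam y}

/-- The `φ`-imaginary Verma module `M_q^φ(λ) = U_q(𝔤) ⊗_{B_q^φ} ℂ(q^{1/2}) v_λ`, as the quotient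
of `U_q(𝔤)` by the left ideal generated by the relations of `v_λ`. -/
def Verma (φ : ℕ+ → ℤˣ) (lam : Weight n) : Type := Uq C ⧸ vermaIdeal C φ lam

section VermaInstances

variable (φ : ℕ+ → ℤˣ) (lam : Weight n)

instance : AddCommGroup (Verma C φ lam) :=
  inferInstanceAs (AddCommGroup (Uq C ⧸ vermaIdeal C φ lam))
instance : Module (Uq C) (Verma C φ lam) :=
  inferInstanceAs (Module (Uq C) (Uq C ⧸ vermaIdeal C φ lam))
instance : Module Kq (Verma C φ lam) :=
  inferInstanceAs (Module Kq (Uq C ⧸ vermaIdeal C φ lam))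
instance : Module ℂ (Verma C φ lam) :=
  inferInstanceAs (Module ℂ (Uq C ⧸ vermaIdeal C φ lam))
instance : IsScalarTower Kq (Uq C) (Verma C φ lam) :=
  inferInstanceAs (IsScalarTower Kq (Uq C) (Uq C ⧸ vermaIdeal C φ lam))
instance : IsScalarTower ℂ (Uq C) (Verma C φ lam) :=
  inferInstanceAs (IsScalarTower ℂ (Uq C) (Uq C ⧸ vermaIdeal C φ lam))
instance : IsScalarTower ℂ Kq (Verma C φ lam) :=
  inferInstanceAs (IsScalarTower ℂ Kq (Uq C ⧸ vermaIdeal C φ lam))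

/-- The generator `v_λ`. -/
def vLam : Verma C φ lam := (Submodule.mkQ (vermaIdeal C φ lam) (1 : Uq C) : _)

/-- The `G_q`-submodule `N_q = G_q v_λ` of `M_q^φ(λ)`. -/
def Nq : Submodule (Gq C) (Verma C φ lam) := Submodule.span (Gq C) {vLam C φ lam}

/-- The `𝔸`-form `N_𝔸 = G_𝔸^d v_λ`. -/
def NA : Submodule (GA C) (Verma C φ lam) := Submodule.span (GA C) {vLam C φ lam}

end VermaInstances

/-! ### The Lie algebra `G + 𝔥` -/

/-- The space `ḣ ⊗ ℂ[t, t⁻¹]`, with basis `h_i ⊗ t^k`. -/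
abbrev Loop (n : ℕ) : Type := (Fin n × ℤ) →₀ ℂ

/-- The derivation `t d/dt`. -/
def loopDer : Loop n →ₗ[ℂ] Loop n :=
  Finsupp.linearCombination ℂ fun p => Finsupp.single p (p.2 : ℂ)

/-- The cocycle `(h_i ⊗ t^k, h_j ⊗ t^l) ↦ δ_{k+l,0} k (h_i|h_j)`, where
`(h_i|h_j) = (α_i|α_j)/(d_i d_j) = a_{ij}/d_j`. -/
def cocycle : Loop n →ₗ[ℂ] Loop n →ₗ[ℂ] ℂ :=
  Finsupp.linearCombination ℂ fun p => Finsupp.linearCombination ℂ fun r =>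
    if p.2 + r.2 = 0 then (p.2 : ℂ) * ((C.a p.1 r.1 : ℂ) / (C.d r.1 : ℂ)) else 0

/-- The subalgebra `G + 𝔥 = ḣ ⊗ ℂ[t, t⁻¹] ⊕ ℂ c ⊕ ℂ d` of the affine Lie algebra; the triple
`(f, u, w)` stands for `f + u c + w d`. -/
def GH (_C : CartanDatum n) : Type := Loop n × ℂ × ℂ

namespace GH

instance : AddCommGroup (GH C) := inferInstanceAs (AddCommGroup (Loop n × ℂ × ℂ))
instance : Module ℂ (GH C) := inferInstanceAs (Module ℂ (Loop n × ℂ × ℂ))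

/-- `h_i ⊗ t^k`; for `k = 0` this is the element `h_i` of `𝔥`. -/
def h (i : Fin n) (k : ℤ) : GH C := (Finsupp.single (i, k) 1, 0, 0)

/-- the central element `c` -/
def c : GH C := (0, 1, 0)

/-- the degree derivation `d` -/
def d : GH C := (0, 0, 1)

/-- `[f + u c + w d, f' + u' c + w' d] = w f'˙ - w' f˙ + (f, f') c`, where `˙` is `t d/dt`. -/
instance : Bracket (GH C) (GH C) where
  bracket y z := (y.2.2 • loopDer z.1 - z.2.2 • loopDer y.1, cocycle C y.1 z.1, 0)

theorem bracket_def (y z : GH C) :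
    ⁅y, z⁆ = ((y.2.2 • loopDer z.1 - z.2.2 • loopDer y.1, cocycle C y.1 z.1, 0) : GH C) := rfl

theorem cocycle_single (p r : Fin n × ℤ) :
    cocycle C (Finsupp.single p 1) (Finsupp.single r 1) =
      if p.2 + r.2 = 0 then (p.2 : ℂ) * ((C.a p.1 r.1 : ℂ) / (C.d r.1 : ℂ)) else 0 := by
  simp [cocycle]

theorem cocycle_skew (f g : Loop n) : cocycle C f g = -cocycle C g f := by
  have key : cocycle C = -(cocycle C).flip := by
    ext p r
    simp only [LinearMap.comp_apply, Finsupp.lsingle_apply, LinearMap.neg_apply,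
      LinearMap.flip_apply, cocycle_single]
    by_cases hpr : p.2 + r.2 = 0
    · rw [if_pos hpr, if_pos (by omega)]
      have hp : (p.2 : ℂ) = -(r.2 : ℂ) := by
        have : p.2 = -r.2 := by omega
        rw [this]; push_cast; ring
      have h1 : (C.d p.1 : ℂ) ≠ 0 := by exact_mod_cast (C.d_pos p.1).ne'
      have h2 : (C.d r.1 : ℂ) ≠ 0 := by exact_mod_cast (C.d_pos r.1).ne'
      have hs : (C.d p.1 : ℂ) * (C.a p.1 r.1 : ℂ) = (C.d r.1 : ℂ) * (C.a r.1 p.1 : ℂ) := by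
        exact_mod_cast C.symm p.1 r.1
      have : (C.a p.1 r.1 : ℂ) / (C.d r.1 : ℂ) = (C.a r.1 p.1 : ℂ) / (C.d p.1 : ℂ) := by
        rw [div_eq_div_iff h2 h1]; linear_combination hs
      rw [this, hp]; ring
    · rw [if_neg hpr, if_neg (by omega)]; simp
  have := congrArg (fun B => B f g) key
  simpa using this

theorem cocycle_der (f g : Loop n) :
    cocycle C (loopDer f) g + cocycle C f (loopDer g) = 0 := by
  have key : (cocycle C).comp loopDer + (cocycle C).compl₂ loopDer = 0 := by
    ext p r
    have h1 : ∀ t : Fin n × ℤ, loopDer (Finsupp.single t (1 : ℂ)) =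
        (t.2 : ℂ) • Finsupp.single t (1 : ℂ) := by
      intro t; simp [loopDer]
    simp only [LinearMap.comp_apply, Finsupp.lsingle_apply, LinearMap.add_apply,
      LinearMap.compl₂_apply, h1, map_smul, LinearMap.smul_apply, cocycle_single]
    by_cases hpr : p.2 + r.2 = 0
    · have hp : (p.2 : ℂ) = -(r.2 : ℂ) := by
        have : p.2 = -r.2 := by omega
        rw [this]; push_cast; ring
      simp [hpr, hp]
    · simp [hpr]
  have := congrArg (fun B => B f g) key
  simpa using this

instance : LieRing (GH C) where
  add_lie y z w := by
    refine Prod.ext ?_ (Prod.ext ?_ ?_)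
    · change (y.2.2 + z.2.2) • loopDer w.1 - w.2.2 • loopDer (y.1 + z.1) =
        (y.2.2 • loopDer w.1 - w.2.2 • loopDer y.1) + (z.2.2 • loopDer w.1 - w.2.2 • loopDer z.1)
      rw [map_add]; module
    · change cocycle C (y.1 + z.1) w.1 = cocycle C y.1 w.1 + cocycle C z.1 w.1
      simp
    · change (0 : ℂ) = 0 + 0
      simp
  lie_add y z w := by
    refine Prod.ext ?_ (Prod.ext ?_ ?_)
    · change y.2.2 • loopDer (z.1 + w.1) - (z.2.2 + w.2.2) • loopDer y.1 =
        (y.2.2 • loopDer z.1 - z.2.2 • loopDer y.1) + (y.2.2 • loopDer w.1 - w.2.2 • loopDer y.1)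
      rw [map_add]; module
    · change cocycle C y.1 (z.1 + w.1) = cocycle C y.1 z.1 + cocycle C y.1 w.1
      simp
    · change (0 : ℂ) = 0 + 0
      simp
  lie_self y := by
    refine Prod.ext ?_ (Prod.ext ?_ rfl)
    · change y.2.2 • loopDer y.1 - y.2.2 • loopDer y.1 = 0
      simp
    · change cocycle C y.1 y.1 = 0
      exact self_eq_neg.mp (cocycle_skew C y.1 y.1)
  leibniz_lie y z w := by
    refine Prod.ext ?_ (Prod.ext ?_ ?_)
    · change y.2.2 • loopDer (z.2.2 • loopDer w.1 - w.2.2 • loopDer z.1) - (0 : ℂ) • loopDer y.1 =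
        ((0 : ℂ) • loopDer w.1 - w.2.2 • loopDer (y.2.2 • loopDer z.1 - z.2.2 • loopDer y.1)) +
        (z.2.2 • loopDer (y.2.2 • loopDer w.1 - w.2.2 • loopDer y.1) - (0 : ℂ) • loopDer z.1)
      simp only [map_sub, map_smul]; module
    · change cocycle C y.1 (z.2.2 • loopDer w.1 - w.2.2 • loopDer z.1) =
        cocycle C (y.2.2 • loopDer z.1 - z.2.2 • loopDer y.1) w.1 +
        cocycle C z.1 (y.2.2 • loopDer w.1 - w.2.2 • loopDer y.1)
      simp only [map_sub, map_smul, LinearMap.sub_apply, LinearMap.smul_apply, smul_eq_mul]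
      have e1 := cocycle_der C z.1 w.1
      have e2 := cocycle_der C y.1 w.1
      have e3 := cocycle_skew C z.1 (loopDer y.1)
      have e4 := cocycle_der C y.1 z.1
      linear_combination z.2.2 * e2 - y.2.2 * e1 + w.2.2 * e3 - w.2.2 * e4
    · change (0 : ℂ) = 0 + 0
      simp

instance : LieAlgebra ℂ (GH C) where
  lie_smul t y z := by
    refine Prod.ext ?_ (Prod.ext ?_ ?_)
    · change y.2.2 • loopDer (t • z.1) - (t * z.2.2) • loopDer y.1 =
        t • (y.2.2 • loopDer z.1 - z.2.2 • loopDer y.1)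
      rw [map_smul]; module
    · change cocycle C y.1 (t • z.1) = t * cocycle C y.1 z.1
      simp
    · change (0 : ℂ) = t * 0
      simp

end GH

/-! ### Graded modules, classical limits, `𝔸`-admissible modules

`M` is a `U_q(𝔤)`-module and `N` a `G_q`-submodule of it; the action of `K_i`, `D` and of `G_𝔸^d`
is the one on `M`. -/

section Modules

variable {M : Type} [AddCommGroup M] [Module (Uq C) M] [Module Kq M] [IsScalarTower Kq (Uq C) M]

/-- The eigenspace of `D` on `M` for the eigenvalue `q^m`. -/
def DEigenspace (m : ℤ) : Submodule Kq M where
  carrier := {y | toUq C Free.D • y = q ^ m • y}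
  add_mem' {y z} hy hz := by
    change toUq C Free.D • (y + z) = q ^ m • (y + z)
    rw [smul_add, smul_add, show toUq C Free.D • y = q ^ m • y from hy,
      show toUq C Free.D • z = q ^ m • z from hz]
  zero_mem' := by simp
  smul_mem' t y hy := by
    change toUq C Free.D • (t • y) = q ^ m • (t • y)
    rw [smul_comm, show toUq C Free.D • y = q ^ m • y from hy, smul_comm]

/-- The homogeneous components of `N`, as a subspace of `M`, when its generating vector of degree
zero has `D`-eigenvalue `q^e`: since `D h_{ik} D^{-1} = q^k h_{ik}`, the component of degree `m`
is the `q^{e+m}`-eigenspace of `D` on `N`. -/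
def grading (N : Submodule (Gq C) M) (e m : ℤ) : Submodule Kq M :=
  N.restrictScalars Kq ⊓ DEigenspace C (e + m)

/-- `N = ⨁ 𝒢 m` is a `ℤ`-graded `G_q`-module, where `deg h_{ik} = k` and `deg γ^{±1/2} = 0`;
that is, `N` with this grading is an object of `𝒦_q`. -/
structure IsGradedGq (N : Submodule (Gq C) M) (𝒢 : ℤ → Submodule Kq M) : Prop where
  independent : iSupIndep 𝒢
  iSup_eq : ⨆ m, 𝒢 m = N.restrictScalars Kq
  h_mem : ∀ (i : Fin n) (k m : ℤ), k ≠ 0 → ∀ y ∈ 𝒢 m, toUq C (Free.h i k) • y ∈ 𝒢 (m + k)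
  gamma_mem : ∀ m, ∀ y ∈ 𝒢 m, toUq C (Free.gam 1) • y ∈ 𝒢 m
  gammaInv_mem : ∀ m, ∀ y ∈ 𝒢 m, toUq C (Free.gam (-1)) • y ∈ 𝒢 m

/-- `N` is an irreducible object of the category `𝒦_q` of `ℤ`-graded `G_q`-modules: it is nonzero
and its only graded submodules are `0` and `N`. -/
structure IsIrreducibleInKq (N : Submodule (Gq C) M) (𝒢 : ℤ → Submodule Kq M) : Prop where
  graded : IsGradedGq C N 𝒢
  ne_bot : N ≠ ⊥
  eq_bot_or_eq : ∀ W : Submodule (Gq C) M, W ≤ N →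
    W.restrictScalars Kq = ⨆ m, W.restrictScalars Kq ⊓ 𝒢 m → W = ⊥ ∨ W = N

variable [Module ℂ M] [IsScalarTower ℂ Kq M] [IsScalarTower ℂ (Uq C) M]

/-- The submodule `(q^{1/2} - 1) L` of a `G_𝔸^d`-module `L`. -/
def specSubmodule (L : Submodule (GA C) M) : Submodule (GA C) L where
  carrier := {y | ∃ z : L, (y : M) = (qh - 1) • (z : M)}
  add_mem' := by
    rintro y y' ⟨z, hz⟩ ⟨z', hz'⟩
    exact ⟨z + z', by simp [hz, hz', smul_add]⟩
  zero_mem' := ⟨0, by simp⟩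
  smul_mem' := by
    rintro g y ⟨z, hz⟩
    refine ⟨g • z, ?_⟩
    change (g : Uq C) • (y : M) = (qh - 1) • ((g : Uq C) • (z : M))
    rw [hz, smul_comm]

/-- The classical limit `L / (q^{1/2} - 1) L`. -/
def ClassicalLimit (L : Submodule (GA C) M) : Type := L ⧸ specSubmodule C L

instance (L : Submodule (GA C) M) : AddCommGroup (ClassicalLimit C L) :=
  inferInstanceAs (AddCommGroup (L ⧸ specSubmodule C L))
instance (L : Submodule (GA C) M) : Module (GA C) (ClassicalLimit C L) :=
  inferInstanceAs (Module (GA C) (L ⧸ specSubmodule C L))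
instance (L : Submodule (GA C) M) : Module ℂ (ClassicalLimit C L) :=
  inferInstanceAs (Module ℂ (L ⧸ specSubmodule C L))
instance (L : Submodule (GA C) M) : IsScalarTower ℂ (GA C) (ClassicalLimit C L) :=
  inferInstanceAs (IsScalarTower ℂ (GA C) (L ⧸ specSubmodule C L))

/-- The projection of `L` onto its classical limit. -/
def toLimit (L : Submodule (GA C) M) : L →ₗ[GA C] ClassicalLimit C L := (specSubmodule C L).mkQ

/-- The degree `m` part of the classical limit: the image of `L ∩ 𝒢 m`. -/
def limitGrading (L : Submodule (GA C) M) (𝒢 : ℤ → Submodule Kq M) (m : ℤ) :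
    Submodule ℂ (ClassicalLimit C L) :=
  (((𝒢 m).restrictScalars ℂ).comap (L.subtype.restrictScalars ℂ)).map
    ((toLimit C L).restrictScalars ℂ)

attribute [local instance] LieRing.ofAssociativeRing

/-- The representation `ρ` of `G + 𝔥` on the classical limit of `L` is the one induced by the
action of `G_𝔸^d`: `h_i ⊗ t^k` (`k ≠ 0`) acts as the image of `h_{ik}`, `h_i` as the image of
`(K_i - K_i^{-1})/(q_i - q_i^{-1})`, `c` as the image of `(γ - γ^{-1})/(q - q^{-1})` and `d` as
the image of `(D - D^{-1})/(q - q^{-1})`. The Lusztig elements `(γ - γ^{-1})/(q_i - q_i^{-1})` and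
`(D - D^{-1})/(q_0 - q_0^{-1})` specialize to `c / d_i` and `d / d_0`. -/
structure IsLimitAction (L : Submodule (GA C) M)
    (ρ : GH C →ₗ⁅ℂ⁆ Module.End ℂ (ClassicalLimit C L)) : Prop where
  h : ∀ (i : Fin n) (k : ℤ) (hk : k ≠ 0) (y : ClassicalLimit C L),
    ρ (GH.h C i k) y = gaGen C (GAGen.h i k hk) • y
  h0 : ∀ (i : Fin n) (y : ClassicalLimit C L),
    ρ (GH.h C i 0) y = gaGen C (GAGen.KBinom i 0 1) • y
  c : ∀ (i : Fin n) (y : ClassicalLimit C L),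
    ρ (GH.c C) y = (C.d i : ℂ) • gaGen C (GAGen.gammaBinom i 1) • y
  d : ∀ y : ClassicalLimit C L,
    ρ (GH.d C) y = (C.d0 : ℂ) • gaGen C (GAGen.DBinom 0 1) • y

/-- The `G_𝔸^d`-submodule `L` of `M` is an `𝔸`-form of the graded module `N` (the `𝔸`-span of a
`ℂ(q^{1/2})`-basis of `N`) whose classical limit is an irreducible `G + 𝔥`-module in the category
`𝒦` of `ℤ`-graded modules. -/
structure IsAdmissibleForm (N : Submodule (Gq C) M) (𝒢 : ℤ → Submodule Kq M)
    (L : Submodule (GA C) M) : Prop where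
  exists_basis : ∃ B : Set M, LinearIndependent Kq (Subtype.val : B → M) ∧
    Submodule.span Kq B = N.restrictScalars Kq ∧
    (Submodule.span (AA C) B : Set M) = L
  exists_rep : ∃ ρ : GH C →ₗ⁅ℂ⁆ Module.End ℂ (ClassicalLimit C L), IsLimitAction C L ρ ∧
    -- the classical limit is a graded module
    DirectSum.IsInternal (limitGrading C L 𝒢) ∧
    (∀ i k m, ∀ y ∈ limitGrading C L 𝒢 m, ρ (GH.h C i k) y ∈ limitGrading C L 𝒢 (m + k)) ∧
    (∀ m, ∀ y ∈ limitGrading C L 𝒢 m, ρ (GH.c C) y ∈ limitGrading C L 𝒢 m) ∧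
    (∀ m, ∀ y ∈ limitGrading C L 𝒢 m, ρ (GH.d C) y ∈ limitGrading C L 𝒢 m) ∧
    -- and irreducible
    Nontrivial (ClassicalLimit C L) ∧
    ∀ W : Submodule ℂ (ClassicalLimit C L), (∀ z, ∀ y ∈ W, ρ z y ∈ W) → W = ⊥ ∨ W = ⊤

/-- `N` is an `𝔸`-admissible irreducible module of `𝒦_q`. -/
def IsAdmissible (N : Submodule (Gq C) M) (𝒢 : ℤ → Submodule Kq M) : Prop :=
  IsIrreducibleInKq C N 𝒢 ∧ ∃ L : Submodule (GA C) M, IsAdmissibleForm C N 𝒢 L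

end Modules

end QHeis

end

noncomputable section

namespace QHeis

/-! ### Gaussian binomial coefficients -/

section Gauss

variable {𝕜 : Type*} [Field 𝕜]

/-! By the Heisenberg relations, N_q is spanned by monomials in the creation operators h_{i,-φ(k)k}
applied to v_λ. It is therefore a quotient of Fock space, the polynomial ring in variables X_{ik} on
which creation operators multiply and h_{i,φ(k)k} acts as ∑_j c_{ij} ∂/∂X_{jk}, where c_{ij} is the
pairing at level λ(c). Once this surjection `fockMap` is known to be injective, everything else is a
computation with polynomials.

Injectivity is the hard part, since the relations among the x^± might collapse N_q. It suffices to
exhibit one U_q(𝔤)-module that contains Fock space, with its Heisenberg action, as vectors killed by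
the x^+. Take the free module on words in the x^- with coefficients in Fock space, let the Cartan
generators act through their commutation rules, and define the x^+ recursively by prescribing [x^+,
x^-]. All relations then hold except those among the x^+ alone and those among the x^- alone
(`isPreRep_rep`). Now divide by the radical, the vectors whose image under every word in the x^+ has
no component at the empty word. Nonzero vectors of the empty word survive. In the quotient a
relation among the x^+ kills the vectors of the empty word, so it vanishes as soon as it commutes
with the x^-. Dually, a relation among the x^- has no component at the empty word, so it vanishes as
soon as it commutes with the x^+ (`quadRel_quotRep`, `quotRep_serre`).

These commutations (`commute_quadRel`, `commute_serre`) are computations with generating functions.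
Commuting with an opposite generator replaces one letter by a coefficient of the current ψ or φ.
Because ψ and φ are exponentials, they solve a first-order equation z F' = U F, and uniqueness of
its solutions gives exchange relations between them and the x, with structure function (P - z)/(1 -
Pz). For the quadratic relations this is already enough. A Serre relation is first polarized to a
single repeated letter. The shifts of that letter are then collected in two series A, B with BA =
p²AB, and moving ψ through the product leaves two Gaussian binomial identities in a quantum plane
(`sum_gauss_quantumPlane`, `sum_gauss_bimodule`).

If the matrices (c_{ij}) are invertible, all partial derivatives are available, so a nonzero stable
subspace of Fock space contains 1 and hence everything (`fock_irreducible`). For λ(c) ≠ 0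
invertibility is checked at q^{1/2} = 1, where the matrix is the positive definite symmetrized
Cartan matrix up to invertible diagonal factors. For λ(c) = 0 the annihilation operators vanish, and
the polynomials without constant term give a proper graded submodule.

For admissibility, N_𝔸 is the 𝔸-span of the monomials. The pairings and the eigenvalues of the
Lusztig elements lie in 𝔸 because the ratios (q^a - q^{-a})/(q^b - q^{-b}) do. This requires the
[m]_q to be invertible in 𝔸, which is where the coprimality of the d_i enters (`qInt_q_inv_mem`).
The elements of 𝔸 vanishing at q^{1/2} = 1 are the multiples of q^{1/2} - 1, so the classical limit
is Fock space over ℂ with the specialized pairing (`limEquiv`), and `fock_irreducible` applies once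
more. -/

/-- The quantum integer `[m]_p` in an arbitrary field. -/
def qNum (p : 𝕜) (m : ℤ) : 𝕜 := (p ^ m - p ^ (-m)) / (p - p⁻¹)

/-- The quantum factorial `[m]_p!` in an arbitrary field. -/
def qNumFact (p : 𝕜) (m : ℕ) : 𝕜 := ∏ k ∈ Finset.Icc 1 m, qNum p k

/-- The quantum parameter `p` is nonzero and not a root of unity. -/
structure IsGeneric (p : 𝕜) : Prop where
  ne_zero : p ≠ 0
  pow_ne_one : ∀ m : ℕ, 0 < m → p ^ (2 * m) ≠ 1

namespace IsGeneric

variable {p : 𝕜}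

theorem inv (hp : IsGeneric p) : IsGeneric p⁻¹ :=
  ⟨inv_ne_zero hp.ne_zero, fun m hm h => hp.pow_ne_one m hm (by
    rw [inv_pow] at h; exact inv_eq_one.mp h)⟩

theorem sub_inv_ne (hp : IsGeneric p) : p - p⁻¹ ≠ 0 := by
  intro h
  apply hp.pow_ne_one 1 one_pos
  have h0 := hp.ne_zero
  field_simp at h
  linear_combination h

theorem zpow_sub_ne (hp : IsGeneric p) {m : ℕ} (hm : 0 < m) :
    p ^ (m : ℤ) - p ^ (-(m : ℤ)) ≠ 0 := by
  intro h
  apply hp.pow_ne_one m hm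
  have h0 := hp.ne_zero
  rw [zpow_neg, zpow_natCast] at h
  field_simp at h
  rw [mul_comm, pow_mul]
  linear_combination h

theorem qNum_ne (hp : IsGeneric p) {m : ℕ} (hm : 0 < m) : qNum p m ≠ 0 :=
  div_ne_zero (hp.zpow_sub_ne hm) hp.sub_inv_ne

end IsGeneric

theorem qNum_one {p : 𝕜} (hp : IsGeneric p) : qNum p 1 = 1 := by
  have := hp.sub_inv_ne
  simp [qNum, this]

theorem qNum_inv (p : 𝕜) (m : ℤ) : qNum p⁻¹ m = qNum p m := by
  simp only [qNum, inv_zpow', neg_neg, inv_inv]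
  rw [← neg_sub, ← neg_sub p p⁻¹, neg_div_neg_eq]

theorem qNumFact_succ (p : 𝕜) (m : ℕ) : qNumFact p (m + 1) = qNumFact p m * qNum p (m + 1 : ℕ) := by
  rw [qNumFact, qNumFact, Finset.prod_Icc_succ_top (by omega)]

theorem qNumFact_ne {p : 𝕜} (hp : IsGeneric p) (m : ℕ) : qNumFact p m ≠ 0 := by
  rw [qNumFact, Finset.prod_ne_zero_iff]
  intro k hk
  exact hp.qNum_ne (Finset.mem_Icc.mp hk).1

/-- Gaussian binomial coefficients, defined by the quantum Pascal rule. -/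
def gauss (p : 𝕜) : ℕ → ℕ → 𝕜
  | _, 0 => 1
  | 0, _ + 1 => 0
  | n + 1, k + 1 => p ^ (k + 1 : ℤ) * gauss p n (k + 1) + p ^ ((k : ℤ) - n) * gauss p n k

theorem gauss_zero_right (p : 𝕜) (n : ℕ) : gauss p n 0 = 1 := by cases n <;> rfl

theorem gauss_succ_succ (p : 𝕜) (n k : ℕ) : gauss p (n + 1) (k + 1) =
    p ^ (k + 1 : ℤ) * gauss p n (k + 1) + p ^ ((k : ℤ) - n) * gauss p n k := rfl

theorem gauss_eq_zero (p : 𝕜) : ∀ (n k : ℕ), n < k → gauss p n k = 0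
  | 0, k + 1, _ => rfl
  | n + 1, k + 1, h => by
    rw [gauss_succ_succ, gauss_eq_zero p n (k + 1) (by omega), gauss_eq_zero p n k (by omega)]
    simp

/-- The factorial formula without division. The Pascal rule reduces it to [k+l+2] = p^{k+1}[l+1] +
p^{-(l+1)}[k+1]. -/
theorem gauss_add_mul {p : 𝕜} (hp : IsGeneric p) :
    ∀ k l : ℕ, gauss p (k + l) k * (qNumFact p k * qNumFact p l) = qNumFact p (k + l)
  | 0, l => by simp [gauss_zero_right, qNumFact]
  | k + 1, 0 => by
    have h := gauss_add_mul hp k 0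
    rw [Nat.add_zero] at h
    rw [Nat.add_zero, gauss_succ_succ, gauss_eq_zero p k (k + 1) (by omega), qNumFact_succ]
    rw [sub_self, zpow_zero]
    linear_combination qNum p (k + 1 : ℕ) * h
  | k + 1, l + 1 => by
    have h1 := gauss_add_mul hp k (l + 1)
    have h2 := gauss_add_mul hp (k + 1) l
    have e1 : k + 1 + (l + 1) = (k + l + 1) + 1 := by ring
    have e2 : k + (l + 1) = k + l + 1 := by ring
    have e3 : k + 1 + l = k + l + 1 := by ring
    rw [e2] at h1
    rw [e3] at h2
    rw [e1, gauss_succ_succ]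
    have h3 : qNum p ((k + l + 1 + 1 : ℕ) : ℤ) =
        p ^ (k + 1 : ℤ) * qNum p ((l + 1 : ℕ) : ℤ) +
        p ^ ((k : ℤ) - (k + l + 1 : ℕ)) * qNum p ((k + 1 : ℕ) : ℤ) := by
      have hp0 := hp.ne_zero
      simp only [qNum]
      rw [mul_div_assoc', mul_div_assoc', ← add_div]
      congr 1
      rw [mul_sub, mul_sub, ← zpow_add₀ hp0, ← zpow_add₀ hp0, ← zpow_add₀ hp0, ← zpow_add₀ hp0]
      push_cast
      ring_nf
    rw [qNumFact_succ p (k + l + 1), h3]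
    rw [qNumFact_succ p k] at h2 ⊢
    rw [qNumFact_succ p l] at h1 ⊢
    linear_combination p ^ (k + 1 : ℤ) * qNum p ((l + 1 : ℕ) : ℤ) * h2 +
      p ^ ((k : ℤ) - (k + l + 1 : ℕ)) * qNum p ((k + 1 : ℕ) : ℤ) * h1

/-- This absorption rule and the next one let the two families of terms in `sum_gauss_bimodule` be
brought to a common binomial coefficient. -/
theorem gauss_mul_qNum_succ {p : 𝕜} (hp : IsGeneric p) {m r : ℕ} (h : r ≤ m) :
    gauss p (m + 1) (r + 1) * qNum p (r + 1 : ℕ) = qNum p (m + 1 : ℕ) * gauss p m r := by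
  obtain ⟨l, rfl⟩ := Nat.exists_eq_add_of_le h
  have h1 := gauss_add_mul hp r l
  have h2 := gauss_add_mul hp (r + 1) l
  rw [show r + 1 + l = r + l + 1 by ring, qNumFact_succ p (r + l), ← h1, qNumFact_succ] at h2
  have := qNumFact_ne hp r
  have := qNumFact_ne hp l
  apply mul_right_cancel₀ (mul_ne_zero (qNumFact_ne hp r) (qNumFact_ne hp l))
  linear_combination h2

theorem gauss_mul_qNum_sub {p : 𝕜} (hp : IsGeneric p) {m r : ℕ} (h : r ≤ m) :
    gauss p (m + 1) r * qNum p (m + 1 - r : ℕ) = qNum p (m + 1 : ℕ) * gauss p m r := by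
  obtain ⟨l, rfl⟩ := Nat.exists_eq_add_of_le h
  have h1 := gauss_add_mul hp r l
  have h2 := gauss_add_mul hp r (l + 1)
  rw [show r + (l + 1) = r + l + 1 by ring, qNumFact_succ p (r + l), ← h1, qNumFact_succ] at h2
  rw [show r + l + 1 - r = l + 1 by omega]
  apply mul_right_cancel₀ (mul_ne_zero (qNumFact_ne hp r) (qNumFact_ne hp l))
  linear_combination h2

theorem qNumFact_inv (p : 𝕜) (m : ℕ) : qNumFact p⁻¹ m = qNumFact p m := by
  simp [qNumFact, qNum_inv]

/-- Quantum factorials are symmetric under p ↦ p⁻¹, although the Pascal rule used as definition is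
not visibly so. This symmetry allows the φ-currents and the x^- to be treated by replacing p with
p⁻¹. -/
theorem gauss_inv {p : 𝕜} (hp : IsGeneric p) (m r : ℕ) : gauss p⁻¹ m r = gauss p m r := by
  rcases lt_or_ge m r with h | h
  · rw [gauss_eq_zero _ _ _ h, gauss_eq_zero _ _ _ h]
  · obtain ⟨l, rfl⟩ := Nat.exists_eq_add_of_le h
    have h1 := gauss_add_mul hp r l
    have h2 := gauss_add_mul hp.inv r l
    simp only [qNumFact_inv] at h2
    exact mul_right_cancel₀ (mul_ne_zero (qNumFact_ne hp r) (qNumFact_ne hp l)) (h2.trans h1.symm)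

theorem pow_two_mul_sub_one {p : 𝕜} (hp : IsGeneric p) (m : ℕ) :
    p ^ (2 * m) - 1 = p ^ m * (p - p⁻¹) * qNum p m := by
  have h0 := hp.ne_zero
  have h1 := hp.sub_inv_ne
  rw [qNum, mul_assoc, mul_div_cancel₀ _ h1, zpow_neg, zpow_natCast, mul_sub, mul_inv_cancel₀
    (pow_ne_zero m h0)]
  ring

end Gauss

theorem qBinom_eq_gauss {p : Kq} (hp : IsGeneric p) {m r : ℕ} (h : r ≤ m) :
    qBinom p m r = gauss p m r := by
  obtain ⟨l, rfl⟩ := Nat.exists_eq_add_of_le h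
  have e : ∀ m, qFact p m = qNumFact p m := fun m => rfl
  rw [qBinom, Nat.add_sub_cancel_left, e, e, e]
  exact (div_eq_iff (mul_ne_zero (qNumFact_ne hp r) (qNumFact_ne hp l))).mpr
    (gauss_add_mul hp r l).symm

/-! ### Identities in the quantum plane -/

section QuantumPlane

variable {𝕜 : Type*} [Field 𝕜] {E : Type*} [Ring E] [Algebra 𝕜 E] {p : 𝕜}

/-- The alternating sum of quantum binomials which governs the commutator of a Serre element with
the generator opposite to the letter occurring once. -/
theorem sum_gauss_quantumPlane (hp : IsGeneric p) (A : E) :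
    ∀ (N : ℕ) (B : E), B * A = p ^ 2 • (A * B) →
      ∑ r ∈ Finset.range (N + 2), ((-1) ^ r * gauss p (N + 1) r) •
        ((A - p ^ (-(N : ℤ)) • B) ^ r * (p ^ (-(N : ℤ)) • A - B) ^ (N + 1 - r)) = 0
  | 0, B, hB => by
    simp [Finset.sum_range_succ, gauss]
  | N + 1, B, hB => by
    have hp0 := hp.ne_zero
    set P : 𝕜 := p ^ (-((N + 1 : ℕ) : ℤ)) with hP
    -- Rescaling B by p⁻¹ makes the left factor X the same for N and N + 1. Only the right factor
    -- changes, from Z to Y, and B Y = p Z B converts one into the other.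
    have ih := sum_gauss_quantumPlane hp A N (p⁻¹ • B) (by
      rw [smul_mul_assoc, hB, mul_smul_comm, smul_comm])
    have hPN : p ^ (-(N : ℤ)) = p * P := by
      rw [hP, ← zpow_one_add₀ hp0]; push_cast; ring_nf
    set X := A - P • B with hX
    set Y := P • A - B with hY
    set Z := (p * P) • A - p⁻¹ • B with hZ
    have e1 : A - p ^ (-(N : ℤ)) • p⁻¹ • B = X := by
      rw [hPN, smul_smul, hX]; congr 2; field_simp
    have e2 : p ^ (-(N : ℤ)) • A - p⁻¹ • B = Z := by rw [hPN]
    rw [e1, e2] at ih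
    have hBY : B * Y = p • (Z * B) := by
      rw [hY, hZ, mul_sub, mul_smul_comm, hB, sub_mul, smul_mul_assoc, smul_mul_assoc, smul_sub,
        smul_smul, smul_smul, smul_smul, mul_inv_cancel₀ hp0, one_smul]
      congr 2; ring
    have hBYm : ∀ m : ℕ, B * Y ^ m = p ^ m • (Z ^ m * B) := by
      intro m
      induction m with
      | zero => simp
      | succ m ihm =>
        rw [pow_succ, ← mul_assoc, ihm, smul_mul_assoc, mul_assoc, hBY, mul_smul_comm, smul_smul,
          ← mul_assoc, ← pow_succ, ← pow_succ]
    -- The two places where the Pascal rule uses the r-th coefficient combine into X^r (p^r Y - p^r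
    -- P X) Y^{N+1-r}. The middle factor is a multiple of B, and moving it to the right turns the
    -- Y's into Z's.
    have key : ∀ r ∈ Finset.range (N + 2),
        ((-1) ^ r * gauss p (N + 1) r) • (p ^ (r : ℤ) • (X ^ r * Y ^ (N + 2 - r)) -
          p ^ ((r : ℤ) - (N + 1 : ℕ)) • (X ^ (r + 1) * Y ^ (N + 1 - r))) =
        (((P ^ 2 - 1) * p ^ (N + 1)) • (((-1) ^ r * gauss p (N + 1) r) •
          (X ^ r * Z ^ (N + 1 - r)))) * B := by
      intro r hr
      have hr' : r ≤ N + 1 := by simp at hr; omega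
      rw [smul_comm, smul_mul_assoc]
      congr 1
      rw [show N + 2 - r = (N + 1 - r) + 1 by omega, pow_succ' Y, pow_succ X]
      have h1 : p ^ (r : ℤ) • Y - p ^ ((r : ℤ) - (N + 1 : ℕ)) • X =
          (p ^ r * (P ^ 2 - 1)) • B := by
        rw [sub_eq_add_neg (r : ℤ), zpow_add₀ hp0, ← hP, hX, hY, zpow_natCast]
        module
      calc p ^ (r : ℤ) • (X ^ r * (Y * Y ^ (N + 1 - r))) -
          p ^ ((r : ℤ) - (N + 1 : ℕ)) • (X ^ r * X * Y ^ (N + 1 - r))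
          = X ^ r * (p ^ (r : ℤ) • Y - p ^ ((r : ℤ) - (N + 1 : ℕ)) • X) * Y ^ (N + 1 - r) := by
            simp only [mul_sub, sub_mul, mul_smul_comm, smul_mul_assoc, mul_assoc]
        _ = _ := by
            rw [h1, mul_smul_comm, smul_mul_assoc, mul_assoc, hBYm, mul_smul_comm, smul_smul,
              smul_mul_assoc, mul_assoc (X ^ r)]
            congr 1
            rw [show p ^ (N + 1) = p ^ r * p ^ (N + 1 - r) by rw [← pow_add]; congr 1; omega]
            ring
    have expand : ∑ r ∈ Finset.range (N + 1 + 2), ((-1) ^ r * gauss p (N + 1 + 1) r) •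
        (X ^ r * Y ^ (N + 1 + 1 - r)) =
        ∑ r ∈ Finset.range (N + 2),
        ((-1) ^ r * gauss p (N + 1) r) • (p ^ (r : ℤ) • (X ^ r * Y ^ (N + 2 - r)) -
          p ^ ((r : ℤ) - (N + 1 : ℕ)) • (X ^ (r + 1) * Y ^ (N + 1 - r))) := by
      simp only [smul_sub, Finset.sum_sub_distrib]
      rw [Finset.sum_range_succ']
      have h2 : ∀ r ∈ Finset.range (N + 2), ((-1) ^ (r + 1) * gauss p (N + 1 + 1) (r + 1)) •
          (X ^ (r + 1) * Y ^ (N + 1 + 1 - (r + 1))) =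
          ((-1) ^ (r + 1) * gauss p (N + 1) (r + 1)) •
            (p ^ ((r + 1 : ℕ) : ℤ) • (X ^ (r + 1) * Y ^ (N + 2 - (r + 1)))) -
          ((-1) ^ r * gauss p (N + 1) r) •
            (p ^ ((r : ℤ) - (N + 1 : ℕ)) • (X ^ (r + 1) * Y ^ (N + 1 - r))) := by
        intro r hr
        rw [gauss_succ_succ, show N + 1 + 1 - (r + 1) = N + 1 - r by omega,
          smul_smul, smul_smul, ← sub_smul]
        congr 1
        push_cast
        ring
      rw [Finset.sum_congr rfl h2, Finset.sum_sub_distrib]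
      have h3 : ∑ r ∈ Finset.range (N + 2), ((-1) ^ r * gauss p (N + 1) r) •
          (p ^ (r : ℤ) • (X ^ r * Y ^ (N + 2 - r))) =
          ∑ r ∈ Finset.range (N + 2), ((-1) ^ (r + 1) * gauss p (N + 1) (r + 1)) •
            (p ^ ((r + 1 : ℕ) : ℤ) • (X ^ (r + 1) * Y ^ (N + 2 - (r + 1)))) + Y ^ (N + 2) := by
        rw [Finset.sum_range_succ', Finset.sum_range_succ _ (N + 1),
          gauss_eq_zero p (N + 1) (N + 1 + 1) (by omega)]
        simp [gauss_zero_right]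
      rw [h3]
      simp only [gauss_zero_right, pow_zero, one_mul, one_smul, Nat.sub_zero]
      abel
    rw [expand, Finset.sum_congr rfl key, ← Finset.sum_mul, ← Finset.smul_sum, ih]
    simp

section

variable {A B : E}

/-- Here and in the next lemma, powers of the two extreme combinations are expressed through A - B,
the only element whose powers survive the geometric sums. The truncated exponent r - 1 is harmless
at r = 0 because its coefficient vanishes there. -/
theorem quantumPlane_pow_left (hB : B * A = p ^ 2 • (A * B)) (r : ℕ) :
    (A - p ^ 2 • B) ^ r = (A - B) ^ r - (p ^ (2 * r) - 1) • ((A - B) ^ (r - 1) * B) := by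
  have hBV : B * (A - B) = p ^ 2 • ((A - B) * B) + (p ^ 2 - 1) • (B * B) := by
    rw [mul_sub, hB, sub_mul]; module
  induction r with
  | zero => simp
  | succ r ih =>
    rw [pow_succ, ih]
    rcases r with _ | r
    · simp; module
    · simp only [Nat.add_sub_cancel] at ih ⊢
      set V := A - B with hV
      have hX : A - p ^ 2 • B = V - (p ^ 2 - 1) • B := by rw [hV]; module
      clear_value V
      rw [hX, sub_mul, mul_sub, mul_sub, ← pow_succ, mul_smul_comm, smul_mul_assoc, mul_assoc, hBV,
        smul_mul_assoc, mul_smul_comm, mul_assoc (V ^ r), mul_add (V ^ r), mul_smul_comm, mul_smul_comm,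
        ← mul_assoc (V ^ r) V B, ← pow_succ]
      module

theorem quantumPlane_pow_right (hB : B * A = p ^ 2 • (A * B)) (r : ℕ) :
    (p ^ 2 • A - B) ^ r =
      p ^ (2 * r) • (A - B) ^ r + (p ^ (2 * r) - 1) • (B * (A - B) ^ (r - 1)) := by
  have hBV : B * (A - B) = p ^ 2 • ((A - B) * B) + (p ^ 2 - 1) • (B * B) := by
    rw [mul_sub, hB, sub_mul]; module
  induction r with
  | zero => simp
  | succ r ih =>
    rw [pow_succ', ih]
    rcases r with _ | r
    · simp; module
    · simp only [Nat.add_sub_cancel] at ih ⊢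
      set V := A - B with hV
      have hX : p ^ 2 • A - B = p ^ 2 • V + (p ^ 2 - 1) • B := by rw [hV]; module
      have hVB : p ^ 2 • (V * (B * V ^ r)) = B * V ^ (r + 1) - (p ^ 2 - 1) • (B * (B * V ^ r)) := by
        rw [← mul_assoc V, ← smul_mul_assoc, eq_sub_of_add_eq hBV.symm, sub_mul, mul_assoc,
          ← pow_succ', smul_mul_assoc, mul_assoc]
      have : (p ^ 2 • V + (p ^ 2 - 1) • B) *
          (p ^ (2 * (r + 1)) • V ^ (r + 1) + (p ^ (2 * (r + 1)) - 1) • (B * V ^ r)) =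
          p ^ (2 * (r + 1)) • p ^ 2 • V ^ (r + 1 + 1) +
          (p ^ (2 * (r + 1)) - 1) • (p ^ 2 • (V * (B * V ^ r))) +
          ((p ^ 2 - 1) * p ^ (2 * (r + 1))) • (B * V ^ (r + 1)) +
          ((p ^ 2 - 1) * (p ^ (2 * (r + 1)) - 1)) • (B * (B * V ^ r)) := by
        rw [add_mul, mul_add (p ^ 2 • V), mul_add ((p ^ 2 - 1) • B), smul_mul_smul_comm, smul_mul_smul_comm, smul_mul_smul_comm,
          smul_mul_smul_comm, ← pow_succ']
        module
      rw [hX, this, hVB]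
      module

/-- The two factors do not commute, yet the homogeneous sum collapses. In the inductive step p²A - B
= p²(A - B) + (p² - 1)B, and the resulting B-term cancels the correction term of (A - p²B)^{r+1},
because [r+1] p^r (p² - 1) = p^{2(r+1)} - 1. -/
theorem quantumPlane_geom_sum (hp : IsGeneric p) (hB : B * A = p ^ 2 • (A * B)) (r : ℕ) :
    ∑ a ∈ Finset.range (r + 1), (A - p ^ 2 • B) ^ a * (p ^ 2 • A - B) ^ (r - a) =
      (qNum p (r + 1 : ℕ) * p ^ r) • (A - B) ^ r := by
  induction r with
  | zero => simp [qNum_one hp]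
  | succ r ih =>
    have h1 : ∀ a ∈ Finset.range (r + 1), (A - p ^ 2 • B) ^ a * (p ^ 2 • A - B) ^ (r + 1 - a) =
        (A - p ^ 2 • B) ^ a * (p ^ 2 • A - B) ^ (r - a) * (p ^ 2 • A - B) := by
      intro a ha
      have : a ≤ r := by simp at ha; omega
      rw [mul_assoc, ← pow_succ, show r + 1 - a = r - a + 1 by omega]
    rw [Finset.sum_range_succ, Finset.sum_congr rfl h1, ← Finset.sum_mul, ih,
      quantumPlane_pow_left hB, Nat.sub_self, pow_zero, mul_one, Nat.add_sub_cancel]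
    have hX : p ^ 2 • A - B = p ^ 2 • (A - B) + (p ^ 2 - 1) • B := by module
    rw [hX, mul_add, mul_smul_comm, mul_smul_comm, smul_mul_assoc, smul_mul_assoc, ← pow_succ]
    have e1 : qNum p (r + 1 + 1 : ℕ) * p ^ (r + 1) = qNum p (r + 1 : ℕ) * p ^ r * p ^ 2 + 1 := by
      have h0 := hp.ne_zero
      have h1 := hp.sub_inv_ne
      have e : ∀ m : ℕ, qNum p m = (p ^ m - (p ^ m)⁻¹) / (p - p⁻¹) := by
        intro m; rw [qNum, zpow_neg, zpow_natCast]
      rw [e, e, div_mul_eq_mul_div, div_mul_eq_mul_div, div_mul_eq_mul_div, div_add_one h1]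
      congr 1
      field_simp
      ring
    have e2 : qNum p (r + 1 : ℕ) * p ^ r * (p ^ 2 - 1) = p ^ (2 * (r + 1)) - 1 := by
      rw [pow_two_mul_sub_one hp (r + 1), pow_succ]
      have := hp.ne_zero
      field_simp
      ring
    rw [e1, ← e2]
    module

end

/-- The identity which governs the commutator of a Serre element with the generator opposite to
the repeated letter. -/
theorem sum_gauss_bimodule (hp : IsGeneric p) (M : ℕ) {A B C D : E}
    (hB : B * A = p ^ 2 • (A * B))
    (hC : p ^ M • (B * C + D * A) = A * D + C * B) :
    ∑ r ∈ Finset.range (M + 2), ((-1) ^ r * gauss p (M + 1) r) •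
      ((∑ a ∈ Finset.range r, (A - p ^ 2 • B) ^ a * (p ^ 2 • A - B) ^ (r - 1 - a)) *
          (p ^ (-(M : ℤ)) • C - D) * (p ^ 2 • A - B) ^ (M + 1 - r) +
        (A - p ^ 2 • B) ^ r * (C - p ^ (-(M : ℤ)) • D) *
          ∑ a ∈ Finset.range (M + 1 - r),
            (A - p ^ 2 • B) ^ a * (p ^ 2 • A - B) ^ (M - r - a)) = 0 := by
  have hp0 := hp.ne_zero
  set V := A - B with hV
  set X := A - p ^ 2 • B with hX
  set Z := p ^ 2 • A - B with hZ
  set P := p ^ (-(M : ℤ)) with hP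
  have hPM : P = (p ^ M)⁻¹ := by rw [hP, zpow_neg, zpow_natCast]
  simp only [smul_add, Finset.sum_add_distrib]
  rw [Finset.sum_range_succ', Finset.sum_range_succ _ (M + 1)]
  simp only [Finset.range_zero, Finset.sum_empty, zero_mul, mul_zero, smul_zero, add_zero,
    Nat.sub_self]
  rw [← Finset.sum_add_distrib]
  -- The first family is shifted by one, since its term at r = 0 is an empty sum, as is the last
  -- term of the second family. The absorption rules then give both families the common coefficient
  -- [M+1] · `gauss p M r`.
  have step : ∀ r ∈ Finset.range (M + 1),
      ((-1) ^ (r + 1) * gauss p (M + 1) (r + 1)) •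
        ((∑ a ∈ Finset.range (r + 1), X ^ a * Z ^ (r + 1 - 1 - a)) * (P • C - D) *
          Z ^ (M + 1 - (r + 1))) +
      ((-1) ^ r * gauss p (M + 1) r) • (X ^ r * (C - P • D) *
          ∑ a ∈ Finset.range (M + 1 - r), X ^ a * Z ^ (M - r - a)) =
      qNum p (M + 1 : ℕ) • ((((-1) ^ r * gauss p M r) * (p ^ (2 * r) - 1)) •
          (V ^ (r - 1) * ((p ^ r)⁻¹ • (A * D) - p ^ (M - r) • (B * C)) * V ^ (M - r)) +
        (((-1) ^ r * gauss p M r) * (p ^ (2 * (M - r)) - 1)) •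
          (V ^ r * (p ^ r • (D * A) - (p ^ (M - r))⁻¹ • (C * B)) * V ^ (M - r - 1))) := by
    intro r hr
    have hr : r ≤ M := by simp at hr; omega
    rw [show M + 1 - r = (M - r) + 1 by omega, Nat.add_sub_cancel, Nat.add_sub_add_right,
      quantumPlane_geom_sum hp hB, quantumPlane_geom_sum hp hB, ← hV, smul_mul_assoc,
      smul_mul_assoc, mul_smul_comm, smul_smul, smul_smul]
    have g1 := gauss_mul_qNum_succ hp hr
    have g2 := gauss_mul_qNum_sub hp hr
    rw [show M + 1 - r = (M - r) + 1 by omega] at g2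
    have c1 : (-1) ^ (r + 1) * gauss p (M + 1) (r + 1) * (qNum p (r + 1 : ℕ) * p ^ r) =
        qNum p (M + 1 : ℕ) * ((-1) ^ r * gauss p M r * -p ^ r) := by
      linear_combination (-1) ^ (r + 1) * p ^ r * g1
    have c2 : (-1) ^ r * gauss p (M + 1) r * (qNum p (M - r + 1 : ℕ) * p ^ (M - r)) =
        qNum p (M + 1 : ℕ) * ((-1) ^ r * gauss p M r * p ^ (M - r)) := by
      linear_combination (-1) ^ r * p ^ (M - r) * g2
    rw [c1, c2, mul_smul _ (_ * -p ^ r), mul_smul _ (_ * p ^ (M - r)), ← smul_add]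
    congr 1
    rw [mul_smul _ (-p ^ r), mul_smul _ (p ^ (M - r)), ← smul_add, mul_smul _ (p ^ (2 * r) - 1),
      mul_smul _ (p ^ (2 * (M - r)) - 1), ← smul_add]
    congr 1
    have hPr : P = (p ^ r)⁻¹ * (p ^ (M - r))⁻¹ := by
      rw [hPM, ← mul_inv, ← pow_add]; congr 2; omega
    have hZp : Z ^ (M - r) = V ^ (M - r) + (p ^ (2 * (M - r)) - 1) • (A * V ^ (M - r - 1)) := by
      rw [hZ, quantumPlane_pow_right hB, ← hV]
      rcases M - r with _ | m
      · simp
      · rw [Nat.add_sub_cancel, show B * V ^ m = A * V ^ m - V ^ (m + 1) by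
          rw [pow_succ', hV]; noncomm_ring]
        module
    have hZp' := quantumPlane_pow_right hB (M - r)
    rw [← hV, ← hZ] at hZp'
    have hXp' : X ^ r = p ^ (2 * r) • V ^ r - (p ^ (2 * r) - 1) • (V ^ (r - 1) * A) := by
      rw [hX, quantumPlane_pow_left hB, ← hV]
      rcases r with _ | m
      · simp
      · rw [Nat.add_sub_cancel, show V ^ m * B = V ^ m * A - V ^ (m + 1) by
          rw [pow_succ, hV]; noncomm_ring]
        module
    have hXp := quantumPlane_pow_left hB r
    rw [← hV, ← hX] at hXp
    have t1 : V ^ r * (P • C - D) * Z ^ (M - r) =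
        P • (V ^ r * C * (p ^ (2 * (M - r)) • V ^ (M - r) +
          (p ^ (2 * (M - r)) - 1) • (B * V ^ (M - r - 1)))) -
        V ^ r * D * (V ^ (M - r) + (p ^ (2 * (M - r)) - 1) • (A * V ^ (M - r - 1))) := by
      rw [← hZp, ← hZp', mul_sub, sub_mul, mul_smul_comm, smul_mul_assoc]
    have t2 : X ^ r * (C - P • D) * V ^ (M - r) =
        (V ^ r - (p ^ (2 * r) - 1) • (V ^ (r - 1) * B)) * C * V ^ (M - r) -
        P • ((p ^ (2 * r) • V ^ r - (p ^ (2 * r) - 1) • (V ^ (r - 1) * A)) * D * V ^ (M - r)) := by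
      rw [← hXp, ← hXp', mul_sub, sub_mul, mul_smul_comm, smul_mul_assoc]
    rw [t1, t2]
    simp only [mul_add, mul_sub, sub_mul, mul_smul_comm, smul_mul_assoc, mul_assoc,
      smul_add, smul_sub, smul_smul, neg_smul]
    have q1 : p ^ r ≠ 0 := pow_ne_zero _ hp0
    have q2 : p ^ (M - r) ≠ 0 := pow_ne_zero _ hp0
    rw [hPr]
    rw [show p ^ (2 * r) = p ^ r * p ^ r by rw [two_mul, pow_add],
      show p ^ (2 * (M - r)) = p ^ (M - r) * p ^ (M - r) by rw [two_mul, pow_add]]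
    generalize p ^ r = u at *
    generalize p ^ (M - r) = w at *
    match_scalars <;> field_simp <;> ring
  -- A second shift is possible because p^{2r} - 1 vanishes at r = 0 and p^{2(M-r)} - 1 at r = M.
  -- Afterwards both families have the shape V^r (…) V^{M-r-1} with matching coefficients, and the
  -- middle factors cancel by `hC`.
  rw [Finset.sum_congr rfl step, ← Finset.smul_sum, Finset.sum_add_distrib, Finset.sum_range_succ',
    Finset.sum_range_succ _ M]
  simp only [mul_zero, pow_zero, sub_self, zero_smul, add_zero, Nat.sub_self]
  rw [← Finset.sum_add_distrib, Finset.sum_eq_zero, smul_zero]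
  intro r hr
  have hr : r < M := by simpa using hr
  obtain ⟨m, rfl⟩ := Nat.exists_eq_add_of_lt hr
  rw [show r + m + 1 - (r + 1) = m by omega, show r + m + 1 - r = m + 1 by omega,
    Nat.add_sub_cancel, Nat.add_sub_cancel]
  have g1 := gauss_mul_qNum_succ hp (show r ≤ r + m by omega)
  have g2 := gauss_mul_qNum_sub hp (show r ≤ r + m by omega)
  rw [show r + m + 1 - r = m + 1 by omega, ← g1] at g2
  have q1 : p ^ r ≠ 0 := pow_ne_zero _ hp0
  have q2 : p ^ m ≠ 0 := pow_ne_zero _ hp0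
  have hC' : A * D = p ^ (r + m + 1) • (B * C + D * A) - C * B := by rw [hC]; abel
  rw [hC', pow_two_mul_sub_one hp, pow_two_mul_sub_one hp]
  have c1 : (-1) ^ (r + 1) * gauss p (r + m + 1) (r + 1) *
      (p ^ (r + 1) * (p - p⁻¹) * qNum p (r + 1 : ℕ)) =
      (-1) ^ r * gauss p (r + m + 1) r * qNum p (m + 1 : ℕ) * (p - p⁻¹) * -p ^ (r + 1) := by
    linear_combination (-1) ^ r * p ^ (r + 1) * (p - p⁻¹) * g2
  rw [c1, show (-1) ^ r * gauss p (r + m + 1) r * (p ^ (m + 1) * (p - p⁻¹) * qNum p (m + 1 : ℕ)) =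
    (-1) ^ r * gauss p (r + m + 1) r * qNum p (m + 1 : ℕ) * (p - p⁻¹) * p ^ (m + 1) by ring,
    mul_smul, mul_smul _ (p ^ (m + 1)), ← smul_add]
  convert smul_zero _
  simp only [mul_add, mul_sub, add_mul, sub_mul, mul_smul_comm, smul_mul_assoc, mul_assoc,
    smul_add, smul_sub, smul_smul, pow_add, pow_one]
  match_scalars <;> field_simp <;> ring

end QuantumPlane

end QHeis

namespace QHeis

/-! ### Serre polynomials and their polarization -/

section SerrePoly

variable {𝕜 : Type*} [Field 𝕜] {E : Type*} [Ring E] [Algebra 𝕜 E]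

/-- The Serre polynomial `∑ (-1)^r [N choose r] X^r Y X^{N-r}`. -/
def serrePoly (p : 𝕜) (N : ℕ) (X Y : E) : E :=
  ∑ r ∈ Finset.range (N + 1), ((-1) ^ r * gauss p N r) • (X ^ r * Y * X ^ (N - r))

/-- The derivative of the Serre polynomial in the variable `X`, in the direction `Z`. -/
def serreDeriv (p : 𝕜) (N : ℕ) (X Y Z : E) : E :=
  ∑ r ∈ Finset.range (N + 1), ((-1) ^ r * gauss p N r) •
    ((∑ a ∈ Finset.range r, X ^ a * Z * X ^ (r - 1 - a)) * Y * X ^ (N - r) +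
      X ^ r * Y * ∑ a ∈ Finset.range (N - r), X ^ a * Z * X ^ (N - r - 1 - a))

theorem serrePoly_zero (p : 𝕜) (N : ℕ) (X : E) : serrePoly p N X 0 = 0 := by
  simp [serrePoly]

theorem serrePoly_add (p : 𝕜) (N : ℕ) (X Y Y' : E) :
    serrePoly p N X (Y + Y') = serrePoly p N X Y + serrePoly p N X Y' := by
  simp [serrePoly, mul_add, add_mul, Finset.sum_add_distrib]

theorem serrePoly_smul (p : 𝕜) (N : ℕ) (X Y : E) (t : 𝕜) :
    serrePoly p N X (t • Y) = t • serrePoly p N X Y := by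
  simp [serrePoly, Finset.smul_sum, smul_comm t]

theorem serreDeriv_zero (p : 𝕜) (N : ℕ) (X Y : E) : serreDeriv p N X Y 0 = 0 := by
  simp [serreDeriv]

theorem serreDeriv_add (p : 𝕜) (N : ℕ) (X Y Z Z' : E) :
    serreDeriv p N X Y (Z + Z') = serreDeriv p N X Y Z + serreDeriv p N X Y Z' := by
  simp only [serreDeriv, ← Finset.sum_add_distrib, ← smul_add]
  refine Finset.sum_congr rfl fun r _ => ?_
  congr 1
  simp only [mul_add, add_mul, Finset.sum_add_distrib]
  abel

theorem serreDeriv_smul (p : 𝕜) (N : ℕ) (X Y Z : E) (t : 𝕜) :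
    serreDeriv p N X Y (t • Z) = t • serreDeriv p N X Y Z := by
  simp only [serreDeriv, mul_smul_comm, smul_mul_assoc, ← Finset.smul_sum, ← smul_add]
  rw [Finset.smul_sum]
  exact Finset.sum_congr rfl fun r _ => smul_comm _ _ _

theorem serreDeriv_sum (p : 𝕜) (N : ℕ) (X Y : E) {ι : Type*} (s : Finset ι) (Z : ι → E) :
    serreDeriv p N X Y (∑ i ∈ s, Z i) = ∑ i ∈ s, serreDeriv p N X Y (Z i) :=
  map_sum (AddMonoidHom.mk' (serreDeriv p N X Y) (serreDeriv_add p N X Y)) Z s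

theorem commutator_pow (u X : E) (r : ℕ) :
    u * X ^ r - X ^ r * u =
      ∑ a ∈ Finset.range r, X ^ a * (u * X - X * u) * X ^ (r - 1 - a) := by
  induction r with
  | zero => simp
  | succ r ih =>
    rw [Finset.sum_range_succ]
    have : ∀ a ∈ Finset.range r, X ^ a * (u * X - X * u) * X ^ (r + 1 - 1 - a) =
        X ^ a * (u * X - X * u) * X ^ (r - 1 - a) * X := by
      intro a ha
      have : a < r := by simpa using ha
      rw [mul_assoc _ _ X, ← pow_succ]
      congr 2
      omega
    rw [Finset.sum_congr rfl this, ← Finset.sum_mul, ← ih]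
    simp [pow_succ]
    noncomm_ring

/-- The Leibniz rule: [u, ·] acts once on Y and once on each copy of X. -/
theorem commutator_serrePoly (p : 𝕜) (N : ℕ) (u X Y : E) :
    u * serrePoly p N X Y - serrePoly p N X Y * u =
      serrePoly p N X (u * Y - Y * u) + serreDeriv p N X Y (u * X - X * u) := by
  simp only [serrePoly, serreDeriv, Finset.mul_sum, Finset.sum_mul, ← Finset.sum_sub_distrib,
    ← Finset.sum_add_distrib]
  refine Finset.sum_congr rfl fun r _ => ?_
  rw [mul_smul_comm, smul_mul_assoc, ← smul_sub, ← smul_add]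
  congr 1
  have h1 := commutator_pow u X r
  have h2 := commutator_pow u X (N - r)
  simp only [← Finset.sum_mul, ← Finset.mul_sum, ← h1, ← h2]
  noncomm_ring

/-- The noncommutative multinomial expansion, with Y inserted after the r-th letter. The words of
length N are indexed by functions `Fin N → ι`. -/
theorem sum_smul_pow_insert {ι : Type*} [Fintype ι] (t : ι → 𝕜) (x : ι → E) (Y : E) :
    ∀ (N r : ℕ), r ≤ N → (∑ i, t i • x i) ^ r * Y * (∑ i, t i • x i) ^ (N - r) =
      ∑ f : Fin N → ι, (∏ s, t (f s)) •
        (((List.ofFn fun s => x (f s)).take r).prod * Y *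
          ((List.ofFn fun s => x (f s)).drop r).prod) := by
  have key : ∀ (N : ℕ) (G : (Fin N → ι) → E), ∑ f : Fin (N + 1) → ι, (∏ s, t (f s)) •
      (x (f 0) * G (fun s => f s.succ)) =
      (∑ i, t i • x i) * ∑ f : Fin N → ι, (∏ s, t (f s)) • G f := by
    intro N G
    rw [← Equiv.sum_comp (Fin.consEquiv fun _ => ι), Fintype.sum_prod_type, Finset.sum_mul]
    refine Finset.sum_congr rfl fun i _ => ?_
    rw [Finset.mul_sum]
    refine Finset.sum_congr rfl fun f _ => ?_
    rw [Fin.prod_univ_succ, smul_mul_smul_comm]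
    simp [Fin.consEquiv]
  have base : ∀ N : ℕ, (∑ i, t i • x i) ^ N =
      ∑ f : Fin N → ι, (∏ s, t (f s)) • (List.ofFn fun s => x (f s)).prod := by
    intro N
    induction N with
    | zero => simp
    | succ N ih =>
      simp only [List.ofFn_succ, List.prod_cons]
      rw [key N (fun f => (List.ofFn fun s => x (f s)).prod), ← ih, pow_succ']
  intro N r
  induction r generalizing N with
  | zero =>
    intro _
    simp only [pow_zero, one_mul, Nat.sub_zero, List.take_zero, List.prod_nil, List.drop_zero]
    rw [base, Finset.mul_sum]
    simp
  | succ r ih =>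
    intro h
    obtain ⟨N, rfl⟩ : ∃ M, N = M + 1 := ⟨N - 1, by omega⟩
    simp only [List.ofFn_succ, List.take_succ_cons, List.prod_cons, List.drop_succ_cons, mul_assoc]
    rw [key N (fun f => ((List.ofFn fun s => x (f s)).take r).prod *
      (Y * ((List.ofFn fun s => x (f s)).drop r).prod))]
    simp only [← mul_assoc]
    rw [← ih N (by omega), pow_succ', Nat.add_sub_add_right]
    simp only [mul_assoc]

/-- Polarization of the Serre polynomial. -/
theorem sum_perm_serre (p : 𝕜) (N : ℕ) (x : Fin N → E) (Y : E) :
    ∑ σ : Equiv.Perm (Fin N), ∑ r ∈ Finset.range (N + 1), ((-1) ^ r * gauss p N r) •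
      (((List.ofFn fun s => x (σ s)).take r).prod * Y *
        ((List.ofFn fun s => x (σ s)).drop r).prod) =
    ∑ S : Finset (Fin N), ((-1 : 𝕜) ^ (Sᶜ).card) •
      serrePoly p N (∑ i, (if i ∈ S then (1 : 𝕜) else 0) • x i) Y := by
  set G : (Fin N → Fin N) → E := fun f => ∑ r ∈ Finset.range (N + 1), ((-1) ^ r * gauss p N r) •
      (((List.ofFn fun s => x (f s)).take r).prod * Y *
        ((List.ofFn fun s => x (f s)).drop r).prod) with hG
  have h1 : ∀ S : Finset (Fin N),
      serrePoly p N (∑ i, (if i ∈ S then (1 : 𝕜) else 0) • x i) Y =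
      ∑ f : Fin N → Fin N, (if ∀ s, f s ∈ S then (1 : 𝕜) else 0) • G f := by
    intro S
    rw [serrePoly]
    simp only [hG, Finset.smul_sum]
    rw [Finset.sum_comm]
    refine Finset.sum_congr rfl fun r hr => ?_
    rw [sum_smul_pow_insert _ _ _ _ _ (by simp at hr; omega), Finset.smul_sum]
    refine Finset.sum_congr rfl fun f _ => ?_
    rw [smul_comm]
    congr 1
    rw [Finset.prod_ite_zero]
    simp
  -- Inclusion–exclusion: the signed sum over the sets S containing the image of f vanishes unless f
  -- is surjective. Only the words that are permutations survive.
  have h2 : ∀ f : Fin N → Fin N, ∑ S : Finset (Fin N),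
      (-1 : 𝕜) ^ (Sᶜ).card * (if ∀ s, f s ∈ S then (1 : 𝕜) else 0) =
      if Function.Surjective f then 1 else 0 := by
    intro f
    have e : ∑ S : Finset (Fin N),
        (-1 : 𝕜) ^ (Sᶜ).card * (if ∀ s, f s ∈ S then (1 : 𝕜) else 0) =
        ∑ T : Finset (Fin N), if T ∈ ((Finset.univ.image f)ᶜ).powerset
          then (-1 : 𝕜) ^ T.card else 0 := by
      rw [← Equiv.sum_comp (compl_involutive (α := Finset (Fin N))).toPerm]
      refine Finset.sum_congr rfl fun S _ => ?_
      have : (∀ s, f s ∈ (Sᶜ : Finset (Fin N))) ↔ S ∈ ((Finset.univ.image f)ᶜ).powerset := by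
        rw [Finset.mem_powerset]
        constructor
        · intro h a ha
          simp only [Finset.mem_compl, Finset.mem_image, Finset.mem_univ, true_and, not_exists]
          rintro s rfl
          exact Finset.mem_compl.mp (h s) ha
        · intro h s
          rw [Finset.mem_compl]
          intro hs
          have := h hs
          simp at this
      simp only [Function.Involutive.coe_toPerm, compl_compl, this, mul_ite, mul_one, mul_zero]
    rw [e, Finset.sum_ite_mem, Finset.univ_inter]
    have := Finset.sum_powerset_neg_one_pow_card (x := (Finset.univ.image f)ᶜ)
    have h3 := congrArg (Int.cast : ℤ → 𝕜) this
    push_cast at h3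
    rw [h3]
    have : (Finset.univ.image f)ᶜ = ∅ ↔ Function.Surjective f := by
      rw [Finset.compl_eq_empty_iff, Finset.eq_univ_iff_forall]
      simp [Function.Surjective]
    simp only [this]
  simp only [h1, Finset.smul_sum, smul_smul]
  conv_rhs => rw [Finset.sum_comm]
  simp only [← Finset.sum_smul, h2, ite_smul, one_smul, zero_smul]
  rw [← Finset.sum_filter]
  refine Finset.sum_bij (fun σ _ => (σ : Fin N → Fin N)) ?_ ?_ ?_ ?_
  · intro σ _
    simpa using σ.surjective
  · intro σ _ τ _ h
    exact DFunLike.coe_injective h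
  · intro f hf
    have hf : Function.Surjective f := by simpa using hf
    exact ⟨Equiv.ofBijective f ⟨Finite.injective_iff_surjective.mpr hf, hf⟩, by simp, rfl⟩
  · intro σ _
    rfl

end SerrePoly

/-! ### Exchange relations -/

section Exchange

variable {𝕜 : Type*} [Field 𝕜] {E : Type*} [Ring E] [Algebra 𝕜 E]

/-- The Taylor coefficients of `(P - z) / (1 - P z)`. -/
def exchCoeff (P : 𝕜) (j : ℕ) : 𝕜 := if j = 0 then P else (P ^ 2 - 1) * P ^ (j - 1)

/-- The exchange relation `ζ(z) X₀ = (∑ c_j X_j z^j) ζ(z)`, where `c_j` are the coefficients of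
`(P - z) / (1 - P z)`. -/
def Exchanges (P : 𝕜) (ζ X : ℕ → E) : Prop :=
  ∀ m, ζ m * X 0 = ∑ jl ∈ Finset.HasAntidiagonal.antidiagonal m, exchCoeff P jl.1 • (X jl.1 * ζ jl.2)

/-- `∑ P^j X_j z^j` -/
def geomSeries (P : 𝕜) (X : ℕ → E) : PowerSeries E := PowerSeries.mk fun j => P ^ j • X j

/-- `∑ P^j X_{j+1} z^{j+1}` -/
def geomSeriesTail (P : 𝕜) (X : ℕ → E) : PowerSeries E :=
  PowerSeries.X * PowerSeries.mk fun j => P ^ j • X (j + 1)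

theorem geomSeries_sub (P : 𝕜) (X : ℕ → E) :
    geomSeries P X - P • geomSeriesTail P X = PowerSeries.C (X 0) := by
  ext m
  rcases m with _ | m
  · simp [geomSeries, geomSeriesTail]
  · simp [geomSeries, geomSeriesTail, PowerSeries.coeff_succ_X_mul, smul_smul, pow_succ']

theorem coeff_smul_geomSeries_sub (P : 𝕜) (X : ℕ → E) (m : ℕ) :
    PowerSeries.coeff m (P • geomSeries P X - geomSeriesTail P X) = exchCoeff P m • X m := by
  rcases m with _ | m
  · simp [geomSeries, geomSeriesTail, exchCoeff]
  · simp only [geomSeries, geomSeriesTail, map_sub, PowerSeries.coeff_succ_X_mul,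
      PowerSeries.coeff_mk, exchCoeff, PowerSeries.coeff_smul]
    simp only [Nat.add_eq_zero_iff, one_ne_zero, and_false, if_false, Nat.add_sub_cancel]
    module

/-- With A = `geomSeries P X` and B = `geomSeriesTail P X`, the combination A - PB is the constant
X₀ and PA - B is the series ∑ c_j X_j z^j. The exchange relation thus says that ζ conjugates the one
into the other, which is the form to which the quantum plane identities apply. -/
theorem Exchanges.mk_mul {P : 𝕜} {ζ X : ℕ → E} (h : Exchanges P ζ X) :
    PowerSeries.mk ζ * PowerSeries.C (X 0) =
      (P • geomSeries P X - geomSeriesTail P X) * PowerSeries.mk ζ := by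
  ext m
  rw [PowerSeries.coeff_mul_C, PowerSeries.coeff_mk, h m, PowerSeries.coeff_mul]
  refine Finset.sum_congr rfl fun jl _ => ?_
  rw [coeff_smul_geomSeries_sub, PowerSeries.coeff_mk, smul_mul_assoc]

theorem mul_pow_of_mul_eq {R : Type*} [Monoid R] {a b c : R} (h : a * b = c * a) (m : ℕ) :
    a * b ^ m = c ^ m * a := by
  induction m with
  | zero => simp
  | succ m ih => rw [pow_succ', ← mul_assoc, h, mul_assoc, ih, ← mul_assoc, ← pow_succ']

/-- The hypothesis only relates sums symmetric in (a, b). Adding the antidiagonal sum to its own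
reflection shows that twice each coefficient vanishes, whence the characteristic assumption. -/
theorem geomSeriesTail_mul_geomSeries [CharZero 𝕜] {s : 𝕜} (P : 𝕜) {X : ℕ → E}
    (hX : ∀ a b, X (a + 1) * X b + X (b + 1) * X a = s • (X b * X (a + 1) + X a * X (b + 1))) :
    geomSeriesTail P X * geomSeries P X = s • (geomSeries P X * geomSeriesTail P X) := by
  have hcomm : geomSeries P X * (PowerSeries.X * PowerSeries.mk fun j => P ^ j • X (j + 1)) =
      PowerSeries.X * (geomSeries P X * PowerSeries.mk fun j => P ^ j • X (j + 1)) := by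
    rw [← mul_assoc, PowerSeries.commute_X, mul_assoc]
  rw [geomSeriesTail, hcomm, mul_assoc, ← mul_smul_comm]
  congr 1
  ext m
  rw [PowerSeries.coeff_smul, PowerSeries.coeff_mul, PowerSeries.coeff_mul, ← sub_eq_zero]
  simp only [geomSeries, PowerSeries.coeff_mk]
  set S := ∑ ab ∈ Finset.HasAntidiagonal.antidiagonal m, (P ^ ab.1 • X (ab.1 + 1)) * (P ^ ab.2 • X ab.2) -
    s • ∑ ab ∈ Finset.HasAntidiagonal.antidiagonal m, (P ^ ab.1 • X ab.1) * (P ^ ab.2 • X (ab.2 + 1)) with hS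
  have h2 : S + S = 0 := by
    nth_rewrite 2 [hS]
    rw [← Finset.Nat.sum_antidiagonal_swap, ← Finset.Nat.sum_antidiagonal_swap (n := m) (f := fun ab =>
      (P ^ ab.1 • X ab.1) * (P ^ ab.2 • X (ab.2 + 1))), hS]
    simp only [Finset.smul_sum, ← Finset.sum_sub_distrib, ← Finset.sum_add_distrib]
    refine Finset.sum_eq_zero fun ab _ => ?_
    simp only [Prod.fst_swap, Prod.snd_swap, smul_mul_smul_comm]
    have := hX ab.1 ab.2
    rw [mul_comm (P ^ ab.2), show ∀ u v w x : E, P ^ ab.1 * P ^ ab.2 = P ^ ab.1 * P ^ ab.2 →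
      (P ^ ab.1 * P ^ ab.2) • u - s • (P ^ ab.1 * P ^ ab.2) • v +
      ((P ^ ab.1 * P ^ ab.2) • w - s • (P ^ ab.1 * P ^ ab.2) • x) =
      (P ^ ab.1 * P ^ ab.2) • (u + w - s • (x + v)) by intros; module]
    · rw [this, sub_self, smul_zero]
    · rfl
  have h3 : (2 : 𝕜) • S = 0 := by rw [two_smul, h2]
  exact (smul_eq_zero.mp h3).resolve_left two_ne_zero

/-- Replacing the letter occurring once in a Serre polynomial by an element exchanging with the
repeated letter gives zero. -/
theorem serrePoly_eq_zero_of_exchanges [CharZero 𝕜] {p : 𝕜} (hp : IsGeneric p) (M : ℕ)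
    {X ζ : ℕ → E}
    (hX : ∀ a b, X (a + 1) * X b + X (b + 1) * X a =
      p ^ 2 • (X b * X (a + 1) + X a * X (b + 1)))
    (hζ : Exchanges (p ^ (-(M : ℤ))) ζ X) (m : ℕ) : serrePoly p (M + 1) (X 0) (ζ m) = 0 := by
  set P := p ^ (-(M : ℤ)) with hP
  have h := sum_gauss_quantumPlane hp (geomSeries P X) M (geomSeriesTail P X)
    (geomSeriesTail_mul_geomSeries P hX)
  rw [← hP, geomSeries_sub] at h
  -- The series ζ, multiplied on the right, moves left through each factor PA - B and turns it into
  -- X₀. What remains in degree m is the Serre polynomial with ζ_m as the single letter.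
  have h1 := congrArg (fun F => PowerSeries.coeff m (F * PowerSeries.mk ζ)) h
  simp only [Finset.sum_mul, zero_mul, map_zero, map_sum, smul_mul_assoc,
    PowerSeries.coeff_smul] at h1
  rw [serrePoly, ← h1]
  refine Finset.sum_congr rfl fun r _ => ?_
  rw [mul_assoc (PowerSeries.C (X 0) ^ r), ← mul_pow_of_mul_eq hζ.mk_mul, ← mul_assoc, ← map_pow, ← map_pow,
    PowerSeries.coeff_mul_C, PowerSeries.coeff_C_mul, PowerSeries.coeff_mk]

/-- Replacing one of the repeated letters in a Serre polynomial by an element exchanging with both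
letters gives zero. -/
theorem serreDeriv_eq_zero_of_exchanges [CharZero 𝕜] {p : 𝕜} (hp : IsGeneric p) (M : ℕ)
    {X Y ξ : ℕ → E}
    (hX : ∀ a b, X (a + 1) * X b + X (b + 1) * X a =
      p ^ 2 • (X b * X (a + 1) + X a * X (b + 1)))
    (hXY : ∀ a b, p ^ M • (X (a + 1) * Y b + Y (b + 1) * X a) =
      X a * Y (b + 1) + Y b * X (a + 1))
    (hξX : Exchanges (p ^ 2) ξ X) (hξY : Exchanges (p ^ (-(M : ℤ))) ξ Y) (m : ℕ) :
    serreDeriv p (M + 1) (X 0) (Y 0) (ξ m) = 0 := by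
  set P := p ^ (-(M : ℤ)) with hP
  -- The generating function form of `hXY`: the two currents use different parameters, p² for X and
  -- p^{-M} for Y, matching their exchange relations with ξ.
  have hC : p ^ M • (geomSeriesTail (p ^ 2) X * geomSeries P Y +
      geomSeriesTail P Y * geomSeries (p ^ 2) X) =
      geomSeries (p ^ 2) X * geomSeriesTail P Y + geomSeries P Y * geomSeriesTail (p ^ 2) X := by
    have hcomm : ∀ F G : PowerSeries E, F * (PowerSeries.X * G) = PowerSeries.X * (F * G) := by
      intro F G
      rw [← mul_assoc, PowerSeries.commute_X, mul_assoc]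
    simp only [geomSeriesTail, hcomm, mul_assoc, ← mul_add, ← mul_smul_comm]
    congr 1
    ext k
    simp only [geomSeries, map_add, PowerSeries.coeff_smul, PowerSeries.coeff_mul,
      PowerSeries.coeff_mk]
    rw [← Finset.Nat.sum_antidiagonal_swap (n := k) (f := fun ab =>
        (P ^ ab.1 • Y (ab.1 + 1)) * ((p ^ 2) ^ ab.2 • X ab.2)),
      ← Finset.Nat.sum_antidiagonal_swap (n := k) (f := fun ab =>
        (P ^ ab.1 • Y ab.1) * ((p ^ 2) ^ ab.2 • X (ab.2 + 1))),
      ← Finset.sum_add_distrib, ← Finset.sum_add_distrib, Finset.smul_sum]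
    refine Finset.sum_congr rfl fun ab _ => ?_
    simp only [Prod.fst_swap, Prod.snd_swap, smul_mul_smul_comm]
    rw [mul_comm (P ^ ab.2), ← smul_add, ← smul_add, smul_comm, hXY]
  have h := sum_gauss_bimodule hp M (geomSeriesTail_mul_geomSeries (p ^ 2) hX) hC
  rw [← hP, geomSeries_sub, geomSeries_sub] at h
  -- As ξ moves left, every factor it passes becomes X₀ or Y₀. The geometric sums over a become the
  -- sums over the position of the replaced letter in `serreDeriv`.
  have h1 := congrArg (fun F => PowerSeries.coeff m (F * PowerSeries.mk ξ)) h
  rw [Finset.sum_mul] at h1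
  simp only [zero_mul, map_zero, map_sum, smul_mul_assoc, PowerSeries.coeff_smul] at h1
  rw [serreDeriv, ← h1]
  refine Finset.sum_congr rfl fun r _ => ?_
  congr 1
  have hx := mul_pow_of_mul_eq hξX.mk_mul
  have hy := hξY.mk_mul
  have hsum : ∀ k s : ℕ, (∑ a ∈ Finset.range k, PowerSeries.C (X 0) ^ a *
      (p ^ 2 • geomSeries (p ^ 2) X - geomSeriesTail (p ^ 2) X) ^ (s - a)) * PowerSeries.mk ξ =
      ∑ a ∈ Finset.range k, PowerSeries.C (X 0) ^ a * PowerSeries.mk ξ *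
        PowerSeries.C (X 0) ^ (s - a) := by
    intro k s
    rw [Finset.sum_mul]
    refine Finset.sum_congr rfl fun a _ => ?_
    rw [mul_assoc, ← hx, mul_assoc]
  rw [add_mul, mul_assoc _ _ (PowerSeries.mk ξ), ← hx, ← mul_assoc, mul_assoc _ _ (PowerSeries.mk ξ),
    ← hy, ← mul_assoc _ (PowerSeries.mk ξ) (PowerSeries.C (Y 0)), hsum, mul_assoc (PowerSeries.C (X 0) ^ r * _), hsum]
  simp only [← map_pow, map_add, PowerSeries.coeff_mul_C, Finset.mul_sum, map_sum,
    PowerSeries.coeff_C_mul, PowerSeries.coeff_mk, mul_assoc, Finset.sum_mul]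
  congr 1
  · refine Finset.sum_congr rfl fun a _ => ?_
    simp only [← map_mul, PowerSeries.coeff_mul_C, PowerSeries.coeff_mk]
  · refine Finset.sum_congr rfl fun a _ => ?_
    rw [show M + 1 - r - 1 - a = M - r - a by omega]

end Exchange

end QHeis

namespace QHeis

open Finset.HasAntidiagonal (antidiagonal)

/-! ### Exponential series -/

section Euler

variable {E : Type*} [Ring E]

/-- The Euler operator `z d/dz`. -/
def eulerOp (F : PowerSeries E) : PowerSeries E :=
  PowerSeries.mk fun m => m • PowerSeries.coeff m F


theorem coeff_eulerOp (F : PowerSeries E) (m : ℕ) :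
    PowerSeries.coeff m (eulerOp F) = m • PowerSeries.coeff m F := by
  simp [eulerOp]

theorem eulerOp_mul (F G : PowerSeries E) : eulerOp (F * G) = eulerOp F * G + F * eulerOp G := by
  ext m
  rw [coeff_eulerOp, map_add, PowerSeries.coeff_mul, PowerSeries.coeff_mul, PowerSeries.coeff_mul,
    Finset.smul_sum, ← Finset.sum_add_distrib]
  refine Finset.sum_congr rfl fun ab hab => ?_
  have : ab.1 + ab.2 = m := Finset.HasAntidiagonal.mem_antidiagonal.mp hab
  rw [coeff_eulerOp, coeff_eulerOp, smul_mul_assoc, mul_smul_comm, ← add_smul, this]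

theorem eulerOp_pow {H : PowerSeries E} (hH : Commute H (eulerOp H)) (r : ℕ) :
    eulerOp (H ^ (r + 1)) = (r + 1) • (eulerOp H * H ^ r) := by
  induction r with
  | zero => simp
  | succ r ih =>
    rw [pow_succ, eulerOp_mul, ih, smul_mul_assoc, mul_assoc, ← pow_succ,
      (hH.pow_left (r + 1)).eq, succ_nsmul _ (r + 1)]

end Euler

/-- A series with vanishing constant term solving `z F' = U F`, where `U` has no constant term,
is zero. -/
theorem eq_zero_of_eulerOp_eq (𝕜 : Type*) [Field 𝕜] [CharZero 𝕜] {E : Type*} [Ring E] [Algebra 𝕜 E]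
    {F U : PowerSeries E} (h : eulerOp F = U * F)
    (hU : PowerSeries.coeff 0 U = 0) (hF : PowerSeries.coeff 0 F = 0) : F = 0 := by
  ext m
  induction m using Nat.strong_induction_on with
  | _ m ih =>
    rcases Nat.eq_zero_or_pos m with rfl | hm
    · simpa using hF
    have h1 := congrArg (PowerSeries.coeff m) h
    rw [coeff_eulerOp, PowerSeries.coeff_mul, Finset.sum_eq_zero] at h1
    · rw [← Nat.cast_smul_eq_nsmul 𝕜] at h1
      simpa using (smul_eq_zero.mp h1).resolve_left (by exact_mod_cast hm.ne')
    · intro ab hab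
      have hab : ab.1 + ab.2 = m := Finset.HasAntidiagonal.mem_antidiagonal.mp hab
      rcases Nat.eq_zero_or_pos ab.1 with h0 | h0
      · rw [h0, hU, zero_mul]
      · rw [ih ab.2 (by omega)]; simp

section Exponential

variable {𝕜 : Type*} [Field 𝕜] [CharZero 𝕜] {E : Type*} [Ring E] [Algebra 𝕜 E]

/-- The coefficient of `z^m` in `exp (t ∑ u_l z^l)`, where `u_0 = 0`. -/
def expSeries (t : 𝕜) (u : ℕ → E) (m : ℕ) : E :=
  ∑ r ∈ Finset.range (m + 1),
    (t ^ r / (r.factorial : 𝕜)) • PowerSeries.coeff m (PowerSeries.mk u ^ r)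

theorem expSeries_zero (t : 𝕜) (u : ℕ → E) : expSeries t u 0 = 1 := by
  simp [expSeries]

/-- A series without constant term has r-th power starting in degree r, so the truncated sum in
`expSeries` is the full exponential. -/
theorem coeff_mk_pow_eq_zero {u : ℕ → E} (hu : u 0 = 0) {m r : ℕ} (h : m < r) :
    PowerSeries.coeff m (PowerSeries.mk u ^ r) = 0 := by
  have h1 : PowerSeries.mk u = PowerSeries.X * PowerSeries.mk fun j => u (j + 1) := by
    ext j
    rcases j with _ | j
    · simp [hu]
    · simp [PowerSeries.coeff_succ_X_mul]
  have h2 : Commute (PowerSeries.X : PowerSeries E) (PowerSeries.mk fun j => u (j + 1)) :=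
    (PowerSeries.commute_X _).symm
  rw [h1, h2.mul_pow, PowerSeries.coeff_X_pow_mul', if_neg (by omega)]

/-- The logarithmic derivative of an exponential, valid because the coefficients of the exponent
commute. The commutation rules of ψ and φ with h, K, D and x are all derived from this first-order
equation. -/
theorem eulerOp_expSeries (t : 𝕜) {u : ℕ → E} (hu : u 0 = 0)
    (hcomm : ∀ k l, Commute (u k) (u l)) :
    eulerOp (PowerSeries.mk (expSeries t u)) =
      PowerSeries.mk (fun l => (t * l) • u l) * PowerSeries.mk (expSeries t u) := by
  have hH : Commute (PowerSeries.mk u) (eulerOp (PowerSeries.mk u)) := by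
    ext m
    rw [PowerSeries.coeff_mul, PowerSeries.coeff_mul, ← Finset.Nat.sum_antidiagonal_swap]
    refine Finset.sum_congr rfl fun ab _ => ?_
    simp only [coeff_eulerOp, PowerSeries.coeff_mk, Prod.fst_swap, Prod.snd_swap]
    rw [mul_smul_comm, smul_mul_assoc, (hcomm _ _).eq]
  have hlong : ∀ m s : ℕ, m ≤ s → expSeries t u m = ∑ r ∈ Finset.range (s + 1),
      (t ^ r / (r.factorial : 𝕜)) • PowerSeries.coeff m (PowerSeries.mk u ^ r) := by
    intro m s hms
    rw [expSeries]
    refine Finset.sum_subset (by simpa using hms) fun r _ hr => ?_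
    rw [coeff_mk_pow_eq_zero hu (by simp at hr; omega), smul_zero]
  ext m
  rw [coeff_eulerOp, PowerSeries.coeff_mk, PowerSeries.coeff_mul]
  simp only [PowerSeries.coeff_mk]
  rcases m with _ | m
  · simp [hu]
  rw [expSeries, Finset.sum_range_succ']
  have h0 : PowerSeries.coeff (m + 1) ((PowerSeries.mk u) ^ 0) = 0 := by
    rw [pow_zero, PowerSeries.coeff_one, if_neg (by omega)]
  rw [h0, smul_zero, add_zero, Finset.smul_sum]
  have h1 : ∀ r : ℕ, (m + 1) • ((t ^ (r + 1) / ((r + 1).factorial : 𝕜)) •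
      PowerSeries.coeff (m + 1) (PowerSeries.mk u ^ (r + 1))) =
      ∑ ab ∈ antidiagonal (m + 1), (t * ab.1) • (u ab.1 *
        ((t ^ r / (r.factorial : 𝕜)) • PowerSeries.coeff ab.2 (PowerSeries.mk u ^ r))) := by
    intro r
    rw [smul_comm, ← coeff_eulerOp, eulerOp_pow hH, map_nsmul, PowerSeries.coeff_mul,
      ← Nat.cast_smul_eq_nsmul 𝕜, smul_smul, Finset.smul_sum]
    refine Finset.sum_congr rfl fun ab _ => ?_
    rw [coeff_eulerOp, PowerSeries.coeff_mk, ← Nat.cast_smul_eq_nsmul 𝕜, smul_mul_assoc,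
      mul_smul_comm, smul_smul, smul_smul]
    congr 1
    rw [Nat.factorial_succ]
    have : ((r : 𝕜) + 1) ≠ 0 := by exact_mod_cast Nat.succ_ne_zero r
    have : (r.factorial : 𝕜) ≠ 0 := by exact_mod_cast r.factorial_ne_zero
    push_cast
    field_simp
    ring
  rw [Finset.sum_congr rfl fun r _ => h1 r, Finset.sum_comm]
  refine Finset.sum_congr rfl fun ab hab => ?_
  have hab : ab.1 + ab.2 = m + 1 := Finset.HasAntidiagonal.mem_antidiagonal.mp hab
  rcases Nat.eq_zero_or_pos ab.1 with h | h
  · rw [h]; simp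
  · rw [← Finset.smul_sum, ← Finset.mul_sum, smul_mul_assoc, ← hlong ab.2 m (by omega)]

/-- The logarithmic derivative of (P - z)/(1 - Pz) under z d/dz is ∑_{l>0} (P^l - P^{-l}) z^l. -/
theorem sum_exchCoeff {P : 𝕜} (hP : P ≠ 0) (m : ℕ) :
    ∑ ab ∈ antidiagonal m, (P ^ ab.1 - (P ^ ab.1)⁻¹) * exchCoeff P ab.2 = m * exchCoeff P m := by
  rcases m with _ | m
  · simp
  rw [Finset.Nat.sum_antidiagonal_succ']
  have h1 : ∀ s : ℕ, ∑ ab ∈ antidiagonal s, (P ^ ab.1 - (P ^ ab.1)⁻¹) * exchCoeff P (ab.2 + 1) =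
      (P ^ 2 - 1) * (s + 1) * P ^ s - P ^ (s + 1) * P + P * (P ^ (s + 1))⁻¹ := by
    intro s
    induction s with
    | zero => simp; field_simp; ring
    | succ s ih =>
      rw [Finset.Nat.sum_antidiagonal_succ']
      have h2 : ∀ ab ∈ antidiagonal s, (P ^ ab.1 - (P ^ ab.1)⁻¹) * exchCoeff P (ab.2 + 1 + 1) =
          P * ((P ^ ab.1 - (P ^ ab.1)⁻¹) * exchCoeff P (ab.2 + 1)) := by
        intro ab _
        simp only [exchCoeff, Nat.add_eq_zero_iff, one_ne_zero, and_false, if_false,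
          Nat.add_sub_cancel, pow_succ]
        ring
      rw [Finset.sum_congr rfl h2, ← Finset.mul_sum, ih]
      simp only [exchCoeff]
      push_cast
      simp
      field_simp
      ring
  rw [h1]
  simp [exchCoeff]
  ring

variable {ψ U X : ℕ → E} {P : 𝕜}

/-- The exchange relation satisfied by the coefficients of an exponential series. -/
theorem exchanges_of_eulerOp (hP : P ≠ 0)
    (hψ : eulerOp (PowerSeries.mk ψ) = PowerSeries.mk U * PowerSeries.mk ψ) (hU : U 0 = 0)
    (hUX : ∀ l a, U l * X a - X a * U l = (P ^ l - (P ^ l)⁻¹) • X (a + l))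
    (hψX : ψ 0 * X 0 = P • (X 0 * ψ 0)) : Exchanges P ψ X := by
  set F : PowerSeries E := PowerSeries.mk fun j => exchCoeff P j • X j with hF
  have hUF : PowerSeries.mk U * F = F * PowerSeries.mk U + eulerOp F := by
    ext m
    rw [map_add, coeff_eulerOp, PowerSeries.coeff_mul, PowerSeries.coeff_mul,
      ← Finset.Nat.sum_antidiagonal_swap (f := fun ab => PowerSeries.coeff ab.1 F *
        PowerSeries.coeff ab.2 (PowerSeries.mk U)), ← sub_eq_iff_eq_add', ← Finset.sum_sub_distrib]
    have : ∀ ab ∈ antidiagonal m, PowerSeries.coeff ab.1 (PowerSeries.mk U) *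
        PowerSeries.coeff ab.2 F - PowerSeries.coeff ab.swap.1 F *
          PowerSeries.coeff ab.swap.2 (PowerSeries.mk U) =
        ((P ^ ab.1 - (P ^ ab.1)⁻¹) * exchCoeff P ab.2) • X m := by
      intro ab hab
      have hab : ab.1 + ab.2 = m := Finset.HasAntidiagonal.mem_antidiagonal.mp hab
      simp only [hF, PowerSeries.coeff_mk, Prod.fst_swap, Prod.snd_swap]
      rw [mul_smul_comm, smul_mul_assoc, ← smul_sub, hUX, smul_smul, mul_comm, add_comm, hab]
    rw [Finset.sum_congr rfl this, ← Finset.sum_smul, sum_exchCoeff hP, hF, PowerSeries.coeff_mk,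
      ← Nat.cast_smul_eq_nsmul 𝕜, smul_smul]
  have hC : eulerOp (PowerSeries.C (X 0)) = 0 := by
    ext m
    rcases m with _ | m <;> simp [coeff_eulerOp, PowerSeries.coeff_C]
  -- Both sides of the exchange relation solve z G' = U G, the right one because [U, F] = z F' by
  -- `hUF`. Their constant terms agree by `hψX`, so uniqueness applies.
  have key : PowerSeries.mk ψ * PowerSeries.C (X 0) - F * PowerSeries.mk ψ = 0 := by
    refine eq_zero_of_eulerOp_eq 𝕜 (U := PowerSeries.mk U) ?_ (by simp [hU]) ?_
    · have hsub : ∀ A B : PowerSeries E, eulerOp (A - B) = eulerOp A - eulerOp B := by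
        intro A B; ext m; simp [coeff_eulerOp, smul_sub]
      rw [hsub, eulerOp_mul, eulerOp_mul, hC, hψ, mul_zero, add_zero, mul_sub, mul_assoc,
        ← mul_assoc F, ← mul_assoc _ F, hUF, add_mul, add_comm (eulerOp F * _)]
    · simp [hF, exchCoeff, hψX]
  intro m
  have := congrArg (PowerSeries.coeff m) (sub_eq_zero.mp key)
  rw [PowerSeries.coeff_mul_C, PowerSeries.coeff_mk, PowerSeries.coeff_mul] at this
  rw [this]
  simp [hF]

/-- Commutation of an exponential series with an element whose commutators with the exponent are
scalar multiples of a power of the variable. -/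
theorem commutator_of_eulerOp {g : E} {k : ℕ} {s : 𝕜}
    (hψ : eulerOp (PowerSeries.mk ψ) = PowerSeries.mk U * PowerSeries.mk ψ) (hU : U 0 = 0)
    (hgU : ∀ l, g * U l - U l * g = if l = k then (s * k) • (1 : E) else 0) (hk : 0 < k)
    (hgψ : g * ψ 0 = ψ 0 * g) (m : ℕ) :
    g * ψ m - ψ m * g = if k ≤ m then s • ψ (m - k) else 0 := by
  have hC : eulerOp (PowerSeries.C g) = 0 := by
    ext m
    rcases m with _ | m <;> simp [coeff_eulerOp, PowerSeries.coeff_C]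
  have hX : eulerOp (PowerSeries.X ^ k : PowerSeries E) = k • PowerSeries.X ^ k := by
    ext m
    rw [coeff_eulerOp, map_nsmul, PowerSeries.coeff_X_pow]
    split_ifs with h
    · rw [h]
    · simp
  have hgU' : PowerSeries.C g * PowerSeries.mk U =
      PowerSeries.mk U * PowerSeries.C g + (s * k) • PowerSeries.X ^ k := by
    rw [← sub_eq_iff_eq_add']
    ext l
    rw [map_sub, PowerSeries.coeff_C_mul, PowerSeries.coeff_mul_C, PowerSeries.coeff_mk, hgU,
      PowerSeries.coeff_smul, PowerSeries.coeff_X_pow]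
    split_ifs <;> simp
  have hsub : ∀ A B : PowerSeries E, eulerOp (A - B) = eulerOp A - eulerOp B := by
    intro A B; ext m; simp [coeff_eulerOp, smul_sub]
  have hsmul : ∀ A : PowerSeries E, eulerOp (s • A) = s • eulerOp A := by
    intro A; ext m; simp [coeff_eulerOp]
  have key : PowerSeries.C g * PowerSeries.mk ψ - PowerSeries.mk ψ * PowerSeries.C g -
      s • (PowerSeries.X ^ k * PowerSeries.mk ψ) = 0 := by
    refine eq_zero_of_eulerOp_eq 𝕜 (U := PowerSeries.mk U) ?_ (by simp [hU]) ?_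
    · have hcomm : PowerSeries.mk U * (PowerSeries.X ^ k * PowerSeries.mk ψ) =
          PowerSeries.X ^ k * (PowerSeries.mk U * PowerSeries.mk ψ) := by
        rw [← mul_assoc, ((PowerSeries.commute_X (PowerSeries.mk U)).pow_right k).eq, mul_assoc]
      rw [hsub, hsub, hsmul, eulerOp_mul, eulerOp_mul, eulerOp_mul, hC, hX, hψ, mul_sub, mul_sub,
        mul_smul_comm, hcomm, ← mul_assoc, hgU', add_mul, zero_mul, mul_zero, zero_add, add_zero,
        smul_add, smul_mul_assoc, smul_mul_assoc, ← mul_assoc (PowerSeries.mk U),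
        ← mul_assoc (PowerSeries.mk U), ← Nat.cast_smul_eq_nsmul 𝕜, smul_smul]
      abel
    · rw [map_sub, map_sub, PowerSeries.coeff_C_mul, PowerSeries.coeff_mul_C, PowerSeries.coeff_mk,
        hgψ, sub_self, PowerSeries.coeff_smul, PowerSeries.coeff_X_pow_mul', if_neg (by omega)]
      simp
  have := congrArg (PowerSeries.coeff m) key
  rw [map_sub, map_sub, PowerSeries.coeff_C_mul, PowerSeries.coeff_mul_C, PowerSeries.coeff_mk,
    PowerSeries.coeff_smul, PowerSeries.coeff_X_pow_mul', map_zero, sub_eq_zero] at this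
  rw [this]
  split_ifs <;> simp

/-- An element which scales the exponent of an exponential series scales its coefficients. -/
theorem mul_eq_smul_of_eulerOp {g : E} {w : 𝕜}
    (hψ : eulerOp (PowerSeries.mk ψ) = PowerSeries.mk U * PowerSeries.mk ψ) (hU : U 0 = 0)
    (hgU : ∀ l, g * U l = w ^ l • (U l * g)) (hgψ : g * ψ 0 = ψ 0 * g) (m : ℕ) :
    g * ψ m = w ^ m • (ψ m * g) := by
  have hrec : ∀ m, m • ψ m = ∑ ab ∈ antidiagonal m, U ab.1 * ψ ab.2 := by
    intro m
    have := congrArg (PowerSeries.coeff m) hψ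
    simpa [coeff_eulerOp, PowerSeries.coeff_mul] using this
  induction m using Nat.strong_induction_on with
  | _ m ih =>
    rcases Nat.eq_zero_or_pos m with rfl | hm
    · simpa using hgψ
    have h1 : (m : 𝕜) • (g * ψ m) = (m : 𝕜) • (w ^ m • (ψ m * g)) := by
      rw [smul_comm, ← mul_smul_comm, ← smul_mul_assoc, Nat.cast_smul_eq_nsmul, hrec,
        Finset.mul_sum, Finset.sum_mul, Finset.smul_sum]
      refine Finset.sum_congr rfl fun ab hab => ?_
      have hab : ab.1 + ab.2 = m := Finset.HasAntidiagonal.mem_antidiagonal.mp hab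
      rcases Nat.eq_zero_or_pos ab.1 with h | h
      · rw [h, hU]; simp
      · rw [← mul_assoc, hgU, smul_mul_assoc, mul_assoc, ih ab.2 (by omega), mul_smul_comm,
          smul_smul, ← pow_add, hab, mul_assoc]
    have hm' : (m : 𝕜) ≠ 0 := by exact_mod_cast hm.ne'
    exact smul_right_injective E hm' h1

end Exponential

end QHeis

namespace QHeis

open Finset.HasAntidiagonal (antidiagonal)

/-! ### Powers of `q` -/

theorem qh_ne_zero : qh ≠ 0 := RatFunc.X_ne_zero

theorem qh_pow_ne_one {m : ℕ} (hm : 0 < m) : qh ^ m ≠ 1 := by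
  intro h
  have h1 : algebraMap (Polynomial ℂ) (RatFunc ℂ) (Polynomial.X ^ m) =
      algebraMap (Polynomial ℂ) (RatFunc ℂ) 1 := by
    rw [map_pow, RatFunc.algebraMap_X, map_one]; exact h
  have h2 := RatFunc.algebraMap_injective ℂ h1
  have := congrArg Polynomial.natDegree h2
  simp at this
  omega

theorem q_ne_zero : q ≠ 0 := pow_ne_zero _ qh_ne_zero

theorem isGeneric_q_pow {m : ℕ} (hm : 0 < m) : IsGeneric (q ^ m) := by
  refine ⟨pow_ne_zero _ q_ne_zero, fun r hr => ?_⟩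
  rw [q, ← pow_mul, ← pow_mul]
  exact qh_pow_ne_one (by positivity)

variable {n : ℕ} (C : CartanDatum n)

theorem isGeneric_qi (i : Fin n) : IsGeneric (qi C i) := isGeneric_q_pow (C.d_pos i)

theorem qi_zpow (i : Fin n) (m : ℤ) : qi C i ^ m = q ^ ((C.d i : ℤ) * m) := by
  rw [qi, ← zpow_natCast, ← zpow_mul]

theorem sub_mul_qInt (i : Fin n) (m : ℤ) :
    (qi C i - (qi C i)⁻¹) * qInt (qi C i) m = qi C i ^ m - qi C i ^ (-m) := by
  rw [qInt, mul_div_cancel₀]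
  exact (isGeneric_qi C i).sub_inv_ne

/-! ### Representations of the relations among Cartan generators -/

section Rep

variable {E : Type*} [Ring E] [Algebra Kq E]

/-- The coefficient of `x_{j,k+l}` in `[h_{ik}, x^+_{jl}]`, up to the power of `γ`. -/
def hxCoeff (i j : Fin n) (k : ℤ) : Kq := (k : Kq)⁻¹ * qInt (qi C i) (k * C.a i j)

/-- The value of `[h_{ik}, h_{j,-k}]` when `γ^{1/2}` acts as `Γ`. -/
def hhCoeff (Γ : Kq) (i j : Fin n) (k : ℤ) : Kq :=
  hxCoeff C i j k * (qi C j - (qi C j)⁻¹)⁻¹ * (Γ ^ (2 * k) - Γ ^ (-(2 * k)))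

/-- An algebra map from the free algebra for which the Drinfeld relations not involving the
generators `x` hold, and `γ^{1/2}` acts as the scalar `Γ`. -/
structure IsCartanRep (Γ : Kq) (ρ : Free n →ₐ[Kq] E) : Prop where
  gamma_ne : Γ ≠ 0
  gammaHalf : ρ (FreeAlgebra.ι Kq Gen.gammaHalf) = algebraMap Kq E Γ
  gammaHalfInv : ρ (FreeAlgebra.ι Kq Gen.gammaHalfInv) = algebraMap Kq E Γ⁻¹
  K_mul_Kinv : ∀ i, ρ (Free.K i) * ρ (Free.Kinv i) = 1
  Kinv_mul_K : ∀ i, ρ (Free.Kinv i) * ρ (Free.K i) = 1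
  D_mul_Dinv : ρ Free.D * ρ Free.Dinv = 1
  Dinv_mul_D : ρ Free.Dinv * ρ Free.D = 1
  D_K : ∀ i, ρ Free.D * ρ (Free.K i) = ρ (Free.K i) * ρ Free.D
  K_K : ∀ i j, ρ (Free.K i) * ρ (Free.K j) = ρ (Free.K j) * ρ (Free.K i)
  K_h : ∀ i j k, ρ (Free.K i) * ρ (Free.h j k) = ρ (Free.h j k) * ρ (Free.K i)
  D_h : ∀ i k, ρ Free.D * ρ (Free.h i k) = q ^ k • (ρ (Free.h i k) * ρ Free.D)
  h_h : ∀ i j (k l : ℤ), k ≠ 0 → l ≠ 0 → ρ (Free.h i k) * ρ (Free.h j l) -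
    ρ (Free.h j l) * ρ (Free.h i k) = if k = -l then hhCoeff C Γ i j k • 1 else 0

/-- An algebra map from the free algebra for which all Drinfeld relations hold except those among
the `x^+` and those among the `x^-`, and `γ^{1/2}` acts as the scalar `Γ`. -/
structure IsPreRep (Γ : Kq) (ρ : Free n →ₐ[Kq] E) : Prop extends IsCartanRep C Γ ρ where
  D_x : ∀ (ε : ℤˣ) i r, ρ Free.D * ρ (Free.x ε i r) = q ^ r • (ρ (Free.x ε i r) * ρ Free.D)
  K_x : ∀ (ε : ℤˣ) i j r, ρ (Free.K i) * ρ (Free.x ε j r) =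
    q ^ ((ε : ℤ) * (C.d i * C.a i j)) • (ρ (Free.x ε j r) * ρ (Free.K i))
  h_x : ∀ (ε : ℤˣ) i j (k l : ℤ), k ≠ 0 → ρ (Free.h i k) * ρ (Free.x ε j l) -
    ρ (Free.x ε j l) * ρ (Free.h i k) =
      (((ε : ℤ) : Kq) * hxCoeff C i j k * Γ ^ (-((ε : ℤ) * |k|))) • ρ (Free.x ε j (k + l))
  xp_xm : ∀ i j k l, ρ (Free.x 1 i k) * ρ (Free.x (-1) j l) -
    ρ (Free.x (-1) j l) * ρ (Free.x 1 i k) = if i = j then ρ (Free.gammaPsi C i k l) else 0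

theorem map_expCoeff (ρ : Free n →ₐ[Kq] E) (t : Kq) (u : ℕ → Free n) (m : ℕ) :
    ρ (Free.expCoeff t u m) = expSeries t (fun l => ρ (u l)) m := by
  have h : ∀ r, ρ (PowerSeries.coeff m (PowerSeries.mk u ^ r)) =
      PowerSeries.coeff m (PowerSeries.mk (fun l => ρ (u l)) ^ r) := by
    intro r
    have h1 : PowerSeries.map (ρ : Free n →+* E) (PowerSeries.mk u) =
        PowerSeries.mk (fun l => ρ (u l)) := by
      ext; simp
    rw [← h1, ← map_pow, PowerSeries.coeff_map]
    rfl
  simp only [Free.expCoeff, expSeries, map_sum, map_smul, h]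

theorem h_zero (i : Fin n) : (Free.h i 0 : Free n) = 0 := by simp [Free.h]

variable {C} {Γ : Kq} {ρ : Free n →ₐ[Kq] E}

namespace IsCartanRep

theorem map_gam (hρ : IsCartanRep C Γ ρ) (m : ℤ) : ρ (Free.gam m) = algebraMap Kq E (Γ ^ m) := by
  rw [Free.gam]
  split_ifs with h
  · rw [map_pow, hρ.gammaHalf, ← map_pow, ← zpow_natCast, Int.toNat_of_nonneg h]
  · rw [map_pow, hρ.gammaHalfInv, ← map_pow, inv_pow, ← zpow_natCast,
      Int.toNat_of_nonneg (by omega), zpow_neg, inv_inv]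

theorem Kinv_h (hρ : IsCartanRep C Γ ρ) (i j : Fin n) (k : ℤ) :
    ρ (Free.Kinv i) * ρ (Free.h j k) = ρ (Free.h j k) * ρ (Free.Kinv i) := by
  calc ρ (Free.Kinv i) * ρ (Free.h j k)
      = ρ (Free.Kinv i) * (ρ (Free.h j k) * ρ (Free.K i)) * ρ (Free.Kinv i) := by
        rw [mul_assoc, mul_assoc, hρ.K_mul_Kinv, mul_one]
    _ = _ := by rw [← hρ.K_h, ← mul_assoc, hρ.Kinv_mul_K, one_mul]

theorem map_gammaPsi (hρ : IsCartanRep C Γ ρ) (i : Fin n) (k l : ℤ) :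
    ρ (Free.gammaPsi C i k l) = (qi C i - (qi C i)⁻¹)⁻¹ •
      (Γ ^ (k - l) • ρ (Free.psi C i (k + l)) - Γ ^ (l - k) • ρ (Free.phi C i (k + l))) := by
  rw [Free.gammaPsi, map_smul, map_sub, map_mul, map_mul, hρ.map_gam, hρ.map_gam,
    ← Algebra.smul_def, ← Algebra.smul_def]

theorem map_psi_natCast (ρ : Free n →ₐ[Kq] E) (i : Fin n) (m : ℕ) :
    ρ (Free.psi C i m) =
      ρ (Free.K i) * expSeries (qi C i - (qi C i)⁻¹) (fun l => ρ (Free.h i l)) m := by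
  rw [Free.psi, if_pos (by omega), map_mul, map_expCoeff, Int.toNat_natCast]

theorem map_phi_neg_natCast (ρ : Free n →ₐ[Kq] E) (i : Fin n) (m : ℕ) :
    ρ (Free.phi C i (-m)) =
      ρ (Free.Kinv i) * expSeries (-(qi C i - (qi C i)⁻¹)) (fun l => ρ (Free.h i (-l))) m := by
  rw [Free.phi, if_pos (by omega), map_mul, map_expCoeff, neg_neg, Int.toNat_natCast]

theorem psi_neg {k : ℤ} (hk : k < 0) (i : Fin n) : Free.psi C i k = 0 := by
  rw [Free.psi, if_neg (by omega)]

theorem phi_pos {k : ℤ} (hk : 0 < k) (i : Fin n) : Free.phi C i k = 0 := by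
  rw [Free.phi, if_neg (by omega)]

/-- Substituting wz for z and multiplying by an operator that commutes with U preserves the
equation. The scalar w will be Γ^{±1} in the exchange relations and 1 elsewhere. -/
theorem eulerOp_mul_left {K : E} {w : Kq} {ψ U : ℕ → E}
    (h : eulerOp (PowerSeries.mk ψ) = PowerSeries.mk U * PowerSeries.mk ψ)
    (hK : ∀ l, K * U l = U l * K) :
    eulerOp (PowerSeries.mk fun m => w ^ m • (K * ψ m)) =
      PowerSeries.mk (fun l => w ^ l • U l) * PowerSeries.mk fun m => w ^ m • (K * ψ m) := by
  ext m
  have h1 := congrArg (PowerSeries.coeff m) h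
  rw [coeff_eulerOp, PowerSeries.coeff_mul, PowerSeries.coeff_mk] at h1
  rw [coeff_eulerOp, PowerSeries.coeff_mul, PowerSeries.coeff_mk, smul_comm, ← mul_smul_comm, h1,
    Finset.mul_sum, Finset.smul_sum]
  refine Finset.sum_congr rfl fun ab hab => ?_
  have hab : ab.1 + ab.2 = m := Finset.HasAntidiagonal.mem_antidiagonal.mp hab
  simp only [PowerSeries.coeff_mk]
  rw [← mul_assoc, hK, smul_mul_smul_comm, ← pow_add, hab, mul_assoc]

/-- The differential equation of `ψ_i`. -/
theorem eulerOp_psi (hρ : IsCartanRep C Γ ρ) (i : Fin n) (w : Kq) :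
    eulerOp (PowerSeries.mk fun m : ℕ => w ^ m • ρ (Free.psi C i m)) =
      PowerSeries.mk (fun l : ℕ => w ^ l • ((qi C i - (qi C i)⁻¹) * l) • ρ (Free.h i l)) *
        PowerSeries.mk fun m : ℕ => w ^ m • ρ (Free.psi C i m) := by
  simp only [map_psi_natCast]
  refine eulerOp_mul_left (eulerOp_expSeries _ ?_ ?_) ?_
  · simp [h_zero]
  · intro k l
    rcases Nat.eq_zero_or_pos k with rfl | hk
    · simp [h_zero]
    rcases Nat.eq_zero_or_pos l with rfl | hl
    · simp [h_zero]
    have := hρ.h_h i i k l (by omega) (by omega)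
    rw [if_neg (by omega)] at this
    exact sub_eq_zero.mp this
  · intro l
    rw [mul_smul_comm, smul_mul_assoc, hρ.K_h]

/-- The differential equation of `φ_i`. -/
theorem eulerOp_phi (hρ : IsCartanRep C Γ ρ) (i : Fin n) (w : Kq) :
    eulerOp (PowerSeries.mk fun m : ℕ => w ^ m • ρ (Free.phi C i (-m))) =
      PowerSeries.mk (fun l : ℕ => w ^ l • (-(qi C i - (qi C i)⁻¹) * l) • ρ (Free.h i (-l))) *
        PowerSeries.mk fun m : ℕ => w ^ m • ρ (Free.phi C i (-m)) := by
  simp only [map_phi_neg_natCast]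
  refine eulerOp_mul_left (eulerOp_expSeries _ ?_ ?_) ?_
  · simp [h_zero]
  · intro k l
    rcases Nat.eq_zero_or_pos k with rfl | hk
    · simp [h_zero]
    rcases Nat.eq_zero_or_pos l with rfl | hl
    · simp [h_zero]
    have := hρ.h_h i i (-k) (-l) (by omega) (by omega)
    rw [if_neg (by omega)] at this
    exact sub_eq_zero.mp this
  · intro l
    rw [mul_smul_comm, smul_mul_assoc, hρ.Kinv_h]

theorem sub_inv_mul_hhCoeff (Γ : Kq) (i j : Fin n) (k : ℤ) :
    (qi C i - (qi C i)⁻¹) * hhCoeff C Γ j i k =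
      hxCoeff C j i k * (Γ ^ (2 * k) - Γ ^ (-(2 * k))) := by
  have := (isGeneric_qi C i).sub_inv_ne
  rw [hhCoeff]
  generalize qi C i - (qi C i)⁻¹ = t at *
  field_simp

theorem psi_zero (ρ : Free n →ₐ[Kq] E) (i : Fin n) :
    ρ (Free.psi C i 0) = ρ (Free.K i) := by
  have := map_psi_natCast (C := C) ρ i 0
  rw [expSeries_zero, mul_one] at this
  exact this

theorem phi_zero (ρ : Free n →ₐ[Kq] E) (i : Fin n) :
    ρ (Free.phi C i 0) = ρ (Free.Kinv i) := by
  have := map_phi_neg_natCast (C := C) ρ i 0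
  rw [expSeries_zero, mul_one, Nat.cast_zero, neg_zero] at this
  exact this

/-- The exponent of ψ contains only h_{il} with l > 0, so only h_{jk} with k < 0 fails to commute
with it, and then only through the scalar [h_{jk}, h_{i,-k}]. The commutator with the exponential is
therefore a shift of ψ. -/
theorem h_psi (hρ : IsCartanRep C Γ ρ) (i j : Fin n) (k M : ℤ) (hk : k ≠ 0) :
    ρ (Free.h j k) * ρ (Free.psi C i M) - ρ (Free.psi C i M) * ρ (Free.h j k) =
      if k < 0 then (hxCoeff C j i k * (Γ ^ (2 * k) - Γ ^ (-(2 * k)))) • ρ (Free.psi C i (M + k))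
      else 0 := by
  rcases lt_or_ge M 0 with hM | hM
  · rw [psi_neg hM]
    split_ifs with h
    · rw [psi_neg (by omega)]; simp
    · simp
  lift M to ℕ using hM
  have h1 := hρ.eulerOp_psi i 1
  simp only [one_pow, one_smul] at h1
  have hU : ((qi C i - (qi C i)⁻¹) * ((0 : ℕ) : Kq)) • ρ (Free.h i (0 : ℕ)) = 0 := by simp
  have hK : ρ (Free.h j k) * ρ (Free.psi C i (0 : ℕ)) =
      ρ (Free.psi C i (0 : ℕ)) * ρ (Free.h j k) := by
    rw [Nat.cast_zero, psi_zero, hρ.K_h]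
  have hcomm := commutator_of_eulerOp (g := ρ (Free.h j k)) (k := k.natAbs)
    (s := if k < 0 then hxCoeff C j i k * (Γ ^ (2 * k) - Γ ^ (-(2 * k))) else 0) h1 hU
    (fun l => ?_) (by omega) hK M
  · rw [hcomm]
    split_ifs with h1 h2
    · rw [show (M : ℤ) + k = ((M - k.natAbs : ℕ) : ℤ) by omega]
    · simp
    · rw [psi_neg (by omega)]; simp
    · simp
  · rcases Nat.eq_zero_or_pos l with rfl | hl
    · rw [if_neg (by omega)]; simp
    rw [mul_smul_comm, smul_mul_assoc, ← smul_sub, hρ.h_h j i k l hk (by omega)]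
    by_cases h : k = -l
    · rw [if_pos h, if_pos (by omega), if_pos (by omega), ← sub_inv_mul_hhCoeff, smul_smul,
        show k.natAbs = l by omega]
      congr 1; ring
    · rw [if_neg h]
      split_ifs with h2 h3
      · omega
      · simp
      · simp

theorem h_phi (hρ : IsCartanRep C Γ ρ) (i j : Fin n) (k M : ℤ) (hk : k ≠ 0) :
    ρ (Free.h j k) * ρ (Free.phi C i M) - ρ (Free.phi C i M) * ρ (Free.h j k) =
      if k < 0 then 0
      else -(hxCoeff C j i k * (Γ ^ (2 * k) - Γ ^ (-(2 * k)))) • ρ (Free.phi C i (M + k)) := by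
  rcases lt_or_ge 0 M with hM | hM
  · rw [phi_pos hM]
    split_ifs with h
    · simp
    · rw [phi_pos (by omega)]; simp
  obtain ⟨m, rfl⟩ : ∃ m : ℕ, M = -m := ⟨M.natAbs, by omega⟩
  have h1 := hρ.eulerOp_phi i 1
  simp only [one_pow, one_smul] at h1
  have hU : (-(qi C i - (qi C i)⁻¹) * ((0 : ℕ) : Kq)) • ρ (Free.h i (-(0 : ℕ))) = 0 := by simp
  have hK : ρ (Free.h j k) * ρ (Free.phi C i (-(0 : ℕ))) =
      ρ (Free.phi C i (-(0 : ℕ))) * ρ (Free.h j k) := by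
    rw [Nat.cast_zero, neg_zero, phi_zero, hρ.Kinv_h]
  have hcomm := commutator_of_eulerOp (g := ρ (Free.h j k)) (k := k.natAbs)
    (s := if k < 0 then 0 else -(hxCoeff C j i k * (Γ ^ (2 * k) - Γ ^ (-(2 * k))))) h1 hU
    (fun l => ?_) (by omega) hK m
  · rw [hcomm]
    split_ifs with h1 h2
    · simp
    · rw [show -(m : ℤ) + k = -((m - k.natAbs : ℕ) : ℤ) by omega]
    · simp
    · rw [phi_pos (by omega)]; simp
  · rcases Nat.eq_zero_or_pos l with rfl | hl
    · rw [if_neg (by omega)]; simp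
    rw [mul_smul_comm, smul_mul_assoc, ← smul_sub, hρ.h_h j i k (-l) hk (by omega)]
    by_cases h : k = l
    · rw [if_pos (by omega), if_pos (by omega), if_neg (by omega), ← sub_inv_mul_hhCoeff, smul_smul,
        show k.natAbs = l by omega]
      congr 1; ring
    · rw [if_neg (by omega)]
      split_ifs with h2 h3
      · simp
      · omega
      · simp

/-- `[h_{jk}, [x^+_{il}, x^-_{im}]]` as dictated by the Jacobi identity. -/
theorem h_gammaPsi (hρ : IsCartanRep C Γ ρ) (i j : Fin n) (k l m : ℤ) (hk : k ≠ 0) :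
    ρ (Free.h j k) * ρ (Free.gammaPsi C i l m) - ρ (Free.gammaPsi C i l m) * ρ (Free.h j k) =
      hxCoeff C j i k • (Γ ^ (-|k|) • ρ (Free.gammaPsi C i (k + l) m) -
        Γ ^ |k| • ρ (Free.gammaPsi C i l (k + m))) := by
  have hΓ := hρ.gamma_ne
  have hz : ∀ a b : ℤ, Γ ^ a * Γ ^ b = Γ ^ (a + b) := fun a b => (zpow_add₀ hΓ a b).symm
  have hψ := hρ.h_psi i j k (l + m) hk
  have hφ := hρ.h_phi i j k (l + m) hk
  simp only [hρ.map_gammaPsi]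
  rw [show k + l + m = l + m + k by ring, show l + (k + m) = l + m + k by ring, mul_smul_comm,
    smul_mul_assoc, ← smul_sub, mul_sub, sub_mul, mul_smul_comm, mul_smul_comm, smul_mul_assoc,
    smul_mul_assoc, sub_sub_sub_comm, ← smul_sub, ← smul_sub, hψ, hφ, smul_comm (Γ ^ (-|k|)),
    smul_comm (Γ ^ |k|), ← smul_sub, smul_comm (hxCoeff C j i k)]
  congr 1
  simp only [smul_sub, smul_smul, hz]
  -- For k < 0 only ψ fails to commute with h, for k > 0 only φ. On the right-hand side the two
  -- contributions of the other current carry the same power of Γ and cancel.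
  rcases lt_or_gt_of_ne hk with h | h
  · rw [if_pos h, if_pos h, abs_of_neg h, smul_zero, sub_zero, smul_smul,
      show - -k + (m - (k + l)) = -k + (k + m - l) by ring, sub_sub_sub_cancel_right, ← sub_smul]
    congr 1
    rw [show - -k + (k + l - m) = l - m + 2 * k by ring,
      show -k + (l - (k + m)) = l - m + -(2 * k) by ring, ← hz, ← hz]
    ring
  · rw [if_neg (by omega), if_neg (by omega), abs_of_pos h, smul_zero, zero_sub, smul_smul,
      show -k + (k + l - m) = k + (l - (k + m)) by ring, sub_sub_sub_cancel_left, ← sub_smul,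
      ← neg_smul]
    congr 1
    rw [show -k + (m - (k + l)) = m - l + -(2 * k) by ring,
      show k + (k + m - l) = m - l + 2 * k by ring, ← hz, ← hz]
    ring

theorem K_psi (hρ : IsCartanRep C Γ ρ) (i j : Fin n) (M : ℤ) :
    ρ (Free.K j) * ρ (Free.psi C i M) = ρ (Free.psi C i M) * ρ (Free.K j) := by
  rcases lt_or_ge M 0 with hM | hM
  · rw [psi_neg hM]; simp
  lift M to ℕ using hM
  have h1 := hρ.eulerOp_psi i 1
  simp only [one_pow, one_smul] at h1
  have := mul_eq_smul_of_eulerOp (g := ρ (Free.K j)) (w := (1 : Kq)) h1 (by simp) (fun l => by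
    rw [one_pow, one_smul, mul_smul_comm, smul_mul_assoc, hρ.K_h])
    (by rw [Nat.cast_zero, psi_zero, hρ.K_K]) M
  rwa [one_pow, one_smul] at this

theorem K_Kinv (hρ : IsCartanRep C Γ ρ) (i j : Fin n) :
    ρ (Free.K i) * ρ (Free.Kinv j) = ρ (Free.Kinv j) * ρ (Free.K i) := by
  calc ρ (Free.K i) * ρ (Free.Kinv j)
      = ρ (Free.Kinv j) * (ρ (Free.K j) * ρ (Free.K i)) * ρ (Free.Kinv j) := by
        rw [← mul_assoc, hρ.Kinv_mul_K, one_mul]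
    _ = _ := by rw [← hρ.K_K, ← mul_assoc, mul_assoc, hρ.K_mul_Kinv, mul_one]

theorem D_Kinv (hρ : IsCartanRep C Γ ρ) (j : Fin n) :
    ρ Free.D * ρ (Free.Kinv j) = ρ (Free.Kinv j) * ρ Free.D := by
  calc ρ Free.D * ρ (Free.Kinv j)
      = ρ (Free.Kinv j) * (ρ (Free.K j) * ρ Free.D) * ρ (Free.Kinv j) := by
        rw [← mul_assoc, hρ.Kinv_mul_K, one_mul]
    _ = _ := by rw [← hρ.D_K, ← mul_assoc, mul_assoc, hρ.K_mul_Kinv, mul_one]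

theorem K_phi (hρ : IsCartanRep C Γ ρ) (i j : Fin n) (M : ℤ) :
    ρ (Free.K j) * ρ (Free.phi C i M) = ρ (Free.phi C i M) * ρ (Free.K j) := by
  rcases lt_or_ge 0 M with hM | hM
  · rw [phi_pos hM]; simp
  obtain ⟨m, rfl⟩ : ∃ m : ℕ, M = -m := ⟨M.natAbs, by omega⟩
  have h1 := hρ.eulerOp_phi i 1
  simp only [one_pow, one_smul] at h1
  have := mul_eq_smul_of_eulerOp (g := ρ (Free.K j)) (w := (1 : Kq)) h1 (by simp) (fun l => by
    rw [one_pow, one_smul, mul_smul_comm, smul_mul_assoc, hρ.K_h])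
    (by rw [Nat.cast_zero, neg_zero, phi_zero, hρ.K_Kinv]) m
  rwa [one_pow, one_smul] at this

theorem D_psi (hρ : IsCartanRep C Γ ρ) (i : Fin n) (M : ℤ) :
    ρ Free.D * ρ (Free.psi C i M) = q ^ M • (ρ (Free.psi C i M) * ρ Free.D) := by
  rcases lt_or_ge M 0 with hM | hM
  · rw [psi_neg hM]; simp
  lift M to ℕ using hM
  have h1 := hρ.eulerOp_psi i 1
  simp only [one_pow, one_smul] at h1
  rw [zpow_natCast]
  exact mul_eq_smul_of_eulerOp (g := ρ Free.D) (w := q) h1 (by simp) (fun l => by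
    rw [mul_smul_comm, smul_mul_assoc, hρ.D_h, smul_comm, zpow_natCast])
    (by rw [Nat.cast_zero, psi_zero, hρ.D_K]) M

theorem D_phi (hρ : IsCartanRep C Γ ρ) (i : Fin n) (M : ℤ) :
    ρ Free.D * ρ (Free.phi C i M) = q ^ M • (ρ (Free.phi C i M) * ρ Free.D) := by
  rcases lt_or_ge 0 M with hM | hM
  · rw [phi_pos hM]; simp
  obtain ⟨m, rfl⟩ : ∃ m : ℕ, M = -m := ⟨M.natAbs, by omega⟩
  have h1 := hρ.eulerOp_phi i 1
  simp only [one_pow, one_smul] at h1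
  rw [zpow_neg, zpow_natCast, ← inv_pow]
  exact mul_eq_smul_of_eulerOp (g := ρ Free.D) (w := q⁻¹) h1 (by simp) (fun l => by
    rw [mul_smul_comm, smul_mul_assoc, hρ.D_h, smul_comm, zpow_neg, zpow_natCast, inv_pow])
    (by rw [Nat.cast_zero, neg_zero, phi_zero, hρ.D_Kinv]) m

theorem K_gammaPsi (hρ : IsCartanRep C Γ ρ) (i j : Fin n) (k l : ℤ) :
    ρ (Free.K j) * ρ (Free.gammaPsi C i k l) = ρ (Free.gammaPsi C i k l) * ρ (Free.K j) := by
  rw [hρ.map_gammaPsi, mul_smul_comm, smul_mul_assoc, mul_sub, sub_mul, mul_smul_comm,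
    mul_smul_comm, smul_mul_assoc, smul_mul_assoc, hρ.K_psi, hρ.K_phi]

theorem D_gammaPsi (hρ : IsCartanRep C Γ ρ) (i : Fin n) (k l : ℤ) :
    ρ Free.D * ρ (Free.gammaPsi C i k l) =
      q ^ (k + l) • (ρ (Free.gammaPsi C i k l) * ρ Free.D) := by
  rw [hρ.map_gammaPsi, mul_smul_comm, smul_mul_assoc, mul_sub, sub_mul, mul_smul_comm,
    mul_smul_comm, smul_mul_assoc, smul_mul_assoc, hρ.D_psi, hρ.D_phi, smul_comm (q ^ (k + l)),
    smul_sub (q ^ (k + l)), smul_comm (q ^ (k + l)), smul_comm (q ^ (k + l)) (Γ ^ (l - k))]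

end IsCartanRep

end Rep

end QHeis

namespace QHeis

open Finset.HasAntidiagonal (antidiagonal)

/-! ### Exchange relations and quadratic relations -/

section Quadratic

variable {𝕜 : Type*} [Field 𝕜] {E : Type*} [Ring E] [Algebra 𝕜 E]

/-- The quadratic expression whose vanishing is the relation between two Drinfeld currents. -/
def quadRel (P : 𝕜) (η y : ℤ → E) (k l : ℤ) : E :=
  η (k + 1) * y l - P • (y l * η (k + 1)) - (P • (η k * y (l + 1)) - y (l + 1) * η k)

/-- This symmetry reduces a bracket falling on the second current to one falling on the first. -/
theorem quadRel_symm (P : 𝕜) (η y : ℤ → E) (k l : ℤ) :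
    quadRel P η y k l = quadRel P y η l k := by
  simp only [quadRel]; abel

theorem quadRel_smul_add_smul (P s t : 𝕜) (η η' y : ℤ → E) (k l : ℤ) :
    quadRel P (fun m => s • η m + t • η' m) y k l =
      s • quadRel P η y k l + t • quadRel P η' y k l := by
  simp only [quadRel, add_mul, mul_add, smul_mul_assoc, mul_smul_comm]
  module

theorem commutator_quadRel (P : 𝕜) (u : E) (η y : ℤ → E) (k l : ℤ) :
    u * quadRel P η y k l - quadRel P η y k l * u =
      quadRel P (fun m => u * η m - η m * u) y k l +
        quadRel P η (fun m => u * y m - y m * u) k l := by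
  simp only [quadRel, mul_sub, sub_mul, mul_smul_comm, smul_mul_assoc, mul_assoc, smul_sub]
  abel

/-- Clearing the denominator 1 - Pz. The coefficients satisfy c_{j+1} = P c_j - δ_{j0}, so
subtracting P times the relation for the shifted current leaves two terms on each side, which is the
quadratic relation between ζ and X. -/
theorem Exchanges.succ {P : 𝕜} {ζ X : ℕ → E} (h : Exchanges P ζ X)
    (h' : Exchanges P ζ fun a => X (a + 1)) (m : ℕ) :
    ζ (m + 1) * X 0 - P • (X 0 * ζ (m + 1)) = P • (ζ m * X 1) - X 1 * ζ m := by
  have h1 := h (m + 1)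
  have h2 := h' m
  rw [Finset.Nat.sum_antidiagonal_succ] at h1
  simp only [zero_add] at h2
  rw [h1, h2, Finset.smul_sum]
  have h3 : ∀ ab : ℕ × ℕ, exchCoeff P (ab.1 + 1) • (X (ab.1 + 1) * ζ ab.2) =
      P • exchCoeff P ab.1 • (X (ab.1 + 1) * ζ ab.2) -
        (if ab.1 = 0 then X (ab.1 + 1) * ζ ab.2 else 0) := by
    intro ab
    rcases ab with ⟨_ | a, b⟩
    · simp [exchCoeff]; module
    · simp [exchCoeff, pow_succ, smul_smul]; congr 1; ring
  have h4 : ∑ ab ∈ antidiagonal m, (if ab.1 = 0 then X (ab.1 + 1) * ζ ab.2 else 0) =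
      X 1 * ζ m := by
    rcases m with _ | m
    · simp
    · rw [Finset.Nat.sum_antidiagonal_succ]
      simp
  rw [Finset.sum_congr rfl fun ab _ => h3 ab, Finset.sum_sub_distrib, h4]
  simp only [exchCoeff, if_true]
  abel

theorem Exchanges.zero {P : 𝕜} {ζ X : ℕ → E} (h : Exchanges P ζ X) :
    ζ 0 * X 0 = P • (X 0 * ζ 0) := by
  simpa [exchCoeff] using h 0

theorem Exchanges.sum_smul {P : 𝕜} {ζ : ℕ → E} {ι : Type*} (s : Finset ι) (t : ι → 𝕜)
    (X : ι → ℕ → E) (h : ∀ i, Exchanges P ζ (X i)) :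
    Exchanges P ζ fun a => ∑ i ∈ s, t i • X i a := by
  intro m
  simp only [Finset.mul_sum, Finset.sum_mul, Finset.smul_sum]
  rw [Finset.sum_comm]
  refine Finset.sum_congr rfl fun i _ => ?_
  rw [mul_smul_comm, h i m, Finset.smul_sum]
  refine Finset.sum_congr rfl fun ab _ => ?_
  rw [smul_mul_assoc, smul_comm]

end Quadratic

section Rep

variable {n : ℕ} {C : CartanDatum n} {E : Type*} [Ring E] [Algebra Kq E]
variable {Γ : Kq} {ρ : Free n →ₐ[Kq] E}

/-- `(ε α_i | α_j)`-th power of `q`. -/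
def qPair (C : CartanDatum n) (ε : ℤˣ) (i j : Fin n) : Kq := q ^ ((ε : ℤ) * (C.d i * C.a i j))

theorem qPair_ne_zero (ε : ℤˣ) (i j : Fin n) : qPair C ε i j ≠ 0 := zpow_ne_zero _ q_ne_zero

theorem qPair_symm (ε : ℤˣ) (i j : Fin n) : qPair C ε i j = qPair C ε j i := by
  rw [qPair, qPair, C.symm]

theorem qPair_pow_sub (ε : ℤˣ) (i j : Fin n) (l : ℕ) :
    qPair C ε i j ^ l - (qPair C ε i j ^ l)⁻¹ =
      ((ε : ℤ) : Kq) * ((qi C i - (qi C i)⁻¹) * qInt (qi C i) (l * C.a i j)) := by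
  rw [sub_mul_qInt, qPair, ← zpow_natCast, ← zpow_mul, ← zpow_neg, qi_zpow, qi_zpow]
  rcases Int.units_eq_one_or ε with rfl | rfl
  · simp only [Units.val_one, Int.cast_one, one_mul]
    congr 2 <;> ring
  · simp only [Units.val_neg, Units.val_one, Int.cast_neg, Int.cast_one, neg_mul, one_mul, neg_neg,
      neg_sub]
    congr 2 <;> ring

namespace IsPreRep

/-- `γ^{ε k/2} ψ_{ik}` -/
def psiTw (ρ : Free n →ₐ[Kq] E) (C : CartanDatum n) (Γ : Kq) (ε : ℤˣ) (i : Fin n) (k : ℤ) : E :=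
  Γ ^ ((ε : ℤ) * k) • ρ (Free.psi C i k)

/-- `γ^{-ε k/2} φ_{ik}` -/
def phiTw (ρ : Free n →ₐ[Kq] E) (C : CartanDatum n) (Γ : Kq) (ε : ℤˣ) (i : Fin n) (k : ℤ) : E :=
  Γ ^ (-((ε : ℤ) * k)) • ρ (Free.phi C i k)

theorem psiTw_natCast (ε : ℤˣ) (i : Fin n) (m : ℕ) :
    psiTw ρ C Γ ε i m = (Γ ^ (ε : ℤ)) ^ m • ρ (Free.psi C i m) := by
  rw [psiTw, zpow_mul, zpow_natCast]

theorem phiTw_neg_natCast (ε : ℤˣ) (i : Fin n) (m : ℕ) :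
    phiTw ρ C Γ ε i (-m) = (Γ ^ (ε : ℤ)) ^ m • ρ (Free.phi C i (-m)) := by
  rw [phiTw, mul_neg, neg_neg, zpow_mul, zpow_natCast]

theorem psiTw_neg {k : ℤ} (hk : k < 0) (ε : ℤˣ) (i : Fin n) : psiTw ρ C Γ ε i k = 0 := by
  rw [psiTw, IsCartanRep.psi_neg hk, map_zero, smul_zero]

theorem phiTw_pos {k : ℤ} (hk : 0 < k) (ε : ℤˣ) (i : Fin n) : phiTw ρ C Γ ε i k = 0 := by
  rw [phiTw, IsCartanRep.phi_pos hk, map_zero, smul_zero]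

theorem Kinv_x (hρ : IsPreRep C Γ ρ) (ε : ℤˣ) (i j : Fin n) (r : ℤ) :
    ρ (Free.Kinv i) * ρ (Free.x ε j r) =
      (qPair C ε i j)⁻¹ • (ρ (Free.x ε j r) * ρ (Free.Kinv i)) := by
  have h : ρ (Free.x ε j r) = qPair C ε i j • (ρ (Free.Kinv i) * ρ (Free.x ε j r) * ρ (Free.K i)) := by
    rw [mul_assoc, ← mul_smul_comm, ← show _ = qPair C ε i j • _ from hρ.K_x ε i j r, ← mul_assoc,
      hρ.Kinv_mul_K, one_mul]
  conv_rhs => rw [h]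
  rw [smul_mul_assoc, smul_smul, inv_mul_cancel₀ (qPair_ne_zero ε i j), one_smul, mul_assoc,
    hρ.K_mul_Kinv, mul_one]

/-- The twist by Γ^{εm} cancels the factor γ^{-ε|l|/2} in [h_{il}, x^ε]. The exponent of the twisted
ψ then acts on x^ε_j by pure shifts with coefficients P^l - P^{-l}, where P = q^{ε(α_i|α_j)}. -/
theorem exchanges_psi (hρ : IsPreRep C Γ ρ) (ε : ℤˣ) (i j : Fin n) (k : ℤ) :
    Exchanges (qPair C ε i j) (fun m : ℕ => psiTw ρ C Γ ε i m)
      (fun a : ℕ => ρ (Free.x ε j (k + a))) := by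
  simp only [psiTw_natCast]
  refine exchanges_of_eulerOp (qPair_ne_zero ε i j) (hρ.eulerOp_psi i (Γ ^ (ε : ℤ))) (by simp)
    ?_ ?_
  · intro l a
    rcases Nat.eq_zero_or_pos l with rfl | hl
    · simp
    rw [smul_mul_assoc, smul_mul_assoc, mul_smul_comm, mul_smul_comm, ← smul_sub, ← smul_sub,
      hρ.h_x ε i j l (k + a) (by omega), smul_smul, smul_smul, qPair_pow_sub, hxCoeff,
      show (l : ℤ) + (k + a) = k + (a + l : ℕ) by push_cast; ring]
    congr 1
    have hl' : (l : Kq) ≠ 0 := by exact_mod_cast hl.ne'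
    have hΓ : (Γ ^ (ε : ℤ)) ^ l * Γ ^ (-((ε : ℤ) * |(l : ℤ)|)) = 1 := by
      rw [← zpow_natCast, ← zpow_mul, ← zpow_add₀ hρ.gamma_ne, Nat.abs_cast, add_neg_cancel,
        zpow_zero]
    have hll : (l : Kq) * (((l : ℤ) : Kq))⁻¹ = 1 := by
      rw [Int.cast_natCast, mul_inv_cancel₀ hl']
    generalize qi C i - (qi C i)⁻¹ = t
    generalize qInt (qi C i) (l * C.a i j) = u
    linear_combination (t * ((ε : ℤ) : Kq) * u) * (hΓ * (l * (((l : ℤ) : Kq))⁻¹) + hll)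
  · simp only [pow_zero, one_smul, Nat.cast_zero, add_zero]
    rw [IsCartanRep.psi_zero]
    exact hρ.K_x ε i j k

/-- The mirror image for φ: the current x is read towards decreasing indices and P is replaced by
P⁻¹. -/
theorem exchanges_phi (hρ : IsPreRep C Γ ρ) (ε : ℤˣ) (i j : Fin n) (k : ℤ) :
    Exchanges (qPair C ε i j)⁻¹ (fun m : ℕ => phiTw ρ C Γ ε i (-m))
      (fun a : ℕ => ρ (Free.x ε j (k - a))) := by
  simp only [phiTw_neg_natCast]
  refine exchanges_of_eulerOp (inv_ne_zero (qPair_ne_zero ε i j))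
    (hρ.eulerOp_phi i (Γ ^ (ε : ℤ))) (by simp) ?_ ?_
  · intro l a
    rcases Nat.eq_zero_or_pos l with rfl | hl
    · simp
    rw [smul_mul_assoc, smul_mul_assoc, mul_smul_comm, mul_smul_comm, ← smul_sub, ← smul_sub,
      hρ.h_x ε i j (-l) (k - a) (by omega), smul_smul, smul_smul, inv_pow, inv_inv,
      ← neg_sub (qPair C ε i j ^ l), qPair_pow_sub, hxCoeff,
      show -(l : ℤ) + (k - a) = k - (a + l : ℕ) by push_cast; ring]
    congr 1
    have hl' : (l : Kq) ≠ 0 := by exact_mod_cast hl.ne'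
    have hΓ : (Γ ^ (ε : ℤ)) ^ l * Γ ^ (-((ε : ℤ) * |-(l : ℤ)|)) = 1 := by
      rw [← zpow_natCast, ← zpow_mul, ← zpow_add₀ hρ.gamma_ne, abs_neg, Nat.abs_cast,
        add_neg_cancel, zpow_zero]
    have hll : (l : Kq) * (((-l : ℤ) : Kq))⁻¹ = -1 := by
      rw [Int.cast_neg, Int.cast_natCast]
      field_simp
    have hq : qInt (qi C i) (-l * C.a i j) = -qInt (qi C i) (l * C.a i j) := by
      rw [qInt, qInt, ← neg_div, neg_sub, neg_mul, neg_neg]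
    rw [hq]
    generalize qi C i - (qi C i)⁻¹ = t
    generalize qInt (qi C i) (l * C.a i j) = u
    linear_combination (t * ((ε : ℤ) : Kq) * u) * (hΓ * (l * (((-l : ℤ) : Kq))⁻¹) + hll)
  · simp only [pow_zero, one_smul, Nat.cast_zero, sub_zero, neg_zero]
    rw [IsCartanRep.phi_zero]
    exact hρ.Kinv_x ε i j k

/-- The exchange relation, cleared of denominators, has the same shape as the relation between x_i
and x_j. Since ψ is cut off at index 0, the case k = -1 is the constant term of the exchange
relation. -/
theorem quadRel_psi (hρ : IsPreRep C Γ ρ) (ε : ℤˣ) (i j : Fin n) (k l : ℤ) :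
    quadRel (qPair C ε i j) (psiTw ρ C Γ ε i) (fun r => ρ (Free.x ε j r)) k l = 0 := by
  rcases lt_trichotomy k (-1) with hk | rfl | hk
  · simp [quadRel, psiTw_neg (show k < 0 by omega), psiTw_neg (show k + 1 < 0 by omega)]
  · have := (hρ.exchanges_psi ε i j l).zero
    simp only [Nat.cast_zero, add_zero] at this
    simp [quadRel, psiTw_neg (show (-1 : ℤ) < 0 by omega), this]
  · lift k to ℕ using (by omega)
    have h1 := hρ.exchanges_psi ε i j l
    have h2 := hρ.exchanges_psi ε i j (l + 1)
    have := Exchanges.succ h1 (by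
      convert h2 using 4
      push_cast; ring) k
    simp only [Nat.cast_zero, add_zero, Nat.cast_add, Nat.cast_one] at this
    rw [quadRel, this, sub_self]

theorem quadRel_phi (hρ : IsPreRep C Γ ρ) (ε : ℤˣ) (i j : Fin n) (k l : ℤ) :
    quadRel (qPair C ε i j) (phiTw ρ C Γ ε i) (fun r => ρ (Free.x ε j r)) k l = 0 := by
  have hP := qPair_ne_zero (C := C) ε i j
  rcases lt_trichotomy k 0 with hk | rfl | hk
  · obtain ⟨m, rfl⟩ : ∃ m : ℕ, k = -(m + 1 : ℕ) := ⟨(-k - 1).toNat, by omega⟩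
    have h1 := hρ.exchanges_phi ε i j (l + 1)
    have h2 := hρ.exchanges_phi ε i j l
    have := Exchanges.succ h1 (by
      convert h2 using 4
      push_cast; ring) m
    simp only [Nat.cast_zero, sub_zero, Nat.cast_one, add_sub_cancel_right] at this
    rw [quadRel, show -((m + 1 : ℕ) : ℤ) + 1 = -m by push_cast; ring]
    have h3 := congrArg (fun z => qPair C ε i j • z) this
    simp only [smul_sub, smul_smul, mul_inv_cancel₀ hP, one_smul] at h3
    rw [h3, sub_self]
  · have := (hρ.exchanges_phi ε i j (l + 1)).zero
    simp only [Nat.cast_zero, sub_zero, neg_zero] at this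
    rw [quadRel, phiTw_pos (show (0 : ℤ) < 0 + 1 by omega), this, smul_smul, mul_inv_cancel₀ hP]
    simp
  · simp [quadRel, phiTw_pos (show 0 < k by omega), phiTw_pos (show 0 < k + 1 by omega)]

/-- The bracket of `x^{-ε}_{im}` and `x^ε_{ik}` as a combination of `ψ` and `φ`. -/
theorem exists_bracket (hρ : IsPreRep C Γ ρ) (ε : ℤˣ) (i : Fin n) (m : ℤ) :
    ∃ s t : Kq, ∀ k, ρ (Free.x (-ε) i m) * ρ (Free.x ε i k) -
      ρ (Free.x ε i k) * ρ (Free.x (-ε) i m) =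
        s • psiTw ρ C Γ ε i (m + k) + t • phiTw ρ C Γ ε i (m + k) := by
  have hz : ∀ a b : ℤ, Γ ^ a * Γ ^ b = Γ ^ (a + b) := fun a b => (zpow_add₀ hρ.gamma_ne a b).symm
  rcases Int.units_eq_one_or ε with rfl | rfl
  · refine ⟨-((qi C i - (qi C i)⁻¹)⁻¹ * Γ ^ (-(2 * m))), (qi C i - (qi C i)⁻¹)⁻¹ * Γ ^ (2 * m),
      fun k => ?_⟩
    have := hρ.xp_xm i i k m
    rw [if_pos rfl, hρ.map_gammaPsi] at this
    rw [← neg_sub, this, psiTw, phiTw, smul_smul, smul_smul, neg_mul, mul_assoc, mul_assoc, hz, hz,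
      smul_sub, smul_smul, smul_smul, neg_smul, add_comm m k]
    simp only [Units.val_one, one_mul]
    rw [show -(2 * m) + (k + m) = k - m by ring, show 2 * m + -(k + m) = m - k by ring]
    abel
  · refine ⟨(qi C i - (qi C i)⁻¹)⁻¹ * Γ ^ (2 * m), -((qi C i - (qi C i)⁻¹)⁻¹ * Γ ^ (-(2 * m))),
      fun k => ?_⟩
    have := hρ.xp_xm i i m k
    rw [if_pos rfl, hρ.map_gammaPsi] at this
    rw [neg_neg, this, psiTw, phiTw, smul_smul, smul_smul, neg_mul, mul_assoc, mul_assoc, hz, hz,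
      smul_sub, smul_smul, smul_smul, neg_smul]
    simp only [Units.val_one, Units.val_neg, one_mul, neg_mul, neg_neg]
    rw [show 2 * m + -(m + k) = m - k by ring, show -(2 * m) + (m + k) = k - m by ring]
    abel

theorem bracket_of_ne (hρ : IsPreRep C Γ ρ) (ε : ℤˣ) {i j : Fin n} (hij : i ≠ j) (m k : ℤ) :
    ρ (Free.x (-ε) i m) * ρ (Free.x ε j k) - ρ (Free.x ε j k) * ρ (Free.x (-ε) i m) = 0 := by
  rcases Int.units_eq_one_or ε with rfl | rfl
  · have := hρ.xp_xm j i k m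
    rw [if_neg hij.symm] at this
    rw [← neg_sub, this, neg_zero]
  · have := hρ.xp_xm i j m k
    rw [if_neg hij] at this
    rw [neg_neg, this]

/-- The bracket is a combination of twisted ψ and φ with coefficients independent of s, so it
satisfies the relation because both currents do. For r ≠ i it is zero. -/
theorem quadRel_bracket (hρ : IsPreRep C Γ ρ) (ε : ℤˣ) (i j r : Fin n) (k l m : ℤ) :
    quadRel (qPair C ε i j) (fun s => ρ (Free.x (-ε) r m) * ρ (Free.x ε i s) -
      ρ (Free.x ε i s) * ρ (Free.x (-ε) r m)) (fun s => ρ (Free.x ε j s)) k l = 0 := by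
  by_cases h : r = i
  · subst h
    obtain ⟨s, t, hst⟩ := hρ.exists_bracket ε r m
    simp only [hst]
    have h1 := hρ.quadRel_psi ε r j (m + k) l
    have h2 := hρ.quadRel_phi ε r j (m + k) l
    have e : ∀ η : ℤ → E, quadRel (qPair C ε r j) (fun a => η (m + a))
        (fun s => ρ (Free.x ε j s)) k l =
        quadRel (qPair C ε r j) η (fun s => ρ (Free.x ε j s)) (m + k) l := by
      intro η
      simp only [quadRel, add_assoc]
    rw [quadRel_smul_add_smul (qPair C ε r j) s t (fun a => psiTw ρ C Γ ε r (m + a))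
      (fun a => phiTw ρ C Γ ε r (m + a)), e, e, h1, h2]
    simp
  · simp [hρ.bracket_of_ne ε h, quadRel]

/-- The quadratic relations among the `x^ε` commute with the `x^{-ε}`. -/
theorem commute_quadRel (hρ : IsPreRep C Γ ρ) (ε : ℤˣ) (i j r : Fin n) (k l m : ℤ) :
    Commute (ρ (Free.x (-ε) r m)) (quadRel (qPair C ε i j) (fun s => ρ (Free.x ε i s))
      (fun s => ρ (Free.x ε j s)) k l) := by
  have := commutator_quadRel (qPair C ε i j) (ρ (Free.x (-ε) r m)) (fun s => ρ (Free.x ε i s))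
      (fun s => ρ (Free.x ε j s)) k l
  have h2 : quadRel (qPair C ε i j) (fun s => ρ (Free.x ε i s))
      (fun s => ρ (Free.x (-ε) r m) * ρ (Free.x ε j s) - ρ (Free.x ε j s) * ρ (Free.x (-ε) r m))
      k l = 0 := by
    rw [quadRel_symm, qPair_symm]
    exact hρ.quadRel_bracket ..
  rw [hρ.quadRel_bracket, h2, add_zero] at this
  exact sub_eq_zero.mp this

end IsPreRep

end Rep

end QHeis

namespace QHeis

open Finset.HasAntidiagonal (antidiagonal)

/-! ### Polarized currents, and the Serre elements commute with the opposite generators -/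

section Quadratic

variable {𝕜 : Type*} [Field 𝕜] {E : Type*} [Ring E] [Algebra 𝕜 E]

theorem quadRel_eq_zero_iff (P : 𝕜) (η y : ℤ → E) (k l : ℤ) :
    quadRel P η y k l = 0 ↔
      η (k + 1) * y l + y (l + 1) * η k = P • (y l * η (k + 1) + η k * y (l + 1)) := by
  rw [quadRel, ← sub_eq_zero (b := P • _), smul_add]
  constructor <;> intro h <;> rw [← h] <;> abel

theorem serrePoly_inv {p : 𝕜} (hp : IsGeneric p) (N : ℕ) (X Y : E) :
    serrePoly p⁻¹ N X Y = serrePoly p N X Y := by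
  simp only [serrePoly, gauss_inv hp]

theorem serreDeriv_inv {p : 𝕜} (hp : IsGeneric p) (N : ℕ) (X Y Z : E) :
    serreDeriv p⁻¹ N X Y Z = serreDeriv p N X Y Z := by
  simp only [serreDeriv, gauss_inv hp]

variable {ι : Type*} [Fintype ι] (t : ι → 𝕜) (κ : ι → ℤ) {x y : ℤ → E}

/-- Polarization replaces the repeated letters x_{ik_1}, …, x_{ik_N} by one combination ∑ t_s
x_{k_s}. Its simultaneous shifts still satisfy the symmetrized quadratic relation. The ascending
version serves ψ and the descending one below serves φ. -/
theorem sum_smul_exchange {P : 𝕜} (h : ∀ k l, quadRel P x x k l = 0) (a b : ℕ) :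
    (∑ s, t s • x (κ s + (a + 1 : ℕ))) * (∑ s, t s • x (κ s + b)) +
      (∑ s, t s • x (κ s + (b + 1 : ℕ))) * (∑ s, t s • x (κ s + a)) =
    P • ((∑ s, t s • x (κ s + b)) * (∑ s, t s • x (κ s + (a + 1 : ℕ))) +
      (∑ s, t s • x (κ s + a)) * (∑ s, t s • x (κ s + (b + 1 : ℕ)))) := by
  simp only [Finset.sum_mul_sum, smul_mul_smul_comm]
  rw [Finset.sum_comm (f := fun i j => (t i * t j) • (x (κ i + (b + 1 : ℕ)) * x (κ j + a))),
    Finset.sum_comm (f := fun i j => (t i * t j) • (x (κ i + b) * x (κ j + (a + 1 : ℕ))))]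
  simp only [← Finset.sum_add_distrib, Finset.smul_sum]
  refine Finset.sum_congr rfl fun i _ => Finset.sum_congr rfl fun j _ => ?_
  have := (quadRel_eq_zero_iff ..).mp (h (κ i + a) (κ j + b))
  rw [mul_comm (t j), ← smul_add, ← smul_add, smul_comm P]
  congr 1
  push_cast
  rw [← add_assoc, ← add_assoc, this]

theorem sum_smul_exchange_sub {P : 𝕜} (hP : P ≠ 0) (h : ∀ k l, quadRel P x x k l = 0) (a b : ℕ) :
    (∑ s, t s • x (κ s - (a + 1 : ℕ))) * (∑ s, t s • x (κ s - b)) +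
      (∑ s, t s • x (κ s - (b + 1 : ℕ))) * (∑ s, t s • x (κ s - a)) =
    P⁻¹ • ((∑ s, t s • x (κ s - b)) * (∑ s, t s • x (κ s - (a + 1 : ℕ))) +
      (∑ s, t s • x (κ s - a)) * (∑ s, t s • x (κ s - (b + 1 : ℕ)))) := by
  simp only [Finset.sum_mul_sum, smul_mul_smul_comm]
  rw [Finset.sum_comm (f := fun i j => (t i * t j) • (x (κ i - (b + 1 : ℕ)) * x (κ j - a))),
    Finset.sum_comm (f := fun i j => (t i * t j) • (x (κ i - b) * x (κ j - (a + 1 : ℕ))))]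
  simp only [← Finset.sum_add_distrib, Finset.smul_sum]
  refine Finset.sum_congr rfl fun i _ => Finset.sum_congr rfl fun j _ => ?_
  have := (quadRel_eq_zero_iff ..).mp (h (κ i - (a + 1 : ℕ)) (κ j - (b + 1 : ℕ)))
  rw [show κ i - ((a + 1 : ℕ) : ℤ) + 1 = κ i - a by push_cast; ring,
    show κ j - ((b + 1 : ℕ) : ℤ) + 1 = κ j - b by push_cast; ring] at this
  rw [mul_comm (t j), ← smul_add, ← smul_add, smul_comm P⁻¹, add_comm (x (κ j - b) * _), this,
    inv_smul_smul₀ hP, add_comm]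

theorem sum_smul_exchange_right {Q : 𝕜} (hQ : Q ≠ 0) (h : ∀ k l, quadRel Q x y k l = 0) (l : ℤ)
    (a b : ℕ) :
    Q⁻¹ • ((∑ s, t s • x (κ s + (a + 1 : ℕ))) * y (l + b) +
      y (l + (b + 1 : ℕ)) * ∑ s, t s • x (κ s + a)) =
    (∑ s, t s • x (κ s + a)) * y (l + (b + 1 : ℕ)) +
      y (l + b) * ∑ s, t s • x (κ s + (a + 1 : ℕ)) := by
  simp only [Finset.sum_mul, Finset.mul_sum, ← Finset.sum_add_distrib, Finset.smul_sum,
    smul_mul_assoc, mul_smul_comm]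
  refine Finset.sum_congr rfl fun i _ => ?_
  have := (quadRel_eq_zero_iff ..).mp (h (κ i + a) (l + b))
  rw [← smul_add, ← smul_add, smul_comm Q⁻¹]
  congr 1
  push_cast
  rw [← add_assoc, ← add_assoc, this, smul_smul, inv_mul_cancel₀ hQ, one_smul, add_comm]

theorem sum_smul_exchange_right_sub {Q : 𝕜} (h : ∀ k l, quadRel Q x y k l = 0) (l : ℤ)
    (a b : ℕ) :
    Q • ((∑ s, t s • x (κ s - (a + 1 : ℕ))) * y (l - b) +
      y (l - (b + 1 : ℕ)) * ∑ s, t s • x (κ s - a)) =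
    (∑ s, t s • x (κ s - a)) * y (l - (b + 1 : ℕ)) +
      y (l - b) * ∑ s, t s • x (κ s - (a + 1 : ℕ)) := by
  simp only [Finset.sum_mul, Finset.mul_sum, ← Finset.sum_add_distrib, Finset.smul_sum,
    smul_mul_assoc, mul_smul_comm]
  refine Finset.sum_congr rfl fun i _ => ?_
  have := (quadRel_eq_zero_iff ..).mp (h (κ i - (a + 1 : ℕ)) (l - (b + 1 : ℕ)))
  rw [show κ i - ((a + 1 : ℕ) : ℤ) + 1 = κ i - a by push_cast; ring,
    show l - ((b + 1 : ℕ) : ℤ) + 1 = l - b by push_cast; ring] at this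
  rw [← smul_add, ← smul_add, smul_comm Q, this, add_comm (y (l - (b + 1 : ℕ)) * _)]

end Quadratic

section Rep

variable {n : ℕ} {C : CartanDatum n} {E : Type*} [Ring E] [Algebra Kq E]
variable {Γ : Kq} {ρ : Free n →ₐ[Kq] E}

/-- `q_i^ε` -/
def qiSign (C : CartanDatum n) (ε : ℤˣ) (i : Fin n) : Kq := qi C i ^ (ε : ℤ)

theorem isGeneric_qiSign (ε : ℤˣ) (i : Fin n) : IsGeneric (qiSign C ε i) := by
  rcases Int.units_eq_one_or ε with rfl | rfl
  · simpa [qiSign] using isGeneric_qi C i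
  · simpa [qiSign] using (isGeneric_qi C i).inv

theorem gauss_qiSign (ε : ℤˣ) (i : Fin n) (m r : ℕ) :
    gauss (qiSign C ε i) m r = gauss (qi C i) m r := by
  rcases Int.units_eq_one_or ε with rfl | rfl
  · simp [qiSign]
  · rw [qiSign, Units.val_neg, Units.val_one, zpow_neg, zpow_one, gauss_inv (isGeneric_qi C i)]

theorem qPair_eq_qiSign (ε : ℤˣ) (i j : Fin n) : qPair C ε i j = qiSign C ε i ^ C.a i j := by
  rw [qPair, qiSign, qi_zpow, ← zpow_mul]
  congr 1; ring

theorem qPair_self (ε : ℤˣ) (i : Fin n) : qPair C ε i i = qiSign C ε i ^ 2 := by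
  rw [qPair_eq_qiSign, C.diag]; rfl

/-- After polarization only Serre polynomials with one repeated element have to be treated. Using
q_i^ε in place of q_i costs nothing, as Gaussian binomials are symmetric, and makes both signs ε
uniform. -/
theorem map_serre (ρ : Free n →ₐ[Kq] E) (ε : ℤˣ) (i j : Fin n) {N : ℕ} (k : Fin N → ℤ) (l : ℤ) :
    ρ (Free.serre C ε i j k l) = ∑ S : Finset (Fin N), ((-1 : Kq) ^ (Sᶜ).card) •
      serrePoly (qiSign C ε i) N (∑ s, (if s ∈ S then (1 : Kq) else 0) • ρ (Free.x ε i (k s)))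
        (ρ (Free.x ε j l)) := by
  rw [← sum_perm_serre, Free.serre, map_sum]
  refine Finset.sum_congr rfl fun σ _ => ?_
  rw [map_sum]
  refine Finset.sum_congr rfl fun r hr => ?_
  rw [Finset.mem_range] at hr
  rw [map_smul, qBinom_eq_gauss (isGeneric_qi C i) (by omega), gauss_qiSign, map_mul, map_mul,
    map_list_prod, map_list_prod, List.map_take, List.map_drop, List.map_ofFn]
  rfl

namespace IsPreRep

/-- The part of the commutator in which x^{-ε} meets the letter occurring once. For r = j the
bracket is a combination of ψ and φ, each exchanging with the repeated letter at P = q_i^{∓εM}. -/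
theorem serrePoly_bracket (hρ : IsPreRep C Γ ρ) {ε : ℤˣ}
    (hq : ∀ i j k l, quadRel (qPair C ε i j) (fun s => ρ (Free.x ε i s))
      (fun s => ρ (Free.x ε j s)) k l = 0) {i j : Fin n} {M : ℕ} (hM : C.a i j = -M)
    (r : Fin n) (k : Fin (M + 1) → ℤ) (t : Fin (M + 1) → Kq) (l m : ℤ) :
    serrePoly (qiSign C ε i) (M + 1) (∑ s, t s • ρ (Free.x ε i (k s)))
      (ρ (Free.x (-ε) r m) * ρ (Free.x ε j l) - ρ (Free.x ε j l) * ρ (Free.x (-ε) r m)) = 0 := by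
  have hp := isGeneric_qiSign (C := C) ε i
  have hP : qPair C ε j i = qiSign C ε i ^ (-(M : ℤ)) := by rw [qPair_symm, qPair_eq_qiSign, hM]
  by_cases h : r = j
  swap
  · rw [hρ.bracket_of_ne ε h, serrePoly_zero]
  subst h
  obtain ⟨a, b, hab⟩ := hρ.exists_bracket ε r m
  rw [hab, serrePoly_add, serrePoly_smul, serrePoly_smul]
  have h1 : serrePoly (qiSign C ε i) (M + 1) (∑ s, t s • ρ (Free.x ε i (k s)))
      (psiTw ρ C Γ ε r (m + l)) = 0 := by
    rcases lt_or_ge (m + l) 0 with hml | hml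
    · rw [psiTw_neg hml, serrePoly_zero]
    obtain ⟨w, hw⟩ := Int.eq_ofNat_of_zero_le hml
    rw [hw]
    have hX := sum_smul_exchange t k (hq i i)
    have hζ : Exchanges (qiSign C ε i ^ (-(M : ℤ))) (fun m : ℕ => psiTw ρ C Γ ε r m)
        (fun a : ℕ => ∑ s, t s • ρ (Free.x ε i (k s + a))) := by
      rw [← hP]
      exact Exchanges.sum_smul Finset.univ t (fun s (a : ℕ) => ρ (Free.x ε i (k s + a)))
        fun s => hρ.exchanges_psi ε r i (k s)
    rw [qPair_self] at hX
    have := serrePoly_eq_zero_of_exchanges hp M hX hζ w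
    simpa using this
  have h2 : serrePoly (qiSign C ε i) (M + 1) (∑ s, t s • ρ (Free.x ε i (k s)))
      (phiTw ρ C Γ ε r (m + l)) = 0 := by
    rcases lt_or_ge 0 (m + l) with hml | hml
    · rw [phiTw_pos hml, serrePoly_zero]
    obtain ⟨w, hw⟩ : ∃ w : ℕ, m + l = -w := ⟨(-(m + l)).toNat, by omega⟩
    rw [hw, ← serrePoly_inv hp]
    have hX := sum_smul_exchange_sub t k (qPair_ne_zero ε i i) (hq i i)
    have hζ : Exchanges ((qiSign C ε i)⁻¹ ^ (-(M : ℤ))) (fun m : ℕ => phiTw ρ C Γ ε r (-m))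
        (fun a : ℕ => ∑ s, t s • ρ (Free.x ε i (k s - a))) := by
      rw [inv_zpow, ← hP]
      exact Exchanges.sum_smul Finset.univ t (fun s (a : ℕ) => ρ (Free.x ε i (k s - a)))
        fun s => hρ.exchanges_phi ε r i (k s)
    rw [qPair_self, ← inv_pow] at hX
    have := serrePoly_eq_zero_of_exchanges hp.inv M hX hζ w
    simpa using this
  rw [h1, h2, smul_zero, smul_zero, add_zero]

/-- The part of the commutator in which x^{-ε} meets a repeated letter. Now the inserted ψ or φ must
be moved past both kinds of letters, so the quadratic relation between x_i and x_j is needed too. -/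
theorem serreDeriv_bracket (hρ : IsPreRep C Γ ρ) {ε : ℤˣ}
    (hq : ∀ i j k l, quadRel (qPair C ε i j) (fun s => ρ (Free.x ε i s))
      (fun s => ρ (Free.x ε j s)) k l = 0) {i j : Fin n} {M : ℕ} (hM : C.a i j = -M)
    (r : Fin n) (k : Fin (M + 1) → ℤ) (t : Fin (M + 1) → Kq) (l m k' : ℤ) :
    serreDeriv (qiSign C ε i) (M + 1) (∑ s, t s • ρ (Free.x ε i (k s))) (ρ (Free.x ε j l))
      (ρ (Free.x (-ε) r m) * ρ (Free.x ε i k') - ρ (Free.x ε i k') * ρ (Free.x (-ε) r m)) = 0 := by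
  have hp := isGeneric_qiSign (C := C) ε i
  have hP : qPair C ε i j = qiSign C ε i ^ (-(M : ℤ)) := by rw [qPair_eq_qiSign, hM]
  by_cases h : r = i
  swap
  · rw [hρ.bracket_of_ne ε h, serreDeriv_zero]
  subst h
  obtain ⟨a, b, hab⟩ := hρ.exists_bracket ε r m
  rw [hab, serreDeriv_add, serreDeriv_smul, serreDeriv_smul]
  have h1 : serreDeriv (qiSign C ε r) (M + 1) (∑ s, t s • ρ (Free.x ε r (k s)))
      (ρ (Free.x ε j l)) (psiTw ρ C Γ ε r (m + k')) = 0 := by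
    rcases lt_or_ge (m + k') 0 with hml | hml
    · rw [psiTw_neg hml, serreDeriv_zero]
    obtain ⟨w, hw⟩ := Int.eq_ofNat_of_zero_le hml
    rw [hw]
    have hX := sum_smul_exchange t k (hq r r)
    have hXY := sum_smul_exchange_right t k (qPair_ne_zero ε r j) (hq r j) l
    have hξX : Exchanges (qiSign C ε r ^ 2) (fun m : ℕ => psiTw ρ C Γ ε r m)
        (fun a : ℕ => ∑ s, t s • ρ (Free.x ε r (k s + a))) := by
      rw [← qPair_self]
      exact Exchanges.sum_smul Finset.univ t (fun s (a : ℕ) => ρ (Free.x ε r (k s + a)))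
        fun s => hρ.exchanges_psi ε r r (k s)
    have hξY := hρ.exchanges_psi ε r j l
    rw [hP] at hξY
    rw [qPair_self] at hX
    rw [hP, ← zpow_neg, neg_neg, zpow_natCast] at hXY
    have := serreDeriv_eq_zero_of_exchanges hp M hX hXY hξX hξY w
    simpa using this
  have h2 : serreDeriv (qiSign C ε r) (M + 1) (∑ s, t s • ρ (Free.x ε r (k s)))
      (ρ (Free.x ε j l)) (phiTw ρ C Γ ε r (m + k')) = 0 := by
    rcases lt_or_ge 0 (m + k') with hml | hml
    · rw [phiTw_pos hml, serreDeriv_zero]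
    obtain ⟨w, hw⟩ : ∃ w : ℕ, m + k' = -w := ⟨(-(m + k')).toNat, by omega⟩
    rw [hw, ← serreDeriv_inv hp]
    have hX := sum_smul_exchange_sub t k (qPair_ne_zero ε r r) (hq r r)
    have hXY := sum_smul_exchange_right_sub t k (hq r j) l
    have hξX : Exchanges ((qiSign C ε r)⁻¹ ^ 2) (fun m : ℕ => phiTw ρ C Γ ε r (-m))
        (fun a : ℕ => ∑ s, t s • ρ (Free.x ε r (k s - a))) := by
      rw [inv_pow, ← qPair_self]
      exact Exchanges.sum_smul Finset.univ t (fun s (a : ℕ) => ρ (Free.x ε r (k s - a)))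
        fun s => hρ.exchanges_phi ε r r (k s)
    have hξY := hρ.exchanges_phi ε r j l
    rw [hP, ← inv_zpow] at hξY
    rw [qPair_self, ← inv_pow] at hX
    rw [hP, zpow_neg, zpow_natCast, ← inv_pow] at hXY
    have := serreDeriv_eq_zero_of_exchanges hp.inv M hX hXY hξX hξY w
    simpa using this
  rw [h1, h2, smul_zero, smul_zero, add_zero]

/-- If the quadratic relations among the `x^ε` hold, the Serre relations among the `x^ε` commute
with the `x^{-ε}`. -/
theorem commute_serre (hρ : IsPreRep C Γ ρ) {ε : ℤˣ}
    (hq : ∀ i j k l, quadRel (qPair C ε i j) (fun s => ρ (Free.x ε i s))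
      (fun s => ρ (Free.x ε j s)) k l = 0) {i j : Fin n} (hij : i ≠ j) (r : Fin n)
    (k : Fin (1 - C.a i j).toNat → ℤ) (l m : ℤ) :
    Commute (ρ (Free.x (-ε) r m)) (ρ (Free.serre C ε i j k l)) := by
  obtain ⟨M, hM⟩ : ∃ M : ℕ, C.a i j = -M :=
    ⟨(-C.a i j).toNat, by have := C.offDiag i j hij; omega⟩
  have hN : (1 - C.a i j).toNat = M + 1 := by omega
  generalize (1 - C.a i j).toNat = N at k hN
  subst hN
  rw [map_serre]
  refine Commute.sum_right _ _ _ fun S _ => Commute.smul_right ?_ _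
  refine sub_eq_zero.mp ?_
  rw [commutator_serrePoly, hρ.serrePoly_bracket hq hM, zero_add]
  rw [Finset.mul_sum, Finset.sum_mul, ← Finset.sum_sub_distrib, serreDeriv_sum]
  refine Finset.sum_eq_zero fun s _ => ?_
  rw [mul_smul_comm, smul_mul_assoc, ← smul_sub, serreDeriv_smul, hρ.serreDeriv_bracket hq hM,
    smul_zero]

end IsPreRep

end Rep

end QHeis

namespace QHeis

/-! ### Operators on a free module over words -/

section Words

variable {𝕜 : Type*} [Field 𝕜] {L V : Type*} [AddCommGroup V] [Module 𝕜 V]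

/-- Prefixing a letter to a word. -/
def wordCons (𝕜 : Type*) [Field 𝕜] (V : Type*) [AddCommGroup V] [Module 𝕜 V] (l : L) :
    Module.End 𝕜 (List L →₀ V) :=
  Finsupp.lmapDomain V 𝕜 (List.cons l)

/-- The vectors of the empty word. -/
def wordNil (𝕜 : Type*) [Field 𝕜] (L V : Type*) [AddCommGroup V] [Module 𝕜 V] :
    V →ₗ[𝕜] List L →₀ V :=
  Finsupp.lsingle []

/-- The component at the empty word. -/
def wordPr (𝕜 : Type*) [Field 𝕜] (L V : Type*) [AddCommGroup V] [Module 𝕜 V] :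
    (List L →₀ V) →ₗ[𝕜] V :=
  Finsupp.lapply []

@[simp] theorem wordCons_single (l : L) (w : List L) (v : V) :
    wordCons 𝕜 V l (Finsupp.single w v) = Finsupp.single (l :: w) v := by
  simp [wordCons]

@[simp] theorem wordPr_wordNil (v : V) : wordPr 𝕜 L V (wordNil 𝕜 L V v) = v := by
  simp [wordPr, wordNil]

@[simp] theorem wordPr_wordCons (l : L) (m : List L →₀ V) :
    wordPr 𝕜 L V (wordCons 𝕜 V l m) = 0 := by
  induction m using Finsupp.induction_linear with
  | zero => simp
  | add f g hf hg => rw [map_add, map_add, hf, hg, add_zero]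
  | single w v => simp [wordPr]

/-- The induction by which operator identities on the induced module are checked: first on the empty
word, then under prefixing a letter. -/
theorem word_ext {W : Type*} [AddCommGroup W] [Module 𝕜 W] {A B : (List L →₀ V) →ₗ[𝕜] W}
    (h0 : ∀ v, A (wordNil 𝕜 L V v) = B (wordNil 𝕜 L V v))
    (h1 : ∀ l m, A m = B m → A (wordCons 𝕜 V l m) = B (wordCons 𝕜 V l m)) : A = B := by
  refine Finsupp.lhom_ext fun w => ?_
  induction w with
  | nil => exact h0
  | cons l w ih =>
    intro v
    simpa using h1 l _ (ih v)

/-- The operator `T` with `T v = t v` on the vectors of the empty word and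
`T (l m) = a_l l (T m) + S_l m`. -/
def wordOp (a : L → 𝕜) (S : L → Module.End 𝕜 (List L →₀ V)) (t : Module.End 𝕜 V) :
    Module.End 𝕜 (List L →₀ V) :=
  Finsupp.lsum 𝕜 fun w => w.rec (wordNil 𝕜 L V ∘ₗ t)
    fun l w T => a l • (wordCons 𝕜 V l ∘ₗ T) + S l ∘ₗ Finsupp.lsingle w

variable (a : L → 𝕜) (S : L → Module.End 𝕜 (List L →₀ V)) (t : Module.End 𝕜 V)

@[simp] theorem wordOp_wordNil (v : V) :
    wordOp a S t (wordNil 𝕜 L V v) = wordNil 𝕜 L V (t v) := by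
  simp [wordOp, wordNil]

theorem wordOp_wordCons (l : L) (m : List L →₀ V) :
    wordOp a S t (wordCons 𝕜 V l m) = a l • wordCons 𝕜 V l (wordOp a S t m) + S l m := by
  induction m using Finsupp.induction_linear with
  | zero => simp
  | add f g hf hg => simp only [map_add, hf, hg, smul_add]; abel
  | single w v =>
    rw [wordCons_single, wordOp, Finsupp.lsum_single, Finsupp.lsum_single]
    rfl

theorem wordPr_wordOp (hS : ∀ l m, wordPr 𝕜 L V (S l m) = 0) (m : List L →₀ V) :
    wordPr 𝕜 L V (wordOp a S t m) = t (wordPr 𝕜 L V m) := by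
  have : wordPr 𝕜 L V ∘ₗ wordOp a S t = t ∘ₗ wordPr 𝕜 L V := by
    refine word_ext (fun v => by simp) fun l m _ => ?_
    simp [wordOp_wordCons, hS]
  exact LinearMap.congr_fun this m

end Words

/-! ### The induced module over words in the `x^-` -/

variable {n : ℕ} {C : CartanDatum n}

theorem map_gammaPsi_congr {E : Type*} [Ring E] [Algebra Kq E] {ρ ρ' : Free n →ₐ[Kq] E}
    (hh : ∀ i k, ρ (Free.h i k) = ρ' (Free.h i k)) (hK : ∀ i, ρ (Free.K i) = ρ' (Free.K i))
    (hK' : ∀ i, ρ (Free.Kinv i) = ρ' (Free.Kinv i))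
    (hg : ρ (FreeAlgebra.ι Kq Gen.gammaHalf) = ρ' (FreeAlgebra.ι Kq Gen.gammaHalf))
    (hg' : ρ (FreeAlgebra.ι Kq Gen.gammaHalfInv) = ρ' (FreeAlgebra.ι Kq Gen.gammaHalfInv))
    (i : Fin n) (k l : ℤ) : ρ (Free.gammaPsi C i k l) = ρ' (Free.gammaPsi C i k l) := by
  have hgam : ∀ m, ρ (Free.gam m) = ρ' (Free.gam m) := by
    intro m
    rw [Free.gam]
    split_ifs
    · rw [map_pow, map_pow, hg]
    · rw [map_pow, map_pow, hg']
  have hψ : ∀ m, ρ (Free.psi C i m) = ρ' (Free.psi C i m) := by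
    intro m
    rw [Free.psi]
    split_ifs
    · simp only [map_mul, map_expCoeff, hh, hK]
    · simp
  have hφ : ∀ m, ρ (Free.phi C i m) = ρ' (Free.phi C i m) := by
    intro m
    rw [Free.phi]
    split_ifs
    · simp only [map_mul, map_expCoeff, hh, hK']
    · simp
  simp only [Free.gammaPsi, map_smul, map_sub, map_mul, hgam, hψ, hφ]

/-- A module over the Cartan part of the Drinfeld generators on which the `K_i` act by scalars. -/
structure CartanModule (C : CartanDatum n) (Γ : Kq) (V : Type) [AddCommGroup V] [Module Kq V] where
  /-- the action of `h_{ik}` -/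
  h : Fin n → ℤ → Module.End Kq V
  /-- the scalar by which `K_i` acts -/
  K : Fin n → Kq
  /-- the action of `D` -/
  D : Module.End Kq V
  /-- the action of `D⁻¹` -/
  Dinv : Module.End Kq V
  gamma_ne : Γ ≠ 0
  K_ne : ∀ i, K i ≠ 0
  D_mul_Dinv : D * Dinv = 1
  Dinv_mul_D : Dinv * D = 1
  D_h : ∀ i k, k ≠ 0 → D * h i k = q ^ k • (h i k * D)
  h_h : ∀ i j (k l : ℤ), k ≠ 0 → l ≠ 0 →
    h i k * h j l - h j l * h i k = if k = -l then hhCoeff C Γ i j k • 1 else 0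

namespace CartanModule

variable {Γ : Kq} {V : Type} [AddCommGroup V] [Module Kq V] (F : CartanModule C Γ V)

/-- The free module on words in the `x^-`. -/
abbrev Ind (n : ℕ) (V : Type) [AddCommGroup V] : Type := List (Fin n × ℤ) →₀ V

/-- the action of `x^-_{ir}` -/
abbrev xm (V : Type) [AddCommGroup V] [Module Kq V] (l : Fin n × ℤ) : Module.End Kq (Ind n V) :=
  wordCons Kq V l

abbrev nil (n : ℕ) (V : Type) [AddCommGroup V] [Module Kq V] : V →ₗ[Kq] Ind n V :=
  wordNil Kq (Fin n × ℤ) V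

/-- the action of `h_{ik}` -/
def opH (i : Fin n) (k : ℤ) : Module.End Kq (Ind n V) :=
  wordOp (fun _ => 1) (fun l => -(hxCoeff C i l.1 k * Γ ^ |k|) • xm V (l.1, k + l.2)) (F.h i k)

/-- the action of `K_i` -/
def opK (i : Fin n) : Module.End Kq (Ind n V) :=
  wordOp (fun l => qPair C (-1) i l.1) 0 (F.K i • 1)

/-- the action of `K_i⁻¹` -/
def opKinv (i : Fin n) : Module.End Kq (Ind n V) :=
  wordOp (fun l => (qPair C (-1) i l.1)⁻¹) 0 ((F.K i)⁻¹ • 1)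

/-- the action of `D` -/
def opD : Module.End Kq (Ind n V) := wordOp (fun l => q ^ l.2) 0 F.D

/-- the action of `D⁻¹` -/
def opDinv : Module.End Kq (Ind n V) := wordOp (fun l => (q ^ l.2)⁻¹) 0 F.Dinv

/-- The action of the generators, given the action of the `x^+`. -/
def actGen (xp : Fin n → ℤ → Module.End Kq (Ind n V)) : Gen n → Module.End Kq (Ind n V)
  | Gen.x ε i r => if ε = 1 then xp i r else xm V (i, r)
  | Gen.h i k => F.opH i k
  | Gen.K i => F.opK i
  | Gen.Kinv i => F.opKinv i
  | Gen.gammaHalf => algebraMap Kq _ Γ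
  | Gen.gammaHalfInv => algebraMap Kq _ Γ⁻¹
  | Gen.D => F.opD
  | Gen.Dinv => F.opDinv

/-- The action of the free algebra, given the action of the `x^+`. -/
def act (xp : Fin n → ℤ → Module.End Kq (Ind n V)) : Free n →ₐ[Kq] Module.End Kq (Ind n V) :=
  FreeAlgebra.lift Kq (F.actGen xp)

section Act

variable (xp : Fin n → ℤ → Module.End Kq (Ind n V))

theorem act_ι (g : Gen n) : F.act xp (FreeAlgebra.ι Kq g) = F.actGen xp g := by
  simp [act]

theorem act_xp (i : Fin n) (r : ℤ) : F.act xp (Free.x 1 i r) = xp i r := by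
  rw [Free.x, act_ι]; simp [actGen]

theorem act_xm (i : Fin n) (r : ℤ) : F.act xp (Free.x (-1) i r) = xm V (i, r) := by
  rw [Free.x, act_ι, actGen, if_neg (by decide)]

theorem act_h {k : ℤ} (hk : k ≠ 0) (i : Fin n) : F.act xp (Free.h i k) = F.opH i k := by
  rw [Free.h, dif_pos hk, act_ι]; rfl

theorem act_K (i : Fin n) : F.act xp (Free.K i) = F.opK i := F.act_ι xp _
theorem act_Kinv (i : Fin n) : F.act xp (Free.Kinv i) = F.opKinv i := F.act_ι xp _
theorem act_D : F.act xp Free.D = F.opD := F.act_ι xp _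
theorem act_Dinv : F.act xp Free.Dinv = F.opDinv := F.act_ι xp _

end Act

theorem opH_xm (i : Fin n) (k : ℤ) (l : Fin n × ℤ) (m : Ind n V) :
    F.opH i k (xm V l m) = xm V l (F.opH i k m) +
      -(hxCoeff C i l.1 k * Γ ^ |k|) • xm V (l.1, k + l.2) m := by
  rw [opH, wordOp_wordCons, one_smul]; rfl

theorem opK_xm (i : Fin n) (l : Fin n × ℤ) (m : Ind n V) :
    F.opK i (xm V l m) = qPair C (-1) i l.1 • xm V l (F.opK i m) := by
  rw [opK, wordOp_wordCons]; simp

theorem opKinv_xm (i : Fin n) (l : Fin n × ℤ) (m : Ind n V) :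
    F.opKinv i (xm V l m) = (qPair C (-1) i l.1)⁻¹ • xm V l (F.opKinv i m) := by
  rw [opKinv, wordOp_wordCons]; simp

theorem opD_xm (l : Fin n × ℤ) (m : Ind n V) :
    F.opD (xm V l m) = q ^ l.2 • xm V l (F.opD m) := by
  rw [opD, wordOp_wordCons]; simp

theorem opDinv_xm (l : Fin n × ℤ) (m : Ind n V) :
    F.opDinv (xm V l m) = (q ^ l.2)⁻¹ • xm V l (F.opDinv m) := by
  rw [opDinv, wordOp_wordCons]; simp

theorem opH_nil (i : Fin n) (k : ℤ) (v : V) : F.opH i k (nil n V v) = nil n V (F.h i k v) :=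
  wordOp_wordNil ..
theorem opK_nil (i : Fin n) (v : V) : F.opK i (nil n V v) = F.K i • nil n V v := by
  rw [opK, wordOp_wordNil]; simp
theorem opKinv_nil (i : Fin n) (v : V) : F.opKinv i (nil n V v) = (F.K i)⁻¹ • nil n V v := by
  rw [opKinv, wordOp_wordNil]; simp
theorem opD_nil (v : V) : F.opD (nil n V v) = nil n V (F.D v) := wordOp_wordNil ..
theorem opDinv_nil (v : V) : F.opDinv (nil n V v) = nil n V (F.Dinv v) := wordOp_wordNil ..

/-- These relations do not involve the x^+, so they hold for any choice of `xp`. That freedom gives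
[x^+, x^-] a meaning before the x^+ have been constructed. -/
theorem isCartanRep_act (xp : Fin n → ℤ → Module.End Kq (Ind n V)) :
    IsCartanRep C Γ (F.act xp) where
  gamma_ne := F.gamma_ne
  gammaHalf := F.act_ι xp _
  gammaHalfInv := F.act_ι xp _
  K_mul_Kinv i := by
    rw [act_K, act_Kinv]
    refine word_ext (fun v => ?_) fun l m ih => ?_
    · change F.opK i (F.opKinv i (nil n V v)) = nil n V v
      rw [opKinv_nil, map_smul, opK_nil, smul_smul, inv_mul_cancel₀ (F.K_ne i), one_smul]
    · change F.opK i (F.opKinv i (xm V l m)) = xm V l m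
      replace ih : F.opK i (F.opKinv i m) = m := ih
      rw [opKinv_xm, map_smul, opK_xm, smul_smul, inv_mul_cancel₀ (qPair_ne_zero _ _ _), one_smul, ih]
  Kinv_mul_K i := by
    rw [act_K, act_Kinv]
    refine word_ext (fun v => ?_) fun l m ih => ?_
    · change F.opKinv i (F.opK i (nil n V v)) = nil n V v
      rw [opK_nil, map_smul, opKinv_nil, smul_smul, mul_inv_cancel₀ (F.K_ne i), one_smul]
    · change F.opKinv i (F.opK i (xm V l m)) = xm V l m
      replace ih : F.opKinv i (F.opK i m) = m := ih
      rw [opK_xm, map_smul, opKinv_xm, smul_smul, mul_inv_cancel₀ (qPair_ne_zero _ _ _), one_smul, ih]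
  D_mul_Dinv := by
    rw [act_D, act_Dinv]
    refine word_ext (fun v => ?_) fun l m ih => ?_
    · change F.opD (F.opDinv (nil n V v)) = nil n V v
      rw [opDinv_nil, opD_nil, ← Module.End.mul_apply, F.D_mul_Dinv, Module.End.one_apply]
    · change F.opD (F.opDinv (xm V l m)) = xm V l m
      replace ih : F.opD (F.opDinv m) = m := ih
      rw [opDinv_xm, map_smul, opD_xm, smul_smul, inv_mul_cancel₀ (zpow_ne_zero _ q_ne_zero),
        one_smul, ih]
  Dinv_mul_D := by
    rw [act_D, act_Dinv]
    refine word_ext (fun v => ?_) fun l m ih => ?_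
    · change F.opDinv (F.opD (nil n V v)) = nil n V v
      rw [opD_nil, opDinv_nil, ← Module.End.mul_apply, F.Dinv_mul_D, Module.End.one_apply]
    · change F.opDinv (F.opD (xm V l m)) = xm V l m
      replace ih : F.opDinv (F.opD m) = m := ih
      rw [opD_xm, map_smul, opDinv_xm, smul_smul, mul_inv_cancel₀ (zpow_ne_zero _ q_ne_zero),
        one_smul, ih]
  D_K i := by
    rw [act_K, act_D]
    refine word_ext (fun v => ?_) fun l m ih => ?_
    · change F.opD (F.opK i (nil n V v)) = F.opK i (F.opD (nil n V v))
      rw [opK_nil, map_smul, opD_nil, opK_nil]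
    · change F.opD (F.opK i (xm V l m)) = F.opK i (F.opD (xm V l m))
      replace ih : F.opD (F.opK i m) = F.opK i (F.opD m) := ih
      rw [opK_xm, opD_xm, map_smul, map_smul, opK_xm, opD_xm, ih, smul_comm]
  K_K i j := by
    rw [act_K, act_K]
    refine word_ext (fun v => ?_) fun l m ih => ?_
    · change F.opK i (F.opK j (nil n V v)) = F.opK j (F.opK i (nil n V v))
      simp only [opK_nil, map_smul]
      rw [smul_comm]
    · change F.opK i (F.opK j (xm V l m)) = F.opK j (F.opK i (xm V l m))
      replace ih : F.opK i (F.opK j m) = F.opK j (F.opK i m) := ih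
      simp only [opK_xm, map_smul, ih]
      rw [smul_comm]
  K_h i j k := by
    rcases eq_or_ne k 0 with rfl | hk
    · simp [h_zero]
    rw [act_K, act_h _ _ hk]
    refine word_ext (fun v => ?_) fun l m ih => ?_
    · change F.opK i (F.opH j k (nil n V v)) = F.opH j k (F.opK i (nil n V v))
      rw [opH_nil, opK_nil, opK_nil, map_smul, opH_nil]
    · change F.opK i (F.opH j k (xm V l m)) = F.opH j k (F.opK i (xm V l m))
      replace ih : F.opK i (F.opH j k m) = F.opH j k (F.opK i m) := ih
      simp only [opK_xm, opH_xm, map_smul, map_add, ih, smul_add]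
      rw [smul_comm (qPair C (-1) i l.1)]
  D_h i k := by
    rcases eq_or_ne k 0 with rfl | hk
    · simp [h_zero]
    rw [act_D, act_h _ _ hk]
    refine word_ext (fun v => ?_) fun l m ih => ?_
    · change F.opD (F.opH i k (nil n V v)) = q ^ k • F.opH i k (F.opD (nil n V v))
      rw [opH_nil, opD_nil, opD_nil, opH_nil, ← map_smul]
      congr 1
      exact LinearMap.congr_fun (F.D_h i k hk) v
    · change F.opD (F.opH i k (xm V l m)) = q ^ k • F.opH i k (F.opD (xm V l m))
      replace ih : F.opD (F.opH i k m) = q ^ k • F.opH i k (F.opD m) := ih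
      simp only [opD_xm, opH_xm, map_smul, map_add, ih, smul_add]
      rw [smul_comm (q ^ k), zpow_add₀ q_ne_zero, mul_smul, smul_comm (q ^ l.2) (-_),
        smul_comm (q ^ k) (-_)]
  h_h i j k l hk hl := by
    rw [act_h _ _ hk, act_h _ _ hl]
    refine word_ext (fun v => ?_) fun w m ih => ?_
    · change F.opH i k (F.opH j l (nil n V v)) - F.opH j l (F.opH i k (nil n V v)) = _
      rw [opH_nil, opH_nil, opH_nil, opH_nil, ← map_sub]
      have := LinearMap.congr_fun (F.h_h i j k l hk hl) v
      rw [LinearMap.sub_apply, Module.End.mul_apply, Module.End.mul_apply] at this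
      rw [this]
      split_ifs <;> simp
    · change F.opH i k (F.opH j l (xm V w m)) - F.opH j l (F.opH i k (xm V w m)) = _
      have e : F.opH i k (F.opH j l (xm V w m)) - F.opH j l (F.opH i k (xm V w m)) =
          xm V w ((F.opH i k * F.opH j l - F.opH j l * F.opH i k) m) := by
        simp only [opH_xm, map_smul, map_add, smul_add, LinearMap.sub_apply, Module.End.mul_apply,
          map_sub]
        rw [smul_comm (-(hxCoeff C j w.1 l * Γ ^ |l|)) (-(hxCoeff C i w.1 k * Γ ^ |k|)),
          show k + (l + w.2) = l + (k + w.2) by ring]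
        abel
      rw [e, ih]
      split_ifs <;> simp

/-- the action of `x^+_{ik}` -/
def opXp (i : Fin n) (k : ℤ) : Module.End Kq (Ind n V) :=
  wordOp (fun _ => 1) (fun l => if i = l.1 then F.act 0 (Free.gammaPsi C i k l.2) else 0) 0

/-- The representation of the free algebra on the induced module. -/
abbrev rep : Free n →ₐ[Kq] Module.End Kq (Ind n V) := F.act F.opXp

/-- `opXp` is defined with the x^+ provisionally sent to 0, to avoid circularity. The prescribed
bracket contains no x^+, so its value is unchanged in the final representation. -/
theorem act_gammaPsi (i : Fin n) (k l : ℤ) :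
    F.act 0 (Free.gammaPsi C i k l) = F.rep (Free.gammaPsi C i k l) := by
  refine map_gammaPsi_congr (fun i k => ?_) (fun i => ?_) (fun i => ?_) ?_ ?_ i k l
  · rcases eq_or_ne k 0 with rfl | hk
    · simp [h_zero]
    · rw [act_h _ _ hk, act_h _ _ hk]
  · rw [act_K, act_K]
  · rw [act_Kinv, act_Kinv]
  · rw [act_ι, act_ι]; rfl
  · rw [act_ι, act_ι]; rfl

theorem opXp_xm (i : Fin n) (k : ℤ) (l : Fin n × ℤ) (m : Ind n V) :
    F.opXp i k (xm V l m) = xm V l (F.opXp i k m) +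
      if i = l.1 then F.rep (Free.gammaPsi C i k l.2) m else 0 := by
  rw [opXp, wordOp_wordCons, one_smul]
  split_ifs with h
  · rw [act_gammaPsi]
  · rfl

theorem opXp_nil (i : Fin n) (k : ℤ) (v : V) : F.opXp i k (nil n V v) = 0 := by
  rw [opXp, wordOp_wordNil]; simp

/-- The relation for [x^+, x^-] holds by construction. The commutation of the x^+ with D, K and h is
proved by induction on words, where prefixing x^- requires that D, K and h commute with the
prescribed bracket as the Jacobi identity demands (`D_gammaPsi`, `K_gammaPsi`, `h_gammaPsi`). -/
theorem isPreRep_rep : IsPreRep C Γ F.rep where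
  __ := F.isCartanRep_act F.opXp
  D_x ε i r := by
    have hD := (F.isCartanRep_act F.opXp).D_gammaPsi
    rcases Int.units_eq_one_or ε with rfl | rfl
    · rw [act_D] at *
      rw [act_xp]
      refine word_ext (fun v => ?_) fun l m ih => ?_
      · change F.opD (F.opXp i r (nil n V v)) = q ^ r • F.opXp i r (F.opD (nil n V v))
        rw [opD_nil, opXp_nil, opXp_nil]; simp
      · change F.opD (F.opXp i r (xm V l m)) = q ^ r • F.opXp i r (F.opD (xm V l m))
        replace ih : F.opD (F.opXp i r m) = q ^ r • F.opXp i r (F.opD m) := ih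
        simp only [opD_xm, opXp_xm, map_smul, map_add, ih, smul_add]
        rw [smul_comm (q ^ r)]
        congr 1
        split_ifs with h
        · have := LinearMap.congr_fun (hD i r l.2) m
          rw [Module.End.mul_apply, zpow_add₀ q_ne_zero] at this
          rw [this, mul_smul]; rfl
        · simp
    · rw [act_D, act_xm]
      refine LinearMap.ext fun m => ?_
      exact F.opD_xm (i, r) m
  K_x ε i j r := by
    have hK := (F.isCartanRep_act F.opXp).K_gammaPsi
    rcases Int.units_eq_one_or ε with rfl | rfl
    · rw [act_xp]
      simp only [act_K] at *
      refine word_ext (fun v => ?_) fun l m ih => ?_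
      · change F.opK i (F.opXp j r (nil n V v)) = qPair C 1 i j • F.opXp j r (F.opK i (nil n V v))
        rw [opK_nil, map_smul, opXp_nil]; simp
      · change F.opK i (F.opXp j r (xm V l m)) = qPair C 1 i j • F.opXp j r (F.opK i (xm V l m))
        replace ih : F.opK i (F.opXp j r m) = qPair C 1 i j • F.opXp j r (F.opK i m) := ih
        simp only [opK_xm, opXp_xm, map_smul, map_add, ih, smul_add]
        rw [smul_comm (qPair C 1 i j)]
        congr 1
        split_ifs with h
        · have := LinearMap.congr_fun (hK j i r l.2) m
          rw [Module.End.mul_apply, Module.End.mul_apply] at this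
          rw [this, smul_smul, ← h]
          have e : qPair C 1 i j * qPair C (-1) i j = 1 := by
            rw [qPair, qPair, ← zpow_add₀ q_ne_zero]; simp
          rw [e, one_smul]
        · simp
    · rw [act_K, act_xm]
      refine LinearMap.ext fun m => ?_
      exact F.opK_xm i (j, r) m
  h_x ε i j k l hk := by
    have hh := (F.isCartanRep_act F.opXp).h_gammaPsi
    rcases Int.units_eq_one_or ε with rfl | rfl
    · rw [act_xp, act_xp]
      simp only [Units.val_one, Int.cast_one, one_mul]
      refine word_ext (fun v => ?_) fun w m ih => ?_
      · rw [act_h _ _ hk]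
        change F.opH i k (F.opXp j l (nil n V v)) - F.opXp j l (F.opH i k (nil n V v)) =
          (hxCoeff C i j k * Γ ^ (-|k|)) • F.opXp j (k + l) (nil n V v)
        rw [opH_nil, opXp_nil, opXp_nil, opXp_nil]; simp
      · have h2 := fun l' => LinearMap.congr_fun (hh j i k l l' hk) m
        rw [act_h _ _ hk] at ih
        simp only [act_h _ _ hk] at h2
        rw [act_h _ _ hk]
        change F.opH i k (F.opXp j l (xm V w m)) - F.opXp j l (F.opH i k (xm V w m)) =
          (hxCoeff C i j k * Γ ^ (-|k|)) • F.opXp j (k + l) (xm V w m)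
        have e : F.opH i k (F.opXp j l (xm V w m)) - F.opXp j l (F.opH i k (xm V w m)) =
          xm V w ((F.opH i k * F.opXp j l - F.opXp j l * F.opH i k) m) +
            if j = w.1 then (F.opH i k * F.rep (Free.gammaPsi C j l w.2) -
              F.rep (Free.gammaPsi C j l w.2) * F.opH i k) m +
              (hxCoeff C i j k * Γ ^ |k|) • F.rep (Free.gammaPsi C j l (k + w.2)) m else 0 := by
          simp only [opH_xm, opXp_xm, map_smul, map_add, smul_add, LinearMap.sub_apply,
            Module.End.mul_apply, map_sub]
          split_ifs with h
          · rw [h, neg_smul, neg_smul]; abel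
          · simp
        rw [e, ih, opXp_xm, smul_add, LinearMap.smul_apply, map_smul]
        congr 1
        split_ifs with h
        · rw [h2]
          simp only [LinearMap.smul_apply, LinearMap.sub_apply, smul_sub, smul_smul]
          abel
        · simp
    · rw [act_h _ _ hk, act_xm, act_xm]
      refine LinearMap.ext fun m => ?_
      change F.opH i k (xm V (j, l) m) - xm V (j, l) (F.opH i k m) = _
      rw [opH_xm, add_sub_cancel_left]
      simp
  xp_xm i j k l := by
    rw [act_xp, act_xm]
    refine LinearMap.ext fun m => ?_
    change F.opXp i k (xm V (j, l) m) - xm V (j, l) (F.opXp i k m) = _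
    rw [opXp_xm, add_sub_cancel_left]
    split_ifs <;> rfl

end CartanModule

end QHeis

/-! ### The radical of the induced module and the action of U_q(𝔤) on the quotient -/

namespace QHeis

variable {n : ℕ} {C : CartanDatum n}

/-- An algebra map satisfying all Drinfeld relations factors through `U_q(𝔤)`. -/
theorem IsPreRep.map_eq_of_rel {E : Type*} [Ring E] [Algebra Kq E] {Γ : Kq} {ρ : Free n →ₐ[Kq] E}
    (hρ : IsPreRep C Γ ρ)
    (hq : ∀ ε i j k l, quadRel (qPair C ε i j) (fun s => ρ (Free.x ε i s))
      (fun s => ρ (Free.x ε j s)) k l = 0)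
    (hs : ∀ (ε : ℤˣ) (i j : Fin n), i ≠ j → ∀ (k : Fin (1 - C.a i j).toNat → ℤ) (l : ℤ),
      ρ (Free.serre C ε i j k l) = 0) ⦃a b : Free n⦄ (h : Rel C a b) : ρ a = ρ b := by
  have hg := hρ.map_gam
  have hΓ := hρ.gamma_ne
  induction h with
  | K_mul_Kinv i => rw [map_mul, map_one, hρ.K_mul_Kinv]
  | Kinv_mul_K i => rw [map_mul, map_one, hρ.Kinv_mul_K]
  | D_mul_Dinv => rw [map_mul, map_one, hρ.D_mul_Dinv]
  | Dinv_mul_D => rw [map_mul, map_one, hρ.Dinv_mul_D]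
  | gamma_mul_inv =>
    rw [map_mul, hg, hg, ← map_mul, ← zpow_add₀ hΓ, map_one]; simp
  | inv_mul_gamma =>
    rw [map_mul, hg, hg, ← map_mul, ← zpow_add₀ hΓ, map_one]; simp
  | gamma_central g => rw [map_mul, map_mul, hg, Algebra.commutes]
  | D_K i => rw [map_mul, map_mul, hρ.D_K]
  | K_K i j => rw [map_mul, map_mul, hρ.K_K]
  | K_h i j k => rw [map_mul, map_mul, hρ.K_h]
  | D_h i k => rw [map_mul, map_smul, map_mul, hρ.D_h]
  | D_x ε i r => rw [map_mul, map_smul, map_mul, hρ.D_x]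
  | K_x ε i j r => rw [map_mul, map_smul, map_mul, hρ.K_x]
  | h_h i j k l hk hl =>
    rw [map_sub, map_mul, map_mul, hρ.h_h i j k l hk hl]
    split_ifs with h
    · rw [map_smul, map_sub, hg, hg, ← map_sub, hhCoeff, Algebra.smul_def, Algebra.smul_def,
        mul_one, ← map_mul]
      rfl
    · rw [map_zero]
  | h_x ε i j k l hk =>
    rw [map_sub, map_mul, map_mul, hρ.h_x ε i j k l hk, map_smul, map_mul, hg, ← Algebra.smul_def,
      smul_smul, hxCoeff]
    congr 1; ring
  | x_x ε i j k l =>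
    have := hq ε i j k l
    simp only [quadRel, qPair] at this
    simp only [map_sub, map_smul, map_mul]
    exact sub_eq_zero.mp this
  | xp_xm i j k l =>
    rw [map_sub, map_mul, map_mul, hρ.xp_xm]
    split_ifs <;> simp
  | serre ε i j hij k l => rw [hs ε i j hij, map_zero]

/-- The relations of a representation hold in every representation with a larger kernel. -/
theorem IsPreRep.of_map_eq {E E' : Type*} [Ring E] [Algebra Kq E] [Ring E'] [Algebra Kq E']
    {Γ : Kq} {ρ : Free n →ₐ[Kq] E} {ρ' : Free n →ₐ[Kq] E'} (hρ : IsPreRep C Γ ρ)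
    (h : ∀ a b, ρ a = ρ b → ρ' a = ρ' b) : IsPreRep C Γ ρ' where
  gamma_ne := hρ.gamma_ne
  gammaHalf := by
    rw [h _ (algebraMap Kq _ Γ) (by rw [hρ.gammaHalf, AlgHom.commutes]), AlgHom.commutes]
  gammaHalfInv := by
    rw [h _ (algebraMap Kq _ Γ⁻¹) (by rw [hρ.gammaHalfInv, AlgHom.commutes]), AlgHom.commutes]
  K_mul_Kinv i := by
    simpa only [map_mul, map_one] using h (Free.K i * Free.Kinv i) 1
      (by simpa only [map_mul, map_one] using hρ.K_mul_Kinv i)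
  Kinv_mul_K i := by
    simpa only [map_mul, map_one] using h (Free.Kinv i * Free.K i) 1
      (by simpa only [map_mul, map_one] using hρ.Kinv_mul_K i)
  D_mul_Dinv := by
    simpa only [map_mul, map_one] using h (@Free.D n * @Free.Dinv n) 1
      (by simpa only [map_mul, map_one] using hρ.D_mul_Dinv)
  Dinv_mul_D := by
    simpa only [map_mul, map_one] using h (@Free.Dinv n * @Free.D n) 1
      (by simpa only [map_mul, map_one] using hρ.Dinv_mul_D)
  D_K i := by
    simpa only [map_mul] using h (@Free.D n * Free.K i) (Free.K i * @Free.D n)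
      (by simpa only [map_mul] using hρ.D_K i)
  K_K i j := by
    simpa only [map_mul] using h (Free.K i * Free.K j) (Free.K j * Free.K i)
      (by simpa only [map_mul] using hρ.K_K i j)
  K_h i j k := by
    simpa only [map_mul] using h (Free.K i * Free.h j k) (Free.h j k * Free.K i)
      (by simpa only [map_mul] using hρ.K_h i j k)
  D_h i k := by
    simpa only [map_mul, map_smul] using h (@Free.D n * Free.h i k) (q ^ k • (Free.h i k * @Free.D n))
      (by simpa only [map_mul, map_smul] using hρ.D_h i k)
  h_h i j k l hk hl := by
    have := h (Free.h i k * Free.h j l - Free.h j l * Free.h i k)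
      (if k = -l then hhCoeff C Γ i j k • 1 else 0) (by
        rw [map_sub, map_mul, map_mul, hρ.h_h i j k l hk hl]
        split_ifs
        · rw [map_smul, map_one]
        · rw [map_zero])
    rw [map_sub, map_mul, map_mul] at this
    rw [this]
    split_ifs
    · rw [map_smul, map_one]
    · rw [map_zero]
  D_x ε i k := by
    simpa only [map_mul, map_smul] using
      h (@Free.D n * Free.x ε i k) (q ^ k • (Free.x ε i k * @Free.D n))
      (by simpa only [map_mul, map_smul] using hρ.D_x ε i k)
  K_x ε i j k := by
    simpa only [map_mul, map_smul] using h (Free.K i * Free.x ε j k)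
      (q ^ ((ε : ℤ) * (C.d i * C.a i j)) • (Free.x ε j k * Free.K i))
      (by simpa only [map_mul, map_smul] using hρ.K_x ε i j k)
  h_x ε i j k l hk := by
    simpa only [map_mul, map_smul, map_sub] using
      h (Free.h i k * Free.x ε j l - Free.x ε j l * Free.h i k)
      ((((ε : ℤ) : Kq) * hxCoeff C i j k * Γ ^ (-((ε : ℤ) * |k|))) • Free.x ε j (k + l))
      (by simpa only [map_mul, map_smul, map_sub] using hρ.h_x ε i j k l hk)
  xp_xm i j k l := by
    have := h (Free.x 1 i k * Free.x (-1) j l - Free.x (-1) j l * Free.x 1 i k)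
      (if i = j then Free.gammaPsi C i k l else 0) (by
        rw [map_sub, map_mul, map_mul, hρ.xp_xm i j k l]
        split_ifs
        · rfl
        · rw [map_zero])
    rw [map_sub, map_mul, map_mul] at this
    rw [this]
    split_ifs
    · rfl
    · rw [map_zero]

namespace CartanModule

variable {Γ : Kq} {V : Type} [AddCommGroup V] [Module Kq V] (F : CartanModule C Γ V)

abbrev pr (n : ℕ) (V : Type) [AddCommGroup V] [Module Kq V] : Ind n V →ₗ[Kq] V :=
  wordPr Kq (Fin n × ℤ) V

/-- The action of a word in the `x^+`, its first letter acting first. -/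
def xpWord (ws : List (Fin n × ℤ)) : Module.End Kq (Ind n V) :=
  ws.foldr (fun l T => T * F.opXp l.1 l.2) 1

/-- The largest submodule meeting the vectors of the empty word trivially. -/
def rad : Submodule Kq (Ind n V) where
  carrier := {m | ∀ ws, pr n V (F.xpWord ws m) = 0}
  add_mem' hm hm' ws := by rw [map_add, map_add, hm ws, hm' ws, add_zero]
  zero_mem' ws := by rw [map_zero, map_zero]
  smul_mem' t m hm ws := by rw [map_smul, map_smul, hm ws, smul_zero]

variable {F}

theorem pr_eq_zero {m : Ind n V} (hm : m ∈ F.rad) : pr n V m = 0 := hm []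

theorem opXp_mem_rad {m : Ind n V} (hm : m ∈ F.rad) (i : Fin n) (k : ℤ) : F.opXp i k m ∈ F.rad :=
  fun ws => hm ((i, k) :: ws)

/-- A coinduction principle for membership in the radical. -/
theorem subset_rad {W : Set (Ind n V)} (h0 : ∀ w ∈ W, pr n V w = 0)
    (h1 : ∀ w ∈ W, ∀ i k, ∃ w' ∈ W, F.opXp i k w - w' ∈ F.rad) {w : Ind n V} (hw : w ∈ W) :
    w ∈ F.rad := by
  intro ws
  induction ws generalizing w with
  | nil => exact h0 w hw
  | cons l ws ih =>
    obtain ⟨w', hw', h⟩ := h1 w hw l.1 l.2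
    have h2 := h ws
    rw [map_sub, map_sub, ih hw', sub_zero] at h2
    exact h2

variable (F)

/-- Coinduction applied to the image of the radical under h. It has no component at the empty word,
as h respects that component, and x^+ h m differs from h x^+ m by a multiple of some x^+ m, which is
again in the radical. The arguments for K and D have the same form. -/
theorem opH_mem_rad (i : Fin n) {k : ℤ} (hk : k ≠ 0) {m : Ind n V} (hm : m ∈ F.rad) :
    F.opH i k m ∈ F.rad := by
  refine subset_rad (W := F.opH i k '' F.rad) ?_ ?_ ⟨m, hm, rfl⟩
  · rintro _ ⟨m, hm, rfl⟩
    rw [opH, wordPr_wordOp _ _ _ (fun l m => by simp), pr_eq_zero hm, map_zero]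
  · rintro _ ⟨m, hm, rfl⟩ j l
    refine ⟨_, ⟨F.opXp j l m, opXp_mem_rad hm j l, rfl⟩, ?_⟩
    have := LinearMap.congr_fun (F.isPreRep_rep.h_x 1 i j k l hk) m
    rw [act_h _ _ hk, act_xp, act_xp, LinearMap.sub_apply, Module.End.mul_apply,
      Module.End.mul_apply] at this
    rw [← neg_sub, this]
    exact neg_mem (Submodule.smul_mem _ _ (opXp_mem_rad hm j _))

theorem opK_mem_rad (i : Fin n) {m : Ind n V} (hm : m ∈ F.rad) : F.opK i m ∈ F.rad := by
  refine subset_rad (W := F.opK i '' F.rad) ?_ ?_ ⟨m, hm, rfl⟩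
  · rintro _ ⟨m, hm, rfl⟩
    rw [opK, wordPr_wordOp _ _ _ (fun l m => by simp), pr_eq_zero hm, map_zero]
  · rintro _ ⟨m, hm, rfl⟩ j l
    refine ⟨_, ⟨(qPair C 1 i j)⁻¹ • F.opXp j l m, Submodule.smul_mem _ _ (opXp_mem_rad hm j l),
      rfl⟩, ?_⟩
    have := LinearMap.congr_fun (F.isPreRep_rep.K_x 1 i j l) m
    rw [act_K, act_xp] at this
    replace this : F.opK i (F.opXp j l m) = qPair C 1 i j • F.opXp j l (F.opK i m) := this
    rw [map_smul, this, inv_smul_smul₀ (qPair_ne_zero _ _ _), sub_self]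
    exact zero_mem _

theorem opKinv_mem_rad (i : Fin n) {m : Ind n V} (hm : m ∈ F.rad) : F.opKinv i m ∈ F.rad := by
  refine subset_rad (W := F.opKinv i '' F.rad) ?_ ?_ ⟨m, hm, rfl⟩
  · rintro _ ⟨m, hm, rfl⟩
    rw [opKinv, wordPr_wordOp _ _ _ (fun l m => by simp), pr_eq_zero hm, map_zero]
  · rintro _ ⟨m, hm, rfl⟩ j l
    refine ⟨_, ⟨qPair C 1 i j • F.opXp j l m, Submodule.smul_mem _ _ (opXp_mem_rad hm j l),
      rfl⟩, ?_⟩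
    have := LinearMap.congr_fun (F.isPreRep_rep.Kinv_x 1 i j l) m
    rw [act_Kinv, act_xp] at this
    replace this : F.opKinv i (F.opXp j l m) = (qPair C 1 i j)⁻¹ • F.opXp j l (F.opKinv i m) := this
    rw [map_smul, this, smul_inv_smul₀ (qPair_ne_zero _ _ _), sub_self]
    exact zero_mem _

theorem opD_mem_rad {m : Ind n V} (hm : m ∈ F.rad) : F.opD m ∈ F.rad := by
  refine subset_rad (W := F.opD '' F.rad) ?_ ?_ ⟨m, hm, rfl⟩
  · rintro _ ⟨m, hm, rfl⟩
    rw [opD, wordPr_wordOp _ _ _ (fun l m => by simp), pr_eq_zero hm, map_zero]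
  · rintro _ ⟨m, hm, rfl⟩ j l
    refine ⟨_, ⟨(q ^ l)⁻¹ • F.opXp j l m, Submodule.smul_mem _ _ (opXp_mem_rad hm j l), rfl⟩, ?_⟩
    have := LinearMap.congr_fun (F.isPreRep_rep.D_x 1 j l) m
    rw [act_D, act_xp] at this
    replace this : F.opD (F.opXp j l m) = q ^ l • F.opXp j l (F.opD m) := this
    rw [map_smul, this, inv_smul_smul₀ (zpow_ne_zero _ q_ne_zero), sub_self]
    exact zero_mem _

theorem opDinv_mem_rad {m : Ind n V} (hm : m ∈ F.rad) : F.opDinv m ∈ F.rad := by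
  have h1 : F.opD * F.opDinv = 1 := by
    have := F.isPreRep_rep.D_mul_Dinv
    rwa [act_D, act_Dinv] at this
  have h2 : F.opDinv * F.opD = 1 := by
    have := F.isPreRep_rep.Dinv_mul_D
    rwa [act_D, act_Dinv] at this
  refine subset_rad (W := F.opDinv '' F.rad) ?_ ?_ ⟨m, hm, rfl⟩
  · rintro _ ⟨m, hm, rfl⟩
    rw [opDinv, wordPr_wordOp _ _ _ (fun l m => by simp), pr_eq_zero hm, map_zero]
  · rintro _ ⟨m, hm, rfl⟩ j l
    refine ⟨_, ⟨q ^ l • F.opXp j l m, Submodule.smul_mem _ _ (opXp_mem_rad hm j l), rfl⟩, ?_⟩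
    have := LinearMap.congr_fun (F.isPreRep_rep.D_x 1 j l) (F.opDinv m)
    rw [act_D, act_xp] at this
    replace this : F.opD (F.opXp j l (F.opDinv m)) =
      q ^ l • F.opXp j l ((F.opD * F.opDinv) m) := this
    rw [h1, Module.End.one_apply] at this
    rw [← this, ← Module.End.mul_apply F.opDinv, h2, Module.End.one_apply, sub_self]
    exact zero_mem _

/-- The subalgebra of the free algebra preserving the radical. -/
def radStab : Subalgebra Kq (Free n) where
  carrier := {a | ∀ m ∈ F.rad, F.rep a m ∈ F.rad}
  mul_mem' ha hb m hm := by rw [map_mul]; exact ha _ (hb m hm)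
  add_mem' ha hb m hm := by rw [map_add]; exact add_mem (ha m hm) (hb m hm)
  algebraMap_mem' t m hm := by
    rw [AlgHom.commutes, Module.algebraMap_end_apply]; exact Submodule.smul_mem _ _ hm

theorem ι_h_mem (i : Fin n) (k : ℤ) : Free.h i k ∈ F.radStab := by
  rcases eq_or_ne k 0 with rfl | hk
  · rw [h_zero]; exact zero_mem _
  · intro m hm
    rw [act_h _ _ hk]; exact F.opH_mem_rad i hk hm

theorem K_mem (i : Fin n) : Free.K i ∈ F.radStab := by
  intro m hm; rw [act_K]; exact F.opK_mem_rad i hm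

theorem Kinv_mem (i : Fin n) : Free.Kinv i ∈ F.radStab := by
  intro m hm; rw [act_Kinv]; exact F.opKinv_mem_rad i hm

theorem gam_mem (k : ℤ) : Free.gam k ∈ F.radStab := by
  intro m hm
  rw [F.isPreRep_rep.map_gam, Module.algebraMap_end_apply]; exact Submodule.smul_mem _ _ hm

end CartanModule

theorem expCoeff_mem {S : Subalgebra Kq (Free n)} {u : ℕ → Free n} (hu : ∀ l, u l ∈ S) (t : Kq)
    (m : ℕ) : Free.expCoeff t u m ∈ S := by
  have h : ∀ r m, PowerSeries.coeff m (PowerSeries.mk u ^ r) ∈ S := by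
    intro r
    induction r with
    | zero =>
      intro m
      rw [pow_zero, PowerSeries.coeff_one]
      split_ifs
      · exact one_mem _
      · exact zero_mem _
    | succ r ih =>
      intro m
      rw [pow_succ, PowerSeries.coeff_mul]
      refine sum_mem fun ab _ => mul_mem (ih _) ?_
      rw [PowerSeries.coeff_mk]; exact hu _
  exact sum_mem fun r _ => Subalgebra.smul_mem _ (h r m) _

theorem gammaPsi_mem {S : Subalgebra Kq (Free n)} (hh : ∀ i k, Free.h i k ∈ S)
    (hK : ∀ i, Free.K i ∈ S) (hK' : ∀ i, Free.Kinv i ∈ S) (hg : ∀ k, Free.gam k ∈ S)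
    (i : Fin n) (k l : ℤ) : Free.gammaPsi C i k l ∈ S := by
  refine Subalgebra.smul_mem _ (sub_mem (mul_mem (hg _) ?_) (mul_mem (hg _) ?_)) _
  · rw [Free.psi]
    split_ifs
    · exact mul_mem (hK i) (expCoeff_mem (fun l => hh i _) _ _)
    · exact zero_mem _
  · rw [Free.phi]
    split_ifs
    · exact mul_mem (hK' i) (expCoeff_mem (fun l => hh i _) _ _)
    · exact zero_mem _

namespace CartanModule

variable {Γ : Kq} {V : Type} [AddCommGroup V] [Module Kq V] (F : CartanModule C Γ V)

/-- A word beginning with a letter has no component at the empty word. The error in moving x^+ past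
x^- is the prescribed bracket, an expression in h, K^{±1} and γ^{±1/2}, which are already known to
preserve the radical. -/
theorem xm_mem_rad (l : Fin n × ℤ) {m : Ind n V} (hm : m ∈ F.rad) : xm V l m ∈ F.rad := by
  refine subset_rad (W := xm V l '' F.rad) ?_ ?_ ⟨m, hm, rfl⟩
  · rintro _ ⟨m, hm, rfl⟩
    simp
  · rintro _ ⟨m, hm, rfl⟩ j k
    refine ⟨_, ⟨F.opXp j k m, opXp_mem_rad hm j k, rfl⟩, ?_⟩
    rw [opXp_xm, add_sub_cancel_left]
    split_ifs with h
    · exact gammaPsi_mem F.ι_h_mem F.K_mem F.Kinv_mem F.gam_mem j k l.2 m hm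
    · exact zero_mem _

theorem radStab_eq_top : F.radStab = ⊤ := by
  rw [eq_top_iff, ← FreeAlgebra.adjoin_range_ι, Algebra.adjoin_le_iff]
  rintro _ ⟨g, rfl⟩
  intro m hm
  rw [act_ι]
  cases g with
  | x ε i r =>
    rw [actGen]
    split_ifs
    · exact opXp_mem_rad hm i r
    · exact F.xm_mem_rad _ hm
  | h i k => exact F.opH_mem_rad i k.2 hm
  | K i => exact F.opK_mem_rad i hm
  | Kinv i => exact F.opKinv_mem_rad i hm
  | gammaHalf =>
    rw [actGen, Module.algebraMap_end_apply]; exact Submodule.smul_mem _ _ hm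
  | gammaHalfInv =>
    rw [actGen, Module.algebraMap_end_apply]; exact Submodule.smul_mem _ _ hm
  | D => exact F.opD_mem_rad hm
  | Dinv => exact F.opDinv_mem_rad hm

theorem rep_mem_rad (a : Free n) {m : Ind n V} (hm : m ∈ F.rad) : F.rep a m ∈ F.rad := by
  have : a ∈ F.radStab := by rw [radStab_eq_top]; exact Algebra.mem_top
  exact this m hm

/-- The quotient of the induced module by its radical. -/
abbrev Quot : Type := Ind n V ⧸ F.rad

/-- The representation of the free algebra on the quotient by the radical. -/
def quotRep : Free n →ₐ[Kq] Module.End Kq F.Quot :=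
  AlgHom.ofLinearMap
    { toFun := fun a => F.rad.mapQ F.rad (F.rep a) fun _ hm => F.rep_mem_rad a hm
      map_add' := fun a b => by
        refine Submodule.linearMap_qext _ (LinearMap.ext fun m => ?_)
        simp
      map_smul' := fun t a => by
        refine Submodule.linearMap_qext _ (LinearMap.ext fun m => ?_)
        simp }
    (by
      refine Submodule.linearMap_qext _ (LinearMap.ext fun m => ?_)
      simp)
    (fun a b => by
      refine Submodule.linearMap_qext _ (LinearMap.ext fun m => ?_)
      simp)

theorem quotRep_mk (a : Free n) (m : Ind n V) :
    F.quotRep a (F.rad.mkQ m) = F.rad.mkQ (F.rep a m) := rfl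

theorem quotRep_eq_zero_iff (a : Free n) : F.quotRep a = 0 ↔ ∀ m, F.rep a m ∈ F.rad := by
  constructor
  · intro h m
    have := LinearMap.congr_fun h (F.rad.mkQ m)
    rwa [quotRep_mk, LinearMap.zero_apply, ← LinearMap.mem_ker, Submodule.ker_mkQ] at this
  · intro h
    refine Submodule.linearMap_qext _ (LinearMap.ext fun m => ?_)
    change F.quotRep a (F.rad.mkQ m) = 0
    rw [quotRep_mk, ← LinearMap.mem_ker, Submodule.ker_mkQ]
    exact h m

theorem isPreRep_quotRep : IsPreRep C Γ F.quotRep := by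
  refine F.isPreRep_rep.of_map_eq fun a b h => ?_
  refine Submodule.linearMap_qext _ (LinearMap.ext fun m => ?_)
  change F.quotRep a (F.rad.mkQ m) = F.quotRep b (F.rad.mkQ m)
  rw [quotRep_mk, quotRep_mk, h]

theorem map_quadRel {E : Type*} [Ring E] [Algebra Kq E] (ρ : Free n →ₐ[Kq] E) (P : Kq)
    (η y : ℤ → Free n) (k l : ℤ) :
    ρ (quadRel P η y k l) = quadRel P (fun s => ρ (η s)) (fun s => ρ (y s)) k l := by
  simp only [quadRel, map_sub, map_smul, map_mul]

/-- An element of the free algebra which commutes with the `x^+` modulo the radical and maps to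
vectors without component at the empty word acts by zero on the quotient. -/
theorem quotRep_eq_zero_of_pr {a : Free n} (h0 : ∀ m, pr n V (F.rep a m) = 0)
    (h1 : ∀ i k, Commute (F.quotRep (Free.x 1 i k)) (F.quotRep a)) : F.quotRep a = 0 := by
  rw [quotRep_eq_zero_iff]
  intro m
  refine subset_rad (W := Set.range (F.rep a)) ?_ ?_ ⟨m, rfl⟩
  · rintro _ ⟨m, rfl⟩; exact h0 m
  · rintro _ ⟨m, rfl⟩ i k
    refine ⟨_, ⟨F.opXp i k m, rfl⟩, ?_⟩
    have := LinearMap.congr_fun (h1 i k) (F.rad.mkQ m)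
    rw [Module.End.mul_apply, Module.End.mul_apply, quotRep_mk, quotRep_mk, quotRep_mk, quotRep_mk,
      ← sub_eq_zero, ← map_sub, ← LinearMap.mem_ker, Submodule.ker_mkQ, act_xp] at this
    exact this

/-- An element of the free algebra which commutes with the `x^-` and annihilates the vectors of
the empty word acts by zero on the quotient. -/
theorem quotRep_eq_zero_of_nil {a : Free n} (h0 : ∀ v, F.rep a (nil n V v) = 0)
    (h1 : ∀ i k, Commute (F.quotRep (Free.x (-1) i k)) (F.quotRep a)) : F.quotRep a = 0 := by
  refine Submodule.linearMap_qext _ (word_ext (fun v => ?_) fun l m ih => ?_)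
  · change F.quotRep a (F.rad.mkQ (nil n V v)) = 0
    rw [quotRep_mk, h0, map_zero]
  · change F.quotRep a (F.rad.mkQ (xm V l m)) = 0
    replace ih : F.quotRep a (F.rad.mkQ m) = 0 := ih
    have := LinearMap.congr_fun (h1 l.1 l.2) (F.rad.mkQ m)
    rw [Module.End.mul_apply, Module.End.mul_apply, ih, map_zero, quotRep_mk _ (Free.x _ _ _),
      act_xm] at this
    exact this.symm

/-- For ε = 1 the expression kills the vectors of the empty word and commutes with the x^-. For ε =
-1 its values consist of nonempty words and it commutes with the x^+. Either way it vanishes modulo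
the radical. -/
theorem quadRel_quotRep (ε : ℤˣ) (i j : Fin n) (k l : ℤ) :
    quadRel (qPair C ε i j) (fun s => F.quotRep (Free.x ε i s))
      (fun s => F.quotRep (Free.x ε j s)) k l = 0 := by
  have hc := F.isPreRep_quotRep.commute_quadRel ε i j
  rw [← map_quadRel]
  simp only [← map_quadRel] at hc
  rcases Int.units_eq_one_or ε with rfl | rfl
  · refine F.quotRep_eq_zero_of_nil (fun v => ?_) fun r m => hc r k l m
    simp only [quadRel, map_sub, map_mul, map_smul, act_xp, LinearMap.sub_apply,
      LinearMap.smul_apply, Module.End.mul_apply, opXp_nil, map_zero, smul_zero, sub_zero]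
  · refine F.quotRep_eq_zero_of_pr (fun v => ?_) fun r m => by
      have := hc r k l m
      rwa [neg_neg] at this
    simp [quadRel, act_xm]

theorem serrePoly_apply_eq_zero {W : Type*} [AddCommGroup W] [Module Kq W]
    {X Y : Module.End Kq W} {w : W} (hX : X w = 0) (hY : Y w = 0) (p : Kq) (M : ℕ) :
    serrePoly p (M + 1) X Y w = 0 := by
  rw [serrePoly, LinearMap.sum_apply]
  refine Finset.sum_eq_zero fun r hr => ?_
  rw [Finset.mem_range] at hr
  rw [LinearMap.smul_apply]
  rcases Nat.eq_zero_or_pos (M + 1 - r) with h | h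
  · rw [h, pow_zero, mul_one, Module.End.mul_apply, hY, map_zero, smul_zero]
  · obtain ⟨s, hs⟩ := Nat.exists_eq_succ_of_ne_zero h.ne'
    rw [hs, pow_succ X s, Module.End.mul_apply, Module.End.mul_apply, Module.End.mul_apply, hX,
      map_zero, map_zero, map_zero, smul_zero]

theorem serrePoly_comp_eq_zero {W W' : Type*} [AddCommGroup W] [Module Kq W] [AddCommGroup W']
    [Module Kq W'] {X Y : Module.End Kq W} {f : W →ₗ[Kq] W'} (hX : ∀ w, f (X w) = 0)
    (hY : ∀ w, f (Y w) = 0) (p : Kq) (N : ℕ) (w : W) :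
    f (serrePoly p N X Y w) = 0 := by
  rw [serrePoly, LinearMap.sum_apply, map_sum]
  refine Finset.sum_eq_zero fun r hr => ?_
  rw [LinearMap.smul_apply, map_smul]
  rcases r with _ | r
  · rw [pow_zero X, one_mul, Module.End.mul_apply, hY, smul_zero]
  · rw [pow_succ' X, mul_assoc X, mul_assoc X, Module.End.mul_apply, hX, smul_zero]

/-- The same dichotomy as for the quadratic relations, which must be established first because
commutation of the Serre elements depends on them. -/
theorem quotRep_serre (ε : ℤˣ) {i j : Fin n} (hij : i ≠ j) (k : Fin (1 - C.a i j).toNat → ℤ)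
    (l : ℤ) : F.quotRep (Free.serre C ε i j k l) = 0 := by
  have hc := F.isPreRep_quotRep.commute_serre (F.quadRel_quotRep ε) hij
  rcases Int.units_eq_one_or ε with rfl | rfl
  · refine F.quotRep_eq_zero_of_nil (fun v => ?_) fun r m => hc r k l m
    obtain ⟨M, hM⟩ : ∃ M : ℕ, (1 - C.a i j).toNat = M + 1 :=
      ⟨(-C.a i j).toNat, by have := C.offDiag i j hij; omega⟩
    generalize (1 - C.a i j).toNat = N at k hM
    subst hM
    rw [map_serre, LinearMap.sum_apply]
    refine Finset.sum_eq_zero fun S _ => ?_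
    rw [LinearMap.smul_apply, serrePoly_apply_eq_zero, smul_zero]
    · simp [act_xp, opXp_nil, LinearMap.sum_apply]
    · rw [act_xp, opXp_nil]
  · refine F.quotRep_eq_zero_of_pr (fun v => ?_) fun r m => by
      have := hc r k l m
      rwa [neg_neg] at this
    rw [map_serre, LinearMap.sum_apply, map_sum]
    refine Finset.sum_eq_zero fun S _ => ?_
    rw [LinearMap.smul_apply, map_smul, serrePoly_comp_eq_zero, smul_zero]
    · intro w
      simp [act_xm, LinearMap.sum_apply]
    · intro w
      simp [act_xm]

/-- The action of `U_q(𝔤)` on the quotient of the induced module by its radical. -/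
def uqRep : Uq C →ₐ[Kq] Module.End Kq F.Quot :=
  RingQuot.liftAlgHom Kq ⟨F.quotRep, F.isPreRep_quotRep.map_eq_of_rel F.quadRel_quotRep
    fun ε _ _ hij => F.quotRep_serre ε hij⟩

theorem uqRep_toUq (a : Free n) : F.uqRep (toUq C a) = F.quotRep a :=
  RingQuot.liftAlgHom_mkAlgHom_apply ..

/-- A vector of a Cartan module satisfying the relations of `v_λ` gives a module map from the
imaginary Verma module to the quotient of the induced module. -/
theorem exists_verma_map (φ : ℕ+ → ℤˣ) (lam : Weight n) (F : CartanModule C (qh ^ lam.c) V)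
    (v : V) (hh : ∀ i (k : ℕ+), F.h i ((φ k : ℤ) * (k : ℤ)) v = 0)
    (hK : ∀ i, F.K i = q ^ lam.h i) (hD : F.D v = q ^ lam.d • v) :
    ∃ (f : Verma C φ lam →ₗ[Kq] F.Quot) (ι : V →ₗ[Kq] F.Quot), Function.Injective ι ∧
      f (vLam C φ lam) = ι v ∧ ∀ i k y w, k ≠ 0 → f y = ι w →
        f (toUq C (Free.h i k) • y) = ι (F.h i k w) := by
  set ι : V →ₗ[Kq] F.Quot := F.rad.mkQ ∘ₗ nil n V with hι
  -- Evaluation at the image of v. It kills the defining left ideal because that image satisfies the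
  -- relations of v_λ.
  let g : Uq C →ₗ[Kq] F.Quot := (LinearMap.applyₗ (ι v)) ∘ₗ F.uqRep.toLinearMap
  have hg : ∀ a, g a = F.uqRep a (ι v) := fun a => rfl
  have hgmul : ∀ a b, g (a * b) = F.uqRep a (g b) := fun a b => by rw [hg, map_mul]; rfl
  have hker : (vermaIdeal C φ lam).restrictScalars Kq ≤ LinearMap.ker g := by
    intro y hy
    rw [LinearMap.mem_ker]
    refine Submodule.span_induction (p := fun y _ => g y = 0) ?_ (map_zero g) ?_ ?_
      ((Submodule.restrictScalars_mem ..).mp hy)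
    · intro y hy
      have hg' : ∀ a, g (toUq C a) = F.rad.mkQ (F.rep a (nil n V v)) := fun a => by
        rw [hg, uqRep_toUq]; rfl
      have hgK : ∀ t, g (algebraMap Kq _ t) = t • F.rad.mkQ (nil n V v) := fun t => by
        rw [hg, AlgHom.commutes]; rfl
      induction hy with
      | x i k => rw [hg', act_xp, opXp_nil, map_zero]
      | h i k =>
        have hk : ((φ k : ℤ) * (k : ℤ)) ≠ 0 := by
          rcases Int.units_eq_one_or (φ k) with h | h <;> simp [h]
        rw [hg', act_h _ _ hk, opH_nil, hh, map_zero, map_zero]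
      | K i => rw [map_sub, hg', hgK, act_K, opK_nil, hK, map_smul, sub_self]
      | D => rw [map_sub, hg', hgK, act_D, opD_nil, hD, map_smul, map_smul, sub_self]
      | gamma =>
        rw [map_sub, hg', hgK, F.isPreRep_rep.map_gam, Module.algebraMap_end_apply, zpow_one,
          map_smul, sub_self]
    · intro a b _ _ ha hb
      rw [map_add, ha, hb, add_zero]
    · intro a b _ hb
      rw [smul_eq_mul, hgmul, hb, map_zero]
  let f : Verma C φ lam →ₗ[Kq] F.Quot :=
    ((vermaIdeal C φ lam).restrictScalars Kq).liftQ g hker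
  have hf : ∀ a : Uq C, f ((vermaIdeal C φ lam).mkQ a) = g a := fun a => rfl
  refine ⟨f, ι, ?_, ?_, ?_⟩
  -- A vector of the empty word equals its own component there, so it lies in the radical only if it
  -- is zero.
  · rw [injective_iff_map_eq_zero]
    intro w hw
    have : nil n V w ∈ F.rad := by
      rwa [hι, LinearMap.comp_apply, ← LinearMap.mem_ker, Submodule.ker_mkQ] at hw
    simpa using pr_eq_zero this
  · rw [vLam, hf, hg, map_one]; rfl
  · intro i k y w hk hy
    obtain ⟨a, rfl⟩ := (vermaIdeal C φ lam).mkQ_surjective y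
    rw [hf] at hy
    have e : toUq C (Free.h i k) • (vermaIdeal C φ lam).mkQ a =
      (vermaIdeal C φ lam).mkQ (toUq C (Free.h i k) * a) := rfl
    refine (congrArg f e).trans ?_
    rw [hf, hgmul, hy, uqRep_toUq, hι, LinearMap.comp_apply, LinearMap.comp_apply, quotRep_mk,
      act_h _ _ hk, opH_nil]

end CartanModule

end QHeis

namespace QHeis

/-! ### The ring `𝔸` and its specialization at `q^{1/2} = 1` -/

variable {n : ℕ} (C : CartanDatum n)

theorem qh_mem : qh ∈ AA C := Algebra.subset_adjoin (by simp)

theorem qh_inv_mem : qh⁻¹ ∈ AA C := Algebra.subset_adjoin (by simp)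

theorem qh_zpow_mem (m : ℤ) : qh ^ m ∈ AA C := by
  rcases Int.eq_nat_or_neg m with ⟨k, rfl | rfl⟩
  · rw [zpow_natCast]; exact pow_mem (qh_mem C) k
  · rw [zpow_neg, zpow_natCast, ← inv_pow]; exact pow_mem (qh_inv_mem C) k

theorem q_zpow (m : ℤ) : q ^ m = qh ^ (2 * m) := by
  rw [q, zpow_mul]; rfl

theorem q_zpow_mem (m : ℤ) : q ^ m ∈ AA C := by
  rw [q_zpow]; exact qh_zpow_mem C _

theorem q_pow_mem (m : ℕ) : q ^ m ∈ AA C := by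
  rw [← zpow_natCast]; exact q_zpow_mem C m

/-- The polynomial form of a quantum integer, from which its integrality and its value at p = 1 can
be read off. -/
theorem qInt_mul_pow {p : Kq} (hp : IsGeneric p) (m : ℕ) :
    qInt p (m + 1 : ℕ) * p ^ m = ∑ j ∈ Finset.range (m + 1), (p ^ 2) ^ j := by
  have h0 := hp.ne_zero
  have h1 := hp.sub_inv_ne
  have h2 : p ^ 2 - 1 ≠ 0 := by
    intro h
    apply h1
    have h3 : p * p⁻¹ = 1 := mul_inv_cancel₀ h0
    linear_combination p⁻¹ * h - p * h3
  rw [geom_sum_eq (by intro h; exact h2 (by rw [h, sub_self])), qInt, zpow_neg, zpow_natCast,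
    div_mul_eq_mul_div, div_eq_div_iff h1 h2]
  field_simp
  ring

theorem qInt_natCast_mem {S : Subalgebra ℂ Kq} {p : Kq} (hp : IsGeneric p) (h1 : p ∈ S) (h2 : p⁻¹ ∈ S) (m : ℕ) :
    qInt p m ∈ S := by
  rcases m with _ | m
  · simp [qInt]
  · have h := qInt_mul_pow hp m
    have h3 : qInt p (m + 1 : ℕ) = p⁻¹ ^ m * ∑ j ∈ Finset.range (m + 1), (p ^ 2) ^ j := by
      rw [← h, mul_comm, mul_assoc, ← mul_pow, mul_inv_cancel₀ hp.ne_zero, one_pow, mul_one]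
    rw [h3]
    exact mul_mem (pow_mem h2 m) (sum_mem fun j _ => pow_mem (pow_mem h1 2) j)

theorem qInt_neg (p : Kq) (m : ℤ) : qInt p (-m) = -qInt p m := by
  rw [qInt, qInt, ← neg_div, neg_sub, neg_neg]

theorem qInt_mem {S : Subalgebra ℂ Kq} {p : Kq} (hp : IsGeneric p) (h1 : p ∈ S) (h2 : p⁻¹ ∈ S) (m : ℤ) :
    qInt p m ∈ S := by
  rcases Int.eq_nat_or_neg m with ⟨k, rfl | rfl⟩
  · exact qInt_natCast_mem hp h1 h2 k
  · rw [qInt_neg]; exact neg_mem (qInt_natCast_mem hp h1 h2 k)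

theorem isGeneric_q : IsGeneric q := by simpa using isGeneric_q_pow (m := 1) one_pos

theorem qi_mem (i : Fin n) : qi C i ∈ AA C := q_pow_mem C _

theorem qi_inv_mem (i : Fin n) : (qi C i)⁻¹ ∈ AA C := by
  rw [qi, ← zpow_natCast, ← zpow_neg]; exact q_zpow_mem C _

theorem qInt_qi_mem (i : Fin n) (m : ℤ) : qInt (qi C i) m ∈ AA C :=
  qInt_mem (isGeneric_qi C i) (qi_mem C i) (qi_inv_mem C i) m

theorem q_inv_mem : q⁻¹ ∈ AA C := by simpa using q_zpow_mem C (-1)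

theorem qInt_q_mem (m : ℤ) : qInt q m ∈ AA C :=
  qInt_mem isGeneric_q (by simpa using q_pow_mem C 1) (q_inv_mem C) m

theorem qInt_one {p : Kq} (hp : IsGeneric p) : qInt p 1 = 1 := by
  rw [qInt, zpow_neg, zpow_one, div_self hp.sub_inv_ne]

theorem qInt_qi_inv_mem (i : Fin n) {m : ℕ} (hm : 0 < m) : (qInt (qi C i) m)⁻¹ ∈ AA C := by
  rcases eq_or_lt_of_le (Nat.succ_le_of_lt hm) with h | h
  · rw [← h, show (((Nat.succ 0 : ℕ)) : ℤ) = 1 by rfl, qInt_one (isGeneric_qi C i), inv_one]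
    exact one_mem _
  · exact Algebra.subset_adjoin (Or.inr ⟨i, m, h, rfl⟩)

/-- The `q`-integers `[m]_q` are invertible in `𝔸`, because the `d_i` are relatively prime. -/
theorem qInt_q_inv_mem {m : ℕ} (hm : 0 < m) : (qInt q m)⁻¹ ∈ AA C := by
  -- A common multiple of m and all d_i: up to powers of q, (q_i² - 1)/(q^{2N} - 1) is
  -- 1/[N/d_i]_{q_i}, a generator of 𝔸 or 1.
  set N : ℕ := m * ∏ i, C.d i with hN
  have hNpos : 0 < N := Nat.mul_pos hm (Finset.prod_pos fun i _ => C.d_pos i)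
  have hq := isGeneric_q
  have hne : ∀ {k : ℕ}, 0 < k → q ^ (2 * k) - 1 ≠ 0 := by
    intro k hk h
    rw [pow_mul] at h
    refine qh_pow_ne_one (m := 2 * 2 * k) (by positivity) ?_
    rw [pow_mul, pow_mul]
    exact sub_eq_zero.mp h
  -- the integers `k` for which `(q^{2k} - 1) / (q^{2N} - 1)` lies in `𝔸`
  let H : AddSubgroup ℤ :=
    { carrier := {k | (q ^ (2 * k) - 1) * (q ^ (2 * N) - 1)⁻¹ ∈ AA C}
      zero_mem' := by simp
      add_mem' := fun {a b} ha hb => by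
        have e : (q ^ (2 * (a + b)) - 1) * (q ^ (2 * N) - 1)⁻¹ =
            q ^ (2 * b) * ((q ^ (2 * a) - 1) * (q ^ (2 * N) - 1)⁻¹) +
              (q ^ (2 * b) - 1) * (q ^ (2 * N) - 1)⁻¹ := by
          rw [mul_add, zpow_add₀ q_ne_zero]; ring
        change _ ∈ AA C
        rw [e]
        exact add_mem (mul_mem (q_zpow_mem C _) ha) hb
      neg_mem' := fun {a} ha => by
        have e : (q ^ (2 * -a) - 1) * (q ^ (2 * N) - 1)⁻¹ =
            -(q ^ (2 * -a) * ((q ^ (2 * a) - 1) * (q ^ (2 * N) - 1)⁻¹)) := by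
          have : q ^ (2 * -a) * q ^ (2 * a) = 1 := by
            rw [← zpow_add₀ q_ne_zero]; simp
          linear_combination ((q ^ (2 * N) - 1)⁻¹) * this
        change _ ∈ AA C
        rw [e]
        exact neg_mem (mul_mem (q_zpow_mem C _) ha) }
  have hd : ∀ i, (C.d i : ℤ) ∈ H := by
    intro i
    obtain ⟨r, hr⟩ : C.d i ∣ N := Dvd.dvd.mul_left (Finset.dvd_prod_of_mem _ (Finset.mem_univ i)) m
    have hrpos : 0 < r := Nat.pos_of_ne_zero (by rintro rfl; omega)
    obtain ⟨s, rfl⟩ := Nat.exists_eq_succ_of_ne_zero hrpos.ne'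
    have h1 := qInt_mul_pow (isGeneric_qi C i) s
    have h2 : (∑ j ∈ Finset.range (s + 1), (qi C i ^ 2) ^ j) * (qi C i ^ 2 - 1) =
        q ^ (2 * N) - 1 := by
      rw [geom_sum_mul, qi, ← pow_mul, ← pow_mul, hr]
      congr 2
      simp only [Nat.succ_eq_add_one]
      ring
    have h3 : q ^ (2 * (C.d i : ℤ)) - 1 = qi C i ^ 2 - 1 := by
      rw [qi, ← pow_mul, mul_comm (C.d i)]; norm_cast
    have h4 := qInt_qi_inv_mem C i (Nat.succ_pos s)
    change _ ∈ AA C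
    have h5 : (qi C i ^ 2 - 1) * (q ^ (2 * N) - 1)⁻¹ =
        (qInt (qi C i) (s.succ : ℕ))⁻¹ * (qi C i)⁻¹ ^ s := by
      rw [← h2, ← h1]
      have e1 : qi C i ^ 2 - 1 ≠ 0 := by
        rw [← h3]
        exact_mod_cast hne (C.d_pos i)
      have e2 := (isGeneric_qi C i).ne_zero
      have e3 : qInt (qi C i) (s.succ : ℕ) ≠ 0 := by
        intro h0
        rw [← h1, show s + 1 = s.succ from rfl, h0, zero_mul, zero_mul] at h2
        exact hne hNpos h2.symm
      rw [show s + 1 = s.succ from rfl]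
      generalize qInt (qi C i) (s.succ : ℕ) = t at *
      generalize qi C i = p at *
      rw [inv_pow]
      field_simp
    rw [h3, h5]
    exact mul_mem h4 (pow_mem (qi_inv_mem C i) s)
  -- The subgroup H is generated by some g dividing every d_i, so g = ±1 by coprimality. Thus (q² -
  -- 1)/(q^{2N} - 1) lies in 𝔸.
  have h1 : (1 : ℤ) ∈ H := by
    obtain ⟨g, hg⟩ := Int.subgroup_cyclic H
    rw [← AddSubgroup.zmultiples_eq_closure] at hg
    have hdvd : ∀ i, g.natAbs ∣ C.d i := by
      intro i
      have := hd i
      rw [hg, Int.mem_zmultiples_iff] at this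
      exact Int.natAbs_dvd_natAbs.mpr this
    have h2 : g.natAbs ∣ 1 := by
      rw [← C.coprime]; exact Finset.dvd_gcd fun i _ => hdvd i
    rw [hg, Int.mem_zmultiples_iff, ← Int.natAbs_dvd_natAbs]
    exact h2
  obtain ⟨s, rfl⟩ := Nat.exists_eq_succ_of_ne_zero hm.ne'
  have e := qInt_mul_pow hq s
  have e2 : (∑ j ∈ Finset.range (s + 1), (q ^ 2) ^ j) * (q ^ 2 - 1) = q ^ (2 * (s + 1)) - 1 := by
    rw [geom_sum_mul, ← pow_mul]
  have e3 : (∑ j ∈ Finset.range (∏ i, C.d i), (q ^ (2 * (s + 1))) ^ j) * (q ^ (2 * (s + 1)) - 1) =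
      q ^ (2 * N) - 1 := by
    rw [geom_sum_mul, ← pow_mul, hN]
    congr 2
    simp only [Nat.succ_eq_add_one]
    ring
  -- Here 1/[m]_q = q^{m-1}(q² - 1)/(q^{2m} - 1), and a geometric sum trades the denominator q^{2m}
  -- - 1 for q^{2N} - 1.
  have e4 : (qInt q (s.succ : ℕ))⁻¹ = q ^ s * ((∑ j ∈ Finset.range (∏ i, C.d i),
      (q ^ (2 * (s + 1))) ^ j) * ((q ^ (2 * (1 : ℤ)) - 1) * (q ^ (2 * N) - 1)⁻¹)) := by
    rw [← e3, ← e2, ← e]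
    have f1 : q ^ 2 - 1 ≠ 0 := by simpa using hne one_pos
    have f2 : ∑ j ∈ Finset.range (∏ i, C.d i), (q ^ (2 * (s + 1))) ^ j ≠ 0 := by
      intro h0
      rw [h0, zero_mul] at e3
      exact hne hNpos e3.symm
    have f3 : qInt q (s + 1 : ℕ) ≠ 0 := by
      intro h0
      rw [← e, h0, zero_mul, zero_mul] at e2
      exact hne (Nat.succ_pos s) e2.symm
    have f4 : q ^ (2 * (1 : ℤ)) = q ^ 2 := by norm_cast
    rw [f4, show s.succ = s + 1 from rfl]
    generalize qInt q (s + 1 : ℕ) = t at *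
    generalize ∑ j ∈ Finset.range (∏ i, C.d i), (q ^ (2 * (s + 1))) ^ j = u at *
    have := q_ne_zero
    generalize q = p at *
    field_simp
  rw [e4]
  exact mul_mem (q_pow_mem C s) (mul_mem (sum_mem fun j _ => pow_mem (q_pow_mem C _) j) h1)

/-- `(q^a - q^{-a}) / (q^b - q^{-b})` lies in `𝔸`. -/
theorem qInt_div_mem (a : ℤ) {b : ℕ} (hb : 0 < b) :
    (q ^ (b : ℤ) - q ^ (-(b : ℤ)))⁻¹ * (q ^ a - q ^ (-a)) ∈ AA C := by
  have e : (q ^ (b : ℤ) - q ^ (-(b : ℤ)))⁻¹ * (q ^ a - q ^ (-a)) = qInt q a * (qInt q b)⁻¹ := by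
    have := isGeneric_q.sub_inv_ne
    rw [qInt, qInt, inv_div]
    generalize q - q⁻¹ = t at *
    field_simp
  rw [e]
  exact mul_mem (qInt_q_mem C a) (qInt_q_inv_mem C hb)

/-! ### Evaluation at `q^{1/2} = 1` -/

/-- Any representation f = p/s with s(1) ≠ 0 suffices, because the reduced denominator divides s. -/
theorem eval_denom_ne_zero_of_mul {f : Kq} {s p : Polynomial ℂ} (hs : s.eval 1 ≠ 0)
    (h : f * algebraMap _ _ s = algebraMap _ _ p) :
    (RatFunc.denom f).eval₂ (RingHom.id ℂ) 1 ≠ 0 := by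
  have hs0 : s ≠ 0 := by rintro rfl; simp at hs
  have hs1 : algebraMap (Polynomial ℂ) Kq s ≠ 0 := by
    simpa using hs0
  have hd : RatFunc.denom f ∣ s := (RatFunc.denom_dvd hs0).mpr ⟨p, by rw [← h]; field_simp⟩
  intro h0
  apply hs
  exact Polynomial.eval₂_eq_zero_of_dvd_of_eval₂_eq_zero _ _ hd h0

/-- Elements of 𝔸 have no pole at q^{1/2} = 1, since [m]_{q_i} takes the nonzero value m there.
Evaluation of rational functions is multiplicative and additive only away from poles. -/
theorem eval_denom_ne_zero {a : Kq} (ha : a ∈ AA C) :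
    (RatFunc.denom a).eval₂ (RingHom.id ℂ) 1 ≠ 0 := by
  have hX : algebraMap (Polynomial ℂ) Kq Polynomial.X = qh := RatFunc.algebraMap_X
  induction ha using Algebra.adjoin_induction with
  | mem x hx =>
    rcases hx with (rfl | rfl) | ⟨i, m, hm, rfl⟩
    · exact eval_denom_ne_zero_of_mul (s := 1) (p := Polynomial.X) (by simp)
        (by rw [hX, map_one, mul_one])
    · exact eval_denom_ne_zero_of_mul (s := Polynomial.X) (p := 1) (by simp)
        (by rw [hX, map_one, inv_mul_cancel₀ qh_ne_zero])
    · obtain ⟨k, rfl⟩ := Nat.exists_eq_succ_of_ne_zero (show m ≠ 0 by omega)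
      have h := qInt_mul_pow (isGeneric_qi C i) k
      have hpos : ((k.succ : ℕ) : ℂ) ≠ 0 := by exact_mod_cast Nat.succ_ne_zero k
      have hne : qInt (qi C i) (k.succ : ℕ) ≠ 0 := by
        have := (isGeneric_qi C i).qNum_ne (m := k.succ) (Nat.succ_pos k)
        exact this
      refine eval_denom_ne_zero_of_mul
        (s := ∑ j ∈ Finset.range (k + 1), (((Polynomial.X ^ 2) ^ C.d i) ^ 2) ^ j)
        (p := ((Polynomial.X ^ 2) ^ C.d i) ^ k) ?_ ?_
      · simp [Polynomial.eval_finsetSum]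
        exact_mod_cast hpos
      · simp only [map_sum, map_pow, hX]
        rw [show (qh ^ 2) ^ C.d i = qi C i from rfl, ← h, ← mul_assoc,
          show ((k + 1 : ℕ) : ℤ) = (k.succ : ℕ) from rfl, inv_mul_cancel₀ hne, one_mul]
  | algebraMap r =>
    refine eval_denom_ne_zero_of_mul (s := 1) (p := Polynomial.C r) (by simp) ?_
    rw [map_one, mul_one, RatFunc.algebraMap_C]
    rfl
  | add x y _ _ hx hy =>
    intro h0
    have := Polynomial.eval₂_eq_zero_of_dvd_of_eval₂_eq_zero _ _ (RatFunc.denom_add_dvd x y) h0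
    rw [Polynomial.eval₂_mul] at this
    exact (mul_ne_zero hx hy) this
  | mul x y _ _ hx hy =>
    intro h0
    have := Polynomial.eval₂_eq_zero_of_dvd_of_eval₂_eq_zero _ _ (RatFunc.denom_mul_dvd x y) h0
    rw [Polynomial.eval₂_mul] at this
    exact (mul_ne_zero hx hy) this

/-- The specialization `𝔸 → ℂ`, `q^{1/2} ↦ 1`. -/
def evOne : AA C →ₐ[ℂ] ℂ where
  toFun a := RatFunc.eval (RingHom.id ℂ) 1 (a : Kq)
  map_one' := RatFunc.eval_one _ _
  map_zero' := RatFunc.eval_zero _ _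
  map_add' a b := RatFunc.eval_add _ _ (eval_denom_ne_zero C a.2) (eval_denom_ne_zero C b.2)
  map_mul' a b := RatFunc.eval_mul _ _ (eval_denom_ne_zero C a.2) (eval_denom_ne_zero C b.2)
  commutes' _ := RatFunc.eval_C _ _

/-- `q^{1/2}` as an element of `𝔸` -/
def qhA : AA C := ⟨qh, qh_mem C⟩

theorem evOne_qhA : evOne C (qhA C) = 1 := RatFunc.eval_X _ _

theorem evOne_qh_zpow (m : ℤ) : evOne C ⟨qh ^ m, qh_zpow_mem C m⟩ = 1 := by
  rcases Int.eq_nat_or_neg m with ⟨k, rfl | rfl⟩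
  · have : (⟨qh ^ (k : ℤ), qh_zpow_mem C k⟩ : AA C) = qhA C ^ k := Subtype.ext (zpow_natCast _ _)
    rw [this, map_pow, evOne_qhA, one_pow]
  · have : (⟨qh ^ (-(k : ℤ)), qh_zpow_mem C _⟩ : AA C) * qhA C ^ k = 1 := by
      apply Subtype.ext
      change qh ^ (-(k : ℤ)) * qh ^ k = 1
      rw [zpow_neg, zpow_natCast, inv_mul_cancel₀ (pow_ne_zero _ qh_ne_zero)]
    have h2 := congrArg (evOne C) this
    rwa [map_mul, map_pow, evOne_qhA, one_pow, mul_one, map_one] at h2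

theorem evOne_q_zpow (m : ℤ) : evOne C ⟨q ^ m, q_zpow_mem C m⟩ = 1 := by
  have : (⟨q ^ m, q_zpow_mem C m⟩ : AA C) = ⟨qh ^ (2 * m), qh_zpow_mem C _⟩ :=
    Subtype.ext (q_zpow m)
  rw [this, evOne_qh_zpow]

theorem evOne_qInt_natCast {p : Kq} (hp : IsGeneric p) (h1 : p ∈ AA C) (h2 : p⁻¹ ∈ AA C)
    (he : evOne C ⟨p, h1⟩ = 1) (m : ℕ) : evOne C ⟨qInt p m, qInt_mem hp h1 h2 m⟩ = m := by
  rcases m with _ | m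
  · have : (⟨qInt p (0 : ℕ), qInt_mem hp h1 h2 _⟩ : AA C) = 0 := Subtype.ext (by simp [qInt])
    rw [this, map_zero, Nat.cast_zero]
  · have : (⟨qInt p (m + 1 : ℕ), qInt_mem hp h1 h2 _⟩ : AA C) * ⟨p, h1⟩ ^ m =
        ∑ j ∈ Finset.range (m + 1), (⟨p, h1⟩ ^ 2) ^ j := by
      apply Subtype.ext
      rw [AddSubmonoidClass.coe_finsetSum]
      exact qInt_mul_pow hp m
    have h3 := congrArg (evOne C) this
    simp only [map_mul, map_pow, map_sum, he, one_pow, mul_one, Finset.sum_const,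
      Finset.card_range, nsmul_eq_mul] at h3
    exact h3

theorem evOne_qInt {p : Kq} (hp : IsGeneric p) (h1 : p ∈ AA C) (h2 : p⁻¹ ∈ AA C)
    (he : evOne C ⟨p, h1⟩ = 1) (m : ℤ) : evOne C ⟨qInt p m, qInt_mem hp h1 h2 m⟩ = m := by
  rcases Int.eq_nat_or_neg m with ⟨k, rfl | rfl⟩
  · rw [evOne_qInt_natCast C hp h1 h2 he, Int.cast_natCast]
  · have : (⟨qInt p (-(k : ℤ)), qInt_mem hp h1 h2 _⟩ : AA C) =
        -⟨qInt p k, qInt_mem hp h1 h2 k⟩ := Subtype.ext (qInt_neg p k)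
    rw [this, map_neg, evOne_qInt_natCast C hp h1 h2 he, Int.cast_neg, Int.cast_natCast]

theorem evOne_qInt_qi (i : Fin n) (m : ℤ) : evOne C ⟨qInt (qi C i) m, qInt_qi_mem C i m⟩ = m := by
  refine evOne_qInt C (isGeneric_qi C i) (qi_mem C i) (qi_inv_mem C i) ?_ m
  have : (⟨qi C i, qi_mem C i⟩ : AA C) = ⟨q ^ (C.d i : ℤ), q_zpow_mem C _⟩ :=
    Subtype.ext (zpow_natCast _ _).symm
  rw [this, evOne_q_zpow]

theorem evOne_qInt_q (m : ℤ) : evOne C ⟨qInt q m, qInt_q_mem C m⟩ = m := by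
  refine evOne_qInt C isGeneric_q (by simpa using q_pow_mem C 1) (q_inv_mem C) ?_ m
  have := evOne_q_zpow C 1
  simpa using this

theorem evOne_qInt_div (a : ℤ) {b : ℕ} (hb : 0 < b) :
    evOne C ⟨_, qInt_div_mem C a hb⟩ = a / b := by
  have hne : q ^ (b : ℤ) - q ^ (-(b : ℤ)) ≠ 0 := isGeneric_q.zpow_sub_ne hb
  have hb' : ((b : ℤ) : ℂ) ≠ 0 := by exact_mod_cast hb.ne'
  have h : (⟨_, qInt_div_mem C a hb⟩ : AA C) * ⟨qInt q b, qInt_q_mem C b⟩ =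
      ⟨qInt q a, qInt_q_mem C a⟩ := by
    apply Subtype.ext
    change (q ^ (b : ℤ) - q ^ (-(b : ℤ)))⁻¹ * (q ^ a - q ^ (-a)) * qInt q b = qInt q a
    rw [qInt, qInt]
    generalize q ^ (b : ℤ) - q ^ (-(b : ℤ)) = t at *
    field_simp
  have h2 := congrArg (evOne C) h
  rw [map_mul, evOne_qInt_q, evOne_qInt_q] at h2
  rw [eq_div_iff (by exact_mod_cast hb')]
  exact_mod_cast h2

/-- The elements of `𝔸` congruent to their value at `q^{1/2} = 1` modulo `q^{1/2} - 1`. -/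
def evSubalgebra : Subalgebra ℂ Kq where
  carrier := {x | ∃ (hx : x ∈ AA C) (b : AA C),
    (⟨x, hx⟩ : AA C) - algebraMap ℂ (AA C) (evOne C ⟨x, hx⟩) = (qhA C - 1) * b}
  algebraMap_mem' r := by
    refine ⟨Subalgebra.algebraMap_mem _ r, 0, ?_⟩
    have e : (⟨algebraMap ℂ Kq r, Subalgebra.algebraMap_mem _ r⟩ : AA C) =
      algebraMap ℂ (AA C) r := rfl
    rw [e, AlgHom.commutes]
    simp
  add_mem' := by
    rintro x y ⟨hx, b, hb⟩ ⟨hy, b', hb'⟩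
    refine ⟨add_mem hx hy, b + b', ?_⟩
    have e : (⟨x + y, add_mem hx hy⟩ : AA C) = ⟨x, hx⟩ + ⟨y, hy⟩ := rfl
    rw [e, map_add, map_add]
    linear_combination hb + hb'
  mul_mem' := by
    rintro x y ⟨hx, b, hb⟩ ⟨hy, b', hb'⟩
    refine ⟨mul_mem hx hy, b * ⟨y, hy⟩ + algebraMap ℂ (AA C) (evOne C ⟨x, hx⟩) * b', ?_⟩
    have e : (⟨x * y, mul_mem hx hy⟩ : AA C) = ⟨x, hx⟩ * ⟨y, hy⟩ := rfl
    rw [e, map_mul, map_mul]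
    linear_combination hb * (⟨y, hy⟩ : AA C) + algebraMap ℂ (AA C) (evOne C ⟨x, hx⟩) * hb'

theorem qh_mem_evSubalgebra : qh ∈ evSubalgebra C := by
  refine ⟨qh_mem C, 1, ?_⟩
  have := evOne_qhA C
  rw [qhA] at this
  rw [this, map_one, mul_one, qhA]

theorem qh_inv_mem_evSubalgebra : qh⁻¹ ∈ evSubalgebra C := by
  have h := evOne_qh_zpow C (-1)
  have e : (⟨qh ^ (-1 : ℤ), qh_zpow_mem C _⟩ : AA C) = ⟨qh⁻¹, qh_inv_mem C⟩ :=
    Subtype.ext (by simp)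
  rw [e] at h
  refine ⟨qh_inv_mem C, -⟨qh⁻¹, qh_inv_mem C⟩, ?_⟩
  rw [h, map_one]
  apply Subtype.ext
  change qh⁻¹ - 1 = (qh - 1) * -qh⁻¹
  have := mul_inv_cancel₀ qh_ne_zero
  linear_combination this

theorem AA_le_evSubalgebra : AA C ≤ evSubalgebra C := by
  refine Algebra.adjoin_le ?_
  rintro x ((rfl | rfl) | ⟨i, m, hm, rfl⟩)
  · exact qh_mem_evSubalgebra C
  · exact qh_inv_mem_evSubalgebra C
  · have h1 : qi C i ∈ evSubalgebra C := pow_mem (pow_mem (qh_mem_evSubalgebra C) 2) _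
    have h2 : (qi C i)⁻¹ ∈ evSubalgebra C := by
      rw [qi, q, ← inv_pow, ← inv_pow]
      exact pow_mem (pow_mem (qh_inv_mem_evSubalgebra C) 2) _
    obtain ⟨hu, b, hb⟩ := qInt_mem (isGeneric_qi C i) h1 h2 m
    have hv := qInt_qi_inv_mem C i (show 0 < m by omega)
    have hm' : (m : ℂ) ≠ 0 := by
      have : m ≠ 0 := by omega
      exact_mod_cast this
    have hne : qInt (qi C i) m ≠ 0 := (isGeneric_qi C i).qNum_ne (m := m) (by omega)
    have huv : (⟨_, hu⟩ : AA C) * ⟨_, hv⟩ = 1 := Subtype.ext (mul_inv_cancel₀ hne)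
    have hev : evOne C ⟨_, hu⟩ = m := by simpa using evOne_qInt_qi C i m
    have hev' : evOne C ⟨_, hv⟩ = (m : ℂ)⁻¹ := by
      have := congrArg (evOne C) huv
      rw [map_mul, hev, map_one] at this
      exact eq_inv_of_mul_eq_one_right this
    rw [hev] at hb
    -- From U = m + (q^{1/2} - 1)b and UW = 1 one gets W - 1/m = -(q^{1/2} - 1) bW/m.
    refine ⟨hv, -(algebraMap ℂ (AA C) (m : ℂ)⁻¹ * b * ⟨_, hv⟩), ?_⟩
    have hmm : algebraMap ℂ (AA C) m * algebraMap ℂ (AA C) (m : ℂ)⁻¹ = 1 := by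
      rw [← map_mul, mul_inv_cancel₀ hm', map_one]
    rw [hev']
    generalize (⟨qInt (qi C i) m, hu⟩ : AA C) = U at *
    generalize (⟨(qInt (qi C i) m)⁻¹, hv⟩ : AA C) = W at *
    generalize algebraMap ℂ (AA C) m = m1 at *
    generalize algebraMap ℂ (AA C) (m : ℂ)⁻¹ = m2 at *
    linear_combination (-m2 * W) * hb + m2 * huv - W * hmm

/-- In other words, the kernel of the specialization is generated by q^{1/2} - 1. -/
theorem exists_sub_evOne (a : AA C) :
    ∃ b : AA C, a - algebraMap ℂ (AA C) (evOne C a) = (qhA C - 1) * b := by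
  obtain ⟨_, b, hb⟩ := AA_le_evSubalgebra C a.2
  exact ⟨b, hb⟩

end QHeis

namespace QHeis

/-! ### Fock space -/

section Index

variable (φ : ℕ+ → ℤˣ)

/-- The index `φ(k) k` of the annihilation operators. -/
def annIdx (k : ℕ+) : ℤ := (φ k : ℤ) * (k : ℤ)

theorem natAbs_annIdx (k : ℕ+) : (annIdx φ k).natAbs = k := by
  rcases Int.units_eq_one_or (φ k) with h | h <;> simp [annIdx, h]

theorem natAbs_toPNat'_annIdx (k : ℕ+) : (annIdx φ k).natAbs.toPNat' = k := by
  rw [natAbs_annIdx, PNat.coe_toPNat']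

theorem annIdx_ne_zero (k : ℕ+) : annIdx φ k ≠ 0 := by
  intro h
  have := natAbs_annIdx φ k
  rw [h] at this
  exact k.pos.ne this

theorem neg_annIdx_ne_zero (k : ℕ+) : -annIdx φ k ≠ 0 := neg_ne_zero.mpr (annIdx_ne_zero φ k)

theorem annIdx_ne_neg (k l : ℕ+) : annIdx φ k ≠ -annIdx φ l := by
  intro h
  have h1 := congrArg Int.natAbs h
  rw [Int.natAbs_neg, natAbs_annIdx, natAbs_annIdx] at h1
  have h2 : k = l := PNat.coe_injective h1
  subst h2
  exact annIdx_ne_zero φ k (by omega)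

theorem annIdx_injective : Function.Injective (annIdx φ) := fun k l h => by
  have h1 := congrArg Int.natAbs h
  rw [natAbs_annIdx, natAbs_annIdx] at h1
  exact PNat.coe_injective h1

theorem exists_annIdx {k : ℤ} (hk : k ≠ 0) : ∃ l, k = annIdx φ l ∨ k = -annIdx φ l := by
  obtain ⟨l, hl⟩ : ∃ l : ℕ+, (l : ℕ) = k.natAbs := ⟨⟨k.natAbs, by omega⟩, rfl⟩
  refine ⟨l, ?_⟩
  have := natAbs_annIdx φ l
  omega

end Index

section Fock

variable {𝕜 : Type*} [Field 𝕜] {n : ℕ} (φ : ℕ+ → ℤˣ) (c : Fin n → Fin n → ℤ → 𝕜)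

/-- Fock space: polynomials in the creation operators. -/
abbrev Fock (𝕜 : Type*) [Field 𝕜] (n : ℕ) : Type _ := MvPolynomial (Fin n × ℕ+) 𝕜

/-- The annihilation operators `∑_j c_{ij} ∂/∂X_{jk}`. -/
def fockAnn (i : Fin n) (k : ℕ+) : Module.End 𝕜 (Fock 𝕜 n) :=
  ∑ j, c i j (annIdx φ k) • (MvPolynomial.pderiv (R := 𝕜) (j, k)).toLinearMap

/-- The action of the Heisenberg algebra on Fock space. -/
def fockH (i : Fin n) (k : ℤ) : Module.End 𝕜 (Fock 𝕜 n) :=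
  if k = annIdx φ k.natAbs.toPNat' then fockAnn φ c i k.natAbs.toPNat'
  else LinearMap.mulLeft 𝕜 (MvPolynomial.X (i, k.natAbs.toPNat'))

theorem fockH_annIdx (i : Fin n) (k : ℕ+) : fockH φ c i (annIdx φ k) = fockAnn φ c i k := by
  rw [fockH, natAbs_toPNat'_annIdx, if_pos rfl]

theorem fockH_neg_annIdx (i : Fin n) (k : ℕ+) :
    fockH φ c i (-annIdx φ k) = LinearMap.mulLeft 𝕜 (MvPolynomial.X (i, k)) := by
  rw [fockH, Int.natAbs_neg, natAbs_toPNat'_annIdx, if_neg (annIdx_ne_neg φ k k).symm]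

theorem fockAnn_apply (i : Fin n) (k : ℕ+) (P : Fock 𝕜 n) :
    fockAnn φ c i k P = ∑ j, c i j (annIdx φ k) • MvPolynomial.pderiv (j, k) P := by
  simp [fockAnn, LinearMap.sum_apply]

theorem fockAnn_X_mul (i j : Fin n) (k l : ℕ+) (P : Fock 𝕜 n) :
    fockAnn φ c i k (MvPolynomial.X (j, l) * P) =
      MvPolynomial.X (j, l) * fockAnn φ c i k P + if k = l then c i j (annIdx φ k) • P else 0 := by
  have h : ∀ j', MvPolynomial.pderiv (j', k) (MvPolynomial.X (j, l) * P : Fock 𝕜 n) =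
      MvPolynomial.X (j, l) * MvPolynomial.pderiv (j', k) P +
        if j' = j then (if k = l then P else 0) else 0 := by
    intro j'
    rw [Derivation.leibniz, smul_eq_mul, smul_eq_mul, MvPolynomial.pderiv_X]
    congr 1
    by_cases h1 : j' = j
    · by_cases h2 : k = l
      · subst h1 h2; simp
      · rw [if_pos h1, if_neg h2, Pi.single_eq_of_ne (by simp [Ne.symm h2]), mul_zero]
    · rw [if_neg h1, Pi.single_eq_of_ne (by simp [Ne.symm h1]), mul_zero]
  simp only [fockAnn_apply, h, smul_add, Finset.sum_add_distrib, Finset.mul_sum, mul_smul_comm]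
  congr 1
  simp only [smul_ite, smul_zero, Finset.sum_ite_eq', Finset.mem_univ, if_true]

theorem fockAnn_comm (i j : Fin n) (k l : ℕ+) :
    fockAnn φ c i k * fockAnn φ c j l = fockAnn φ c j l * fockAnn φ c i k := by
  have hp : ∀ a b : Fin n × ℕ+, ∀ P : Fock 𝕜 n, MvPolynomial.pderiv a (MvPolynomial.pderiv b P) =
      MvPolynomial.pderiv b (MvPolynomial.pderiv a P) := by
    intro a b P
    have : ⁅MvPolynomial.pderiv (R := 𝕜) a, MvPolynomial.pderiv (R := 𝕜) b⁆ = 0 := by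
      refine MvPolynomial.derivation_ext fun x => ?_
      classical
      rw [Derivation.commutator_apply]
      simp only [MvPolynomial.pderiv_X, Pi.single_apply]
      split_ifs <;> simp
    have h2 := DFunLike.congr_fun this P
    rw [Derivation.commutator_apply] at h2
    exact sub_eq_zero.mp h2
  refine LinearMap.ext fun P => ?_
  simp only [Module.End.mul_apply, fockAnn_apply, map_sum, map_smul, Finset.smul_sum]
  rw [Finset.sum_comm]
  refine Finset.sum_congr rfl fun a _ => Finset.sum_congr rfl fun b _ => ?_
  rw [hp, smul_comm]

/-- The Heisenberg relations. -/
theorem fockH_comm (hc : ∀ i j k, c j i (-k) = -c i j k) (i j : Fin n) {k l : ℤ} (hk : k ≠ 0)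
    (hl : l ≠ 0) : fockH φ c i k * fockH φ c j l - fockH φ c j l * fockH φ c i k =
      if k = -l then c i j k • 1 else 0 := by
  obtain ⟨k, rfl | rfl⟩ := exists_annIdx φ hk <;> obtain ⟨l, rfl | rfl⟩ := exists_annIdx φ hl
  · rw [fockH_annIdx, fockH_annIdx, fockAnn_comm, sub_self, if_neg (annIdx_ne_neg φ k l)]
  · rw [fockH_annIdx, fockH_neg_annIdx, neg_neg]
    refine LinearMap.ext fun P => ?_
    rw [LinearMap.sub_apply, Module.End.mul_apply, Module.End.mul_apply, LinearMap.mulLeft_apply,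
      LinearMap.mulLeft_apply, fockAnn_X_mul, add_sub_cancel_left]
    by_cases h : k = l
    · subst h; simp
    · rw [if_neg h, if_neg fun h' => h (annIdx_injective φ h')]; simp
  · rw [fockH_annIdx, fockH_neg_annIdx]
    refine LinearMap.ext fun P => ?_
    rw [LinearMap.sub_apply, Module.End.mul_apply, Module.End.mul_apply, LinearMap.mulLeft_apply,
      LinearMap.mulLeft_apply, fockAnn_X_mul, sub_add_cancel_left]
    by_cases h : l = k
    · subst h
      have h2 : c i j (-annIdx φ l) = -c j i (annIdx φ l) := by
        rw [← hc j i]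
      simp [h2]
    · rw [if_neg h, if_neg fun h' => h (annIdx_injective φ (neg_injective h').symm)]; simp
  · rw [fockH_neg_annIdx, fockH_neg_annIdx, if_neg]
    · refine LinearMap.ext fun P => ?_
      simp only [LinearMap.sub_apply, Module.End.mul_apply, LinearMap.mulLeft_apply,
        LinearMap.zero_apply]
      ring
    · rw [neg_neg]; exact (annIdx_ne_neg φ l k).symm

theorem fockH_annIdx_one (i : Fin n) (k : ℕ+) : fockH φ c i (annIdx φ k) 1 = 0 := by
  rw [fockH_annIdx, fockAnn_apply]
  simp

/-- The weights of the variables. -/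
def fockWt (n : ℕ) (x : Fin n × ℕ+) : ℤ := -annIdx φ x.2

/-- The degree of a monomial. -/
def fockDeg (s : (Fin n × ℕ+) →₀ ℕ) : ℤ := Finsupp.weight (fockWt φ n) s

theorem fockDeg_zero : fockDeg φ (0 : (Fin n × ℕ+) →₀ ℕ) = 0 := map_zero _

theorem fockDeg_single_add (x : Fin n × ℕ+) (s : (Fin n × ℕ+) →₀ ℕ) :
    fockDeg φ (Finsupp.single x 1 + s) = fockDeg φ s + -annIdx φ x.2 := by
  rw [fockDeg, map_add, Finsupp.weight_single, one_smul, fockWt, add_comm]; rfl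

/-- The operator multiplying each monomial by a scalar. -/
def diagOp {σ : Type*} (f : (σ →₀ ℕ) → 𝕜) : Module.End 𝕜 (MvPolynomial σ 𝕜) :=
  (MvPolynomial.basisMonomials σ 𝕜).constr 𝕜 fun s => MvPolynomial.monomial s (f s)

theorem diagOp_monomial {σ : Type*} (f : (σ →₀ ℕ) → 𝕜) (s : σ →₀ ℕ) (a : 𝕜) :
    diagOp f (MvPolynomial.monomial s a) = f s • MvPolynomial.monomial s a := by
  have h : diagOp f (MvPolynomial.monomial s 1) = MvPolynomial.monomial s (f s) := by
    have := (MvPolynomial.basisMonomials σ 𝕜).constr_basis 𝕜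
      (fun s => MvPolynomial.monomial s (f s)) s
    rwa [MvPolynomial.coe_basisMonomials] at this
  have e : MvPolynomial.monomial s a = a • MvPolynomial.monomial s (1 : 𝕜) := by
    rw [MvPolynomial.smul_monomial, smul_eq_mul, mul_one]
  rw [e, map_smul, h, MvPolynomial.smul_monomial, MvPolynomial.smul_monomial,
    MvPolynomial.smul_monomial, smul_eq_mul, smul_eq_mul, smul_eq_mul, mul_one, mul_comm]

theorem coeff_diagOp {σ : Type*} (f : (σ →₀ ℕ) → 𝕜) (P : MvPolynomial σ 𝕜) (s : σ →₀ ℕ) :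
    (diagOp f P).coeff s = f s * P.coeff s := by
  classical
  induction P using MvPolynomial.induction_on' with
  | monomial t a =>
    rw [diagOp_monomial, MvPolynomial.coeff_smul, MvPolynomial.coeff_monomial, smul_eq_mul]
    split_ifs with h
    · rw [h]
    · rw [mul_zero, mul_zero]
  | add P Q hP hQ => rw [map_add, MvPolynomial.coeff_add, MvPolynomial.coeff_add, hP, hQ, mul_add]

theorem diagOp_one {σ : Type*} (f : (σ →₀ ℕ) → 𝕜) : diagOp f 1 = f 0 • 1 := diagOp_monomial f 0 1

theorem fock_ext {σ : Type*} {W : Type*} [AddCommGroup W] [Module 𝕜 W]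
    {A B : MvPolynomial σ 𝕜 →ₗ[𝕜] W}
    (h : ∀ s, A (MvPolynomial.monomial s 1) = B (MvPolynomial.monomial s 1)) : A = B := by
  refine (MvPolynomial.basisMonomials σ 𝕜).ext fun s => ?_
  rw [MvPolynomial.coe_basisMonomials]; exact h s

theorem diagOp_mul {σ : Type*} (f g : (σ →₀ ℕ) → 𝕜) :
    diagOp f * diagOp g = diagOp fun s => f s * g s := by
  refine fock_ext fun s => ?_
  rw [Module.End.mul_apply, diagOp_monomial, diagOp_monomial, map_smul, diagOp_monomial, smul_smul,
    mul_comm]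

/-- `fockH` with index k shifts the degree by k. Suitable f and g yield D h = q^k h D in the quantum
case and [d, h] = k h in the classical one. -/
theorem diagOp_fockH (i : Fin n) {k : ℤ} (hk : k ≠ 0) (f g : ((Fin n × ℕ+) →₀ ℕ) → 𝕜)
    (hfg : ∀ s s', fockDeg φ s' = fockDeg φ s + k → f s' = g s) :
    diagOp f * fockH φ c i k = fockH φ c i k * diagOp g := by
  refine fock_ext fun s => ?_
  rw [Module.End.mul_apply, Module.End.mul_apply, diagOp_monomial, map_smul]
  obtain ⟨k, rfl | rfl⟩ := exists_annIdx φ hk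
  · rw [fockH_annIdx, fockAnn_apply, map_sum, Finset.smul_sum]
    refine Finset.sum_congr rfl fun j _ => ?_
    rw [map_smul, smul_comm (g s), MvPolynomial.pderiv_monomial, diagOp_monomial]
    congr 1
    rcases Nat.eq_zero_or_pos (s (j, k)) with h | h
    · rw [h]; simp
    · congr 1
      refine hfg s _ ?_
      have e : Finsupp.single (j, k) 1 + (s - Finsupp.single (j, k) 1) = s := by
        refine add_tsub_cancel_of_le ?_
        rwa [Finsupp.single_le_iff]
      conv_rhs => rw [← e, fockDeg_single_add]
      ring
  · rw [fockH_neg_annIdx, LinearMap.mulLeft_apply, MvPolynomial.X, MvPolynomial.monomial_mul,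
      diagOp_monomial]
    rw [hfg s _ (fockDeg_single_add φ (i, k) s)]

/-- A subspace of Fock space stable under the Heisenberg algebra is trivial when the pairings are
nondegenerate. -/
theorem fock_irreducible [CharZero 𝕜] (hdet : ∀ k, (Matrix.of fun i j => c i j (annIdx φ k)).det ≠ 0)
    (W : Submodule 𝕜 (Fock 𝕜 n)) (hW : ∀ i k, k ≠ 0 → ∀ P ∈ W, fockH φ c i k P ∈ W) :
    W = ⊥ ∨ W = ⊤ := by
  have hX : ∀ x, ∀ P ∈ W, MvPolynomial.X x * P ∈ W := by
    rintro ⟨i, k⟩ P hP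
    have := hW i _ (neg_annIdx_ne_zero φ k) P hP
    rwa [fockH_neg_annIdx] at this
  have hD : ∀ x, ∀ P ∈ W, MvPolynomial.pderiv x P ∈ W := by
    rintro ⟨j, k⟩ P hP
    set A := Matrix.of fun i j => c i j (annIdx φ k) with hA
    have h1 : ∀ i, ∑ j, A i j • MvPolynomial.pderiv (j, k) P ∈ W := by
      intro i
      have := hW i _ (annIdx_ne_zero φ k) P hP
      rwa [fockH_annIdx, fockAnn_apply] at this
    -- Inverting the pairing matrix recovers each single partial derivative from the annihilation
    -- operators.
    have h2 : ∑ i, A⁻¹ j i • ∑ j', A i j' • MvPolynomial.pderiv (j', k) P ∈ W :=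
      sum_mem fun i _ => W.smul_mem _ (h1 i)
    have h3 : ∑ i, A⁻¹ j i • ∑ j', A i j' • MvPolynomial.pderiv (j', k) P =
        MvPolynomial.pderiv (j, k) P := by
      simp only [Finset.smul_sum, smul_smul]
      rw [Finset.sum_comm]
      simp only [← Finset.sum_smul, ← Matrix.mul_apply]
      rw [Matrix.nonsing_inv_mul A (isUnit_iff_ne_zero.mpr (hdet k))]
      simp [Matrix.one_apply]
    rwa [h3] at h2
  rw [or_iff_not_imp_left]
  intro hne
  obtain ⟨P₀, hP₀, hP₀'⟩ := Submodule.exists_mem_ne_zero_of_ne_bot hne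
  have h1 : (1 : Fock 𝕜 n) ∈ W := by
    by_contra hone
    have hconst : ∀ P ∈ W, (∀ s, s ≠ 0 → P.coeff s = 0) → P = 0 := by
      intro P hP h
      have hd : P = MvPolynomial.C (P.coeff 0) := by
        ext s
        rw [MvPolynomial.coeff_C]
        split_ifs with h0
        · rw [h0]
        · exact h s (Ne.symm h0)
      by_contra hP0
      have hc0 : P.coeff 0 ≠ 0 := fun h => hP0 (by rw [hd, h, map_zero])
      apply hone
      have := W.smul_mem (P.coeff 0)⁻¹ hP
      rw [hd, MvPolynomial.smul_eq_C_mul, MvPolynomial.coeff_C, if_pos rfl, ← map_mul,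
        inv_mul_cancel₀ hc0, map_one] at this
      exact this
    -- If 1 is not in W, then W contains no nonzero constant. Differentiation lowers the degree
    -- bound, and in characteristic zero a polynomial with vanishing derivatives is constant, so by
    -- induction W would be zero.
    have key : ∀ d : ℕ, ∀ P ∈ W, (∀ s, d < Finsupp.degree s → P.coeff s = 0) → P = 0 := by
      intro d
      induction d with
      | zero =>
        intro P hP hd
        refine hconst P hP fun s hs => hd s (Nat.pos_of_ne_zero ?_)
        rwa [Ne, Finsupp.degree_eq_zero_iff]
      | succ d ih =>
        intro P hP hd
        have hder : ∀ x, MvPolynomial.pderiv x P = 0 := by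
          intro x
          refine ih _ (hD x P hP) fun s hs => ?_
          rw [MvPolynomial.coeff_pderiv, hd, zero_mul]
          rw [map_add, Finsupp.degree_single]
          omega
        refine hconst P hP fun s hs => ?_
        obtain ⟨x, hx⟩ := Finsupp.ne_iff.mp hs
        have h2 := congrArg (MvPolynomial.coeff (s - Finsupp.single x 1)) (hder x)
        rw [MvPolynomial.coeff_pderiv, MvPolynomial.coeff_zero,
          Finsupp.sub_add_single_one_cancel hx] at h2
        refine (mul_eq_zero.mp h2).resolve_right ?_
        exact Nat.cast_add_one_ne_zero _
    refine hP₀' (key P₀.totalDegree P₀ hP₀ fun s hs => ?_)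
    by_contra h
    exact absurd (MvPolynomial.le_totalDegree (MvPolynomial.mem_support_iff.mpr h)) (not_le.mpr hs)
  rw [eq_top_iff]
  rintro P -
  induction P using MvPolynomial.induction_on with
  | C a =>
    have := W.smul_mem a h1
    rwa [MvPolynomial.smul_eq_C_mul, mul_one] at this
  | add P Q hP hQ => exact add_mem hP hQ
  | mul_X P x hP => rw [mul_comm]; exact hX x P hP

/-- The module map out of a polynomial ring determined by commuting operators. -/
theorem exists_polynomial_map {σ M : Type*} [AddCommGroup M] [Module 𝕜 M]
    (H : σ → Module.End 𝕜 M) (hH : ∀ x y, H x * H y = H y * H x) (v : M) :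
    ∃ f : MvPolynomial σ 𝕜 →ₗ[𝕜] M, f 1 = v ∧ ∀ x P, f (MvPolynomial.X x * P) = H x (f P) := by
  -- Commuting operators generate a commutative algebra, to which the universal property of
  -- polynomials applies. The map sought is evaluation of its operators at v.
  have : IsMulCommutative (Algebra.adjoin 𝕜 (Set.range H)) :=
    Algebra.isMulCommutative_adjoin 𝕜 (by rintro _ ⟨x, rfl⟩ _ ⟨y, rfl⟩; exact hH x y)
  let _ : CommRing (Algebra.adjoin 𝕜 (Set.range H)) :=
    { (Algebra.adjoin 𝕜 (Set.range H)).toRing with mul_comm := this.is_comm.comm }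
  let g : MvPolynomial σ 𝕜 →ₐ[𝕜] Algebra.adjoin 𝕜 (Set.range H) :=
    MvPolynomial.aeval fun x => ⟨H x, Algebra.subset_adjoin ⟨x, rfl⟩⟩
  refine ⟨LinearMap.applyₗ v ∘ₗ (Subalgebra.val _).toLinearMap ∘ₗ g.toLinearMap, ?_, ?_⟩
  · simp
  · intro x P
    have : ((g (MvPolynomial.X x * P) : Algebra.adjoin 𝕜 (Set.range H)) : Module.End 𝕜 M) =
        H x * (g P : Module.End 𝕜 M) := by
      rw [map_mul, MvPolynomial.aeval_X]; rfl
    exact LinearMap.congr_fun this v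

end Fock

end QHeis

namespace QHeis

/-! ### The Fock space realization of `N_q` -/

theorem fock_hom_ext {𝕜 σ W : Type*} [Field 𝕜] [AddCommGroup W] [Module 𝕜 W]
    {A B : MvPolynomial σ 𝕜 →ₗ[𝕜] W} (h0 : A 1 = B 1)
    (h1 : ∀ x P, A P = B P → A (MvPolynomial.X x * P) = B (MvPolynomial.X x * P)) : A = B := by
  refine LinearMap.ext fun P => ?_
  induction P using MvPolynomial.induction_on with
  | C a =>
    have e : (MvPolynomial.C a : MvPolynomial σ 𝕜) = a • 1 := by
      rw [MvPolynomial.smul_eq_C_mul, mul_one]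
    rw [e, map_smul, map_smul, h0]
  | add P Q hP hQ => rw [map_add, map_add, hP, hQ]
  | mul_X P x hP => rw [mul_comm]; exact h1 x P hP

variable {n : ℕ} (C : CartanDatum n) (φ : ℕ+ → ℤˣ) (lam : Weight n)

theorem hxCoeff_neg (i j : Fin n) (k : ℤ) : hxCoeff C i j (-k) = hxCoeff C i j k := by
  rw [hxCoeff, hxCoeff, neg_mul, qInt_neg, Int.cast_neg]
  rcases eq_or_ne k 0 with rfl | hk
  · simp
  · have : (k : Kq) ≠ 0 := by exact_mod_cast hk
    field_simp

/-- Antisymmetry of the bracket of the h's. It rests on d_i a_{ij} = d_j a_{ji}, which makes [k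
a_{ij}]_{q_i}/(q_j - q_j⁻¹) symmetric in i and j. -/
theorem hhCoeff_neg (Γ : Kq) (i j : Fin n) (k : ℤ) :
    hhCoeff C Γ j i (-k) = -hhCoeff C Γ i j k := by
  have h : hxCoeff C j i k * (qi C i - (qi C i)⁻¹)⁻¹ = hxCoeff C i j k * (qi C j - (qi C j)⁻¹)⁻¹ := by
    have h1 := (isGeneric_qi C i).sub_inv_ne
    have h2 := (isGeneric_qi C j).sub_inv_ne
    have h3 := sub_mul_qInt C i (k * C.a i j)
    have h4 := sub_mul_qInt C j (k * C.a j i)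
    have e : (C.d i : ℤ) * (k * C.a i j) = C.d j * (k * C.a j i) := by
      have := C.symm i j
      linear_combination k * this
    rw [qi_zpow, qi_zpow, mul_neg, e, ← mul_neg, ← qi_zpow, ← qi_zpow, ← h4] at h3
    rw [hxCoeff, hxCoeff]
    generalize qi C i - (qi C i)⁻¹ = t at *
    generalize qi C j - (qi C j)⁻¹ = u at *
    field_simp
    linear_combination -(k : Kq)⁻¹ * h3
  rw [hhCoeff, hhCoeff, hxCoeff_neg, h, mul_neg, neg_neg]
  ring

/-- Fock space as a module over the Cartan generators. -/
def fockModule : CartanModule C (qh ^ lam.c) (Fock Kq n) where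
  h := fockH φ (hhCoeff C (qh ^ lam.c))
  K i := q ^ lam.h i
  D := diagOp fun s => q ^ (lam.d + fockDeg φ s)
  Dinv := diagOp fun s => (q ^ (lam.d + fockDeg φ s))⁻¹
  gamma_ne := zpow_ne_zero _ qh_ne_zero
  K_ne _ := zpow_ne_zero _ q_ne_zero
  D_mul_Dinv := by
    rw [diagOp_mul]
    refine fock_ext fun s => ?_
    rw [diagOp_monomial, mul_inv_cancel₀ (zpow_ne_zero _ q_ne_zero), one_smul, Module.End.one_apply]
  Dinv_mul_D := by
    rw [diagOp_mul]
    refine fock_ext fun s => ?_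
    rw [diagOp_monomial, inv_mul_cancel₀ (zpow_ne_zero _ q_ne_zero), one_smul, Module.End.one_apply]
  D_h i k hk := by
    rw [diagOp_fockH φ _ i hk _ (fun s => q ^ k * q ^ (lam.d + fockDeg φ s)) fun s s' h => by
      rw [h, ← zpow_add₀ q_ne_zero]; congr 1; ring, ← mul_smul_comm]
    congr 1
    refine fock_ext fun s => ?_
    rw [diagOp_monomial, LinearMap.smul_apply, diagOp_monomial, smul_smul]
  h_h i j k l hk hl := fockH_comm φ _ (hhCoeff_neg C _) i j hk hl

/-! ### The Cartan generators on the imaginary Verma module and the comparison with Fock space -/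

theorem toUq_rel {a b : Free n} (h : Rel C a b) : toUq C a = toUq C b :=
  RingQuot.mkAlgHom_rel Kq h

theorem toUq_surjective : Function.Surjective (toUq C) := RingQuot.mkAlgHom_surjective Kq (Rel C)

theorem smul_vLam {y : Uq C} (h : VermaRel C φ lam y) : y • vLam C φ lam = 0 := by
  have h1 : y • vLam C φ lam = (vermaIdeal C φ lam).mkQ (y * 1) := rfl
  rw [h1, mul_one]
  exact (Submodule.Quotient.mk_eq_zero _).mpr (Submodule.subset_span h)

theorem exists_smul_vLam (y : Verma C φ lam) : ∃ a : Free n, y = toUq C a • vLam C φ lam := by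
  obtain ⟨b, rfl⟩ := (vermaIdeal C φ lam).mkQ_surjective y
  obtain ⟨a, rfl⟩ := toUq_surjective C b
  refine ⟨a, ?_⟩
  have h1 : toUq C a • vLam C φ lam = (vermaIdeal C φ lam).mkQ (toUq C a * 1) := rfl
  rw [h1, mul_one]

theorem gam_one : (Free.gam 1 : Free n) = FreeAlgebra.ι Kq Gen.gammaHalf := by
  simp [Free.gam]

theorem gam_neg_one : (Free.gam (-1) : Free n) = FreeAlgebra.ι Kq Gen.gammaHalfInv := by
  simp [Free.gam]

theorem gam_one_comm (a : Free n) :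
    toUq C (Free.gam 1) * toUq C a = toUq C a * toUq C (Free.gam 1) := by
  induction a using FreeAlgebra.induction with
  | grade0 r => rw [AlgHom.commutes, Algebra.commutes]
  | grade1 g =>
    have := toUq_rel C (Rel.gamma_central g)
    rwa [map_mul, map_mul] at this
  | mul a b ha hb => rw [map_mul, ← mul_assoc, ha, mul_assoc, hb, mul_assoc]
  | add a b ha hb => rw [map_add, mul_add, add_mul, ha, hb]

theorem gam_one_smul (y : Verma C φ lam) : toUq C (Free.gam 1) • y = qh ^ lam.c • y := by
  obtain ⟨a, rfl⟩ := exists_smul_vLam C φ lam y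
  have := smul_vLam C φ lam VermaRel.gamma
  rw [sub_smul, algebraMap_smul, sub_eq_zero] at this
  rw [← mul_smul, gam_one_comm, mul_smul, this, smul_comm]

theorem gam_neg_one_smul (y : Verma C φ lam) :
    toUq C (Free.gam (-1)) • y = (qh ^ lam.c)⁻¹ • y := by
  have h := toUq_rel C Rel.gamma_mul_inv
  rw [map_mul, map_one] at h
  have h2 : toUq C (Free.gam 1) • toUq C (Free.gam (-1)) • y = y := by
    rw [← mul_smul, h, one_smul]
  rw [gam_one_smul] at h2
  conv_rhs => rw [← h2]
  rw [inv_smul_smul₀ (zpow_ne_zero _ qh_ne_zero)]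

/-- The representation of the free algebra on the imaginary Verma module. -/
def vermaRep : Free n →ₐ[Kq] Module.End Kq (Verma C φ lam) :=
  (Algebra.lsmul Kq Kq (Verma C φ lam)).comp (toUq C)

theorem vermaRep_apply (a : Free n) (y : Verma C φ lam) :
    vermaRep C φ lam a y = toUq C a • y := rfl

theorem vermaRep_rel {a b : Free n} (h : Rel C a b) : vermaRep C φ lam a = vermaRep C φ lam b := by
  rw [vermaRep, AlgHom.comp_apply, AlgHom.comp_apply, toUq_rel C h]

theorem isCartanRep_vermaRep : IsCartanRep C (qh ^ lam.c) (vermaRep C φ lam) where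
  gamma_ne := zpow_ne_zero _ qh_ne_zero
  gammaHalf := by
    rw [← gam_one]
    exact LinearMap.ext fun y => gam_one_smul C φ lam y
  gammaHalfInv := by
    rw [← gam_neg_one]
    exact LinearMap.ext fun y => gam_neg_one_smul C φ lam y
  K_mul_Kinv i := by
    simpa only [map_mul, map_one] using vermaRep_rel C φ lam (Rel.K_mul_Kinv i)
  Kinv_mul_K i := by
    simpa only [map_mul, map_one] using vermaRep_rel C φ lam (Rel.Kinv_mul_K i)
  D_mul_Dinv := by simpa only [map_mul, map_one] using vermaRep_rel C φ lam Rel.D_mul_Dinv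
  Dinv_mul_D := by simpa only [map_mul, map_one] using vermaRep_rel C φ lam Rel.Dinv_mul_D
  D_K i := by simpa only [map_mul] using vermaRep_rel C φ lam (Rel.D_K i)
  K_K i j := by simpa only [map_mul] using vermaRep_rel C φ lam (Rel.K_K i j)
  K_h i j k := by simpa only [map_mul] using vermaRep_rel C φ lam (Rel.K_h i j k)
  D_h i k := by simpa only [map_mul, map_smul] using vermaRep_rel C φ lam (Rel.D_h i k)
  h_h i j k l hk hl := by
    have hg : ∀ m : ℤ, vermaRep C φ lam (Free.gam m) =
        algebraMap Kq _ ((qh ^ lam.c) ^ m) := by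
      intro m
      have h1 : vermaRep C φ lam (FreeAlgebra.ι Kq Gen.gammaHalf) =
          algebraMap Kq _ (qh ^ lam.c) := by
        rw [← gam_one]
        exact LinearMap.ext fun y => gam_one_smul C φ lam y
      have h2 : vermaRep C φ lam (FreeAlgebra.ι Kq Gen.gammaHalfInv) =
          algebraMap Kq _ (qh ^ lam.c)⁻¹ := by
        rw [← gam_neg_one]
        exact LinearMap.ext fun y => gam_neg_one_smul C φ lam y
      rw [Free.gam]
      split_ifs with h
      · rw [map_pow, h1, ← map_pow, ← zpow_natCast, Int.toNat_of_nonneg h]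
      · rw [map_pow, h2, ← map_pow, inv_pow, ← zpow_natCast (qh ^ lam.c),
          Int.toNat_of_nonneg (by omega), ← zpow_neg, neg_neg]
    have := vermaRep_rel C φ lam (Rel.h_h i j k l hk hl)
    rw [map_sub, map_mul, map_mul] at this
    rw [this]
    split_ifs with h
    · rw [map_smul, map_sub, hg, hg, ← map_sub, hhCoeff, hxCoeff, Algebra.smul_def,
        Algebra.smul_def, mul_one, ← map_mul]
    · rw [map_zero]

theorem h_ann_smul_vLam (i : Fin n) (k : ℕ+) :
    toUq C (Free.h i (annIdx φ k)) • vLam C φ lam = 0 :=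
  smul_vLam C φ lam (VermaRel.h i k)

theorem exists_fockMap : ∃ f : Fock Kq n →ₗ[Kq] Verma C φ lam, f 1 = vLam C φ lam ∧
    ∀ x P, f (MvPolynomial.X x * P) = toUq C (Free.h x.1 (-annIdx φ x.2)) • f P := by
  refine exists_polynomial_map (fun x : Fin n × ℕ+ => vermaRep C φ lam (Free.h x.1 (-annIdx φ x.2))) ?_ _
  intro x y
  have := (isCartanRep_vermaRep C φ lam).h_h x.1 y.1 _ _ (neg_annIdx_ne_zero φ x.2)
    (neg_annIdx_ne_zero φ y.2)
  rw [if_neg (by rw [neg_neg]; exact (annIdx_ne_neg φ y.2 x.2).symm)] at this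
  exact sub_eq_zero.mp this

/-- The map from Fock space to the imaginary Verma module. -/
def fockMap : Fock Kq n →ₗ[Kq] Verma C φ lam := (exists_fockMap C φ lam).choose

theorem fockMap_one : fockMap C φ lam 1 = vLam C φ lam := (exists_fockMap C φ lam).choose_spec.1

theorem fockMap_X_mul (x : Fin n × ℕ+) (P : Fock Kq n) : fockMap C φ lam (MvPolynomial.X x * P) =
    toUq C (Free.h x.1 (-annIdx φ x.2)) • fockMap C φ lam P :=
  (exists_fockMap C φ lam).choose_spec.2 x P

/-- For creation operators this holds by construction. For annihilation operators it follows by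
induction on monomials, since both sides kill the vacuum and obey the same commutation with
multiplication by a variable. -/
theorem fockMap_fockH (i : Fin n) {k : ℤ} (hk : k ≠ 0) (P : Fock Kq n) :
    fockMap C φ lam (fockH φ (hhCoeff C (qh ^ lam.c)) i k P) =
      toUq C (Free.h i k) • fockMap C φ lam P := by
  obtain ⟨k, rfl | rfl⟩ := exists_annIdx φ hk
  · have : fockMap C φ lam ∘ₗ fockH φ (hhCoeff C (qh ^ lam.c)) i (annIdx φ k) =
        vermaRep C φ lam (Free.h i (annIdx φ k)) ∘ₗ fockMap C φ lam := by
      refine fock_hom_ext ?_ fun x P hP => ?_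
      · rw [LinearMap.comp_apply, LinearMap.comp_apply, fockH_annIdx_one, map_zero, fockMap_one,
          vermaRep_apply, h_ann_smul_vLam]
      · rw [LinearMap.comp_apply, LinearMap.comp_apply] at *
        rw [fockH_annIdx, fockAnn_X_mul, map_add, fockMap_X_mul, ← fockH_annIdx, hP, fockMap_X_mul,
          ← vermaRep_apply, ← vermaRep_apply, ← Module.End.mul_apply, ← Module.End.mul_apply]
        have h := LinearMap.congr_fun ((isCartanRep_vermaRep C φ lam).h_h i x.1 (annIdx φ k) _
          (annIdx_ne_zero φ k) (neg_annIdx_ne_zero φ x.2)) (fockMap C φ lam P)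
        rw [LinearMap.sub_apply, sub_eq_iff_eq_add'] at h
        rw [h, neg_neg]
        congr 1
        by_cases hkx : k = x.2
        · rw [if_pos hkx, if_pos (by rw [hkx]), map_smul]; rfl
        · rw [if_neg hkx, if_neg fun h' => hkx (annIdx_injective φ h'), map_zero]; rfl
    exact LinearMap.congr_fun this P
  · rw [fockH_neg_annIdx, LinearMap.mulLeft_apply, fockMap_X_mul]

/-- Composed with the map from the Verma module to the radical quotient, `fockMap` becomes the
embedding of Fock space as the vectors of the empty word. Hence the relations of U_q(𝔤) impose no
further relations on N_q. -/
theorem fockMap_injective : Function.Injective (fockMap C φ lam) := by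
  obtain ⟨f, ι, hι, hf, hfh⟩ := CartanModule.exists_verma_map φ lam (fockModule C φ lam) 1
    (fun i k => fockH_annIdx_one φ _ i k) (fun i => rfl) (by
      change diagOp _ 1 = _
      rw [diagOp_one, fockDeg_zero, add_zero])
  have h : f ∘ₗ fockMap C φ lam = ι := by
    refine fock_hom_ext ?_ fun x P hP => ?_
    · rw [LinearMap.comp_apply, fockMap_one, hf]
    · rw [LinearMap.comp_apply] at *
      rw [fockMap_X_mul, hfh _ _ _ _ (neg_annIdx_ne_zero φ x.2) hP]
      congr 1
      change fockH φ _ x.1 (-annIdx φ x.2) P = _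
      rw [fockH_neg_annIdx]; rfl
  refine Function.Injective.of_comp (f := f) ?_
  rw [← LinearMap.coe_comp, h]
  exact hι

theorem K_smul_fockMap (i : Fin n) (P : Fock Kq n) :
    toUq C (Free.K i) • fockMap C φ lam P = q ^ lam.h i • fockMap C φ lam P := by
  have : vermaRep C φ lam (Free.K i) ∘ₗ fockMap C φ lam = q ^ lam.h i • fockMap C φ lam := by
    refine fock_hom_ext ?_ fun x P hP => ?_
    · have := smul_vLam C φ lam (VermaRel.K i)
      rw [sub_smul, algebraMap_smul, sub_eq_zero] at this
      rw [LinearMap.comp_apply, fockMap_one, vermaRep_apply, this, LinearMap.smul_apply,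
        fockMap_one]
    · rw [LinearMap.comp_apply, LinearMap.smul_apply] at *
      rw [fockMap_X_mul, ← vermaRep_apply, ← Module.End.mul_apply,
        (isCartanRep_vermaRep C φ lam).K_h, Module.End.mul_apply, hP, map_smul]
  exact LinearMap.congr_fun this P

theorem D_smul_fockMap (P : Fock Kq n) : toUq C Free.D • fockMap C φ lam P =
    fockMap C φ lam (diagOp (fun s => q ^ (lam.d + fockDeg φ s)) P) := by
  have : vermaRep C φ lam Free.D ∘ₗ fockMap C φ lam =
      fockMap C φ lam ∘ₗ diagOp (fun s => q ^ (lam.d + fockDeg φ s)) := by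
    refine fock_hom_ext ?_ fun x P hP => ?_
    · have := smul_vLam C φ lam VermaRel.D
      rw [sub_smul, algebraMap_smul, sub_eq_zero] at this
      rw [LinearMap.comp_apply, fockMap_one, vermaRep_apply, this, LinearMap.comp_apply,
        diagOp_one, map_smul, fockMap_one, fockDeg_zero, add_zero]
    · rw [LinearMap.comp_apply, LinearMap.comp_apply] at *
      have h := LinearMap.congr_fun ((fockModule C φ lam).D_h x.1 _ (neg_annIdx_ne_zero φ x.2)) P
      replace h : diagOp (fun s => q ^ (lam.d + fockDeg φ s))
          (fockH φ (hhCoeff C (qh ^ lam.c)) x.1 (-annIdx φ x.2) P) = q ^ (-annIdx φ x.2) •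
          fockH φ (hhCoeff C (qh ^ lam.c)) x.1 (-annIdx φ x.2)
            (diagOp (fun s => q ^ (lam.d + fockDeg φ s)) P) := h
      rw [fockH_neg_annIdx, LinearMap.mulLeft_apply, LinearMap.mulLeft_apply] at h
      rw [fockMap_X_mul, ← vermaRep_apply, ← Module.End.mul_apply,
        (isCartanRep_vermaRep C φ lam).D_h, h, LinearMap.smul_apply, Module.End.mul_apply, hP,
        map_smul, fockMap_X_mul]
      rfl
  exact LinearMap.congr_fun this P

theorem D_smul_fockMap_monomial (s : (Fin n × ℕ+) →₀ ℕ) (a : Kq) :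
    toUq C Free.D • fockMap C φ lam (MvPolynomial.monomial s a) =
      q ^ (lam.d + fockDeg φ s) • fockMap C φ lam (MvPolynomial.monomial s a) := by
  rw [D_smul_fockMap, diagOp_monomial, map_smul]

/-! ### `G_q`-submodules -/

/-- A subspace stable under the `h_{ik}` is stable under `G_q`. -/
def gqSubmodule (W : Submodule Kq (Verma C φ lam))
    (hW : ∀ i k, k ≠ 0 → ∀ y ∈ W, toUq C (Free.h i k) • y ∈ W) :
    Submodule (Gq C) (Verma C φ lam) where
  toAddSubmonoid := W.toAddSubmonoid
  smul_mem' := by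
    rintro ⟨g, hg⟩ y hy
    change g • y ∈ W
    induction hg using Algebra.adjoin_induction generalizing y with
    | mem g hg =>
      obtain ⟨_, ⟨i, k, hk, rfl⟩ | rfl | rfl, rfl⟩ := hg
      · exact hW i k hk y hy
      · rw [gam_one_smul]; exact W.smul_mem _ hy
      · rw [gam_neg_one_smul]; exact W.smul_mem _ hy
    | algebraMap r => rw [algebraMap_smul]; exact W.smul_mem _ hy
    | add a b _ _ ha hb => rw [add_smul]; exact W.add_mem (ha hy) (hb hy)
    | mul a b _ _ ha hb => rw [mul_smul]; exact ha (hb hy)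

theorem mem_gqSubmodule {W : Submodule Kq (Verma C φ lam)}
    {hW : ∀ i k, k ≠ 0 → ∀ y ∈ W, toUq C (Free.h i k) • y ∈ W} {y : Verma C φ lam} :
    y ∈ gqSubmodule C φ lam W hW ↔ y ∈ W := Iff.rfl

theorem h_mem_Gq (i : Fin n) {k : ℤ} (hk : k ≠ 0) : toUq C (Free.h i k) ∈ Gq C :=
  Algebra.subset_adjoin ⟨_, Or.inl ⟨i, k, hk, rfl⟩, rfl⟩

theorem h_smul_mem (W : Submodule (Gq C) (Verma C φ lam)) (i : Fin n) {k : ℤ} (hk : k ≠ 0)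
    {y : Verma C φ lam} (hy : y ∈ W) : toUq C (Free.h i k) • y ∈ W :=
  W.smul_mem (⟨_, h_mem_Gq C i hk⟩ : Gq C) hy

/-- The image contains v_λ and is stable under all h_{ik}, because annihilation operators act on it
through differentiation. So monomials in creation operators alone already span N_q. -/
theorem range_fockMap : LinearMap.range (fockMap C φ lam) = (Nq C φ lam).restrictScalars Kq := by
  refine le_antisymm ?_ ?_
  · rintro _ ⟨P, rfl⟩
    rw [Submodule.restrictScalars_mem]
    induction P using MvPolynomial.induction_on with
    | C a =>
      have e : (MvPolynomial.C a : Fock Kq n) = a • 1 := by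
        rw [MvPolynomial.smul_eq_C_mul, mul_one]
      rw [e, map_smul, fockMap_one]
      have h1 : vLam C φ lam ∈ Nq C φ lam := Submodule.mem_span_singleton_self _
      exact ((Nq C φ lam).restrictScalars Kq).smul_mem a h1
    | add P Q hP hQ => rw [map_add]; exact add_mem hP hQ
    | mul_X P x hP =>
      rw [mul_comm, fockMap_X_mul]
      exact h_smul_mem C φ lam _ _ (neg_annIdx_ne_zero φ x.2) hP
  · have h : Nq C φ lam ≤ gqSubmodule C φ lam (LinearMap.range (fockMap C φ lam)) (by
        rintro i k hk _ ⟨P, rfl⟩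
        exact ⟨_, fockMap_fockH C φ lam i hk P⟩) := by
      rw [Nq, Submodule.span_singleton_le_iff_mem, mem_gqSubmodule]
      exact ⟨1, fockMap_one C φ lam⟩
    exact fun y hy => h hy

theorem mem_Nq_iff {y : Verma C φ lam} : y ∈ Nq C φ lam ↔ ∃ P, fockMap C φ lam P = y := by
  rw [← Submodule.restrictScalars_mem Kq, ← range_fockMap, LinearMap.mem_range]

end QHeis

namespace QHeis

variable {n : ℕ} (C : CartanDatum n) (φ : ℕ+ → ℤˣ) (lam : Weight n)

/-! ### The pairing and its specialization -/

/-- The value of `[h_i ⊗ t^k, h_j ⊗ t^{-k}]` in level `c`. -/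
def clCoeff (c : ℤ) (i j : Fin n) (k : ℤ) : ℂ := k * ((C.a i j : ℂ) / (C.d j : ℂ)) * c

theorem qh_zpow_two_mul (c k : ℤ) : (qh ^ c) ^ (2 * k) = q ^ (k * c) := by
  rw [q_zpow, ← zpow_mul]; congr 1; ring

/-- A factorization whose three factors each lie in 𝔸: a complex constant, a quantum integer and a
ratio of the type in `qInt_div_mem`. -/
theorem hhCoeff_eq (c : ℤ) (i j : Fin n) (k : ℤ) : hhCoeff C (qh ^ c) i j k =
    algebraMap ℂ Kq (k : ℂ)⁻¹ * qInt (qi C i) (k * C.a i j) *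
      ((q ^ (C.d j : ℤ) - q ^ (-(C.d j : ℤ)))⁻¹ * (q ^ (k * c) - q ^ (-(k * c)))) := by
  rw [hhCoeff, hxCoeff, qh_zpow_two_mul, show -(2 * k) = 2 * (-k) by ring, qh_zpow_two_mul, map_inv₀,
    map_intCast, zpow_neg q (C.d j), zpow_natCast, neg_mul, qi, qi, mul_assoc]

theorem hhCoeff_mem (c : ℤ) (i j : Fin n) (k : ℤ) : hhCoeff C (qh ^ c) i j k ∈ AA C := by
  rw [hhCoeff_eq]
  exact mul_mem (mul_mem (Subalgebra.algebraMap_mem _ _) (qInt_qi_mem C i _))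
    (qInt_div_mem C _ (C.d_pos j))

theorem evOne_hhCoeff (c : ℤ) (i j : Fin n) (k : ℤ) :
    evOne C ⟨hhCoeff C (qh ^ c) i j k, hhCoeff_mem C c i j k⟩ = clCoeff C c i j k := by
  have e : (⟨hhCoeff C (qh ^ c) i j k, hhCoeff_mem C c i j k⟩ : AA C) =
      algebraMap ℂ (AA C) (k : ℂ)⁻¹ * ⟨qInt (qi C i) (k * C.a i j), qInt_qi_mem C i _⟩ *
        ⟨_, qInt_div_mem C (k * c) (C.d_pos j)⟩ := Subtype.ext (hhCoeff_eq C c i j k)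
  rw [e, map_mul, map_mul, AlgHom.commutes, evOne_qInt_qi, evOne_qInt_div C _ (C.d_pos j), clCoeff]
  simp only [Algebra.algebraMap_self, RingHom.id_apply]
  push_cast
  rcases eq_or_ne k 0 with rfl | hk
  · simp
  · have : (k : ℂ) ≠ 0 := by exact_mod_cast hk
    field_simp

/-- The matrix is kc times the positive definite symmetrized Cartan matrix with both sides scaled by
the d_i⁻¹. -/
theorem det_clCoeff_ne_zero {c : ℤ} (hc : c ≠ 0) {k : ℤ} (hk : k ≠ 0) :
    (Matrix.of fun i j => clCoeff C c i j k).det ≠ 0 := by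
  set B : Matrix (Fin n) (Fin n) ℝ := Matrix.of fun i j => ((C.d i : ℝ) * (C.a i j : ℝ)) with hB
  have hd : ∀ i, (C.d i : ℂ) ≠ 0 := fun i => by exact_mod_cast (C.d_pos i).ne'
  have e : (Matrix.of fun i j => clCoeff C c i j k) =
      Matrix.diagonal (fun i => (k : ℂ) * c * (C.d i : ℂ)⁻¹) * B.map Complex.ofRealHom *
        Matrix.diagonal fun j => (C.d j : ℂ)⁻¹ := by
    ext i j
    rw [Matrix.mul_diagonal, Matrix.diagonal_mul]
    simp only [Matrix.of_apply, clCoeff, hB, Matrix.map_apply, map_mul, map_natCast, map_intCast]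
    have := hd i
    field_simp
  rw [e, Matrix.det_mul, Matrix.det_mul, Matrix.det_diagonal, Matrix.det_diagonal,
    ← RingHom.mapMatrix_apply, ← RingHom.map_det]
  have hB0 : Complex.ofRealHom B.det ≠ 0 := by
    have := C.posDef.det_pos.ne'
    simpa using this
  have hk' : (k : ℂ) ≠ 0 := by exact_mod_cast hk
  have hc' : (c : ℂ) ≠ 0 := by exact_mod_cast hc
  refine mul_ne_zero (mul_ne_zero ?_ hB0) ?_
  · exact Finset.prod_ne_zero_iff.mpr fun i _ => mul_ne_zero (mul_ne_zero hk' hc')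
      (inv_ne_zero (hd i))
  · exact Finset.prod_ne_zero_iff.mpr fun i _ => inv_ne_zero (hd i)

/-- The determinant lies in 𝔸 and its specialization is the classical determinant, which is nonzero.
-/
theorem det_hhCoeff_ne_zero {c : ℤ} (hc : c ≠ 0) {k : ℤ} (hk : k ≠ 0) :
    (Matrix.of fun i j => hhCoeff C (qh ^ c) i j k).det ≠ 0 := by
  let A : Matrix (Fin n) (Fin n) (AA C) :=
    Matrix.of fun i j => ⟨hhCoeff C (qh ^ c) i j k, hhCoeff_mem C c i j k⟩
  have h1 : evOne C A.det ≠ 0 := by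
    rw [AlgHom.map_det]
    convert det_clCoeff_ne_zero C hc hk using 2
    ext i j
    exact evOne_hhCoeff C c i j k
  have h2 : (AA C).val A.det = (Matrix.of fun i j => hhCoeff C (qh ^ c) i j k).det := by
    rw [AlgHom.map_det]; rfl
  rw [← h2]
  intro h0
  apply h1
  have : A.det = 0 := Subtype.ext h0
  rw [this, map_zero]

/-! ### The grading of `N_q` -/

/-- Different degrees have different D-eigenvalues because q is not a root of unity. -/
theorem q_zpow_injective : Function.Injective fun m : ℤ => q ^ m := by
  have key : ∀ m : ℤ, q ^ m = 1 → m = 0 := by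
    intro m hm
    by_contra h0
    have h1 : q ^ m.natAbs = 1 := by
      rcases Int.natAbs_eq m with h | h
      · rw [h, zpow_natCast] at hm; exact hm
      · rw [h, zpow_neg, zpow_natCast, inv_eq_one] at hm; exact hm
    rw [q, ← pow_mul] at h1
    exact qh_pow_ne_one (by omega) h1
  intro a b hab
  have : q ^ (a - b) = 1 := by
    rw [zpow_sub₀ q_ne_zero, div_eq_one_iff_eq (zpow_ne_zero _ q_ne_zero)]; exact hab
  have := key _ this
  omega

theorem fockMap_monomial_mem (s : (Fin n × ℕ+) →₀ ℕ) (a : Kq) :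
    fockMap C φ lam (MvPolynomial.monomial s a) ∈
      grading C (Nq C φ lam) lam.d (fockDeg φ s) := by
  refine ⟨?_, D_smul_fockMap_monomial C φ lam s a⟩
  rw [← range_fockMap]; exact ⟨_, rfl⟩

theorem h_smul_mem_grading (i : Fin n) {k : ℤ} (hk : k ≠ 0) (m : ℤ) {y : Verma C φ lam}
    (hy : y ∈ grading C (Nq C φ lam) lam.d m) :
    toUq C (Free.h i k) • y ∈ grading C (Nq C φ lam) lam.d (m + k) := by
  refine ⟨h_smul_mem C φ lam _ i hk hy.1, ?_⟩
  have h1 : toUq C Free.D • y = q ^ (lam.d + m) • y := hy.2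
  have h2 := LinearMap.congr_fun ((isCartanRep_vermaRep C φ lam).D_h i k) y
  change toUq C Free.D • toUq C (Free.h i k) • y = q ^ (lam.d + (m + k)) • toUq C (Free.h i k) • y
  replace h2 : toUq C Free.D • toUq C (Free.h i k) • y =
    q ^ k • toUq C (Free.h i k) • toUq C Free.D • y := h2
  rw [h2, h1, smul_comm (toUq C (Free.h i k)), smul_smul, ← zpow_add₀ q_ne_zero]
  congr 2; ring

theorem isGradedGq_Nq : IsGradedGq C (Nq C φ lam) (grading C (Nq C φ lam) lam.d) where
  independent := by
    have h1 := (Module.End.eigenspaces_iSupIndep (vermaRep C φ lam Free.D)).comp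
      (f := fun m : ℤ => q ^ (lam.d + m)) fun a b hab => by
        have := q_zpow_injective hab
        omega
    refine h1.mono fun m y hy => ?_
    exact Module.End.mem_eigenspace_iff.mpr hy.2
  iSup_eq := by
    refine le_antisymm (iSup_le fun m => inf_le_left) ?_
    rw [← range_fockMap]
    rintro _ ⟨P, rfl⟩
    induction P using MvPolynomial.induction_on' with
    | monomial s a =>
      exact Submodule.mem_iSup_of_mem (fockDeg φ s) (fockMap_monomial_mem C φ lam s a)
    | add P Q hP hQ => rw [map_add]; exact add_mem hP hQ
  h_mem i k m hk y hy := h_smul_mem_grading C φ lam i hk m hy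
  gamma_mem m y hy := by rw [gam_one_smul]; exact Submodule.smul_mem _ _ hy
  gammaInv_mem m y hy := by rw [gam_neg_one_smul]; exact Submodule.smul_mem _ _ hy

/-! ### Irreducibility -/

theorem vLam_mem_Nq : vLam C φ lam ∈ Nq C φ lam := Submodule.mem_span_singleton_self _

theorem vLam_ne_zero : vLam C φ lam ≠ 0 := by
  rw [← fockMap_one, Ne, map_eq_zero_iff _ (fockMap_injective C φ lam)]
  exact one_ne_zero

theorem Nq_ne_bot : Nq C φ lam ≠ ⊥ := fun h => vLam_ne_zero C φ lam (by
  have := vLam_mem_Nq C φ lam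
  rwa [h, Submodule.mem_bot] at this)

theorem eq_bot_or_eq_Nq (hc : lam.c ≠ 0) (W : Submodule (Gq C) (Verma C φ lam))
    (hW : W ≤ Nq C φ lam) : W = ⊥ ∨ W = Nq C φ lam := by
  have h := fock_irreducible φ (hhCoeff C (qh ^ lam.c))
    (fun k => det_hhCoeff_ne_zero C hc (annIdx_ne_zero φ k))
    ((W.restrictScalars Kq).comap (fockMap C φ lam)) fun i k hk P hP => by
      rw [Submodule.mem_comap, fockMap_fockH _ _ _ _ hk]
      exact h_smul_mem C φ lam W i hk hP
  rcases h with h | h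
  · left
    rw [Submodule.eq_bot_iff]
    intro y hy
    obtain ⟨P, rfl⟩ := (mem_Nq_iff C φ lam).mp (hW hy)
    have : P ∈ (W.restrictScalars Kq).comap (fockMap C φ lam) := hy
    rw [h, Submodule.mem_bot] at this
    rw [this, map_zero]
  · right
    refine le_antisymm hW fun y hy => ?_
    obtain ⟨P, rfl⟩ := (mem_Nq_iff C φ lam).mp hy
    have : P ∈ (W.restrictScalars Kq).comap (fockMap C φ lam) := by rw [h]; trivial
    exact this

theorem CartanDatum.nonempty {n : ℕ} (C : CartanDatum n) : Nonempty (Fin n) := by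
  rcases n with _ | n
  · have := C.coprime
    simp at this
  · exact ⟨0⟩

/-- In level zero, `N_q` has a proper nonzero graded submodule. -/
theorem exists_proper_submodule (hc : lam.c = 0) : ∃ W : Submodule (Gq C) (Verma C φ lam),
    W ≤ Nq C φ lam ∧ W ≠ ⊥ ∧ W ≠ Nq C φ lam ∧ W.restrictScalars Kq =
      ⨆ m, W.restrictScalars Kq ⊓ grading C (Nq C φ lam) lam.d m := by
  -- In level zero γ acts by 1, so the pairing is zero and only multiplication operators remain. The
  -- ideal of polynomials without constant term is then stable.
  have hann : ∀ i k (P : Fock Kq n), fockAnn φ (hhCoeff C (qh ^ lam.c)) i k P = 0 := by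
    intro i k P
    rw [fockAnn_apply]
    refine Finset.sum_eq_zero fun j _ => ?_
    rw [hhCoeff, hc]
    simp
  let A : Submodule Kq (Fock Kq n) := LinearMap.ker (MvPolynomial.lcoeff Kq 0)
  have hA : ∀ P, P ∈ A ↔ P.coeff 0 = 0 := fun P => Iff.rfl
  let W := gqSubmodule C φ lam (A.map (fockMap C φ lam)) (by
    rintro i k hk _ ⟨P, hP, rfl⟩
    refine ⟨_, ?_, fockMap_fockH C φ lam i hk P⟩
    obtain ⟨k, rfl | rfl⟩ := exists_annIdx φ hk
    · rw [fockH_annIdx, hann]; exact zero_mem A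
    · rw [fockH_neg_annIdx]
      change MvPolynomial.coeff 0 (MvPolynomial.X (i, k) * P) = 0
      rw [← MvPolynomial.constantCoeff_eq, map_mul, MvPolynomial.constantCoeff_X, zero_mul])
  refine ⟨W, ?_, ?_, ?_, ?_⟩
  · rintro _ ⟨P, _, rfl⟩
    exact (mem_Nq_iff C φ lam).mpr ⟨P, rfl⟩
  · obtain ⟨i⟩ := C.nonempty
    intro h
    have h1 : fockMap C φ lam (MvPolynomial.X (i, 1)) ∈ W :=
      ⟨_, by rw [SetLike.mem_coe, hA, ← MvPolynomial.constantCoeff_eq,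
        MvPolynomial.constantCoeff_X], rfl⟩
    rw [h, Submodule.mem_bot, map_eq_zero_iff _ (fockMap_injective C φ lam)] at h1
    exact MvPolynomial.X_ne_zero _ h1
  · intro h
    have h1 := vLam_mem_Nq C φ lam
    rw [← h] at h1
    obtain ⟨P, hP, hP'⟩ := h1
    rw [← fockMap_one] at hP'
    have := fockMap_injective C φ lam hP'
    rw [this, SetLike.mem_coe, hA, MvPolynomial.coeff_zero_one] at hP
    exact one_ne_zero hP
  · refine le_antisymm ?_ (iSup_le fun m => inf_le_left)
    rintro _ ⟨P, hP, rfl⟩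
    rw [← P.support_sum_monomial_coeff, map_sum]
    refine sum_mem fun s hs => Submodule.mem_iSup_of_mem (fockDeg φ s)
      ⟨⟨_, ?_, rfl⟩, fockMap_monomial_mem C φ lam s _⟩
    rw [SetLike.mem_coe, hA, MvPolynomial.coeff_monomial, if_neg]
    rintro rfl
    exact (MvPolynomial.mem_support_iff.mp hs) hP

theorem isIrreducibleInKq_iff : IsIrreducibleInKq C (Nq C φ lam)
    (grading C (Nq C φ lam) lam.d) ↔ lam.c ≠ 0 := by
  constructor
  · intro h hc
    obtain ⟨W, h1, h2, h3, h4⟩ := exists_proper_submodule C φ lam hc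
    exact (h.eq_bot_or_eq W h1 h4).elim h2 h3
  · intro hc
    exact ⟨isGradedGq_Nq C φ lam, Nq_ne_bot C φ lam,
      fun W hW _ => eq_bot_or_eq_Nq C φ lam hc W hW⟩

theorem isSimpleModule_Nq_iff : IsSimpleModule (Gq C) (Nq C φ lam) ↔ lam.c ≠ 0 := by
  rw [isSimpleModule_iff_isAtom]
  constructor
  · intro h hc
    obtain ⟨W, h1, h2, h3, -⟩ := exists_proper_submodule C φ lam hc
    exact h2 (h.2 W (lt_of_le_of_ne h1 h3))
  · intro hc
    exact ⟨Nq_ne_bot C φ lam, fun W hW =>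
      (eq_bot_or_eq_Nq C φ lam hc W hW.le).resolve_right hW.ne⟩

end QHeis

namespace QHeis

variable {n : ℕ} (C : CartanDatum n) (φ : ℕ+ → ℤˣ) (lam : Weight n)

/-! ### The `𝔸`-form of `N_q` -/

/-- The image of a monomial. -/
def fockVec (s : (Fin n × ℕ+) →₀ ℕ) : Verma C φ lam :=
  fockMap C φ lam (MvPolynomial.monomial s 1)

theorem fockMap_monomial (s : (Fin n × ℕ+) →₀ ℕ) (a : Kq) :
    fockMap C φ lam (MvPolynomial.monomial s a) = a • fockVec C φ lam s := by
  rw [fockVec, ← map_smul, MvPolynomial.smul_monomial, smul_eq_mul, mul_one]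

/-- The `𝔸`-span of the monomials. -/
def fockForm : Submodule (AA C) (Verma C φ lam) :=
  Submodule.span (AA C) (Set.range (fockVec C φ lam))

theorem fockVec_mem (s : (Fin n × ℕ+) →₀ ℕ) : fockVec C φ lam s ∈ fockForm C φ lam :=
  Submodule.subset_span ⟨s, rfl⟩

theorem smul_mem_fockForm {a : Kq} (ha : a ∈ AA C) {y : Verma C φ lam}
    (hy : y ∈ fockForm C φ lam) : a • y ∈ fockForm C φ lam :=
  (fockForm C φ lam).smul_mem (⟨a, ha⟩ : AA C) hy

/-- The operators preserving the `𝔸`-form. -/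
def formStab : Subring (Module.End Kq (Verma C φ lam)) where
  carrier := {T | ∀ y ∈ fockForm C φ lam, T y ∈ fockForm C φ lam}
  mul_mem' hS hT y hy := hS _ (hT y hy)
  one_mem' _ hy := hy
  add_mem' hS hT y hy := add_mem (hS y hy) (hT y hy)
  zero_mem' _ _ := zero_mem _
  neg_mem' hT y hy := neg_mem (hT y hy)

theorem mem_formStab {T : Module.End Kq (Verma C φ lam)}
    (h : ∀ s, T (fockVec C φ lam s) ∈ fockForm C φ lam) : T ∈ formStab C φ lam := by
  intro y hy
  refine Submodule.span_induction (p := fun y _ => T y ∈ fockForm C φ lam) ?_ ?_ ?_ ?_ hy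
  · rintro _ ⟨s, rfl⟩; exact h s
  · rw [map_zero]; exact zero_mem _
  · intro y z _ _ hy hz; rw [map_add]; exact add_mem hy hz
  · intro a y _ hy
    have : T (a • y) = (a : Kq) • T y := map_smul T (a : Kq) y
    rw [this]
    exact smul_mem_fockForm C φ lam a.2 hy

theorem smul_mem_formStab {a : Kq} (ha : a ∈ AA C) {T : Module.End Kq (Verma C φ lam)}
    (hT : T ∈ formStab C φ lam) : a • T ∈ formStab C φ lam :=
  fun y hy => smul_mem_fockForm C φ lam ha (hT y hy)

theorem h_mem_formStab (i : Fin n) (k : ℤ) :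
    vermaRep C φ lam (Free.h i k) ∈ formStab C φ lam := by
  rcases eq_or_ne k 0 with rfl | hk
  · rw [h_zero, map_zero]; exact zero_mem _
  refine mem_formStab C φ lam fun s => ?_
  rw [vermaRep_apply, fockVec, ← fockMap_fockH C φ lam i hk]
  obtain ⟨k, rfl | rfl⟩ := exists_annIdx φ hk
  · rw [fockH_annIdx, fockAnn_apply, map_sum]
    refine sum_mem fun j _ => ?_
    rw [map_smul, MvPolynomial.pderiv_monomial, fockMap_monomial, one_mul]
    refine smul_mem_fockForm C φ lam (hhCoeff_mem C _ _ _ _)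
      (smul_mem_fockForm C φ lam (natCast_mem _ _) (fockVec_mem C φ lam _))
  · rw [fockH_neg_annIdx, LinearMap.mulLeft_apply, MvPolynomial.X, MvPolynomial.monomial_mul,
      one_mul]
    exact fockVec_mem C φ lam _

theorem Kinv_smul_fockMap (i : Fin n) (P : Fock Kq n) :
    toUq C (Free.Kinv i) • fockMap C φ lam P = q ^ (-lam.h i) • fockMap C φ lam P := by
  have h := LinearMap.congr_fun ((isCartanRep_vermaRep C φ lam).Kinv_mul_K i) (fockMap C φ lam P)
  rw [Module.End.mul_apply, vermaRep_apply, vermaRep_apply, K_smul_fockMap, smul_comm,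
    Module.End.one_apply] at h
  rw [zpow_neg, eq_inv_smul_iff₀ (zpow_ne_zero _ q_ne_zero)]
  exact h

theorem D_smul_fockVec (s : (Fin n × ℕ+) →₀ ℕ) :
    toUq C Free.D • fockVec C φ lam s = q ^ (lam.d + fockDeg φ s) • fockVec C φ lam s :=
  D_smul_fockMap_monomial C φ lam s 1

theorem Dinv_smul_fockVec (s : (Fin n × ℕ+) →₀ ℕ) :
    toUq C Free.Dinv • fockVec C φ lam s = q ^ (-(lam.d + fockDeg φ s)) • fockVec C φ lam s := by
  have h := LinearMap.congr_fun ((isCartanRep_vermaRep C φ lam).Dinv_mul_D) (fockVec C φ lam s)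
  rw [Module.End.mul_apply, vermaRep_apply, vermaRep_apply, D_smul_fockVec, smul_comm,
    Module.End.one_apply] at h
  rw [zpow_neg, eq_inv_smul_iff₀ (zpow_ne_zero _ q_ne_zero)]
  exact h

/-- On a vector where Y acts by q^a, each factor of a Lusztig product is separately a scalar of the
form (q^u - q^{-u})/(q^v - q^{-v}), hence in 𝔸. -/
theorem lusztig_factor (d : ℕ) (a s : ℤ) (j : ℕ) {Y Yinv : Free n} {y : Verma C φ lam}
    (hY : toUq C Y • y = q ^ a • y) (hY' : toUq C Yinv • y = q ^ (-a) • y) :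
    toUq C (((q ^ d) ^ ((j : ℤ) + 1) - (q ^ d) ^ (-((j : ℤ) + 1)))⁻¹ •
      ((q ^ d) ^ (s - j) • Y - (q ^ d) ^ (-(s - j)) • Yinv)) • y =
    ((q ^ ((d * (j + 1) : ℕ) : ℤ) - q ^ (-((d * (j + 1) : ℕ) : ℤ)))⁻¹ *
      (q ^ (d * (s - j) + a) - q ^ (-(d * (s - j) + a)))) • y := by
  have e : ∀ m : ℤ, (q ^ d) ^ m = q ^ (d * m) := fun m => by rw [← zpow_natCast, ← zpow_mul]
  rw [map_smul, map_sub, map_smul, map_smul, smul_assoc, sub_smul, smul_assoc, smul_assoc, hY, hY',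
    e, e, e, e, smul_smul, smul_smul, ← sub_smul, smul_smul, ← zpow_add₀ q_ne_zero,
    ← zpow_add₀ q_ne_zero]
  congr 4
  ring_nf

theorem lusztig_eq (p : Kq) (Y Yinv : Free n) (s : ℤ) (r : ℕ) :
    Free.lusztig p Y Yinv s r = ((List.range r).map fun j : ℕ =>
      (p ^ ((j : ℤ) + 1) - p ^ (-((j : ℤ) + 1)))⁻¹ •
        (p ^ (s - j) • Y - p ^ (-(s - j)) • Yinv)).prod := by
  have e : (do let a ← List.range r; pure (a : ℤ)) = (List.range r).map fun a : ℕ => (a : ℤ) := by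
    simp [List.map_eq_flatMap]
  rw [Free.lusztig, e, List.map_map]
  rfl

theorem exists_lusztig_smul {d : ℕ} (hd : 0 < d) (a s : ℤ) (r : ℕ) {Y Yinv : Free n}
    {y : Verma C φ lam} (hY : toUq C Y • y = q ^ a • y) (hY' : toUq C Yinv • y = q ^ (-a) • y) :
    ∃ t ∈ AA C, toUq C (Free.lusztig (q ^ d) Y Yinv s r) • y = t • y := by
  rw [lusztig_eq]
  generalize List.range r = L
  induction L with
  | nil => exact ⟨1, one_mem _, by simp⟩
  | cons j L ih =>
    obtain ⟨t, ht, h⟩ := ih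
    refine ⟨_, mul_mem ht (qInt_div_mem C (d * (s - j) + a)
      (show 0 < d * (j + 1) by positivity)), ?_⟩
    rw [List.map_cons, List.prod_cons, map_mul, mul_smul, h, smul_comm,
      lusztig_factor C φ lam d a s j hY hY', smul_smul]

theorem lusztig_one_smul (d : ℕ) (a : ℤ) {Y Yinv : Free n} {y : Verma C φ lam}
    (hY : toUq C Y • y = q ^ a • y) (hY' : toUq C Yinv • y = q ^ (-a) • y) :
    toUq C (Free.lusztig (q ^ d) Y Yinv 0 1) • y =
      ((q ^ (d : ℤ) - q ^ (-(d : ℤ)))⁻¹ * (q ^ a - q ^ (-a))) • y := by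
  have := lusztig_factor C φ lam d a 0 0 hY hY'
  rw [lusztig_eq, List.range_one, List.map_singleton, List.prod_singleton, this]
  simp

theorem gammaBinom_smul (i : Fin n) (s : ℤ) (y : Verma C φ lam) :
    toUq C (Free.gammaBinom C i s) • y = ((q ^ (C.d i : ℤ) - q ^ (-(C.d i : ℤ)))⁻¹ *
      (q ^ (s * lam.c) - q ^ (-(s * lam.c)))) • y := by
  have hg := fun m => LinearMap.congr_fun ((isCartanRep_vermaRep C φ lam).map_gam m) y
  simp only [vermaRep_apply, Module.algebraMap_end_apply] at hg
  rw [Free.gammaBinom, map_smul, map_sub, smul_assoc, sub_smul, hg, hg, ← sub_smul, smul_smul,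
    qh_zpow_two_mul, show -(2 * s) = 2 * (-s) by ring, qh_zpow_two_mul, neg_mul, zpow_neg q (C.d i),
    zpow_natCast, qi]

theorem coeff_pow_mem_formStab {u : ℕ → Module.End Kq (Verma C φ lam)}
    (hu : ∀ l, u l ∈ formStab C φ lam) (r m : ℕ) :
    PowerSeries.coeff m (PowerSeries.mk u ^ r) ∈ formStab C φ lam := by
  induction r generalizing m with
  | zero =>
    rw [pow_zero, PowerSeries.coeff_one]
    split_ifs
    · exact one_mem _
    · exact zero_mem _
  | succ r ih =>
    rw [pow_succ, PowerSeries.coeff_mul]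
    refine sum_mem fun ab _ => mul_mem (ih _) ?_
    rw [PowerSeries.coeff_mk]; exact hu _

/-- In positive degree every term of the exponential carries at least one factor t, so one division
by q_i - q_i⁻¹ is harmless. The factorials are units because ℂ ⊆ 𝔸. -/
theorem expSeries_mem_formStab {u : ℕ → Module.End Kq (Verma C φ lam)}
    (hu : ∀ l, u l ∈ formStab C φ lam) {t : Kq} (ht : t ∈ AA C) {m : ℕ} (hm : 0 < m) (w : Kq)
    (hw : w * t ∈ AA C) : w • expSeries t u m ∈ formStab C φ lam := by
  rw [expSeries, Finset.smul_sum]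
  refine sum_mem fun r _ => ?_
  rcases r with _ | r
  · rw [pow_zero (PowerSeries.mk u), PowerSeries.coeff_one, if_neg hm.ne', smul_zero, smul_zero]
    exact zero_mem _
  · rw [smul_smul]
    refine smul_mem_formStab C φ lam ?_ (coeff_pow_mem_formStab C φ lam hu _ _)
    have e : w * (t ^ (r + 1) / ((r + 1).factorial : Kq)) =
        w * t * t ^ r * algebraMap ℂ Kq ((r + 1).factorial : ℂ)⁻¹ := by
      rw [map_inv₀, map_natCast, pow_succ]
      ring
    rw [e]
    exact mul_mem (mul_mem hw (pow_mem ht r)) (Subalgebra.algebraMap_mem _ _)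

theorem K_mem_formStab (i : Fin n) : vermaRep C φ lam (Free.K i) ∈ formStab C φ lam := by
  refine mem_formStab C φ lam fun s => ?_
  rw [vermaRep_apply, fockVec, K_smul_fockMap]
  exact smul_mem_fockForm C φ lam (q_zpow_mem C _) (fockVec_mem C φ lam s)

theorem Kinv_mem_formStab (i : Fin n) : vermaRep C φ lam (Free.Kinv i) ∈ formStab C φ lam := by
  refine mem_formStab C φ lam fun s => ?_
  rw [vermaRep_apply, fockVec, Kinv_smul_fockMap]
  exact smul_mem_fockForm C φ lam (q_zpow_mem C _) (fockVec_mem C φ lam s)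

theorem gammaPsi_mem_formStab (i : Fin n) (k l : ℤ) :
    vermaRep C φ lam (Free.gammaPsi C i k l) ∈ formStab C φ lam := by
  have hρ := isCartanRep_vermaRep C φ lam
  have hΓ : ∀ m : ℤ, (qh ^ lam.c) ^ m ∈ AA C := fun m => by
    rw [← zpow_mul]; exact qh_zpow_mem C _
  have ht : qi C i - (qi C i)⁻¹ ∈ AA C := sub_mem (qi_mem C i) (qi_inv_mem C i)
  have ht0 := (isGeneric_qi C i).sub_inv_ne
  have hwt : (qi C i - (qi C i)⁻¹)⁻¹ * (qi C i - (qi C i)⁻¹) ∈ AA C := by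
    rw [inv_mul_cancel₀ ht0]; exact one_mem _
  rw [hρ.map_gammaPsi]
  rcases lt_trichotomy (k + l) 0 with h | h | h
  · obtain ⟨m, hm⟩ : ∃ m : ℕ, k + l = -m := ⟨(-(k + l)).toNat, by omega⟩
    rw [IsCartanRep.psi_neg h, map_zero, smul_zero, zero_sub, hm,
      IsCartanRep.map_phi_neg_natCast, smul_neg, smul_comm]
    refine neg_mem (smul_mem_formStab C φ lam (hΓ _) ?_)
    rw [← mul_smul_comm]
    refine mul_mem (Kinv_mem_formStab C φ lam i) (expSeries_mem_formStab C φ lam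
      (fun l => h_mem_formStab C φ lam i _) (neg_mem ht) (by omega) _ ?_)
    rw [mul_neg]; exact neg_mem hwt
  -- In degree zero there is no factor to divide by. Instead, the K_i and K_i⁻¹ terms, weighted by
  -- powers of γ, combine into a ratio (q^a - q^{-a})/(q_i - q_i⁻¹) with a = kλ(c) + λ(h_i).
  · refine mem_formStab C φ lam fun s => ?_
    obtain rfl : l = -k := by omega
    rw [h, IsCartanRep.psi_zero, IsCartanRep.phi_zero]
    have e : ((qi C i - (qi C i)⁻¹)⁻¹ • ((qh ^ lam.c) ^ (k - -k) • vermaRep C φ lam (Free.K i) -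
        (qh ^ lam.c) ^ (-k - k) • vermaRep C φ lam (Free.Kinv i))) (fockVec C φ lam s) =
        ((q ^ (C.d i : ℤ) - q ^ (-(C.d i : ℤ)))⁻¹ *
          (q ^ (k * lam.c + lam.h i) - q ^ (-(k * lam.c + lam.h i)))) • fockVec C φ lam s := by
      rw [LinearMap.smul_apply, LinearMap.sub_apply, LinearMap.smul_apply, LinearMap.smul_apply,
        vermaRep_apply, vermaRep_apply, fockVec, K_smul_fockMap, Kinv_smul_fockMap,
        show k - -k = 2 * k by ring, show -k - k = 2 * (-k) by ring, qh_zpow_two_mul,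
        qh_zpow_two_mul, smul_smul, smul_smul, ← zpow_add₀ q_ne_zero, ← zpow_add₀ q_ne_zero,
        ← sub_smul, smul_smul, zpow_neg q (C.d i), zpow_natCast, qi,
        show -k * lam.c + -lam.h i = -(k * lam.c + lam.h i) by ring]
    rw [e]
    exact smul_mem_fockForm C φ lam (qInt_div_mem C _ (C.d_pos i)) (fockVec_mem C φ lam s)
  · obtain ⟨m, hm⟩ : ∃ m : ℕ, k + l = m := ⟨(k + l).toNat, by omega⟩
    rw [IsCartanRep.phi_pos h, map_zero, smul_zero, sub_zero, hm,
      IsCartanRep.map_psi_natCast, smul_comm]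
    refine smul_mem_formStab C φ lam (hΓ _) ?_
    rw [← mul_smul_comm]
    exact mul_mem (K_mem_formStab C φ lam i) (expSeries_mem_formStab C φ lam
      (fun l => h_mem_formStab C φ lam i _) ht (by omega) _ hwt)

theorem CartanDatum.d0_pos {n : ℕ} (C : CartanDatum n) : 0 < C.d0 := by
  obtain ⟨i⟩ := C.nonempty
  exact lt_of_lt_of_le (C.d_pos i) (Finset.le_sup (f := C.d) (Finset.mem_univ i))

theorem GAGen.mem_formStab {a : Free n} (ha : GAGen C a) :
    vermaRep C φ lam a ∈ formStab C φ lam := by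
  have hv := fockVec_mem C φ lam
  induction ha with
  | h i k hk => exact h_mem_formStab C φ lam i k
  | K i => exact K_mem_formStab C φ lam i
  | Kinv i => exact Kinv_mem_formStab C φ lam i
  | gamma =>
    intro y hy
    rw [vermaRep_apply, gam_one_smul]
    exact smul_mem_fockForm C φ lam (qh_zpow_mem C _) hy
  | gammaInv =>
    intro y hy
    rw [vermaRep_apply, gam_neg_one_smul, ← zpow_neg]
    exact smul_mem_fockForm C φ lam (qh_zpow_mem C _) hy
  | D =>
    refine QHeis.mem_formStab C φ lam fun s => ?_
    rw [vermaRep_apply, D_smul_fockVec]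
    exact smul_mem_fockForm C φ lam (q_zpow_mem C _) (hv s)
  | Dinv =>
    refine QHeis.mem_formStab C φ lam fun s => ?_
    rw [vermaRep_apply, Dinv_smul_fockVec]
    exact smul_mem_fockForm C φ lam (q_zpow_mem C _) (hv s)
  | KBinom i s r =>
    refine QHeis.mem_formStab C φ lam fun w => ?_
    obtain ⟨t, ht, h⟩ := exists_lusztig_smul C φ lam (C.d_pos i) (lam.h i) s r
      (K_smul_fockMap C φ lam i _) (Kinv_smul_fockMap C φ lam i (MvPolynomial.monomial w 1))
    rw [vermaRep_apply]
    change toUq C (Free.lusztig (q ^ C.d i) _ _ s r) • fockMap C φ lam _ ∈ _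
    rw [h]
    exact smul_mem_fockForm C φ lam ht (hv w)
  | DBinom s r =>
    refine QHeis.mem_formStab C φ lam fun w => ?_
    obtain ⟨t, ht, h⟩ := exists_lusztig_smul C φ lam C.d0_pos _ s r
      (D_smul_fockVec C φ lam w) (Dinv_smul_fockVec C φ lam w)
    rw [vermaRep_apply]
    change toUq C (Free.lusztig (q ^ C.d0) _ _ s r) • _ ∈ _
    rw [h]
    exact smul_mem_fockForm C φ lam ht (hv w)
  | gammaBinom i s =>
    intro y hy
    rw [vermaRep_apply, gammaBinom_smul]
    exact smul_mem_fockForm C φ lam (qInt_div_mem C _ (C.d_pos i)) hy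
  | gammaPsi i k l => exact gammaPsi_mem_formStab C φ lam i k l

theorem GA_smul_mem {g : Uq C} (hg : g ∈ GA C) {y : Verma C φ lam} (hy : y ∈ fockForm C φ lam) :
    g • y ∈ fockForm C φ lam := by
  induction hg using Algebra.adjoin_induction generalizing y with
  | mem g hg =>
    obtain ⟨a, ha, rfl⟩ | ⟨a, ha, rfl⟩ := hg
    · rw [algebraMap_smul]; exact smul_mem_fockForm C φ lam ha hy
    · exact GAGen.mem_formStab C φ lam ha y hy
  | algebraMap r =>
    rw [algebraMap_smul, ← algebraMap_smul Kq r y]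
    exact smul_mem_fockForm C φ lam (Subalgebra.algebraMap_mem _ r) hy
  | add a b _ _ ha hb => rw [add_smul]; exact add_mem (ha hy) (hb hy)
  | mul a b _ _ ha hb => rw [mul_smul]; exact ha (hb hy)

theorem algebraMap_mem_GA {a : Kq} (ha : a ∈ AA C) : algebraMap Kq (Uq C) a ∈ GA C :=
  Algebra.subset_adjoin (Or.inl ⟨a, ha, rfl⟩)

theorem smul_mem_NA {a : Kq} (ha : a ∈ AA C) {y : Verma C φ lam} (hy : y ∈ NA C φ lam) :
    a • y ∈ NA C φ lam := by
  have := (NA C φ lam).smul_mem (⟨_, algebraMap_mem_GA C ha⟩ : GA C) hy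
  have e : (⟨_, algebraMap_mem_GA C ha⟩ : GA C) • y = algebraMap Kq (Uq C) a • y := rfl
  rwa [e, algebraMap_smul] at this


/-- The span of the monomials contains v_λ and is stable under G_𝔸^d. Conversely each monomial
arises from v_λ by creation operators, which belong to G_𝔸^d. -/
theorem mem_NA_iff {y : Verma C φ lam} : y ∈ NA C φ lam ↔ y ∈ fockForm C φ lam := by
  constructor
  · intro hy
    refine Submodule.span_induction (p := fun y _ => y ∈ fockForm C φ lam) ?_ ?_ ?_ ?_ hy
    · rintro _ rfl
      rw [← fockMap_one]
      exact fockVec_mem C φ lam 0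
    · exact zero_mem _
    · intro y z _ _ hy hz; exact add_mem hy hz
    · intro g y _ hy; exact GA_smul_mem C φ lam g.2 hy
  · intro hy
    refine Submodule.span_induction (p := fun y _ => y ∈ NA C φ lam) ?_ ?_ ?_ ?_ hy
    · rintro _ ⟨s, rfl⟩
      have key : ∀ P : Fock ℂ n,
          fockMap C φ lam (MvPolynomial.map (algebraMap ℂ Kq) P) ∈ NA C φ lam := by
        intro P
        induction P using MvPolynomial.induction_on with
        | C a =>
          have e : (MvPolynomial.C (algebraMap ℂ Kq a) : Fock Kq n) = algebraMap ℂ Kq a • 1 := by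
            rw [MvPolynomial.smul_eq_C_mul, mul_one]
          rw [MvPolynomial.map_C, e, map_smul, fockMap_one]
          exact smul_mem_NA C φ lam (Subalgebra.algebraMap_mem _ a)
            (Submodule.mem_span_singleton_self _)
        | add P Q hP hQ => rw [map_add, map_add]; exact add_mem hP hQ
        | mul_X P x hP =>
          rw [mul_comm, map_mul, MvPolynomial.map_X, fockMap_X_mul]
          exact (NA C φ lam).smul_mem (gaGen C (GAGen.h x.1 _ (neg_annIdx_ne_zero φ x.2))) hP
      have := key (MvPolynomial.monomial s 1)
      rwa [MvPolynomial.map_monomial, map_one] at this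
    · exact zero_mem _
    · intro y z _ _ hy hz; exact add_mem hy hz
    · intro a y _ hy; exact smul_mem_NA C φ lam a.2 hy

theorem linearIndependent_fockVec : LinearIndependent Kq (fockVec C φ lam) := by
  have h := (MvPolynomial.basisMonomials (Fin n × ℕ+) Kq).linearIndependent.map'
    (fockMap C φ lam) (LinearMap.ker_eq_bot.mpr (fockMap_injective C φ lam))
  rw [MvPolynomial.coe_basisMonomials] at h
  exact h

theorem span_fockVec :
    Submodule.span Kq (Set.range (fockVec C φ lam)) = (Nq C φ lam).restrictScalars Kq := by
  have h := (MvPolynomial.basisMonomials (Fin n × ℕ+) Kq).span_eq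
  rw [MvPolynomial.coe_basisMonomials] at h
  rw [← range_fockMap, ← Submodule.map_top, ← h, Submodule.map_span, ← Set.range_comp]
  rfl

theorem exists_basis_NA : ∃ B : Set (Verma C φ lam),
    LinearIndependent Kq (Subtype.val : B → Verma C φ lam) ∧
    Submodule.span Kq B = (Nq C φ lam).restrictScalars Kq ∧
    (Submodule.span (AA C) B : Set (Verma C φ lam)) = NA C φ lam :=
  ⟨Set.range (fockVec C φ lam), (linearIndependent_fockVec C φ lam).linearIndepOn_id,
    span_fockVec C φ lam, Set.ext fun _ => (mem_NA_iff C φ lam).symm⟩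

end QHeis

namespace QHeis

variable {n : ℕ} (C : CartanDatum n) (φ : ℕ+ → ℤˣ) (lam : Weight n)

/-! ### The classical limit of `N_𝔸` -/

/-- Polynomials with coefficients in `𝔸`. -/
abbrev FockA : Type := MvPolynomial (Fin n × ℕ+) (AA C)

/-- Extension of scalars from `𝔸`. -/
abbrev fockIncl : FockA C →ₐ[ℂ] Fock Kq n := MvPolynomial.mapAlgHom (AA C).val

/-- Specialization of the coefficients. -/
abbrev fockEv : FockA C →ₐ[ℂ] Fock ℂ n := MvPolynomial.mapAlgHom (evOne C)

theorem fockIncl_monomial (s : (Fin n × ℕ+) →₀ ℕ) (a : AA C) :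
    fockIncl C (MvPolynomial.monomial s a) = MvPolynomial.monomial s (a : Kq) :=
  MvPolynomial.map_monomial _ _ _

theorem fockIncl_injective : Function.Injective (fockIncl C) :=
  MvPolynomial.map_injective _ Subtype.val_injective

theorem fockEv_monomial (s : (Fin n × ℕ+) →₀ ℕ) (a : AA C) :
    fockEv C (MvPolynomial.monomial s a) = MvPolynomial.monomial s (evOne C a) :=
  MvPolynomial.map_monomial _ _ _

theorem fockEv_surjective : Function.Surjective (fockEv C) := by
  refine MvPolynomial.map_surjective _ fun a => ⟨algebraMap ℂ (AA C) a, ?_⟩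
  exact (evOne C).commutes a

/-- The description of the kernel of 𝔸 → ℂ, applied to each coefficient. -/
theorem fockEv_eq_zero_iff (Q : FockA C) :
    fockEv C Q = 0 ↔ ∃ Q', Q = MvPolynomial.C (qhA C - 1) * Q' := by
  constructor
  · intro h
    refine (MvPolynomial.C_dvd_iff_dvd_coeff _ _).mpr fun s => ?_
    obtain ⟨b, hb⟩ := exists_sub_evOne C (Q.coeff s)
    have h2 : evOne C (Q.coeff s) = 0 := by
      have := congrArg (MvPolynomial.coeff s) h
      rwa [MvPolynomial.mapAlgHom_apply, MvPolynomial.coeff_map, MvPolynomial.coeff_zero] at this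
    rw [h2, map_zero, sub_zero] at hb
    exact ⟨b, hb⟩
  · rintro ⟨Q', rfl⟩
    have : fockEv C (MvPolynomial.C (qhA C - 1)) = 0 := by
      rw [MvPolynomial.mapAlgHom_apply, MvPolynomial.map_C]
      change MvPolynomial.C (evOne C (qhA C - 1)) = 0
      rw [map_sub, evOne_qhA, map_one, sub_self, map_zero]
    rw [map_mul, this, zero_mul]

theorem mem_NA_iff_exists {y : Verma C φ lam} :
    y ∈ NA C φ lam ↔ ∃ Q, fockMap C φ lam (fockIncl C Q) = y := by
  rw [mem_NA_iff]
  constructor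
  · intro hy
    refine Submodule.span_induction
      (p := fun y _ => ∃ Q, fockMap C φ lam (fockIncl C Q) = y) ?_ ?_ ?_ ?_ hy
    · rintro _ ⟨s, rfl⟩
      exact ⟨MvPolynomial.monomial s 1, by rw [fockIncl_monomial]; rfl⟩
    · exact ⟨0, by rw [map_zero, map_zero]⟩
    · rintro y z _ _ ⟨Q, rfl⟩ ⟨R, rfl⟩
      exact ⟨Q + R, by rw [map_add, map_add]⟩
    · rintro a y _ ⟨Q, rfl⟩
      refine ⟨MvPolynomial.C a * Q, ?_⟩
      have e : fockIncl C (MvPolynomial.C a * Q) = (a : Kq) • fockIncl C Q := by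
        rw [map_mul, MvPolynomial.mapAlgHom_apply, MvPolynomial.map_C, MvPolynomial.smul_eq_C_mul]
        rfl
      rw [e, map_smul]; rfl
  · rintro ⟨Q, rfl⟩
    induction Q using MvPolynomial.induction_on' with
    | monomial s a =>
      rw [fockIncl_monomial, fockMap_monomial]
      exact smul_mem_fockForm C φ lam a.2 (fockVec_mem C φ lam s)
    | add P Q hP hQ => rw [map_add, map_add]; exact add_mem hP hQ

/-- The parametrization of `N_𝔸` by polynomials over `𝔸`. -/
def formMap : FockA C →ₗ[ℂ] NA C φ lam where
  toFun Q := ⟨fockMap C φ lam (fockIncl C Q), (mem_NA_iff_exists C φ lam).mpr ⟨Q, rfl⟩⟩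
  map_add' P Q := Subtype.ext (by
    change fockMap C φ lam (fockIncl C (P + Q)) =
      fockMap C φ lam (fockIncl C P) + fockMap C φ lam (fockIncl C Q)
    rw [map_add, map_add])
  map_smul' a Q := Subtype.ext (by
    change fockMap C φ lam (fockIncl C (a • Q)) = a • fockMap C φ lam (fockIncl C Q)
    rw [map_smul, ← algebraMap_smul Kq a (fockIncl C Q), map_smul, algebraMap_smul])

theorem coe_formMap (Q : FockA C) :
    (formMap C φ lam Q : Verma C φ lam) = fockMap C φ lam (fockIncl C Q) := rfl

theorem formMap_surjective : Function.Surjective (formMap C φ lam) := fun y => by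
  obtain ⟨Q, hQ⟩ := (mem_NA_iff_exists C φ lam).mp y.2
  exact ⟨Q, Subtype.ext hQ⟩

theorem formMap_C_mul (a : AA C) (Q : FockA C) :
    (formMap C φ lam (MvPolynomial.C a * Q) : Verma C φ lam) =
      (a : Kq) • (formMap C φ lam Q : Verma C φ lam) := by
  rw [coe_formMap, coe_formMap, map_mul, MvPolynomial.mapAlgHom_apply, MvPolynomial.map_C,
    ← map_smul, MvPolynomial.smul_eq_C_mul]
  rfl

/-- The composition of `formMap` with the projection to the classical limit. -/
def limMap : FockA C →ₗ[ℂ] ClassicalLimit C (NA C φ lam) :=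
  (toLimit C (NA C φ lam)).restrictScalars ℂ ∘ₗ formMap C φ lam

theorem limMap_apply (Q : FockA C) :
    limMap C φ lam Q = toLimit C (NA C φ lam) (formMap C φ lam Q) := rfl

theorem toLimit_surjective : Function.Surjective (toLimit C (NA C φ lam)) :=
  Submodule.mkQ_surjective _

theorem limMap_surjective : Function.Surjective (limMap C φ lam) :=
  (toLimit_surjective C φ lam).comp (formMap_surjective C φ lam)

theorem toLimit_eq_zero_iff (y : NA C φ lam) : toLimit C (NA C φ lam) y = 0 ↔
    ∃ z : NA C φ lam, (y : Verma C φ lam) = (qh - 1) • (z : Verma C φ lam) :=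
  Submodule.Quotient.mk_eq_zero _

/-- Reduction modulo q^{1/2} - 1 in N_𝔸 and specialization of coefficients have the same kernel, as
`fockMap` is injective. Both maps are surjective, which identifies their targets. -/
theorem limMap_eq_zero_iff (Q : FockA C) : limMap C φ lam Q = 0 ↔ fockEv C Q = 0 := by
  rw [limMap_apply, toLimit_eq_zero_iff, fockEv_eq_zero_iff]
  constructor
  · rintro ⟨z, hz⟩
    obtain ⟨Q', rfl⟩ := formMap_surjective C φ lam z
    refine ⟨Q', fockIncl_injective C (fockMap_injective C φ lam ?_)⟩
    rw [← coe_formMap, ← coe_formMap, formMap_C_mul, hz]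
    rfl
  · rintro ⟨Q', rfl⟩
    exact ⟨formMap C φ lam Q', by rw [formMap_C_mul]; rfl⟩

/-- The classical limit of `N_𝔸` is Fock space over `ℂ`. -/
def limEquiv : Fock ℂ n ≃ₗ[ℂ] ClassicalLimit C (NA C φ lam) :=
  ((fockEv C).toLinearMap.quotKerEquivOfSurjective (fockEv_surjective C)).symm.trans
    ((Submodule.quotEquivOfEq _ _ (by
      ext Q
      rw [LinearMap.mem_ker, LinearMap.mem_ker, limMap_eq_zero_iff]; rfl)).trans
    ((limMap C φ lam).quotKerEquivOfSurjective (limMap_surjective C φ lam)))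

theorem limEquiv_fockEv (Q : FockA C) : limEquiv C φ lam (fockEv C Q) = limMap C φ lam Q := by
  have h : ((fockEv C).toLinearMap.quotKerEquivOfSurjective (fockEv_surjective C)).symm
      (fockEv C Q) = Submodule.Quotient.mk Q := by
    rw [LinearEquiv.symm_apply_eq]; rfl
  rw [limEquiv, LinearEquiv.trans_apply, h]
  rfl

/-- A generator of `G_𝔸^d` acting on polynomials over `𝔸`. -/
theorem gaGen_smul_limEquiv {a : Free n} (ha : GAGen C a) {Q Q' : FockA C}
    (h : toUq C a • fockMap C φ lam (fockIncl C Q) = fockMap C φ lam (fockIncl C Q')) :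
    gaGen C ha • limEquiv C φ lam (fockEv C Q) = limEquiv C φ lam (fockEv C Q') := by
  rw [limEquiv_fockEv, limEquiv_fockEv, limMap_apply, limMap_apply, ← map_smul]
  exact congrArg _ (Subtype.ext h)

theorem gaGen_smul_limEquiv_of_smul {g : Free n} (hg : GAGen C g) (a : AA C)
    (h : ∀ P, toUq C g • fockMap C φ lam P = (a : Kq) • fockMap C φ lam P) (P : Fock ℂ n) :
    gaGen C hg • limEquiv C φ lam P = limEquiv C φ lam (evOne C a • P) := by
  obtain ⟨Q, rfl⟩ := fockEv_surjective C P
  have e : evOne C a • fockEv C Q = fockEv C (MvPolynomial.C a * Q) := by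
    rw [map_mul, MvPolynomial.smul_eq_C_mul, MvPolynomial.mapAlgHom_apply,
      MvPolynomial.mapAlgHom_apply, MvPolynomial.map_C]
    rfl
  rw [e]
  refine gaGen_smul_limEquiv C φ lam hg ?_
  rw [← coe_formMap C φ lam (MvPolynomial.C a * Q), formMap_C_mul, h]
  rfl

theorem h_smul_limEquiv (i : Fin n) {k : ℤ} (hk : k ≠ 0) (P : Fock ℂ n) :
    gaGen C (GAGen.h i k hk) • limEquiv C φ lam P =
      limEquiv C φ lam (fockH φ (clCoeff C lam.c) i k P) := by
  obtain ⟨Q, rfl⟩ := fockEv_surjective C P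
  obtain ⟨k, rfl | rfl⟩ := exists_annIdx φ hk
  · let cA : Fin n → AA C := fun j => ⟨_, hhCoeff_mem C lam.c i j (annIdx φ k)⟩
    -- A single formula over 𝔸 for the annihilation operator, stated for an arbitrary base change f.
    -- It is used for the inclusion into ℂ(q^{1/2}) and for the specialization to ℂ.
    have e : ∀ {S : Type} [Field S] [Algebra ℂ S] (f : AA C →ₐ[ℂ] S)
        (c : Fin n → Fin n → ℤ → S), (∀ j, f (cA j) = c i j (annIdx φ k)) →
        fockH φ c i (annIdx φ k) (MvPolynomial.mapAlgHom f Q) = MvPolynomial.mapAlgHom f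
          (∑ j, MvPolynomial.C (cA j) * MvPolynomial.pderiv (j, k) Q) := by
      intro S _ _ f c hc
      rw [fockH_annIdx, fockAnn_apply, map_sum]
      refine Finset.sum_congr rfl fun j _ => ?_
      rw [map_mul, MvPolynomial.mapAlgHom_apply, MvPolynomial.mapAlgHom_apply,
        MvPolynomial.mapAlgHom_apply, MvPolynomial.map_C, ← hc, MvPolynomial.smul_eq_C_mul,
        MvPolynomial.pderiv_map]
      rfl
    rw [e (evOne C) (clCoeff C lam.c) fun j => evOne_hhCoeff C lam.c i j _]
    refine gaGen_smul_limEquiv C φ lam _ ?_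
    rw [← fockMap_fockH C φ lam i hk, e (AA C).val (hhCoeff C (qh ^ lam.c)) fun j => rfl]
  · have e : MvPolynomial.X (i, k) * fockEv C Q = fockEv C (MvPolynomial.X (i, k) * Q) := by
      rw [map_mul, MvPolynomial.mapAlgHom_apply, MvPolynomial.mapAlgHom_apply, MvPolynomial.map_X]
    rw [fockH_neg_annIdx, LinearMap.mulLeft_apply, e]
    refine gaGen_smul_limEquiv C φ lam _ ?_
    rw [map_mul, MvPolynomial.mapAlgHom_apply, MvPolynomial.mapAlgHom_apply, MvPolynomial.map_X,
      fockMap_X_mul]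

theorem KBinom_smul_limEquiv (i : Fin n) (P : Fock ℂ n) :
    gaGen C (GAGen.KBinom i 0 1) • limEquiv C φ lam P =
      limEquiv C φ lam (((lam.h i : ℂ) / C.d i) • P) := by
  rw [← evOne_qInt_div C (lam.h i) (C.d_pos i)]
  exact gaGen_smul_limEquiv_of_smul C φ lam _ _ (fun P => lusztig_one_smul C φ lam (C.d i) (lam.h i)
    (K_smul_fockMap C φ lam i P) (Kinv_smul_fockMap C φ lam i P)) P

theorem gammaBinom_smul_limEquiv (i : Fin n) (P : Fock ℂ n) :
    gaGen C (GAGen.gammaBinom i 1) • limEquiv C φ lam P =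
      limEquiv C φ lam (((lam.c : ℂ) / C.d i) • P) := by
  rw [← evOne_qInt_div C lam.c (C.d_pos i)]
  refine gaGen_smul_limEquiv_of_smul C φ lam _ _ (fun P => ?_) P
  rw [gammaBinom_smul, one_mul]

theorem DBinom_smul_limEquiv (P : Fock ℂ n) :
    gaGen C (GAGen.DBinom 0 1) • limEquiv C φ lam P = limEquiv C φ lam
      (diagOp (fun s => ((lam.d + fockDeg φ s : ℤ) : ℂ) / C.d0) P) := by
  induction P using MvPolynomial.induction_on' with
  | monomial s a =>
    rw [diagOp_monomial]
    have e : MvPolynomial.monomial s a =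
        fockEv C (MvPolynomial.monomial s (algebraMap ℂ (AA C) a)) := by
      rw [fockEv_monomial, AlgHom.commutes]; rfl
    let t : AA C := ⟨_, qInt_div_mem C (lam.d + fockDeg φ s) C.d0_pos⟩
    have e2 : ((lam.d + fockDeg φ s : ℤ) : ℂ) / C.d0 = evOne C t :=
      (evOne_qInt_div C _ C.d0_pos).symm
    have e3 : evOne C t • MvPolynomial.monomial s a =
        fockEv C (MvPolynomial.monomial s (t * algebraMap ℂ (AA C) a)) := by
      rw [fockEv_monomial, map_mul, AlgHom.commutes, MvPolynomial.smul_monomial]; rfl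
    rw [e2, e3, e]
    refine gaGen_smul_limEquiv C φ lam _ ?_
    rw [fockIncl_monomial, fockIncl_monomial, fockMap_monomial, fockMap_monomial, MulMemClass.coe_mul,
      mul_comm, mul_smul, smul_comm]
    congr 1
    exact lusztig_one_smul C φ lam C.d0 (lam.d + fockDeg φ s)
      (D_smul_fockVec C φ lam s) (Dinv_smul_fockVec C φ lam s)
  | add P Q hP hQ => rw [map_add, smul_add, hP, hQ, map_add, map_add]

/-- Comparing D-eigenvalues coefficientwise shows that a homogeneous element of N_𝔸 involves only
monomials of its degree. Conversely, complex coefficients lift to constants in 𝔸 without changing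
the degree. -/
theorem limitGrading_eq (m : ℤ) :
    limitGrading C (NA C φ lam) (grading C (Nq C φ lam) lam.d) m =
      (MvPolynomial.weightedHomogeneousSubmodule ℂ (fockWt φ n) m).map
        (limEquiv C φ lam).toLinearMap := by
  refine le_antisymm ?_ ?_
  · rintro _ ⟨y, hy, rfl⟩
    obtain ⟨Q, rfl⟩ := formMap_surjective C φ lam y
    refine ⟨fockEv C Q, ?_, limEquiv_fockEv C φ lam Q⟩
    have h1 : toUq C Free.D • fockMap C φ lam (fockIncl C Q) =
      q ^ (lam.d + m) • fockMap C φ lam (fockIncl C Q) := hy.2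
    rw [D_smul_fockMap, ← map_smul] at h1
    have h2 := fockMap_injective C φ lam h1
    intro s hs
    by_contra hne
    apply hs
    have h3 := congrArg (MvPolynomial.coeff s) h2
    rw [coeff_diagOp, MvPolynomial.coeff_smul, smul_eq_mul] at h3
    have h4 : ((Q.coeff s : AA C) : Kq) = 0 := by
      have h5 : (fockIncl C Q).coeff s = ((Q.coeff s : AA C) : Kq) := MvPolynomial.coeff_map _ _ _
      rw [h5] at h3
      by_contra h6
      have := q_zpow_injective (mul_right_cancel₀ h6 h3)
      exact hne (add_left_cancel this)
    rw [MvPolynomial.mapAlgHom_apply, MvPolynomial.coeff_map, show Q.coeff s = 0 from Subtype.ext h4,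
      map_zero]
  · rintro _ ⟨P, hP, rfl⟩
    rw [P.as_sum, map_sum]
    refine sum_mem fun s hs => ?_
    have hs' : fockDeg φ s = m := hP (MvPolynomial.mem_support_iff.mp hs)
    have e : MvPolynomial.monomial s (P.coeff s) =
        fockEv C (MvPolynomial.monomial s (algebraMap ℂ (AA C) (P.coeff s))) := by
      rw [fockEv_monomial, AlgHom.commutes]; rfl
    refine ⟨formMap C φ lam (MvPolynomial.monomial s (algebraMap ℂ (AA C) (P.coeff s))), ?_, ?_⟩
    · change fockMap C φ lam (fockIncl C _) ∈ grading C (Nq C φ lam) lam.d m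
      rw [fockIncl_monomial, ← hs']
      exact fockMap_monomial_mem C φ lam s _
    · rw [e]
      exact (limEquiv_fockEv C φ lam _).symm

theorem isInternal_limitGrading :
    DirectSum.IsInternal (limitGrading C (NA C φ lam) (grading C (Nq C φ lam) lam.d)) := by
  have h := @DirectSum.Decomposition.isInternal _ _ _ _ _ _ _
    (MvPolynomial.weightedHomogeneousSubmodule ℂ (fockWt φ n))
    (MvPolynomial.weightedDecomposition ℂ (fockWt φ n))
  rw [DirectSum.isInternal_submodule_iff_iSupIndep_and_iSup_eq_top] at h ⊢
  have e : limitGrading C (NA C φ lam) (grading C (Nq C φ lam) lam.d) =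
      Submodule.orderIsoMapComap (limEquiv C φ lam) ∘
        MvPolynomial.weightedHomogeneousSubmodule ℂ (fockWt φ n) :=
    funext fun m => limitGrading_eq C φ lam m
  rw [e]
  refine ⟨h.1.map_orderIso _, ?_⟩
  have h2 := (Submodule.orderIsoMapComap (limEquiv C φ lam)).map_iSup
    (MvPolynomial.weightedHomogeneousSubmodule ℂ (fockWt φ n))
  rw [h.2, OrderIso.map_top] at h2
  exact h2.symm

end QHeis

namespace QHeis

variable {n : ℕ} (C : CartanDatum n) (φ : ℕ+ → ℤˣ) (lam : Weight n)

/-! ### Fock space as a `G + 𝔥`-module -/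

theorem clCoeff_neg (c : ℤ) (i j : Fin n) (k : ℤ) :
    clCoeff C c j i (-k) = -clCoeff C c i j k := by
  have h1 : (C.d i : ℂ) ≠ 0 := by exact_mod_cast (C.d_pos i).ne'
  have h2 : (C.d j : ℂ) ≠ 0 := by exact_mod_cast (C.d_pos j).ne'
  have hs : (C.d i : ℂ) * (C.a i j : ℂ) = (C.d j : ℂ) * (C.a j i : ℂ) := by
    exact_mod_cast C.symm i j
  have : (C.a i j : ℂ) / (C.d j : ℂ) = (C.a j i : ℂ) / (C.d i : ℂ) := by
    rw [div_eq_div_iff h2 h1]; linear_combination hs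
  rw [clCoeff, clCoeff, this]
  push_cast
  ring

/-- The action of `h_i ⊗ t^k` on Fock space. -/
def loopOp (i : Fin n) (k : ℤ) : Module.End ℂ (Fock ℂ n) :=
  -- K_i acts by q^{λ(h_i)} rather than q_i^{λ(h_i)}, so the limit of (K_i - K_i⁻¹)/(q_i - q_i⁻¹)
  -- carries the denominator d_i.
  if k = 0 then ((lam.h i : ℂ) / C.d i) • 1 else fockH φ (clCoeff C lam.c) i k

/-- The action of `ḣ ⊗ ℂ[t, t⁻¹]` on Fock space. -/
def loopRep : Loop n →ₗ[ℂ] Module.End ℂ (Fock ℂ n) :=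
  Finsupp.linearCombination ℂ fun p => loopOp C φ lam p.1 p.2

/-- The action of `d` on Fock space. -/
def degOp : Module.End ℂ (Fock ℂ n) := diagOp fun s => ((lam.d + fockDeg φ s : ℤ) : ℂ)

theorem loopRep_single (p : Fin n × ℤ) (a : ℂ) :
    loopRep C φ lam (Finsupp.single p a) = a • loopOp C φ lam p.1 p.2 :=
  Finsupp.linearCombination_single _ _ _

theorem loopOp_comm (p r : Fin n × ℤ) :
    loopOp C φ lam p.1 p.2 * loopOp C φ lam r.1 r.2 =
      loopOp C φ lam r.1 r.2 * loopOp C φ lam p.1 p.2 +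
      (cocycle C (Finsupp.single p 1) (Finsupp.single r 1) * lam.c) • 1 := by
  rw [GH.cocycle_single]
  by_cases hp : p.2 = 0
  · have e : (if p.2 + r.2 = 0 then (p.2 : ℂ) * ((C.a p.1 r.1 : ℂ) / (C.d r.1 : ℂ)) else 0) = 0 := by
      rw [hp]; simp
    rw [e, zero_mul, zero_smul, add_zero, loopOp, if_pos hp, smul_mul_assoc, mul_smul_comm, one_mul,
      mul_one]
  by_cases hr : r.2 = 0
  · rw [if_neg (by omega), zero_mul, zero_smul, add_zero, loopOp.eq_1 C φ lam r.1, if_pos hr,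
      smul_mul_assoc, mul_smul_comm, one_mul, mul_one]
  rw [loopOp, loopOp, if_neg hp, if_neg hr, add_comm, ← sub_eq_iff_eq_add,
    fockH_comm φ _ (clCoeff_neg C lam.c) _ _ hp hr]
  by_cases h : p.2 = -r.2
  · rw [if_pos h, if_pos (by omega), clCoeff]
  · rw [if_neg h, if_neg (by omega), zero_mul, zero_smul]

theorem degOp_loopOp (i : Fin n) (k : ℤ) : degOp φ lam * loopOp C φ lam i k =
    loopOp C φ lam i k * degOp φ lam + (k : ℂ) • loopOp C φ lam i k := by
  rw [loopOp]
  split_ifs with h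
  · rw [h, Int.cast_zero, zero_smul, add_zero, smul_mul_assoc, mul_smul_comm, one_mul, mul_one]
  · rw [degOp, diagOp_fockH φ (clCoeff C lam.c) i h _
      (fun s => ((lam.d + fockDeg φ s : ℤ) : ℂ) + k) fun s s' hs => by rw [hs]; push_cast; ring]
    have e : diagOp (fun s => ((lam.d + fockDeg φ s : ℤ) : ℂ) + k) =
        diagOp (fun s : (Fin n × ℕ+) →₀ ℕ => ((lam.d + fockDeg φ s : ℤ) : ℂ)) + (k : ℂ) • 1 := by
      refine fock_ext fun s => ?_
      rw [LinearMap.add_apply, diagOp_monomial, diagOp_monomial, add_smul]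
      rfl
    rw [e, mul_add, mul_smul_comm, mul_one]

theorem loopRep_comm (f g : Loop n) : loopRep C φ lam f * loopRep C φ lam g =
    loopRep C φ lam g * loopRep C φ lam f + (cocycle C f g * lam.c) • 1 := by
  induction f using Finsupp.induction_linear with
  | zero => simp
  | add f f' hf hf' =>
    rw [map_add, map_add, add_mul, mul_add, hf, hf', LinearMap.add_apply, add_mul, add_smul]
    abel
  | single p a =>
    induction g using Finsupp.induction_linear with
    | zero => simp
    | add g g' hg hg' => rw [map_add, map_add, add_mul, mul_add, hg, hg', add_mul, add_smul]; abel
    | single r b =>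
      have e : ∀ (t : Fin n × ℤ) (a : ℂ), Finsupp.single t a = a • Finsupp.single t (1 : ℂ) := by
        intro t a; rw [Finsupp.smul_single, smul_eq_mul, mul_one]
      have e2 : cocycle C (Finsupp.single p a) (Finsupp.single r b) =
          a * (b * cocycle C (Finsupp.single p 1) (Finsupp.single r 1)) := by
        rw [e p a, e r b, map_smul, map_smul, LinearMap.smul_apply, smul_eq_mul, smul_eq_mul]
        ring
      rw [loopRep_single, loopRep_single, e2, smul_mul_smul_comm, smul_mul_smul_comm, loopOp_comm]
      module

theorem degOp_loopRep (f : Loop n) : degOp φ lam * loopRep C φ lam f =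
    loopRep C φ lam f * degOp φ lam + loopRep C φ lam (loopDer f) := by
  induction f using Finsupp.induction_linear with
  | zero => simp
  | add f f' hf hf' => rw [map_add, map_add, map_add, add_mul, mul_add, hf, hf']; abel
  | single p a =>
    have e : loopDer (Finsupp.single p a) = a • Finsupp.single p (p.2 : ℂ) :=
      Finsupp.linearCombination_single _ _ _
    rw [e, map_smul, loopRep_single, loopRep_single, mul_smul_comm, degOp_loopOp, smul_mul_assoc,
      smul_add]

attribute [local instance] LieRing.ofAssociativeRing

/-- The representation of `G + 𝔥` on Fock space. -/
def ghRep : GH C →ₗ⁅ℂ⁆ Module.End ℂ (Fock ℂ n) where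
  toFun y := loopRep C φ lam y.1 + (y.2.1 * lam.c) • 1 + y.2.2 • degOp φ lam
  map_add' y z := by
    change loopRep C φ lam (y.1 + z.1) + ((y.2.1 + z.2.1) * lam.c) • 1 +
      (y.2.2 + z.2.2) • degOp φ lam = _
    rw [map_add]; module
  map_smul' a y := by
    change loopRep C φ lam (a • y.1) + ((a * y.2.1) * lam.c) • 1 + (a * y.2.2) • degOp φ lam =
      a • (loopRep C φ lam y.1 + (y.2.1 * lam.c) • 1 + y.2.2 • degOp φ lam)
    rw [map_smul]; module
  map_lie' := by
    intro y z
    change loopRep C φ lam (y.2.2 • loopDer z.1 - z.2.2 • loopDer y.1) +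
      (cocycle C y.1 z.1 * lam.c) • 1 + (0 : ℂ) • degOp φ lam =
      (loopRep C φ lam y.1 + (y.2.1 * lam.c) • 1 + y.2.2 • degOp φ lam) *
        (loopRep C φ lam z.1 + (z.2.1 * lam.c) • 1 + z.2.2 • degOp φ lam) -
      (loopRep C φ lam z.1 + (z.2.1 * lam.c) • 1 + z.2.2 • degOp φ lam) *
        (loopRep C φ lam y.1 + (y.2.1 * lam.c) • 1 + y.2.2 • degOp φ lam)
    simp only [map_sub, map_smul, add_mul, mul_add, smul_mul_assoc, mul_smul_comm, one_mul, mul_one]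
    rw [loopRep_comm C φ lam y.1 z.1, degOp_loopRep C φ lam y.1, degOp_loopRep C φ lam z.1]
    module

theorem ghRep_h (i : Fin n) (k : ℤ) : ghRep C φ lam (GH.h C i k) = loopOp C φ lam i k := by
  change loopRep C φ lam (Finsupp.single (i, k) 1) + ((0 : ℂ) * lam.c) • 1 +
    (0 : ℂ) • degOp φ lam = _
  rw [loopRep_single, one_smul, zero_mul, zero_smul, zero_smul, add_zero, add_zero]

theorem ghRep_c : ghRep C φ lam (GH.c C) = (lam.c : ℂ) • 1 := by
  change loopRep C φ lam 0 + ((1 : ℂ) * lam.c) • 1 + (0 : ℂ) • degOp φ lam = _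
  rw [map_zero, one_mul, zero_smul, zero_add, add_zero]

theorem ghRep_d : ghRep C φ lam (GH.d C) = degOp φ lam := by
  change loopRep C φ lam 0 + ((0 : ℂ) * lam.c) • 1 + (1 : ℂ) • degOp φ lam = _
  rw [map_zero, zero_mul, zero_smul, zero_add, zero_add, one_smul]

/-- Homogeneity as an eigenvalue condition, so that the degree shift by the h_i ⊗ t^k follows from
`diagOp_fockH`. -/
theorem mem_weightedHomogeneousSubmodule_iff_diagOp (m : ℤ) (P : Fock ℂ n) :
    P ∈ MvPolynomial.weightedHomogeneousSubmodule ℂ (fockWt φ n) m ↔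
      diagOp (fun s => (fockDeg φ s : ℂ)) P = (m : ℂ) • P := by
  constructor
  · intro h
    ext s
    rw [coeff_diagOp, MvPolynomial.coeff_smul, smul_eq_mul]
    by_cases h0 : P.coeff s = 0
    · rw [h0, mul_zero, mul_zero]
    · have : fockDeg φ s = m := h h0
      rw [this]
  · intro h s h0
    have := congrArg (MvPolynomial.coeff s) h
    rw [coeff_diagOp, MvPolynomial.coeff_smul, smul_eq_mul] at this
    exact_mod_cast mul_right_cancel₀ h0 this

theorem loopOp_mem (i : Fin n) (k m : ℤ) {P : Fock ℂ n}
    (hP : P ∈ MvPolynomial.weightedHomogeneousSubmodule ℂ (fockWt φ n) m) :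
    loopOp C φ lam i k P ∈ MvPolynomial.weightedHomogeneousSubmodule ℂ (fockWt φ n) (m + k) := by
  rw [loopOp]
  split_ifs with h
  · rw [h, add_zero]
    exact Submodule.smul_mem _ _ hP
  · rw [mem_weightedHomogeneousSubmodule_iff_diagOp] at hP ⊢
    have e := LinearMap.congr_fun (diagOp_fockH φ (clCoeff C lam.c) i h
      (fun s => (fockDeg φ s : ℂ) - k) (fun s => (fockDeg φ s : ℂ)) fun s s' hs => by
        rw [hs]; push_cast; ring) P
    have e2 : diagOp (fun s => (fockDeg φ s : ℂ) - k) =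
        diagOp (fun s : (Fin n × ℕ+) →₀ ℕ => (fockDeg φ s : ℂ)) - (k : ℂ) • 1 := by
      refine fock_ext fun s => ?_
      rw [LinearMap.sub_apply, diagOp_monomial, diagOp_monomial, sub_smul]
      rfl
    rw [e2, Module.End.mul_apply, Module.End.mul_apply, hP, map_smul, LinearMap.sub_apply,
      LinearMap.smul_apply, Module.End.one_apply, sub_eq_iff_eq_add, ← add_smul] at e
    rw [e]; push_cast; rfl

theorem degOp_mem (m : ℤ) {P : Fock ℂ n}
    (hP : P ∈ MvPolynomial.weightedHomogeneousSubmodule ℂ (fockWt φ n) m) :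
    degOp φ lam P ∈ MvPolynomial.weightedHomogeneousSubmodule ℂ (fockWt φ n) m := by
  intro s hs
  rw [degOp, coeff_diagOp] at hs
  exact hP (right_ne_zero_of_mul hs)

/-- The representation of `G + 𝔥` on the classical limit of `N_𝔸`. -/
def limRep : GH C →ₗ⁅ℂ⁆ Module.End ℂ (ClassicalLimit C (NA C φ lam)) :=
  (limEquiv C φ lam).lieConj.toLieHom.comp (ghRep C φ lam)

theorem limRep_limEquiv (z : GH C) (P : Fock ℂ n) :
    limRep C φ lam z (limEquiv C φ lam P) = limEquiv C φ lam (ghRep C φ lam z P) := by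
  change limEquiv C φ lam (ghRep C φ lam z ((limEquiv C φ lam).symm (limEquiv C φ lam P))) = _
  rw [LinearEquiv.symm_apply_apply]

theorem isLimitAction_limRep : IsLimitAction C (NA C φ lam) (limRep C φ lam) where
  h i k hk y := by
    obtain ⟨P, rfl⟩ := (limEquiv C φ lam).surjective y
    rw [limRep_limEquiv, ghRep_h, loopOp, if_neg hk, h_smul_limEquiv C φ lam i hk]
  h0 i y := by
    obtain ⟨P, rfl⟩ := (limEquiv C φ lam).surjective y
    rw [limRep_limEquiv, ghRep_h, loopOp, if_pos rfl, KBinom_smul_limEquiv]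
    rfl
  c i y := by
    obtain ⟨P, rfl⟩ := (limEquiv C φ lam).surjective y
    have h : (C.d i : ℂ) ≠ 0 := by exact_mod_cast (C.d_pos i).ne'
    rw [limRep_limEquiv, ghRep_c, gammaBinom_smul_limEquiv, ← map_smul, smul_smul,
      mul_div_cancel₀ _ h]
    rfl
  d y := by
    obtain ⟨P, rfl⟩ := (limEquiv C φ lam).surjective y
    have h : (C.d0 : ℂ) ≠ 0 := by exact_mod_cast C.d0_pos.ne'
    rw [limRep_limEquiv, ghRep_d, DBinom_smul_limEquiv, ← map_smul]
    congr 1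
    ext s
    rw [degOp, MvPolynomial.coeff_smul, coeff_diagOp, coeff_diagOp, smul_eq_mul, ← mul_assoc,
      mul_div_cancel₀ _ h]

/-- The irreducibility argument for Fock space, now over ℂ with the classical pairing. Only the
operators h_i ⊗ t^k with k ≠ 0 are needed. -/
theorem limRep_irreducible (hc : lam.c ≠ 0) (W : Submodule ℂ (ClassicalLimit C (NA C φ lam)))
    (hW : ∀ z, ∀ y ∈ W, limRep C φ lam z y ∈ W) : W = ⊥ ∨ W = ⊤ := by
  have h := fock_irreducible φ (clCoeff C lam.c)
    (fun k => det_clCoeff_ne_zero C hc (annIdx_ne_zero φ k))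
    (W.comap (limEquiv C φ lam).toLinearMap) fun i k hk P hP => by
      have := hW (GH.h C i k) _ hP
      rw [LinearEquiv.coe_coe, limRep_limEquiv, ghRep_h, loopOp, if_neg hk] at this
      exact this
  have e : (W.comap (limEquiv C φ lam).toLinearMap).map (limEquiv C φ lam).toLinearMap = W :=
    Submodule.map_comap_eq_of_surjective (limEquiv C φ lam).surjective W
  rcases h with h | h
  · left; rw [← e, h, Submodule.map_bot]
  · right
    rw [← e, h, Submodule.map_top, LinearEquiv.range]

theorem isAdmissibleForm_NA (hc : lam.c ≠ 0) :
    IsAdmissibleForm C (Nq C φ lam) (grading C (Nq C φ lam) lam.d) (NA C φ lam) where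
  exists_basis := exists_basis_NA C φ lam
  exists_rep := by
    refine ⟨limRep C φ lam, isLimitAction_limRep C φ lam, isInternal_limitGrading C φ lam,
      ?_, ?_, ?_, (limEquiv C φ lam).symm.toEquiv.nontrivial, limRep_irreducible C φ lam hc⟩
    · intro i k m y hy
      rw [limitGrading_eq] at hy ⊢
      obtain ⟨P, hP, rfl⟩ := hy
      rw [LinearEquiv.coe_coe, limRep_limEquiv, ghRep_h]
      exact ⟨_, loopOp_mem C φ lam i k m hP, rfl⟩
    · intro m y hy
      rw [limitGrading_eq] at hy ⊢
      obtain ⟨P, hP, rfl⟩ := hy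
      rw [LinearEquiv.coe_coe, limRep_limEquiv, ghRep_c]
      exact ⟨_, Submodule.smul_mem _ (lam.c : ℂ) hP, rfl⟩
    · intro m y hy
      rw [limitGrading_eq] at hy ⊢
      obtain ⟨P, hP, rfl⟩ := hy
      rw [LinearEquiv.coe_coe, limRep_limEquiv, ghRep_d]
      exact ⟨_, degOp_mem φ lam m hP, rfl⟩

end QHeis

end

theorem mainTheorem5 {n : ℕ} (C : QHeis.CartanDatum n) (φ : ℕ+ → ℤˣ) (lam : QHeis.Weight n) :
    QHeis.IsGradedGq C (QHeis.Nq C φ lam) (QHeis.grading C (QHeis.Nq C φ lam) lam.d) ∧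
    (QHeis.IsIrreducibleInKq C (QHeis.Nq C φ lam)
        (QHeis.grading C (QHeis.Nq C φ lam) lam.d) ↔ lam.c ≠ 0) ∧
    (IsSimpleModule (QHeis.Gq C) (QHeis.Nq C φ lam) ↔ lam.c ≠ 0) ∧
    (lam.c ≠ 0 →
      QHeis.IsAdmissible C (QHeis.Nq C φ lam) (QHeis.grading C (QHeis.Nq C φ lam) lam.d) ∧
      QHeis.IsAdmissibleForm C (QHeis.Nq C φ lam) (QHeis.grading C (QHeis.Nq C φ lam) lam.d)
        (QHeis.NA C φ lam)) := by
  refine ⟨QHeis.isGradedGq_Nq C φ lam, QHeis.isIrreducibleInKq_iff C φ lam,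
    QHeis.isSimpleModule_Nq_iff C φ lam, fun hc => ?_⟩
  have h := QHeis.isAdmissibleForm_NA C φ lam hc
  exact ⟨⟨(QHeis.isIrreducibleInKq_iff C φ lam).mpr hc, _, h⟩, h⟩
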